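/- **Data.** Let $N,M\in\mathbb N$, $N\ge 1$, $N\ge M$, $h>0$, $T:=Nh$. Let $\mathcal K\subseteq\mathbb R^m$ be a closed (not necessarily convex) cone with $0\in\mathcal K$, $\check x_0\in\mathbb R^n$, $\xi_0\in C([-Mh,0],\mathbb R^n)$, and let $f,g_1,\dots,g_m:\mathbb R\times(\mathbb R^n)^{M+1}\to\mathbb R^n$ be bounded and of class $C^1$. Put $\|w\|=\sum_j|w^j|$ for $w\in\mathbb R^m$, write $\{z_k\}_k$ for $(z_0,\dots,z_M)$, $z^\pm$ for one-sided limits, $|\mu|=\sum_j(\mu^j_++\mu^j_-)$ for the total variation, and $\mu^c$ for the continuous (atom-free) component of a measure. A finite vector measure $\mu$ on $[0,T]$ is *directed by $\mathcal K$* if $\mu=w|\mu|$ with a Borel density $w$ with values in $\mathcal K$. It is *in $C^*_{\mathcal K}$* if all values $\mu(B)$ lie in the closed convex hull of $\mathcal K$ and $\mu^c$ is directed by $\mathcal K$. (If $\mathcal K$ is convex, each of these two conditions says exactly that $\mu(B)\in\mathcal K$ for all Borel $B$.) For $\mu\in C^*_{\mathcal K}$, let $\mathcal V_c(\mu)$ be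 the set of finite nonnegative measures $\nu$ on $[0,T]$ with $\nu^c=|\mu^c|$ for which there are measures $\mu_i$ directed by $\mathcal K$ with $(\mu_i,|\mu_i|)\rightharpoonup^*(\mu,\nu)$. The *right inverse* of an increasing $A:[T_1,T_2]\to[S_1,S_2]$ is $B$ with $B(S_1)=T_1$, $B(S_2)=T_2$, $B(s)=\inf\{t:A(t)>s\}$ for $S_1<s<S_2$. **Impulse processes.** An *impulse control* is $(\mu,\nu,\{\omega^r\}_{r\in[0,h]})$ with $\mu\in C^*_{\mathcal K}$, $\nu\in\mathcal V_c(\mu)$ and $\omega^r=(\omega^r_1,\dots,\omega^r_N)\in L^\infty([0,1];\mathcal K^N)$ such that, with $\omega^h_0\equiv0\equiv\omega^0_{N+1}$: (i) $\sum_l\|\omega^r_l(s)\|=\sum_l\int_0^1\|\omega^r_l\|$ for a.e. $s$ and all $r\in[0,h]$; (ii) $\int_0^1\|\omega^r_l\|=\nu(\{r+(l-1)h\})$ for $0<r<h$, $1\le l\le N$, and $\int_0^1(\|\omega^h_l\|+\|\omega^0_{l+1}\|)=\nu(\{lh\})$ for $0\le l\le N$; (iii) $\int_0^1\omega^r_l=\mu(\{r+(l-1)h\})$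 and $\int_0^1(\omega^h_l+\omega^0_{l+1})=\mu(\{lh\})$ for the same indices. An *impulse process* is $(\mu,\nu,\{\omega^r\},x,v)$, where moreover $x:[-Mh,T]\to\mathbb R^n$ and $v:[0,T]\to\mathbb R$ are of bounded variation on $[0,T]$, $x=\xi_0$ on $[-Mh,0[$, $(x,v)(0)=(\check x_0,0)$, $(x,v)((l-1)h)=(\zeta^0_l,\theta^0_l)(1)$ for $2\le l\le N+1$ (for $l=N+1$ this means $(x,v)(T)=(\zeta^h_N,\theta^h_N)(1)$), and for $1\le l\le N$, $(l-1)h<t<lh$, $$x(t)=\zeta^0_l(1)+\int_{(l-1)h}^t f(t',\{x(t'-kh)\}_k)\,dt'+\sum_j\int_{[(l-1)h,t]}g_j(t',\{x(t'-kh)\}_k)\,d(\mu^c)^j+\sum_{0<r\le t-(l-1)h}\big(\zeta^r_l(1)-x^-(r+(l-1)h)\big),$$ $$v(t)=\theta^0_l(1)+\nu^c([(l-1)h,t])+\sum_{0<r\le t-(l-1)h}\big(\theta^r_l(1)-v^-(r+(l-1)h)\big),$$ the sums being absolutely convergent. Here, for $r\in[0,h]$ and $1\le l\le N$, $\zeta^r_l$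 is the absolutely continuous solution on $[0,1]$ of $\dot\zeta^r_l=\sum_jg_j(r+(l-1)h,\{\zeta^r_{l-k}\}_k)(\omega^r_l)^j$ a.e., with $\zeta^r_l(0)=x^-(r+(l-1)h)$ if $r>0$ and $\zeta^0_l(0)=\zeta^h_{l-1}(1)$; $\theta^r_l(s)=\theta^r_l(0)+\int_0^s\|\omega^r_l\|$, with $\theta^r_l(0)=v^-(r+(l-1)h)$ if $r>0$ and $\theta^0_l(0)=\theta^h_{l-1}(1)$; and $\theta^r_0\equiv0$, $\zeta^r_{-a}\equiv\xi_0(r-(a+1)h)$ for $a\ge0$, except that $\zeta^h_0(1)=\check x_0$. The $\omega^r_l$ are identified modulo null sets. **Canonical extended processes.** These are tuples $(S,\varphi_0,\varphi,\tau,y,\beta)$ with $S>0$, where $\varphi_0:[0,S]\to[0,h]$ is increasing with $\varphi_0(0)=0$, $\varphi_0(S)=h$; $\varphi=(\varphi_1,\dots,\varphi_N)$, $\varphi_l:[0,S]\to\mathbb R^m$; $\varphi_0$ and all $\varphi_l$ are Lipschitz; $\varphi_1(0)=0$, $\varphi_l(0)=\varphi_{l-1}(S)$ for $l\ge2$; $\dot\varphi_l\in\mathcal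 K$ a.e.; $\dot\varphi_0+\sum_l\|\dot\varphi_l\|=1$ a.e. on $[0,S]$; and $(\tau_l,y_l,\beta_l)$, $1\le l\le N$, is the absolutely continuous solution (with $\tau_l,\beta_l\ge0$) of the delay-free time-space system (ACS) $$\dot\tau_l=\dot\varphi_0,\quad \dot y_l=f(\tau_l,\{y_{l-k}\}_k)\dot\varphi_0+\sum_jg_j(\tau_l,\{y_{l-k}\}_k)\dot\varphi_l^j,\quad \dot\beta_l=\|\dot\varphi_l\|,$$ $y_{-a}(s)=\xi_0(\tau_1(s)-(a+1)h)$ for $0\le a\le M-1$, $(\tau_1,y_1,\beta_1)(0)=(0,\check x_0,0)$, $(\tau_l,y_l,\beta_l)(0)=(\tau_{l-1},y_{l-1},\beta_{l-1})(S)$ for $l\ge2$. For $z\in\{\varphi,\tau,y,\beta\}$ let $\tilde z(s)=z_l(s-(l-1)S)$ for $(l-1)S\le s<lS$ and $\tilde z(NS)=z_N(S)$; let $\tilde\sigma:[0,T]\to[0,NS]$ be the right inverse of $\tilde\tau$. The *graph completion solution* is $(\tilde y,\tilde\beta)\circ\tilde\sigma$ on $[0,T]$. Below, $\sigma$ is the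 right inverse of $\varphi_0$, and $\sigma^-(0)=0$, $\sigma^+(h)=S$, $\tilde\sigma^+(T)=NS$. **Construction A.** Given an impulse process, let $\mu_l$ be the measure on $[0,h]$ consisting of $\mu$ on $](l-1)h,lh[$, translated by $-(l-1)h$, plus the atoms $\int_0^1\omega^0_l$ at $0$ and $\int_0^1\omega^h_l$ at $h$; define $\nu_l$ likewise from $\nu$ and $\|\omega^0_l\|,\|\omega^h_l\|$. Let $\phi(0)=0$, $\phi(r)=r+\sum_l\nu_l([0,r])$ for $0<r\le h$, $S=\phi(h)$; $\mathcal J$ the set of discontinuities of $\phi$; $\Sigma^r=[\phi^-(r),\phi^+(r)]$ with $\phi^-(0)=0$, $\phi^+(h)=\phi(h)$; $\gamma^r(s)=(s-\phi^-(r))/(\phi^+(r)-\phi^-(r))$; and $m_l$ the Radon–Nikodym derivative of $\mu_l^c$ with respect to $d\phi$ (Lebesgue measure on $[0,h]$ plus $\sum_l\nu_l$). Let $\varphi_0$ be the right inverse of $\phi$; let $\varphi_l$ be absolutely continuous with $\dot\varphi_l(s)=m_l(\varphi_0(s))$ for a.e. $s\notin\bigcup_{r\in\mathcal J}\Sigma^r$,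 $\dot\varphi_l(s)=(\phi^+(r)-\phi^-(r))^{-1}\omega^r_l(\gamma^r(s))$ for a.e. $s\in\Sigma^r$, $r\in\mathcal J$, and $\varphi_1(0)=0$, $\varphi_l(0)=\varphi_{l-1}(S)$ for $l\ge 2$; let $\tau_l=(l-1)h+\varphi_0$; let $(y_1,\beta_1)(0)=(\check x_0,0)$, $(y_l,\beta_l)(0)=(\zeta^h_{l-1},\theta^h_{l-1})(1)$ for $l\ge2$, $(y_l,\beta_l)(S)=(\zeta^h_l,\theta^h_l)(1)$, and for $0<s<S$ let $(y_l,\beta_l)(s)=(x,v)(\tau_l(s))$ if $s\notin\bigcup_{r\in\mathcal J}\Sigma^r$, and $(y_l,\beta_l)(s)=(\zeta^r_l,\theta^r_l)(\gamma^r(s))$ if $s\in\Sigma^r$, $r\in\mathcal J$. **Construction B.** Given a canonical extended process, let $\mu,\nu$ be the finite measures on $[0,T]$ with $\mu([0,t])=\int_0^{\tilde\sigma^+(t)}\dot{\tilde\varphi}\,ds$, $\nu([0,t])=\int_0^{\tilde\sigma^+(t)}\|\dot{\tilde\varphi}\|\,ds$ for $t\in[0,T]$; let $\omega^r_l(s)=(\sigma^+(r)-\sigma^-(r))\,\dot\varphi_l\big((\sigma^+(r)-\sigma^-(r))s+\sigma^-(r)\big)$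 for a.e. $s\in[0,1]$; let $x=\xi_0$ on $[-Mh,0[$ and $(x,v)=(\tilde y,\tilde\beta)\circ\tilde\sigma$ on $[0,T]$. **Theorem.** (i) For every impulse process, Construction A determines one and only one tuple $(S,\varphi_0,\varphi,\tau,y,\beta)$; this tuple is a canonical extended process, and $(x,v)=(\tilde y,\tilde\beta)\circ\tilde\sigma$ on $[0,T]$, i.e. $(x,v)$ is its graph completion solution. (ii) For every canonical extended process, Construction B determines one and only one tuple $(\mu,\nu,\{\omega^r\},x,v)$; this tuple is an impulse process, and Construction A applied to it gives back the given canonical extended process. (iii) For every impulse process, Construction B applied to the result of Construction A gives back the given impulse process. -/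

import Mathlib

open Set Filter Topology MeasureTheory
open scoped NNReal ENNReal

noncomputable section

namespace DelayImpulse

/-- The state space `ℝⁿ`. -/
abbrev State (n : ℕ) := EuclideanSpace ℝ (Fin n)

/-- The control space `ℝᵐ`; its norm in the sense of the theory is `norm1` below. -/
abbrev Ctrl (m : ℕ) := Fin m → ℝ

/-- `‖w‖ = ∑ⱼ |wʲ|`. -/
def norm1 {m : ℕ} (w : Ctrl m) : ℝ := ∑ j, |w j|

/-! ### Vector measures -/

/-- An `ℝᵐ`-valued finite Borel measure on `ℝ`, given by its components. -/
abbrev VMeas (m : ℕ) := Fin m → SignedMeasure ℝ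

/-- The value `μ(B) ∈ ℝᵐ`. -/
def VMeas.val {m : ℕ} (μ : VMeas m) (B : Set ℝ) : Ctrl m := fun j => μ j B

/-- The total variation measure `|μ| = ∑ⱼ (μʲ₊ + μʲ₋)`. -/
def VMeas.tv {m : ℕ} (μ : VMeas m) : Measure ℝ := ∑ j, (μ j).totalVariation

/-- The atoms of `μ`. -/
def VMeas.atoms {m : ℕ} (μ : VMeas m) : Set ℝ := {t | μ.val {t} ≠ 0}

/-- The continuous component `μᶜ`: the restriction of `μ` to the complement of its atoms. -/
def VMeas.cont {m : ℕ} (μ : VMeas m) : VMeas m := fun j => (μ j).restrict μ.atomsᶜ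

/-- The continuous component of a nonnegative measure. -/
def contPart (ν : Measure ℝ) : Measure ℝ := ν.restrict {t | ν {t} ≠ 0}ᶜ

/-- `μ` is a measure on `[0,T]`. -/
def VMeas.On {m : ℕ} (μ : VMeas m) (T : ℝ) : Prop :=
  ∀ B, MeasurableSet B → Disjoint B (Icc 0 T) → μ.val B = 0

/-- The direction of `μ` lies in the cone `K`: `μ = w |μ|` with a `K`-valued density `w`.
For a closed convex cone this says exactly that every value `μ(B)` lies in `K`,
see `hasConeDensity_iff`. -/
def HasConeDensity {m : ℕ} (K : Set (Ctrl m)) (μ : VMeas m) : Prop :=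
  ∃ w : ℝ → Ctrl m, Measurable w ∧ (∀ t, w t ∈ K) ∧
    (∀ j, Integrable (fun t => w t j) μ.tv) ∧
    ∀ j B, MeasurableSet B → μ j B = ∫ t in B, w t j ∂μ.tv

/-- The class of measures `μ` on `[0,T]` with values in the cone `K`: all values `μ(B)` lie in the
closed convex hull of `K`, and the continuous component has a `K`-valued density.
For a closed convex cone this says exactly that every value `μ(B)` lies in `K`,
see `isConeMeasure_iff`. -/
def IsConeMeasure {m : ℕ} (K : Set (Ctrl m)) (T : ℝ) (μ : VMeas m) : Prop :=
  μ.On T ∧ (∀ B, MeasurableSet B → μ.val B ∈ closedConvexHull ℝ K) ∧ HasConeDensity K μ.cont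

/-- `ν ∈ 𝒱_c(μ)`: `ν` is a finite nonnegative measure on `[0,T]` with `νᶜ = |μᶜ|`, and
`(μᵢ, |μᵢ|) ⇀* (μ, ν)` for some sequence of measures `μᵢ` on `[0,T]` directed by `K`. -/
def MemVc {m : ℕ} (K : Set (Ctrl m)) (T : ℝ) (μ : VMeas m) (ν : Measure ℝ) : Prop :=
  IsFiniteMeasure ν ∧ ν (Icc 0 T)ᶜ = 0 ∧ contPart ν = μ.cont.tv ∧
  ∃ μs : ℕ → VMeas m,
    (∀ i, (μs i).On T ∧ HasConeDensity K (μs i)) ∧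
    (∀ ψ : ℝ → ℝ, Continuous ψ → ∀ j,
      Tendsto (fun i => ∫ᵛ t in Icc 0 T, ψ t ∂<•(μs i j)) atTop
        (𝓝 (∫ᵛ t in Icc 0 T, ψ t ∂<•(μ j)))) ∧
    (∀ ψ : ℝ → ℝ, Continuous ψ →
      Tendsto (fun i => ∫ t in Icc 0 T, ψ t ∂(μs i).tv) atTop (𝓝 (∫ t in Icc 0 T, ψ t ∂ν)))

/-! ### The two facts about convex cones announced above -/

lemma VMeas.isFiniteMeasure_tv {m : ℕ} (μ : VMeas m) : IsFiniteMeasure μ.tv := by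
  unfold VMeas.tv
  infer_instance

theorem hasConeDensity_iff {m : ℕ} {K : Set (Ctrl m)} (hc : IsClosed K) (h0 : (0 : Ctrl m) ∈ K)
    (hK : ∀ c : ℝ, 0 ≤ c → ∀ w ∈ K, c • w ∈ K) (hconv : Convex ℝ K) (μ : VMeas m) :
    HasConeDensity K μ ↔ ∀ B, MeasurableSet B → μ.val B ∈ K := by
  have : IsFiniteMeasure μ.tv := μ.isFiniteMeasure_tv
  have key : ∀ w : ℝ → Ctrl m, Integrable w μ.tv →
      (∀ j B, MeasurableSet B → μ j B = ∫ t in B, w t j ∂μ.tv) →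
      ∀ B, MeasurableSet B → μ.val B = (μ.tv.real B) • ⨍ t in B, w t ∂μ.tv := by
    intro w hw h B hB
    rw [measure_smul_setAverage _ (measure_ne_top _ _)]
    ext j
    rw [VMeas.val, h j B hB]
    exact (eval_integral (fun i => (hw.eval i).integrableOn) j).symm
  constructor
  · rintro ⟨w, -, hwK, hwi, hw⟩ B hB
    have hi : Integrable w μ.tv := Integrable.of_eval hwi
    rw [key w hi hw B hB]
    by_cases hz : μ.tv B = 0
    · simp [Measure.real, hz, h0]
    · exact hK _ measureReal_nonneg _ (hconv.set_average_mem hc hz (measure_ne_top _ _)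
        (Eventually.of_forall hwK) hi.integrableOn)
  · intro h
    set w0 : ℝ → Ctrl m := fun t j => (μ j).rnDeriv μ.tv t with hw0
    have hm : Measurable w0 := measurable_pi_iff.2 fun j => SignedMeasure.measurable_rnDeriv _ _
    have hi : Integrable w0 μ.tv :=
      Integrable.of_eval fun j => SignedMeasure.integrable_rnDeriv _ _
    have hval : ∀ j B, MeasurableSet B → μ j B = ∫ t in B, w0 t j ∂μ.tv := by
      intro j B hB
      have hac : μ j ≪ᵥ μ.tv.toENNRealVectorMeasure := by
        rw [SignedMeasure.absolutelyContinuous_ennreal_iff,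
          VectorMeasure.ennrealToMeasure_toENNRealVectorMeasure]
        unfold VMeas.tv
        refine Measure.absolutelyContinuous_of_le ?_
        exact Finset.single_le_sum (f := fun j => (μ j).totalVariation)
          (fun _ _ => Measure.zero_le _) (Finset.mem_univ j)
      have := (SignedMeasure.absolutelyContinuous_iff_withDensityᵥ_rnDeriv_eq (μ j) μ.tv).1 hac
      conv_lhs => rw [← this]
      exact withDensityᵥ_apply (SignedMeasure.integrable_rnDeriv _ _) hB
    have hae : ∀ᵐ t ∂μ.tv, w0 t ∈ K := by
      have hnull : (μ.tv.map w0) Kᶜ = 0 := by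
        refine measure_null_of_locally_null _ fun x hx => ?_
        obtain ⟨ε, hε, hb⟩ := Metric.nhds_basis_closedBall.mem_iff.1 (hc.isOpen_compl.mem_nhds hx)
        refine ⟨Metric.closedBall x ε, mem_nhdsWithin_of_mem_nhds
          (Metric.closedBall_mem_nhds x hε), ?_⟩
        rw [Measure.map_apply hm Metric.isClosed_closedBall.measurableSet]
        by_contra hz
        set A := w0 ⁻¹' Metric.closedBall x ε with hA
        have hAm : MeasurableSet A := hm Metric.isClosed_closedBall.measurableSet
        have h1 : (⨍ t in A, w0 t ∂μ.tv) ∈ Metric.closedBall x ε :=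
          (convex_closedBall x ε).set_average_mem Metric.isClosed_closedBall hz
            (measure_ne_top _ _) (ae_restrict_of_forall_mem hAm fun t ht => ht) hi.integrableOn
        have hpos : 0 < μ.tv.real A :=
          ENNReal.toReal_pos hz (measure_ne_top _ _)
        have h2 : (⨍ t in A, w0 t ∂μ.tv) ∈ K := by
          have := hK (μ.tv.real A)⁻¹ (by positivity) _ (h A hAm)
          rwa [key w0 hi hval A hAm, smul_smul, inv_mul_cancel₀ hpos.ne', one_smul] at this
        exact hb h1 h2
      rw [Measure.map_apply hm hc.isOpen_compl.measurableSet] at hnull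
      exact hnull
    classical
    refine ⟨fun t => if w0 t ∈ K then w0 t else 0,
      Measurable.ite (hm hc.measurableSet) hm measurable_const, ?_, ?_, ?_⟩
    · intro t
      dsimp only
      split_ifs with ht
      · exact ht
      · exact h0
    · intro j
      refine (hi.eval j).congr ?_
      filter_upwards [hae] with t ht
      simp [ht]
    · intro j B hB
      rw [hval j B hB]
      refine integral_congr_ae (ae_restrict_of_ae ?_)
      filter_upwards [hae] with t ht
      simp [ht]

lemma VMeas.measurableSet_atoms {m : ℕ} (μ : VMeas m) : MeasurableSet μ.atoms := by
  have : IsFiniteMeasure μ.tv := μ.isFiniteMeasure_tv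
  refine Set.Countable.measurableSet ?_
  have : {t : ℝ | 0 < μ.tv {t}}.Countable :=
    Measure.countable_meas_pos_of_disjoint_iUnion (μ := μ.tv) (As := fun t : ℝ => ({t} : Set ℝ))
      (fun t => measurableSet_singleton t) (fun a b hab => by simpa using hab)
  refine this.mono fun t ht => ?_
  by_contra hz
  refine ht ?_
  have hz : μ.tv {t} = 0 := by simpa using hz
  ext j
  have h1 : (μ j).totalVariation {t} = 0 := by
    refine le_antisymm (le_trans ?_ hz.le) zero_le
    exact Finset.single_le_sum (f := fun j => (μ j).totalVariation)
      (fun _ _ => Measure.zero_le _) (Finset.mem_univ j) {t}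
  have h2 := SignedMeasure.enorm_le_totalVariation (μ j) {t}
  rw [h1] at h2
  show μ j {t} = 0
  simpa using h2

theorem isConeMeasure_iff {m : ℕ} {K : Set (Ctrl m)} (hc : IsClosed K) (h0 : (0 : Ctrl m) ∈ K)
    (hK : ∀ c : ℝ, 0 ≤ c → ∀ w ∈ K, c • w ∈ K) (hconv : Convex ℝ K) (T : ℝ) (μ : VMeas m) :
    IsConeMeasure K T μ ↔ μ.On T ∧ ∀ B, MeasurableSet B → μ.val B ∈ K := by
  have hull : closedConvexHull ℝ K = K := by
    rw [closedConvexHull_eq_closure_convexHull, hconv.convexHull_eq, hc.closure_eq]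
  rw [IsConeMeasure, hull, hasConeDensity_iff hc h0 hK hconv]
  refine ⟨fun h => ⟨h.1, h.2.1⟩, fun h => ⟨h.1, h.2, fun B hB => ?_⟩⟩
  have : μ.cont.val B = μ.val (B ∩ μ.atomsᶜ) := by
    ext j
    exact VectorMeasure.restrict_apply _ μ.measurableSet_atoms.compl hB
  rw [this]
  exact h.2 _ (hB.inter μ.measurableSet_atoms.compl)

/-! ### One-dimensional notions -/

/-- `y` is an absolutely continuous solution of `dy/ds = F` a.e. on `[a,b]`. -/
def SolvesOn {V : Type*} [NormedAddCommGroup V] [NormedSpace ℝ V]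
    (F : ℝ → V) (y : ℝ → V) (a b : ℝ) : Prop :=
  IntervalIntegrable F volume a b ∧ ∀ s ∈ Icc a b, y s = y a + ∫ s' in a..s, F s'

/-- The right inverse `[S₁,S₂] → [T₁,T₂]` of an increasing function `A : [T₁,T₂] → [S₁,S₂]`. It is
continued by constants, so that its left limit at `S₁` is `T₁` and its right limit at `S₂`
is `T₂`. -/
def rightInv (A : ℝ → ℝ) (T₁ T₂ S₁ S₂ : ℝ) (s : ℝ) : ℝ :=
  if s ≤ S₁ then T₁ else if S₂ ≤ s then T₂ else sInf {t | t ∈ Icc T₁ T₂ ∧ s < A t}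

/-- The concatenation `z̃` on `[0, N S]` of the functions `z₁, …, z_N` on `[0,S]`. -/
def tilde {V : Type*} [AddCommMonoid V] (N : ℕ) (S : ℝ) (z : ℕ → ℝ → V) (s : ℝ) : V :=
  if s = N * S then z N S
  else ∑ l ∈ Finset.Icc 1 N,
    (Ico (((l : ℝ) - 1) * S) (l * S)).indicator (fun s' => z l (s' - ((l : ℝ) - 1) * S)) s

/-! ### The delay system -/

/-- The data of the delay impulse system: the delay `h`, the cone `K`, the dynamics `f, g₁, …, gₘ`
(functions of time and of the `M + 1` states `x(t), x(t-h), …, x(t-Mh)`), the history `ξ₀` and the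
initial state `x̌₀`. The horizon is `T = N h`. -/
structure System (n m N M : ℕ) where
  h : ℝ
  K : Set (Ctrl m)
  f : ℝ → (Fin (M + 1) → State n) → State n
  g : Fin m → ℝ → (Fin (M + 1) → State n) → State n
  ξ : ℝ → State n
  x₀ : State n

/-- A tuple `(μ, ν, {ω^r}, x, v)`; `ω r l s` stands for `ω^r_l(s)`. Only the values for
`r ∈ [0,h]`, `1 ≤ l ≤ N`, `s ∈ [0,1]`, and those of `x` on `[-Mh,T]`, `v` on `[0,T]` matter. -/
structure ImpulseTuple (n m : ℕ) where
  μ : VMeas m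
  ν : Measure ℝ
  ω : ℝ → ℕ → ℝ → Ctrl m
  x : ℝ → State n
  v : ℝ → ℝ

/-- A tuple `(S, φ₀, φ, τ, y, β)`. Only the values of `φ₀` on `[0,S]` and those of
`φ l, τ l, y l, β l` on `[0,S]` for `1 ≤ l ≤ N` matter. -/
structure ExtendedTuple (n m : ℕ) where
  S : ℝ
  φ₀ : ℝ → ℝ
  φ : ℕ → ℝ → Ctrl m
  τ : ℕ → ℝ → ℝ
  y : ℕ → ℝ → State n
  β : ℕ → ℝ → ℝ

/-- Two tuples (with `N` periods) describe the same extended process. -/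
def ExtendedTuple.Same {n m : ℕ} (N : ℕ) (E F : ExtendedTuple n m) : Prop :=
  E.S = F.S ∧ EqOn E.φ₀ F.φ₀ (Icc 0 E.S) ∧
  ∀ l ∈ Icc 1 N, EqOn (E.φ l) (F.φ l) (Icc 0 E.S) ∧ EqOn (E.τ l) (F.τ l) (Icc 0 E.S) ∧
    EqOn (E.y l) (F.y l) (Icc 0 E.S) ∧ EqOn (E.β l) (F.β l) (Icc 0 E.S)

namespace System

variable {n m N M : ℕ} (D : System n m N M)

/-- The final time `T = N h`. -/
def T : ℝ := N * D.h

/-- The standing hypotheses on the data. -/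
structure Standing : Prop where
  one_le_N : 1 ≤ N
  M_le_N : M ≤ N
  h_pos : 0 < D.h
  K_closed : IsClosed D.K
  K_zero : (0 : Ctrl m) ∈ D.K
  K_cone : ∀ c : ℝ, 0 ≤ c → ∀ w ∈ D.K, c • w ∈ D.K
  f_smooth : ContDiff ℝ 1 (fun p : ℝ × (Fin (M + 1) → State n) => D.f p.1 p.2)
  f_bounded : ∃ C : ℝ, ∀ t z, ‖D.f t z‖ ≤ C
  g_smooth : ∀ j, ContDiff ℝ 1 (fun p : ℝ × (Fin (M + 1) → State n) => D.g j p.1 p.2)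
  g_bounded : ∀ j, ∃ C : ℝ, ∀ t z, ‖D.g j t z‖ ≤ C
  ξ_cont : ContinuousOn D.ξ (Icc (-(M * D.h)) 0)

/-- The initial time `(l-1)h` of the `l`-th period. -/
def start (l : ℕ) : ℝ := ((l : ℝ) - 1) * D.h

/-! #### Impulse controls and impulse processes -/

/-- `ω^r_l`, with the convention `ω^r_0 ≡ 0`, `ω^r_{N+1} ≡ 0`. -/
def attached (ω : ℝ → ℕ → ℝ → Ctrl m) (r : ℝ) (l : ℕ) (s : ℝ) : Ctrl m :=
  if 1 ≤ l ∧ l ≤ N then ω r l s else 0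

/-- `(μ, ν, {ω^r})` is an impulse control. -/
structure IsImpulseControl (μ : VMeas m) (ν : Measure ℝ) (ω : ℝ → ℕ → ℝ → Ctrl m) : Prop where
  mem_cone : IsConeMeasure D.K D.T μ
  mem_Vc : MemVc D.K D.T μ ν
  bounded : ∀ r ∈ Icc 0 D.h, ∀ l ∈ Icc 1 N, MemLp (ω r l) ∞ (volume.restrict (Icc 0 1))
  valued : ∀ r ∈ Icc 0 D.h, ∀ l ∈ Icc 1 N, ∀ᵐ s ∂volume.restrict (Icc 0 1), ω r l s ∈ D.K
  /-- (i) -/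
  const_speed : ∀ r ∈ Icc 0 D.h, ∀ᵐ s ∂volume.restrict (Icc 0 1),
    ∑ l ∈ Finset.Icc 1 N, norm1 (ω r l s)
      = ∑ l ∈ Finset.Icc 1 N, ∫ s' in (0 : ℝ)..1, norm1 (ω r l s')
  /-- (ii.1) -/
  ν_inner : ∀ r ∈ Ioo 0 D.h, ∀ l ∈ Icc 1 N,
    ∫ s in (0 : ℝ)..1, norm1 (ω r l s) = ν.real {r + D.start l}
  /-- (ii.2) -/
  ν_grid : ∀ l ≤ N,
    ∫ s in (0 : ℝ)..1, (norm1 (attached (N := N) ω D.h l s)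
        + norm1 (attached (N := N) ω 0 (l + 1) s)) = ν.real {l * D.h}
  /-- (iii.1) -/
  μ_inner : ∀ r ∈ Ioo 0 D.h, ∀ l ∈ Icc 1 N, ∀ j,
    ∫ s in (0 : ℝ)..1, ω r l s j = μ j {r + D.start l}
  /-- (iii.2) -/
  μ_grid : ∀ l ≤ N, ∀ j,
    ∫ s in (0 : ℝ)..1, (attached (N := N) ω D.h l s j
        + attached (N := N) ω 0 (l + 1) s j) = μ j {l * D.h}

/-- `ζ^r_{-a}(s)` for `a ≥ 0`. -/
def histJump (a : ℕ) (r s : ℝ) : State n :=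
  open Classical in
  if a = 0 ∧ r = D.h ∧ s = 1 then D.x₀ else D.ξ (r - (a + 1) * D.h)

/-- `ζ^r_{l-k}(s)`; here `ζ l r s` stands for `ζ^r_l(s)`, `1 ≤ l ≤ N`. -/
def backJump (ζ : ℕ → ℝ → ℝ → State n) (l k : ℕ) (r s : ℝ) : State n :=
  if k < l then ζ (l - k) r s else D.histJump (k - l) r s

/-- `(ζ^r_l, θ^r_l)`, `r ∈ [0,h]`, `1 ≤ l ≤ N`, describe the jumps of `(x,v)`: `ζ^r_l` solves the
Cauchy problem on `[0,1]` driven by `ω^r_l`, and `θ^r_l` is the accumulated variation. -/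
structure IsJump (ω : ℝ → ℕ → ℝ → Ctrl m) (x : ℝ → State n) (v : ℝ → ℝ)
    (ζ : ℕ → ℝ → ℝ → State n) (θ : ℕ → ℝ → ℝ → ℝ) : Prop where
  ode : ∀ l ∈ Icc 1 N, ∀ r ∈ Icc 0 D.h,
    SolvesOn (fun s => ∑ j, ω r l s j •
      D.g j (r + D.start l) (fun k => D.backJump ζ l k r s)) (ζ l r) 0 1
  init : ∀ l ∈ Icc 1 N, ∀ r ∈ Ioc 0 D.h, ζ l r 0 = Function.leftLim x (r + D.start l)
  init_zero : ∀ l ∈ Icc 1 N, ζ l 0 0 = D.backJump ζ l 1 D.h 1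
  var : ∀ l ∈ Icc 1 N, ∀ r ∈ Icc 0 D.h, ∀ s ∈ Icc (0 : ℝ) 1,
    θ l r s = θ l r 0 + ∫ s' in (0 : ℝ)..s, norm1 (ω r l s')
  var_init : ∀ l ∈ Icc 1 N, ∀ r ∈ Ioc 0 D.h, θ l r 0 = Function.leftLim v (r + D.start l)
  var_init_zero : ∀ l ∈ Icc 1 N, θ l 0 0 = if l = 1 then 0 else θ (l - 1) D.h 1

/-- `{x(t-kh)}_{k=0}^M`. -/
def delayed (x : ℝ → State n) (t : ℝ) : Fin (M + 1) → State n := fun k => x (t - k * D.h)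

/-- `(x,v)` is an impulse solution associated with `(μ, ν, {ω^r})`. The requirement at the final
time is `(x,v)(T) = (ζ^0_{N+1}, θ^0_{N+1})(1)`, which equals `(ζ^h_N, θ^h_N)(1)` because
`ω^0_{N+1} ≡ 0`. -/
def IsImpulseSolution (P : ImpulseTuple n m) : Prop :=
  BoundedVariationOn P.x (Icc 0 D.T) ∧ BoundedVariationOn P.v (Icc 0 D.T) ∧
  (∀ t ∈ Ico (-(M * D.h)) 0, P.x t = D.ξ t) ∧ P.x 0 = D.x₀ ∧ P.v 0 = 0 ∧
  ∃ ζ θ, D.IsJump P.ω P.x P.v ζ θ ∧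
    (∀ l ∈ Icc 2 N, P.x (D.start l) = ζ l 0 1 ∧ P.v (D.start l) = θ l 0 1) ∧
    P.x D.T = ζ N D.h 1 ∧ P.v D.T = θ N D.h 1 ∧
    ∀ l ∈ Icc 1 N, ∀ t ∈ Ioo (D.start l) (l * D.h),
      Summable (fun r : Ioc 0 (t - D.start l) =>
        ζ l r 1 - Function.leftLim P.x (r + D.start l)) ∧
      Summable (fun r : Ioc 0 (t - D.start l) =>
        θ l r 1 - Function.leftLim P.v (r + D.start l)) ∧
      P.x t = ζ l 0 1 + (∫ t' in D.start l..t, D.f t' (D.delayed P.x t'))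
        + (∑ j, ∫ᵛ t' in Icc (D.start l) t, D.g j t' (D.delayed P.x t') ∂<•(P.μ.cont j))
        + ∑' r : Ioc 0 (t - D.start l), (ζ l r 1 - Function.leftLim P.x (r + D.start l)) ∧
      P.v t = θ l 0 1 + (contPart P.ν).real (Icc (D.start l) t)
        + ∑' r : Ioc 0 (t - D.start l), (θ l r 1 - Function.leftLim P.v (r + D.start l))

/-- `(μ, ν, {ω^r}, x, v)` is an impulse process. -/
def IsImpulseProc (P : ImpulseTuple n m) : Prop :=
  D.IsImpulseControl P.μ P.ν P.ω ∧ D.IsImpulseSolution P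

/-- Two tuples describe the same impulse process (the `ω^r` are classes modulo null sets). -/
def SameImpulse (P Q : ImpulseTuple n m) : Prop :=
  P.μ = Q.μ ∧ P.ν = Q.ν ∧
  (∀ r ∈ Icc 0 D.h, ∀ l ∈ Icc 1 N, P.ω r l =ᵐ[volume.restrict (Icc 0 1)] Q.ω r l) ∧
  EqOn P.x Q.x (Icc (-(M * D.h)) D.T) ∧ EqOn P.v Q.v (Icc 0 D.T)

/-! #### Extended controls and extended processes -/

/-- `(S, φ₀, φ)` is an extended control. -/
structure IsExtendedControl (E : ExtendedTuple n m) : Prop where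
  S_pos : 0 < E.S
  lipschitz : ∃ L : ℝ≥0, LipschitzOnWith L E.φ₀ (Icc 0 E.S) ∧
    ∀ l ∈ Icc 1 N, LipschitzOnWith L (E.φ l) (Icc 0 E.S)
  mono : MonotoneOn E.φ₀ (Icc 0 E.S)
  φ₀_zero : E.φ₀ 0 = 0
  φ₀_end : E.φ₀ E.S = D.h
  φ_zero : E.φ 1 0 = 0
  φ_chain : ∀ l ∈ Icc 2 N, E.φ l 0 = E.φ (l - 1) E.S
  φ_cone : ∀ l ∈ Icc 1 N, ∀ᵐ s ∂volume.restrict (Icc 0 E.S), deriv (E.φ l) s ∈ D.K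

/-- `y_{l-k}(s)`, where `y_{-a}(s) = ξ₀(τ₁(s) - (a+1)h)` for `a ≥ 0`. -/
def backState (E : ExtendedTuple n m) (l k : ℕ) (s : ℝ) : State n :=
  if k < l then E.y (l - k) s else D.ξ (E.τ 1 s - (((k - l : ℕ) : ℝ) + 1) * D.h)

/-- `(τ, y, β)` is the solution of the delay-free time-space system driven by `(S, φ₀, φ)`. -/
structure IsExtendedSolution (E : ExtendedTuple n m) : Prop where
  τ_ode : ∀ l ∈ Icc 1 N, SolvesOn (deriv E.φ₀) (E.τ l) 0 E.S
  y_ode : ∀ l ∈ Icc 1 N, SolvesOn (fun s =>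
    deriv E.φ₀ s • D.f (E.τ l s) (fun k => D.backState E l k s)
      + ∑ j, deriv (E.φ l) s j • D.g j (E.τ l s) (fun k => D.backState E l k s)) (E.y l) 0 E.S
  β_ode : ∀ l ∈ Icc 1 N, SolvesOn (fun s => norm1 (deriv (E.φ l) s)) (E.β l) 0 E.S
  init : E.τ 1 0 = 0 ∧ E.y 1 0 = D.x₀ ∧ E.β 1 0 = 0
  chain : ∀ l ∈ Icc 2 N, E.τ l 0 = E.τ (l - 1) E.S ∧ E.y l 0 = E.y (l - 1) E.S ∧
    E.β l 0 = E.β (l - 1) E.S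
  nonneg : ∀ l ∈ Icc 1 N, ∀ s ∈ Icc 0 E.S, 0 ≤ E.τ l s ∧ 0 ≤ E.β l s

/-- `(S, φ₀, φ, τ, y, β)` is a canonical extended process. -/
def IsCanonicalProc (E : ExtendedTuple n m) : Prop :=
  D.IsExtendedControl E ∧ D.IsExtendedSolution E ∧
  ∀ᵐ s ∂volume.restrict (Icc 0 E.S),
    deriv E.φ₀ s + ∑ l ∈ Finset.Icc 1 N, norm1 (deriv (E.φ l) s) = 1

/-- `σ̃`, the right inverse of `τ̃ : [0, N S] → [0,T]`. -/
def sigmaTilde (E : ExtendedTuple n m) : ℝ → ℝ :=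
  rightInv (tilde N E.S E.τ) 0 (N * E.S) 0 D.T

/-- `(x,v) = (ỹ, β̃) ∘ σ̃` on `[0,T]`: `(x,v)` is the graph completion solution associated with
`(S, φ₀, φ, τ, y, β)`. -/
def IsGCSolution (E : ExtendedTuple n m) (x : ℝ → State n) (v : ℝ → ℝ) : Prop :=
  ∀ t ∈ Icc 0 D.T,
    x t = tilde N E.S E.y (D.sigmaTilde E t) ∧ v t = tilde N E.S E.β (D.sigmaTilde E t)

/-! #### From impulse processes to canonical extended processes -/

/-- The measure `μ_l` on `[0,h]`: the part of `μ` on `](l-1)h, lh[` shifted to `]0,h[`, with the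
atoms `∫ω^0_l` at `0` and `∫ω^h_l` at `h`. -/
def muL (P : ImpulseTuple n m) (l : ℕ) : VMeas m := fun j =>
  VectorMeasure.dirac 0 (∫ s in (0 : ℝ)..1, P.ω 0 l s j)
    + ((P.μ j).restrict (Ioo (D.start l) (l * D.h))).map (fun t => t - D.start l)
    + VectorMeasure.dirac D.h (∫ s in (0 : ℝ)..1, P.ω D.h l s j)

/-- The measure `ν_l` on `[0,h]`: the part of `ν` on `](l-1)h, lh[` shifted to `]0,h[`, with the
atoms `∫‖ω^0_l‖` at `0` and `∫‖ω^h_l‖` at `h`. -/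
def nuL (P : ImpulseTuple n m) (l : ℕ) : Measure ℝ :=
  ENNReal.ofReal (∫ s in (0 : ℝ)..1, norm1 (P.ω 0 l s)) • Measure.dirac 0
    + (P.ν.restrict (Ioo (D.start l) (l * D.h))).map (fun t => t - D.start l)
    + ENNReal.ofReal (∫ s in (0 : ℝ)..1, norm1 (P.ω D.h l s)) • Measure.dirac D.h

/-- `φ(0) = 0`, `φ(r) = r + ∑_l ν_l([0,r])` for `r ∈ ]0,h]`. The same formulas are used outside
`[0,h]`, so that `φ⁻(0) = 0` and `φ⁺(h) = φ(h)`. -/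
def phi (P : ImpulseTuple n m) (r : ℝ) : ℝ :=
  if r ≤ 0 then 0 else r + ∑ l ∈ Finset.Icc 1 N, (D.nuL P l).real (Icc 0 r)

/-- The measure `dφ` on `[0,h]`: Lebesgue measure plus `∑_l ν_l`. -/
def dphi (P : ImpulseTuple n m) : Measure ℝ :=
  volume.restrict (Icc 0 D.h) + ∑ l ∈ Finset.Icc 1 N, D.nuL P l

/-- `m_l`, the Radon–Nikodym derivative of `μ_lᶜ` with respect to `dφ`. -/
def density (P : ImpulseTuple n m) (l : ℕ) (r : ℝ) : Ctrl m := fun j =>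
  ((D.muL P l).cont j).rnDeriv (D.dphi P) r

/-- `𝒥`, the set of discontinuity points of `φ` on `[0,h]`. -/
def jumpSet (P : ImpulseTuple n m) : Set ℝ :=
  {r | r ∈ Icc 0 D.h ∧ ¬ ContinuousWithinAt (D.phi P) (Icc 0 D.h) r}

/-- `φ⁻(r)` -/
def phiL (P : ImpulseTuple n m) (r : ℝ) : ℝ := Function.leftLim (D.phi P) r

/-- `φ⁺(r)` -/
def phiR (P : ImpulseTuple n m) (r : ℝ) : ℝ := Function.rightLim (D.phi P) r

/-- `Σ^r = [φ⁻(r), φ⁺(r)]`. -/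
def plateau (P : ImpulseTuple n m) (r : ℝ) : Set ℝ := Icc (D.phiL P r) (D.phiR P r)

/-- `⋃_{r ∈ 𝒥} Σ^r`. -/
def plateaus (P : ImpulseTuple n m) : Set ℝ := ⋃ r ∈ D.jumpSet P, D.plateau P r

/-- `γ^r(s) = (s - φ⁻(r)) / (φ⁺(r) - φ⁻(r))`. -/
def gam (P : ImpulseTuple n m) (r s : ℝ) : ℝ :=
  (s - D.phiL P r) / (D.phiR P r - D.phiL P r)

/-- The right-hand side of the equation for `φ_l`: `m_l(φ₀(s))` off the plateaus, and
`(φ⁺(r) - φ⁻(r))⁻¹ ω^r_l(γ^r(s))` on `Σ^r`, `r ∈ 𝒥`, where `r = φ₀(s)`. -/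
def phiRate (P : ImpulseTuple n m) (φ₀ : ℝ → ℝ) (l : ℕ) (s : ℝ) : Ctrl m :=
  open Classical in
  if s ∈ D.plateaus P then
    (D.phiR P (φ₀ s) - D.phiL P (φ₀ s))⁻¹ • P.ω (φ₀ s) l (D.gam P (φ₀ s) s)
  else D.density P l (φ₀ s)

/-- `E = (S, φ₀, φ, τ, y, β)` is the extended process constructed from the impulse process
`P = (μ, ν, {ω^r}, x, v)`. -/
def IsExtendedOf (P : ImpulseTuple n m) (E : ExtendedTuple n m) : Prop :=
  E.S = D.phi P D.h ∧
  (∀ s ∈ Icc 0 E.S, E.φ₀ s = rightInv (D.phi P) 0 D.h 0 E.S s) ∧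
  (∀ l ∈ Icc 1 N, SolvesOn (D.phiRate P E.φ₀ l) (E.φ l) 0 E.S) ∧
  E.φ 1 0 = 0 ∧ (∀ l ∈ Icc 2 N, E.φ l 0 = E.φ (l - 1) E.S) ∧
  (∀ l ∈ Icc 1 N, ∀ s ∈ Icc 0 E.S, E.τ l s = D.start l + E.φ₀ s) ∧
  ∃ ζ θ, D.IsJump P.ω P.x P.v ζ θ ∧
    E.y 1 0 = D.x₀ ∧ E.β 1 0 = 0 ∧
    (∀ l ∈ Icc 2 N, E.y l 0 = ζ (l - 1) D.h 1 ∧ E.β l 0 = θ (l - 1) D.h 1) ∧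
    (∀ l ∈ Icc 1 N, E.y l E.S = ζ l D.h 1 ∧ E.β l E.S = θ l D.h 1) ∧
    (∀ l ∈ Icc 1 N, ∀ s ∈ Ioo 0 E.S \ D.plateaus P,
      E.y l s = P.x (E.τ l s) ∧ E.β l s = P.v (E.τ l s)) ∧
    (∀ l ∈ Icc 1 N, ∀ r ∈ D.jumpSet P, ∀ s ∈ Ioo 0 E.S ∩ D.plateau P r,
      E.y l s = ζ l r (D.gam P r s) ∧ E.β l s = θ l r (D.gam P r s))

/-! #### From canonical extended processes to impulse processes -/

/-- `σ`, the right inverse of `φ₀ : [0,S] → [0,h]`. -/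
def sigma (E : ExtendedTuple n m) : ℝ → ℝ := rightInv E.φ₀ 0 E.S 0 D.h

/-- `P = (μ, ν, {ω^r}, x, v)` is the tuple constructed from the canonical extended process
`E = (S, φ₀, φ, τ, y, β)`. -/
def IsImpulseOf (E : ExtendedTuple n m) (P : ImpulseTuple n m) : Prop :=
  P.μ.On D.T ∧ IsFiniteMeasure P.ν ∧ P.ν (Icc 0 D.T)ᶜ = 0 ∧
  (∀ t ∈ Icc 0 D.T, ∀ j, P.μ j (Icc 0 t)
    = ∫ s in (0 : ℝ)..Function.rightLim (D.sigmaTilde E) t, deriv (tilde N E.S E.φ) s j) ∧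
  (∀ t ∈ Icc 0 D.T, P.ν.real (Icc 0 t)
    = ∫ s in (0 : ℝ)..Function.rightLim (D.sigmaTilde E) t, norm1 (deriv (tilde N E.S E.φ) s)) ∧
  (∀ r ∈ Icc 0 D.h, ∀ l ∈ Icc 1 N, ∀ᵐ s ∂volume.restrict (Icc 0 1),
    P.ω r l s =
      (Function.rightLim (D.sigma E) r - Function.leftLim (D.sigma E) r) •
        deriv (E.φ l)
          ((Function.rightLim (D.sigma E) r - Function.leftLim (D.sigma E) r) * s
            + Function.leftLim (D.sigma E) r)) ∧
  (∀ t ∈ Ico (-(M * D.h)) 0, P.x t = D.ξ t) ∧ D.IsGCSolution E P.x P.v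

end System

end DelayImpulse

end

noncomputable section

namespace DelayImpulse

/-! ### Right inverses of continuous increasing functions -/

/-! An impulse control and a canonical extended control are two descriptions of one object: a vector
density on the disjoint union of N copies of [0,S]. Let `base` be Lebesgue measure there, and put
`clock` (l,s) = (l-1)h + φ₀(s), `rate` (l,s) = dφ_l/ds (s). Construction B then says that μ is the
image of rate·base under the clock, that ν is the image of ‖rate‖·base, and that ω^r_l is the rate
on the plateau {φ₀ = r} = [σ⁻(r), σ⁺(r)], rescaled to [0,1]. This is `ControlOf`; `isImpulseOf_iff`
identifies it with the prescribed distribution functions.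

The clock fails to be injective only over plateaus and at the grid points lh. All atoms sit over
these countably many times, and what the image measures forget there is recorded by ω. Elsewhere the
rate is a function of time, so nothing cancels: the continuous part of ν is the total variation of
that of μ, and its directions stay in the cone (`pushV_tv`, `pushV_hasConeDensity`). Perturbing the
clock to an injective one gives the weak* approximation required in 𝒱_c (`memVc_push`).

Starting from an extended control, unit speed means that dφ is the image of Lebesgue measure on
[0,S] under φ₀. Hence φ and φ₀ are right inverses of each other, and the Radon–Nikodym derivative of
μ_lᶜ with respect to dφ, composed with φ₀, is dφ_l/ds off the plateaus (`ControlOf.controlExtends`).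
Starting from an impulse control, dφ dominates Lebesgue measure, so φ₀ is 1-Lipschitz and dφ is
again the image of Lebesgue measure. The speed is one off the plateaus because νᶜ = |μᶜ|, and on
them because ω has constant speed (`ControlExtends.isCanonicalControl`). The pushed measures then
have the atoms of μ and ν, since ω determines these, and the same densities elsewhere
(`ControlExtends.controlOf`).

For the states, the integral of the right-hand side of the equation for y_l from σ⁺(0) to σ⁺(r)
splits into the countably many plateaus, each of which contributes one jump of x, and the rest,
which the substitution t = (l-1)h + φ₀(s) turns into the drift and the integral against μᶜ
(`hasSum_jumps`, `Matches.integral_field`). So the impulse equation for x and the delay-free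
equation for y are the same integral equation (`StatesExtend.solves_y`,
`IsGCSolution.solutionWith`). The jump trajectories enter both definitions through an existential
quantifier; a Grönwall argument shows that they are unique (`IsJump.eqOn`), and this identifies the
two choices. -/

lemma rightInv_of_le {A : ℝ → ℝ} {T₁ T₂ S₁ S₂ r : ℝ} (h : r ≤ S₁) :
    rightInv A T₁ T₂ S₁ S₂ r = T₁ := by
  simp [rightInv, h]

lemma rightInv_of_ge {A : ℝ → ℝ} {T₁ T₂ S₁ S₂ r : ℝ} (hS : S₁ < S₂) (h : S₂ ≤ r) :
    rightInv A T₁ T₂ S₁ S₂ r = T₂ := by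
  simp [rightInv, h, (hS.trans_le h).not_ge]

/-- `A` is a continuous increasing map of `[T₁,T₂]` onto `[S₁,S₂]`. -/
structure IsClock (A : ℝ → ℝ) (T₁ T₂ S₁ S₂ : ℝ) : Prop where
  hT : T₁ < T₂
  hS : S₁ < S₂
  cont : ContinuousOn A (Icc T₁ T₂)
  mono : MonotoneOn A (Icc T₁ T₂)
  left : A T₁ = S₁
  right : A T₂ = S₂

namespace IsClock

variable {A : ℝ → ℝ} {T₁ T₂ S₁ S₂ : ℝ} (hA : IsClock A T₁ T₂ S₁ S₂)
include hA

lemma mem_left : T₁ ∈ Icc T₁ T₂ := ⟨le_rfl, hA.hT.le⟩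
lemma mem_right : T₂ ∈ Icc T₁ T₂ := ⟨hA.hT.le, le_rfl⟩

lemma mapsTo {t : ℝ} (ht : t ∈ Icc T₁ T₂) : A t ∈ Icc S₁ S₂ :=
  ⟨hA.left ▸ hA.mono hA.mem_left ht ht.1, hA.right ▸ hA.mono ht hA.mem_right ht.2⟩

lemma rightInv_mem (r : ℝ) : rightInv A T₁ T₂ S₁ S₂ r ∈ Icc T₁ T₂ := by
  unfold rightInv
  split_ifs with h h'
  · exact hA.mem_left
  · exact hA.mem_right
  · have hne : T₂ ∈ {t | t ∈ Icc T₁ T₂ ∧ r < A t} :=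
      ⟨hA.mem_right, by rw [hA.right]; exact not_le.1 h'⟩
    exact ⟨le_csInf ⟨_, hne⟩ fun t ht => ht.1.1, csInf_le ⟨T₁, fun t ht => ht.1.1⟩ hne⟩

lemma rightInv_monotone : Monotone (rightInv A T₁ T₂ S₁ S₂) := by
  intro r r' hr
  by_cases h1 : r ≤ S₁
  · rw [rightInv_of_le h1]; exact (hA.rightInv_mem r').1
  by_cases h3 : S₂ ≤ r'
  · rw [rightInv_of_ge hA.hS h3]
    exact (hA.rightInv_mem r).2
  have h1' : ¬ r' ≤ S₁ := fun h => h1 (hr.trans h)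
  have h3' : ¬ S₂ ≤ r := fun h => h3 (h.trans hr)
  simp only [rightInv, h1, h3, h1', h3', if_false]
  refine csInf_le_csInf ⟨T₁, fun t ht => ht.1.1⟩
    ⟨T₂, hA.mem_right, by rw [hA.right]; exact not_le.1 h3⟩ ?_
  exact fun t ht => ⟨ht.1, hr.trans_lt ht.2⟩

/-- An adjunction. One direction is monotonicity; for the other, continuity from the left moves a
point with A t > r slightly to the left, so that the infimum is strictly below t. End values of r
are excluded because the right inverse is prescribed there. -/
lemma le_iff_le_rightInv {r t : ℝ} (hr : r ∈ Ioo S₁ S₂) (ht : t ∈ Icc T₁ T₂) :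
    A t ≤ r ↔ t ≤ rightInv A T₁ T₂ S₁ S₂ r := by
  have e : rightInv A T₁ T₂ S₁ S₂ r = sInf {t | t ∈ Icc T₁ T₂ ∧ r < A t} := by
    simp [rightInv, hr.1.not_ge, hr.2.not_ge]
  have hne : {t | t ∈ Icc T₁ T₂ ∧ r < A t}.Nonempty := ⟨T₂, hA.mem_right, by rw [hA.right]; exact hr.2⟩
  rw [e]
  constructor
  · intro h
    refine le_csInf hne fun t' ht' => ?_
    by_contra hlt
    exact absurd ((ht'.2.trans_le (hA.mono ht'.1 ht (not_le.1 hlt).le)).trans_le h) (lt_irrefl _)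
  · intro h
    by_contra hlt
    push Not at hlt
    have hTt : T₁ < t := by
      rcases ht.1.eq_or_lt with h' | h'
      · rw [← h', hA.left] at hlt; exact absurd hlt hr.1.not_gt
      · exact h'
    have h1 : ∀ᶠ t' in 𝓝[<] t, r < A t' ∧ t' ∈ Ioo T₁ t := by
      have c : ContinuousWithinAt A (Ioo T₁ t) t :=
        (hA.cont t ht).mono fun u hu => ⟨hu.1.le, hu.2.le.trans ht.2⟩
      have := c.eventually (lt_mem_nhds hlt)
      rw [nhdsWithin_Ioo_eq_nhdsLT hTt] at this
      exact this.and (Ioo_mem_nhdsLT hTt)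
    obtain ⟨t', h2, h3⟩ := h1.exists
    have : sInf {t | t ∈ Icc T₁ T₂ ∧ r < A t} ≤ t' :=
      csInf_le ⟨T₁, fun t ht => ht.1.1⟩ ⟨⟨h3.1.le, h3.2.le.trans ht.2⟩, h2⟩
    linarith [h3.2]

/-- Passing to the right limit extends the adjunction to the end points: at S₁ the prescribed value
T₁ is replaced by the last point at which A equals S₁. -/
lemma le_iff {r t : ℝ} (hr : r ∈ Icc S₁ S₂) (ht : t ∈ Icc T₁ T₂) :
    A t ≤ r ↔ t ≤ Function.rightLim (rightInv A T₁ T₂ S₁ S₂) r := by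
  constructor
  · intro h
    refine ge_of_tendsto ((hA.rightInv_monotone).tendsto_rightLim r) ?_
    filter_upwards [self_mem_nhdsWithin] with r' hr'
    by_cases h2 : S₂ ≤ r'
    · rw [rightInv_of_ge hA.hS h2]; exact ht.2
    · exact (hA.le_iff_le_rightInv ⟨hr.1.trans_lt hr', not_le.1 h2⟩ ht).1 (h.trans (le_of_lt hr'))
  · intro h
    rcases hr.2.eq_or_lt with h2 | h2
    · rw [h2]; exact (hA.mapsTo ht).2
    refine le_of_forall_gt_imp_ge_of_dense fun r' hr' => ?_
    rcases lt_or_ge r' S₂ with h3 | h3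
    · exact (hA.le_iff_le_rightInv ⟨hr.1.trans_lt hr', h3⟩ ht).2
        (h.trans (hA.rightInv_monotone.rightLim_le hr'))
    · exact (hA.mapsTo ht).2.trans h3

/-- Strictness comes from surjectivity: a level r' between A t and r is attained at some t' > t, and
t' is at most the value of the right inverse at r', hence at most its left limit at r. -/
lemma lt_iff {r t : ℝ} (hr : r ∈ Icc S₁ S₂) (ht : t ∈ Icc T₁ T₂) :
    A t < r ↔ t < Function.leftLim (rightInv A T₁ T₂ S₁ S₂) r := by
  constructor
  · intro h
    obtain ⟨r', h1, h2⟩ := exists_between h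
    have hmem : r' ∈ Icc (A t) (A T₂) := ⟨h1.le, by rw [hA.right]; exact h2.le.trans hr.2⟩
    obtain ⟨t', ht', e⟩ := intermediate_value_Icc ht.2 (hA.cont.mono (Icc_subset_Icc_left ht.1)) hmem
    have hlt : t < t' := by
      rcases ht'.1.eq_or_lt with h' | h'
      · rw [← h'] at e; linarith
      · exact h'
    have h3 : t' ≤ rightInv A T₁ T₂ S₁ S₂ r' :=
      (hA.le_iff_le_rightInv ⟨(hA.mapsTo ht).1.trans_lt h1, h2.trans_le hr.2⟩
        ⟨ht.1.trans ht'.1, ht'.2⟩).1 e.le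
    exact hlt.trans_le (h3.trans (hA.rightInv_monotone.le_leftLim h2))
  · intro h
    have h1 := ((hA.rightInv_monotone).tendsto_leftLim r).eventually (lt_mem_nhds h)
    obtain ⟨r', h2, h3⟩ := (h1.and self_mem_nhdsWithin).exists
    have h3 : r' < r := h3
    have h4 : S₁ < r' := by
      by_contra hle
      rw [rightInv_of_le (not_lt.1 hle)] at h2
      exact absurd h2 ht.1.not_gt
    exact ((hA.le_iff_le_rightInv ⟨h4, h3.trans_le hr.2⟩ ht).2 h2.le).trans_lt h3

lemma rightLim_mem (r : ℝ) : Function.rightLim (rightInv A T₁ T₂ S₁ S₂) r ∈ Icc T₁ T₂ := by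
  constructor
  · exact (hA.rightInv_mem r).1.trans (hA.rightInv_monotone.le_rightLim le_rfl)
  · exact (hA.rightInv_monotone.rightLim_le (lt_add_one r)).trans (hA.rightInv_mem _).2

lemma leftLim_mem (r : ℝ) : Function.leftLim (rightInv A T₁ T₂ S₁ S₂) r ∈ Icc T₁ T₂ := by
  constructor
  · exact (hA.rightInv_mem _).1.trans (hA.rightInv_monotone.le_leftLim (sub_one_lt r))
  · exact (hA.rightInv_monotone.leftLim_le le_rfl).trans (hA.rightInv_mem r).2

lemma leftLim_le_rightLim (r : ℝ) : Function.leftLim (rightInv A T₁ T₂ S₁ S₂) r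
    ≤ Function.rightLim (rightInv A T₁ T₂ S₁ S₂) r :=
  hA.rightInv_monotone.leftLim_le_rightLim le_rfl

/-- Applied to φ₀, this says that level sets are exactly the plateaus [σ⁻(r), σ⁺(r)]; every
computation of an atom below rests on it. -/
lemma eq_iff {r t : ℝ} (hr : r ∈ Icc S₁ S₂) (ht : t ∈ Icc T₁ T₂) :
    A t = r ↔ t ∈ Icc (Function.leftLim (rightInv A T₁ T₂ S₁ S₂) r)
      (Function.rightLim (rightInv A T₁ T₂ S₁ S₂) r) := by
  rw [mem_Icc, ← hA.le_iff hr ht, ← not_lt, ← hA.lt_iff hr ht, not_lt, and_comm]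
  exact ⟨fun h => ⟨h.le, h.ge⟩, fun h => le_antisymm h.1 h.2⟩

lemma rightLim_eq_of {r c : ℝ} (hr : r ∈ Icc S₁ S₂) (hc : c ∈ Icc T₁ T₂) (h1 : A c ≤ r)
    (h2 : ∀ t ∈ Icc T₁ T₂, c < t → r < A t) :
    Function.rightLim (rightInv A T₁ T₂ S₁ S₂) r = c := by
  refine le_antisymm ?_ ((hA.le_iff hr hc).1 h1)
  by_contra hlt
  push Not at hlt
  have := h2 _ (hA.rightLim_mem r) hlt
  exact absurd ((hA.le_iff hr (hA.rightLim_mem r)).2 le_rfl) this.not_ge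

lemma leftLim_eq_of {r c : ℝ} (hr : r ∈ Icc S₁ S₂) (hc : c ∈ Icc T₁ T₂) (h1 : r ≤ A c)
    (h2 : ∀ t ∈ Icc T₁ T₂, t < c → A t < r) :
    Function.leftLim (rightInv A T₁ T₂ S₁ S₂) r = c := by
  refine le_antisymm ?_ ?_
  · by_contra hlt
    exact absurd ((hA.lt_iff hr hc).2 (not_le.1 hlt)) h1.not_gt
  · by_contra hlt
    have := h2 _ (hA.leftLim_mem r) (not_le.1 hlt)
    exact absurd ((hA.lt_iff hr (hA.leftLim_mem r)).1 this) (lt_irrefl _)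

/-- Right continuity can fail only at S₁, where the value is prescribed. This exception is the
reason for the separate convention φ(0) = 0 in Construction A. -/
lemma rightInv_eq_rightLim {r : ℝ} (hr : r ∈ Ioc S₁ S₂) :
    rightInv A T₁ T₂ S₁ S₂ r = Function.rightLim (rightInv A T₁ T₂ S₁ S₂) r := by
  rcases hr.2.eq_or_lt with h | h
  · refine le_antisymm (hA.rightInv_monotone.le_rightLim le_rfl) ?_
    rw [h, rightInv_of_ge hA.hS le_rfl]
    exact (hA.rightLim_mem _).2
  · refine (hA.rightLim_eq_of ⟨hr.1.le, hr.2⟩ (hA.rightInv_mem r) ?_ ?_).symm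
    · exact (hA.le_iff_le_rightInv ⟨hr.1, h⟩ (hA.rightInv_mem r)).2 le_rfl
    · intro t ht hlt
      by_contra hle
      exact absurd ((hA.le_iff_le_rightInv ⟨hr.1, h⟩ ht).1 (not_lt.1 hle)) hlt.not_ge

lemma leftLim_left : Function.leftLim (rightInv A T₁ T₂ S₁ S₂) S₁ = T₁ :=
  hA.leftLim_eq_of ⟨le_rfl, hA.hS.le⟩ hA.mem_left hA.left.ge
    fun _ ht h => absurd h ht.1.not_gt

lemma rightLim_right : Function.rightLim (rightInv A T₁ T₂ S₁ S₂) S₂ = T₂ :=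
  hA.rightLim_eq_of ⟨hA.hS.le, le_rfl⟩ hA.mem_right hA.right.le
    fun _ ht h => absurd h ht.2.not_gt

lemma apply_rightLim {r : ℝ} (hr : r ∈ Icc S₁ S₂) :
    A (Function.rightLim (rightInv A T₁ T₂ S₁ S₂) r) = r :=
  (hA.eq_iff hr (hA.rightLim_mem r)).2 ⟨hA.leftLim_le_rightLim r, le_rfl⟩

end IsClock

/-! ### Absolutely continuous functions -/

section SolvesOn

variable {V : Type*} [NormedAddCommGroup V] [NormedSpace ℝ V] {F G y : ℝ → V} {a b : ℝ}

lemma SolvesOn.congr_ae (h : SolvesOn F y a b) (hab : a ≤ b)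
    (hFG : ∀ᵐ s ∂volume.restrict (Icc a b), F s = G s) : SolvesOn G y a b := by
  have hFG' : ∀ᵐ s ∂volume, s ∈ Icc a b → F s = G s := (ae_restrict_iff' measurableSet_Icc).1 hFG
  refine ⟨h.1.congr_ae ?_, fun s hs => ?_⟩
  · rw [uIoc_of_le hab]
    exact (ae_mono (Measure.restrict_mono Ioc_subset_Icc_self le_rfl)) hFG
  · rw [h.2 s hs]
    congr 1
    refine intervalIntegral.integral_congr_ae ?_
    filter_upwards [hFG'] with u hu hu'
    rw [uIoc_of_le hs.1] at hu'
    exact hu ⟨hu'.1.le, hu'.2.trans hs.2⟩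

lemma SolvesOn.intervalIntegrable (h : SolvesOn F y a b) {s t : ℝ} (hs : s ∈ Icc a b)
    (ht : t ∈ Icc a b) : IntervalIntegrable F volume s t := by
  refine h.1.mono_set ?_
  rw [uIcc_of_le (hs.1.trans hs.2)]
  exact uIcc_subset_Icc hs ht

lemma SolvesOn.sub_eq (h : SolvesOn F y a b) {s t : ℝ} (hs : s ∈ Icc a b) (ht : t ∈ Icc a b) :
    y t - y s = ∫ u in s..t, F u := by
  have ha : a ∈ Icc a b := ⟨le_rfl, hs.1.trans hs.2⟩
  rw [h.2 t ht, h.2 s hs, ← intervalIntegral.integral_interval_sub_left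
    (h.intervalIntegrable ha ht) (h.intervalIntegrable ha hs)]
  abel

lemma SolvesOn.continuousOn (h : SolvesOn F y a b) (hab : a ≤ b) : ContinuousOn y (Icc a b) := by
  have : ContinuousOn (fun s => y a + ∫ u in a..s, F u) (Icc a b) := by
    refine continuousOn_const.add ?_
    have := intervalIntegral.continuousOn_primitive_interval (μ := volume) (f := F) (a := a) (b := b) ?_
    · rwa [uIcc_of_le hab] at this
    · rw [uIcc_of_le hab, integrableOn_Icc_iff_integrableOn_Ioc]
      exact (intervalIntegrable_iff_integrableOn_Ioc_of_le hab).1 h.1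
  exact this.congr h.2

lemma SolvesOn.ae_deriv [CompleteSpace V] (h : SolvesOn F y a b) (hab : a ≤ b) :
    ∀ᵐ s ∂volume.restrict (Icc a b), deriv y s = F s := by
  rw [← Measure.restrict_congr_set Ioo_ae_eq_Icc, ae_restrict_iff' measurableSet_Ioo]
  filter_upwards [h.1.ae_hasDerivAt_integral] with s hs hs'
  have h1 := hs (by rw [uIcc_of_le hab]; exact Ioo_subset_Icc_self hs') a left_mem_uIcc
  have h2 : y =ᶠ[𝓝 s] fun x => y a + ∫ u in a..x, F u := by
    filter_upwards [Ioo_mem_nhds hs'.1 hs'.2] with x hx using h.2 x (Ioo_subset_Icc_self hx)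
  exact ((h1.const_add (y a)).congr_of_eventuallyEq h2).deriv

lemma SolvesOn.lipschitzOnWith (h : SolvesOn F y a b) {C : ℝ≥0}
    (hC : ∀ᵐ s ∂volume.restrict (Icc a b), ‖F s‖ ≤ C) : LipschitzOnWith C y (Icc a b) := by
  have hC' : ∀ᵐ s ∂volume, s ∈ Icc a b → ‖F s‖ ≤ C := (ae_restrict_iff' measurableSet_Icc).1 hC
  refine LipschitzOnWith.of_dist_le_mul fun s hs t ht => ?_
  rw [dist_comm, dist_eq_norm, h.sub_eq hs ht]
  refine (intervalIntegral.norm_integral_le_of_norm_le_const_ae ?_).trans (by rw [Real.dist_eq, abs_sub_comm])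
  filter_upwards [hC'] with u hu hu'
  have := uIoc_subset_uIcc hu'
  exact hu (uIcc_subset_Icc hs ht this)

end SolvesOn

lemma LipschitzOnWith.solvesOn_deriv_real {f : ℝ → ℝ} {a b : ℝ} {C : ℝ≥0} (hab : a ≤ b)
    (h : LipschitzOnWith C f (Icc a b)) : SolvesOn (deriv f) f a b := by
  have hac : AbsolutelyContinuousOnInterval f a b := by
    refine LipschitzOnWith.absolutelyContinuousOnInterval (K := C) ?_
    rwa [uIcc_of_le hab]
  refine ⟨hac.intervalIntegrable_deriv, fun s hs => ?_⟩
  have hs' : AbsolutelyContinuousOnInterval f a s := by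
    refine hac.mono ?_
    rw [uIcc_of_le hab, uIcc_of_le hs.1]
    exact Icc_subset_Icc_right hs.2
  rw [hs'.integral_deriv_eq_sub]; ring

lemma LipschitzOnWith.ae_differentiableAt_Icc {f : ℝ → ℝ} {a b : ℝ} {C : ℝ≥0} (hab : a ≤ b)
    (h : LipschitzOnWith C f (Icc a b)) :
    ∀ᵐ s ∂volume.restrict (Icc a b), DifferentiableAt ℝ f s := by
  have hac : AbsolutelyContinuousOnInterval f a b := by
    refine LipschitzOnWith.absolutelyContinuousOnInterval (K := C) ?_
    rwa [uIcc_of_le hab]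
  rw [ae_restrict_iff' measurableSet_Icc]
  have := hac.ae_differentiableAt
  rwa [uIcc_of_le hab] at this

lemma intervalIntegral_apply {m : ℕ} {F : ℝ → Ctrl m} {a b : ℝ}
    (h : IntervalIntegrable F volume a b) (j : Fin m) :
    (∫ s in a..b, F s) j = ∫ s in a..b, F s j :=
  (ContinuousLinearMap.intervalIntegral_comp_comm
    (ContinuousLinearMap.proj (R := ℝ) (φ := fun _ : Fin m => ℝ) j) h).symm

lemma LipschitzOnWith.solvesOn_deriv {m : ℕ} {f : ℝ → Ctrl m} {a b : ℝ} {C : ℝ≥0} (hab : a ≤ b)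
    (h : LipschitzOnWith C f (Icc a b)) : SolvesOn (deriv f) f a b := by
  have hj : ∀ j, LipschitzOnWith C (fun s => f s j) (Icc a b) := fun j x hx y hy =>
    (edist_le_pi_edist (f x) (f y) j).trans (h hx hy)
  -- The derivative of a vector function is the vector of derivatives only where all components are
  -- differentiable; elsewhere `deriv` takes the default value 0.
  have hd : ∀ᵐ s ∂volume.restrict (Icc a b), ∀ j, deriv f s j = deriv (fun s => f s j) s := by
    filter_upwards [ae_all_iff.2 fun j => LipschitzOnWith.ae_differentiableAt_Icc hab (hj j)]
      with s hs j
    rw [deriv_pi hs]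
  have hs : ∀ j, SolvesOn (fun s => deriv f s j) (fun s => f s j) a b := fun j =>
    (LipschitzOnWith.solvesOn_deriv_real hab (hj j)).congr_ae hab
      (hd.mono fun s hs => (hs j).symm)
  have hi : IntervalIntegrable (deriv f) volume a b := by
    rw [intervalIntegrable_iff_integrableOn_Ioc_of_le hab]
    exact Integrable.of_eval fun j =>
      (intervalIntegrable_iff_integrableOn_Ioc_of_le hab).1 (hs j).1
  refine ⟨hi, fun s hs' => ?_⟩
  ext j
  have : IntervalIntegrable (deriv f) volume a s := hi.mono_set (by
    rw [uIcc_of_le hab, uIcc_of_le hs'.1]; exact Icc_subset_Icc_right hs'.2)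
  rw [Pi.add_apply, intervalIntegral_apply this]
  exact (hs j).2 s hs'

/-! ### Signed measures on the line -/

/-- Half-lines form a π-system generating the Borel sets, and of `Iic y` a measure on [0,T] sees
only [0, min y T]. Thus Construction B, which prescribes distribution functions only, determines the
measures. -/
lemma signedMeasure_ext_Icc {s t : SignedMeasure ℝ} {T : ℝ} (hT : 0 ≤ T)
    (hs : ∀ B, MeasurableSet B → Disjoint B (Icc 0 T) → s B = 0)
    (ht : ∀ B, MeasurableSet B → Disjoint B (Icc 0 T) → t B = 0)
    (h : ∀ x ∈ Icc 0 T, s (Icc 0 x) = t (Icc 0 x)) : s = t := by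
  have key : ∀ x y : ℝ, x ∈ Icc 0 T → x ≤ y → (Icc 0 T ∩ Iic y = Icc 0 x) → s (Iic y) = t (Iic y) := by
    intro x y hx hxy he
    have hu : ∀ u : SignedMeasure ℝ, (∀ B, MeasurableSet B → Disjoint B (Icc 0 T) → u B = 0) →
        u (Iic y) = u (Icc 0 x) := by
      intro u hu
      have e : Iic y = (Icc 0 x) ∪ (Iic y \ Icc 0 T) := by
        rw [← he, inter_comm, inter_union_sdiff]
      rw [e, VectorMeasure.of_union _ measurableSet_Icc (measurableSet_Iic.diff measurableSet_Icc),
        hu _ (measurableSet_Iic.diff measurableSet_Icc) disjoint_sdiff_left, add_zero]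
      rw [← he]
      exact (disjoint_sdiff_right).mono_left inter_subset_left
    rw [hu s hs, hu t ht, h x hx]
  refine VectorMeasure.ext_of_generateFrom (range Iic) ?_ (borel_eq_generateFrom_Iic ℝ ▸
    (BorelSpace.measurable_eq (α := ℝ))) isPiSystem_Iic ?_
  · rintro _ ⟨y, rfl⟩
    rcases lt_or_ge y 0 with h0 | h0
    · have : Disjoint (Iic y) (Icc 0 T) := by
        rw [Set.disjoint_left]; intro u hu hu'; exact absurd (hu'.1.trans hu) h0.not_ge
      rw [hs _ measurableSet_Iic this, ht _ measurableSet_Iic this]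
    · refine key (min y T) y ⟨le_min h0 hT, min_le_right _ _⟩ (min_le_left _ _) ?_
      ext u
      simp only [mem_inter_iff, mem_Icc, mem_Iic, le_min_iff]
      tauto
  · have e : (univ : Set ℝ) = Icc 0 T ∪ (Icc 0 T)ᶜ := (union_compl_self _).symm
    have hd : Disjoint ((Icc 0 T)ᶜ) (Icc (0:ℝ) T) := disjoint_compl_left
    rw [e, VectorMeasure.of_union hd.symm measurableSet_Icc measurableSet_Icc.compl,
      VectorMeasure.of_union hd.symm measurableSet_Icc measurableSet_Icc.compl,
      hs _ measurableSet_Icc.compl hd, ht _ measurableSet_Icc.compl hd, h T ⟨hT, le_rfl⟩]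

lemma measure_ext_Icc {μ ν : Measure ℝ} [IsFiniteMeasure μ] [IsFiniteMeasure ν] {T : ℝ} (hT : 0 ≤ T)
    (hμ : μ (Icc 0 T)ᶜ = 0) (hν : ν (Icc 0 T)ᶜ = 0)
    (h : ∀ x ∈ Icc 0 T, μ.real (Icc 0 x) = ν.real (Icc 0 x)) : μ = ν := by
  rw [← Measure.toSignedMeasure_eq_toSignedMeasure_iff]
  refine signedMeasure_ext_Icc hT ?_ ?_ ?_
  · intro B hB hd
    rw [Measure.toSignedMeasure_apply_measurable hB, Measure.real,
      measure_mono_null hd.subset_compl_right hμ]; rfl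
  · intro B hB hd
    rw [Measure.toSignedMeasure_apply_measurable hB, Measure.real,
      measure_mono_null hd.subset_compl_right hν]; rfl
  · intro x hx
    rw [Measure.toSignedMeasure_apply_measurable measurableSet_Icc,
      Measure.toSignedMeasure_apply_measurable measurableSet_Icc, h x hx]

lemma signedMeasure_countable_eq {s t : SignedMeasure ℝ} {C : Set ℝ} (hC : C.Countable)
    (h1 : ∀ x ∈ C, s {x} = t {x}) : s C = t C := by
  have : C = ⋃ x ∈ C, {x} := by simp
  rw [this, VectorMeasure.of_biUnion hC (fun a _ b _ hab => by simpa [Function.onFun] using hab)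
    fun b _ => measurableSet_singleton b,
    VectorMeasure.of_biUnion hC (fun a _ b _ hab => by simpa [Function.onFun] using hab)
    fun b _ => measurableSet_singleton b]
  exact tsum_congr fun x => h1 x x.2

lemma signedMeasure_ext_countable {s t : SignedMeasure ℝ} {C : Set ℝ} (hC : C.Countable)
    (h1 : ∀ x ∈ C, s {x} = t {x})
    (h2 : ∀ B, MeasurableSet B → Disjoint B C → s B = t B) : s = t := by
  ext B hB
  have hm := hC.measurableSet
  have e : B = (B ∩ C) ∪ (B \ C) := (inter_union_sdiff _ _).symm
  rw [e, VectorMeasure.of_union disjoint_sdiff_inter.symm (hB.inter hm) (hB.diff hm),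
    VectorMeasure.of_union disjoint_sdiff_inter.symm (hB.inter hm) (hB.diff hm),
    h2 _ (hB.diff hm) disjoint_sdiff_left,
    signedMeasure_countable_eq (hC.mono inter_subset_right) fun x hx => h1 x hx.2]

/-- A countable set of points without mass is null by countable additivity, so it may be removed as
well. -/
lemma signedMeasure_restrict_compl_eq {s : SignedMeasure ℝ} {A C : Set ℝ} (hC : C.Countable)
    (hA : A ⊆ C) (h : ∀ x ∈ C \ A, s {x} = 0) : s.restrict Aᶜ = s.restrict Cᶜ := by
  have hA' := hC.mono hA
  ext B hB
  rw [VectorMeasure.restrict_apply _ hA'.measurableSet.compl hB,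
    VectorMeasure.restrict_apply _ hC.measurableSet.compl hB]
  have e : B ∩ Aᶜ = (B ∩ Cᶜ) ∪ (B ∩ (C \ A)) := by
    ext x
    have := @hA x
    simp only [mem_inter_iff, mem_compl_iff, mem_union, Set.mem_sdiff]
    tauto
  have hc : (B ∩ (C \ A)).Countable := hC.mono fun x hx => hx.2.1
  rw [e, VectorMeasure.of_union _ (hB.inter hC.measurableSet.compl) hc.measurableSet,
    signedMeasure_countable_eq (t := 0) hc fun x hx => by rw [h x hx.2]; simp]
  · simp
  · rw [Set.disjoint_left]; rintro x ⟨_, hx⟩ ⟨_, hx', _⟩; exact hx hx'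

/-- The exact set of atoms is inconvenient, since a plateau may carry no mass of μ or a mass that
cancels. Removing any countable set that contains the atoms gives the same continuous part. -/
lemma cont_eq_restrict {m : ℕ} {μ : VMeas m} {C : Set ℝ} (hC : C.Countable) (h : μ.atoms ⊆ C)
    (j : Fin m) : μ.cont j = (μ j).restrict Cᶜ := by
  refine signedMeasure_restrict_compl_eq hC h fun x hx => ?_
  by_contra hne
  exact hx.2 fun h0 => hne (congrFun h0 j)

lemma contPart_eq_restrict {ν : Measure ℝ} {C : Set ℝ} (hC : C.Countable)
    (h : ∀ t, ν {t} ≠ 0 → t ∈ C) : contPart ν = ν.restrict Cᶜ := by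
  unfold contPart
  refine Measure.restrict_congr_set ?_
  have h0 : ν (C \ {t | ν {t} ≠ 0}) = 0 := by
    have hc : (C \ {t | ν {t} ≠ 0}).Countable := hC.mono sdiff_subset
    rw [measure_null_iff_singleton hc]
    intro x hx
    by_contra hne
    exact hx.2 hne
  refine ae_eq_set.2 ⟨measure_mono_null (fun x hx => ?_) h0, measure_mono_null (fun x hx => ?_) h0⟩
  · exact ⟨by_contra fun hh => hx.2 hh, hx.1⟩
  · exact absurd (h x (not_not.1 hx.2)) hx.1

/-! ### Measures with density transported to the line -/

section Push

variable {Ω : Type*} [MeasurableSpace Ω] {m : ℕ}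

/-- The image under `τ` of the vector measure with density `Φ` with respect to `κ`. -/
def pushV (κ : Measure Ω) (τ : Ω → ℝ) (Φ : Ω → Ctrl m) : VMeas m := fun j =>
  (κ.withDensityᵥ fun p => Φ p j).map τ

/-- The image under `τ` of the measure with density `‖Φ‖` with respect to `κ`. -/
def pushN (κ : Measure Ω) (τ : Ω → ℝ) (Φ : Ω → Ctrl m) : Measure ℝ :=
  (κ.withDensity fun p => ENNReal.ofReal (norm1 (Φ p))).map τ

lemma norm1_nonneg (w : Ctrl m) : 0 ≤ norm1 w := Finset.sum_nonneg fun _ _ => abs_nonneg _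

lemma abs_le_norm1 (w : Ctrl m) (j : Fin m) : |w j| ≤ norm1 w :=
  Finset.single_le_sum (f := fun j => |w j|) (fun _ _ => abs_nonneg _) (Finset.mem_univ j)

lemma norm_le_norm1 (w : Ctrl m) : ‖w‖ ≤ norm1 w :=
  (pi_norm_le_iff_of_nonneg (norm1_nonneg w)).2 fun j => abs_le_norm1 w j

lemma norm1_smul (c : ℝ) (w : Ctrl m) : norm1 (c • w) = |c| * norm1 w := by
  simp [norm1, abs_mul, Finset.mul_sum]

lemma norm1_zero : norm1 (0 : Ctrl m) = 0 := by simp [norm1]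

lemma eq_zero_of_norm1 {w : Ctrl m} (h : norm1 w = 0) : w = 0 := by
  ext j
  have := abs_le_norm1 w j
  rw [h] at this
  simpa using this

lemma continuous_norm1 : Continuous (norm1 : Ctrl m → ℝ) := by unfold norm1; fun_prop

lemma measurable_norm1 : Measurable (norm1 : Ctrl m → ℝ) := continuous_norm1.measurable

variable {κ : Measure Ω} {τ : Ω → ℝ} {Φ : Ω → Ctrl m}

lemma integrable_norm1 (hi : Integrable Φ κ) : Integrable (fun p => norm1 (Φ p)) κ := by
  unfold norm1
  exact integrable_finsetSum _ fun j _ => (hi.eval j).abs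

lemma pushV_apply (hτ : Measurable τ) (hi : Integrable Φ κ) {B : Set ℝ} (hB : MeasurableSet B)
    (j : Fin m) : pushV κ τ Φ j B = ∫ p in τ ⁻¹' B, Φ p j ∂κ := by
  rw [pushV, VectorMeasure.map_apply _ hτ hB, withDensityᵥ_apply (hi.eval j) (hτ hB)]

lemma isFiniteMeasure_pushN (hi : Integrable Φ κ) : IsFiniteMeasure (pushN κ τ Φ) := by
  have : IsFiniteMeasure (κ.withDensity fun p => ENNReal.ofReal (norm1 (Φ p))) :=
    isFiniteMeasure_withDensity_ofReal (integrable_norm1 hi).2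
  unfold pushN
  infer_instance

lemma pushN_apply (hτ : Measurable τ) {B : Set ℝ} (hB : MeasurableSet B) :
    pushN κ τ Φ B = ∫⁻ p in τ ⁻¹' B, ENNReal.ofReal (norm1 (Φ p)) ∂κ := by
  rw [pushN, Measure.map_apply hτ hB, withDensity_apply _ (hτ hB)]

lemma pushN_real (hτ : Measurable τ) (hi : Integrable Φ κ) {B : Set ℝ} (hB : MeasurableSet B) :
    (pushN κ τ Φ).real B = ∫ p in τ ⁻¹' B, norm1 (Φ p) ∂κ := by
  rw [Measure.real, pushN_apply hτ hB, ← ofReal_integral_eq_lintegral_ofReal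
    (integrable_norm1 hi).integrableOn (Eventually.of_forall fun p => norm1_nonneg _),
    ENNReal.toReal_ofReal (integral_nonneg fun p => norm1_nonneg _)]

lemma pushV_restrict (hτ : Measurable τ) (hi : Integrable Φ κ) {B : Set ℝ} (hB : MeasurableSet B)
    (j : Fin m) : (pushV κ τ Φ j).restrict B = pushV (κ.restrict (τ ⁻¹' B)) τ Φ j := by
  ext C hC
  rw [VectorMeasure.restrict_apply _ hB hC, pushV_apply hτ hi (hC.inter hB),
    pushV_apply hτ hi.integrableOn hC, Measure.restrict_restrict (hτ hC), preimage_inter]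

lemma pushN_restrict (hτ : Measurable τ) {B : Set ℝ} (hB : MeasurableSet B) :
    (pushN κ τ Φ).restrict B = pushN (κ.restrict (τ ⁻¹' B)) τ Φ := by
  ext C hC
  rw [Measure.restrict_apply hC, pushN_apply hτ (hC.inter hB),
    pushN_apply hτ hC, Measure.restrict_restrict (hτ hC), preimage_inter]

/-- The signed measure is written as the difference of the finite measures with densities q⁺ and q⁻;
a bounded f is integrable for both, which reduces the claim to nonnegative densities. -/
lemma integral_withDensityV {V : Type*} [NormedAddCommGroup V] [NormedSpace ℝ V]
    {q : Ω → ℝ} (hq : Integrable q κ) {f : Ω → V} (hf : StronglyMeasurable f) {C : ℝ}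
    (hC : ∀ p, ‖f p‖ ≤ C) : ∫ᵛ p, f p ∂<•(κ.withDensityᵥ q) = ∫ p, q p • f p ∂κ := by
  have f1 : IsFiniteMeasure (κ.withDensity fun x => ENNReal.ofReal (q x)) :=
    isFiniteMeasure_withDensity_ofReal hq.2
  have f2 : IsFiniteMeasure (κ.withDensity fun x => ENNReal.ofReal (-q x)) :=
    isFiniteMeasure_withDensity_ofReal hq.neg.2
  have hb : ∀ (ρ : Measure Ω) [IsFiniteMeasure ρ], Integrable f ρ := fun ρ _ =>
    Integrable.of_bound hf.aestronglyMeasurable C (Eventually.of_forall hC)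
  have hqm := hq.aestronglyMeasurable.aemeasurable
  have hqn : AEMeasurable (fun x => -q x) κ := hqm.neg
  rw [withDensityᵥ_eq_withDensity_pos_part_sub_withDensity_neg_part hq,
    VectorMeasure.integral_sub_vectorMeasure (by
      rw [VectorMeasure.Integrable, Measure.variation_toSignedMeasure]; exact hb _) (by
      rw [VectorMeasure.Integrable, Measure.variation_toSignedMeasure]; exact hb _),
    VectorMeasure.integral_toSignedMeasure, VectorMeasure.integral_toSignedMeasure,
    integral_withDensity_eq_integral_toReal_smul₀ hqm.ennreal_ofReal (by simp),
    integral_withDensity_eq_integral_toReal_smul₀ hqn.ennreal_ofReal (by simp),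
    ← integral_sub]
  · refine integral_congr_ae (Eventually.of_forall fun p => ?_)
    simp only [← sub_smul]
    congr 1
    rcases le_total 0 (q p) with h | h
    · rw [ENNReal.toReal_ofReal h, ENNReal.ofReal_of_nonpos (by linarith)]; simp
    · rw [ENNReal.ofReal_of_nonpos h, ENNReal.toReal_ofReal (neg_nonneg.2 h)]; simp
  · exact (integrable_withDensity_iff_integrable_smul₀' hqm.ennreal_ofReal (by simp)).1 (hb _)
  · exact (integrable_withDensity_iff_integrable_smul₀' hqn.ennreal_ofReal (by simp)).1 (hb _)

lemma isFiniteMeasure_variation (s : SignedMeasure Ω) : IsFiniteMeasure s.variation := by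
  rw [← SignedMeasure.totalVariation_eq_variation]
  infer_instance

lemma integral_pushV {V : Type*} [NormedAddCommGroup V] [NormedSpace ℝ V]
    (hτ : Measurable τ) (hi : Integrable Φ κ) {f : ℝ → V} (hf : StronglyMeasurable f) {C : ℝ}
    (hC : ∀ t, ‖f t‖ ≤ C) (j : Fin m) :
    ∫ᵛ t, f t ∂<•(pushV κ τ Φ j) = ∫ p, Φ p j • f (τ p) ∂κ := by
  have := isFiniteMeasure_variation (κ.withDensityᵥ fun p => Φ p j)
  rw [pushV, VectorMeasure.integral_map hτ hf.aestronglyMeasurable,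
    integral_withDensityV (hi.eval j) (f := fun p => f (τ p)) (hf.comp_measurable hτ) fun p => hC _]
  exact Integrable.of_bound (hf.comp_measurable hτ).aestronglyMeasurable C
    (Eventually.of_forall fun p => hC _)

lemma setIntegral_pushV {V : Type*} [NormedAddCommGroup V] [NormedSpace ℝ V]
    (hτ : Measurable τ) (hi : Integrable Φ κ) {f : ℝ → V} (hf : StronglyMeasurable f) {C : ℝ}
    (hC : ∀ t, ‖f t‖ ≤ C) (j : Fin m) {B : Set ℝ} (hB : MeasurableSet B) :
    ∫ᵛ t in B, f t ∂<•(pushV κ τ Φ j) = ∫ p in τ ⁻¹' B, Φ p j • f (τ p) ∂κ := by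
  rw [pushV_restrict hτ hi hB, integral_pushV hτ hi.integrableOn hf hC]

/-- If `τ` is injective on a set of full measure, then `Φ` factors through `τ`. -/
lemma exists_factor [StandardBorelSpace Ω] (hτ : Measurable τ) (hΦ : Measurable Φ) {A : Set Ω}
    (hA : MeasurableSet A) (hinj : InjOn τ A) (h0 : κ Aᶜ = 0) :
    ∃ w : ℝ → Ctrl m, Measurable w ∧ ∀ᵐ p ∂κ, w (τ p) = Φ p := by
  have := hA.standardBorel
  -- By the Lusin–Souslin theorem an injective measurable map on a standard Borel space has a
  -- measurable inverse on its range; composing this inverse with Φ gives the factor.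
  have hme : MeasurableEmbedding (fun p : A => τ p) :=
    (hτ.comp measurable_subtype_coe).measurableEmbedding (injOn_iff_injective.1 hinj)
  obtain ⟨w, hw, e⟩ := hme.exists_measurable_extend (hΦ.comp measurable_subtype_coe)
    (fun _ => ⟨(0 : Ctrl m)⟩)
  refine ⟨w, hw, ?_⟩
  have : ∀ᵐ p ∂κ, p ∈ A := by rwa [ae_iff]
  filter_upwards [this] with p hp using congrFun e ⟨p, hp⟩

lemma pushV_eq_withDensity (hτ : Measurable τ) (hi : Integrable Φ κ) {w : ℝ → Ctrl m}
    (hw : Measurable w) (h : ∀ᵐ p ∂κ, w (τ p) = Φ p) :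
    Integrable w (κ.map τ) ∧ ∀ j, pushV κ τ Φ j = (κ.map τ).withDensityᵥ fun t => w t j := by
  have hiw : Integrable w (κ.map τ) :=
    (integrable_map_measure hw.aestronglyMeasurable hτ.aemeasurable).2
      (hi.congr (h.mono fun p hp => hp.symm))
  refine ⟨hiw, fun j => ?_⟩
  ext B hB
  rw [pushV_apply hτ hi hB, withDensityᵥ_apply (hiw.eval j) hB,
    setIntegral_map hB (hiw.eval j).aestronglyMeasurable hτ.aemeasurable]
  refine integral_congr_ae (ae_restrict_of_ae ?_)
  filter_upwards [h] with p hp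
  rw [hp]

lemma pushN_eq_withDensity (hτ : Measurable τ) {w : ℝ → Ctrl m}
    (hw : Measurable w) (h : ∀ᵐ p ∂κ, w (τ p) = Φ p) :
    pushN κ τ Φ = (κ.map τ).withDensity fun t => ENNReal.ofReal (norm1 (w t)) := by
  have hm : Measurable fun t => ENNReal.ofReal (norm1 (w t)) :=
    (measurable_norm1.comp hw).ennreal_ofReal
  ext B hB
  rw [pushN_apply hτ hB, withDensity_apply _ hB, setLIntegral_map hB hm hτ]
  refine lintegral_congr_ae (ae_restrict_of_ae ?_)
  filter_upwards [h] with p hp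
  rw [hp]

/-- The component with density w_j has total variation |w_j|ρ. Summing over j produces the ℓ¹ norm,
which is why `norm1` is the norm adapted to |μ|. -/
lemma tv_withDensity {ρ : Measure ℝ} {w : ℝ → Ctrl m} (hw : Measurable w) (hi : Integrable w ρ) :
    VMeas.tv (fun j => ρ.withDensityᵥ fun t => w t j)
      = ρ.withDensity fun t => ENNReal.ofReal (norm1 (w t)) := by
  have hwj : ∀ j, Measurable fun t => w t j := fun j => (measurable_pi_apply j).comp hw
  have e : ∀ j, SignedMeasure.totalVariation (ρ.withDensityᵥ fun t => w t j)
      = ρ.withDensity fun t => ‖w t j‖ₑ := fun j => by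
    rw [SignedMeasure.totalVariation_eq_variation, Measure.variation_withDensityᵥ (hi.eval j)]
  rw [VMeas.tv, Finset.sum_congr rfl fun j _ => e j]
  ext B hB
  rw [Measure.finsetSum_apply, withDensity_apply _ hB]
  simp_rw [withDensity_apply _ hB]
  rw [← lintegral_finsetSum _ fun j _ => (hwj j).enorm]
  refine lintegral_congr fun t => ?_
  rw [norm1, ENNReal.ofReal_sum_of_nonneg fun _ _ => abs_nonneg _]
  refine Finset.sum_congr rfl fun j _ => ?_
  rw [← Real.norm_eq_abs, ofReal_norm]

lemma hasConeDensity_withDensity {K : Set (Ctrl m)} (hK : IsClosed K) (h0 : (0 : Ctrl m) ∈ K)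
    (hc : ∀ c : ℝ, 0 ≤ c → ∀ w ∈ K, c • w ∈ K) {ρ : Measure ℝ} {w : ℝ → Ctrl m} (hw : Measurable w)
    (hi : Integrable w ρ) (hwK : ∀ᵐ t ∂ρ, w t ∈ K) :
    HasConeDensity K (fun j => ρ.withDensityᵥ fun t => w t j) := by
  classical
  -- The density with respect to the total variation is w/‖w‖. Where w vanishes, the convention 0⁻¹
  -- = 0 yields the value 0, which lies in the cone.
  set u : ℝ → Ctrl m := fun t => if w t ∈ K then (norm1 (w t))⁻¹ • w t else 0 with hu
  have hn : Measurable fun t => norm1 (w t) := measurable_norm1.comp hw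
  have hum : Measurable u :=
    Measurable.ite (hw hK.measurableSet) (hn.inv.smul hw) measurable_const
  have hfin := VMeas.isFiniteMeasure_tv (fun j => ρ.withDensityᵥ fun t => w t j)
  have hub : ∀ t j, ‖u t j‖ ≤ 1 := by
    intro t j
    simp only [hu]
    split_ifs
    · rw [Pi.smul_apply, smul_eq_mul, norm_mul, norm_inv, Real.norm_of_nonneg (norm1_nonneg _)]
      rcases (norm1_nonneg (w t)).eq_or_lt with h | h
      · rw [← h]; simp
      · rw [inv_mul_le_iff₀ h, mul_one]; exact abs_le_norm1 _ _
    · simp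
  have huj : ∀ j, Measurable fun t => u t j := fun j => (measurable_pi_apply j).comp hum
  refine ⟨u, hum, ?_, ?_, ?_⟩
  · intro t
    simp only [hu]
    split_ifs with h
    · exact hc _ (inv_nonneg.2 (norm1_nonneg _)) _ h
    · exact h0
  · intro j
    exact Integrable.of_bound (huj j).aestronglyMeasurable 1 (Eventually.of_forall fun t => hub t j)
  · intro j B hB
    rw [withDensityᵥ_apply (hi.eval j) hB, tv_withDensity hw hi,
      setIntegral_withDensity_eq_setIntegral_toReal_smul hn.ennreal_ofReal (by simp) _ hB]
    refine integral_congr_ae (ae_restrict_of_ae ?_)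
    filter_upwards [hwK] with t ht
    simp only [hu, if_pos ht, ENNReal.toReal_ofReal (norm1_nonneg _), Pi.smul_apply, smul_eq_mul]
    rcases (norm1_nonneg (w t)).eq_or_lt with h | h
    · rw [eq_zero_of_norm1 h.symm]; simp
    · field_simp

/-- In general the contributions of different points over the same time may cancel, and the total
variation of the image is smaller than `pushN`. Injectivity excludes this: Φ is then a function of
τ, and both sides are densities with respect to the image of κ. -/
lemma pushV_tv [StandardBorelSpace Ω] (hτ : Measurable τ) (hΦ : Measurable Φ) (hi : Integrable Φ κ)
    {A : Set Ω} (hA : MeasurableSet A) (hinj : InjOn τ A) (h0 : κ Aᶜ = 0) :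
    (pushV κ τ Φ).tv = pushN κ τ Φ := by
  obtain ⟨w, hw, e⟩ := exists_factor hτ hΦ hA hinj h0
  obtain ⟨hiw, h1⟩ := pushV_eq_withDensity hτ hi hw e
  rw [pushN_eq_withDensity hτ hw e, ← tv_withDensity hw hiw, funext h1]

/-- A value of the image density is a single value of Φ and not an average of several, so it stays
in K although K need not be convex. -/
lemma pushV_hasConeDensity [StandardBorelSpace Ω] {K : Set (Ctrl m)} (hK : IsClosed K)
    (hz : (0 : Ctrl m) ∈ K) (hc : ∀ c : ℝ, 0 ≤ c → ∀ w ∈ K, c • w ∈ K)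
    (hτ : Measurable τ) (hΦ : Measurable Φ) (hi : Integrable Φ κ)
    {A : Set Ω} (hA : MeasurableSet A) (hinj : InjOn τ A) (h0 : κ Aᶜ = 0)
    (hΦK : ∀ᵐ p ∂κ, Φ p ∈ K) : HasConeDensity K (pushV κ τ Φ) := by
  obtain ⟨w, hw, e⟩ := exists_factor hτ hΦ hA hinj h0
  obtain ⟨hiw, h1⟩ := pushV_eq_withDensity hτ hi hw e
  rw [funext h1]
  refine hasConeDensity_withDensity hK hz hc hw hiw ?_
  rw [ae_map_iff hτ.aemeasurable (hw hK.measurableSet)]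
  filter_upwards [e, hΦK] with p hp hp'
  rwa [hp]

end Push

/-! ### The disjoint union of `N` copies of `[0,S]` -/

/-- Lebesgue measure on the disjoint union of the intervals `{l} × [0,S]`, `1 ≤ l ≤ N`. -/
def base (N : ℕ) (S : ℝ) : Measure (ℕ × ℝ) :=
  ∑ l ∈ Finset.Icc 1 N, (volume.restrict (Icc 0 S)).map (Prod.mk l)

section Base

variable {N : ℕ} {S : ℝ}

lemma ae_base {p : ℕ × ℝ → Prop} :
    (∀ᵐ x ∂base N S, p x) ↔ ∀ l ∈ Icc 1 N, ∀ᵐ s ∂volume.restrict (Icc 0 S), p (l, s) := by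
  have : ∀ l ∈ Finset.Icc 1 N, ((volume.restrict (Icc 0 S)).map (Prod.mk l) {x | ¬ p x} = 0
      ↔ ∀ᵐ s ∂volume.restrict (Icc 0 S), p (l, s)) := by
    intro l _
    rw [(measurableEmbedding_prodMk_left l).map_apply]
    rfl
  rw [ae_iff, base, Measure.finsetSum_apply, Finset.sum_eq_zero_iff]
  constructor
  · intro h l hl
    have hl' : l ∈ Finset.Icc 1 N := Finset.mem_Icc.2 hl
    exact (this l hl').1 (h l hl')
  · intro h l hl
    exact (this l hl).2 (h l (Finset.mem_Icc.1 hl))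

variable {V : Type*} [NormedAddCommGroup V]

lemma integrable_base {f : ℕ × ℝ → V} :
    Integrable f (base N S) ↔ ∀ l ∈ Icc 1 N, IntegrableOn (fun s => f (l, s)) (Icc 0 S) := by
  rw [base, integrable_finsetSum_measure]
  constructor
  · intro h l hl
    exact (measurableEmbedding_prodMk_left l).integrable_map_iff.1 (h l (Finset.mem_Icc.2 hl))
  · intro h l hl
    exact (measurableEmbedding_prodMk_left l).integrable_map_iff.2 (h l (Finset.mem_Icc.1 hl))

variable [NormedSpace ℝ V]

lemma setIntegral_base {f : ℕ × ℝ → V}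
    (hf : ∀ l ∈ Icc 1 N, IntegrableOn (fun s => f (l, s)) (Icc 0 S)) {A : Set (ℕ × ℝ)}
    (hA : MeasurableSet A) :
    ∫ x in A, f x ∂base N S = ∑ l ∈ Finset.Icc 1 N, ∫ s in Icc 0 S ∩ {s | (l, s) ∈ A}, f (l, s) := by
  rw [← integral_indicator hA, base, integral_finsetSum_measure]
  · refine Finset.sum_congr rfl fun l _ => ?_
    have hm : MeasurableSet {s | (l, s) ∈ A} := measurable_prodMk_left hA
    rw [(measurableEmbedding_prodMk_left l).integral_map, inter_comm, ← Measure.restrict_restrict hm,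
      ← integral_indicator hm]
    rfl
  · intro l hl
    rw [integrable_indicator_iff hA]
    exact ((measurableEmbedding_prodMk_left l).integrable_map_iff.2
      (hf l (Finset.mem_Icc.1 hl))).integrableOn

lemma isFiniteMeasure_base : IsFiniteMeasure (base N S) := by
  unfold base; infer_instance

end Base

/-- The projection of `ℝ` onto `[0,S]`. -/
def clamp (S s : ℝ) : ℝ := max 0 (min S s)

lemma clamp_mem {S : ℝ} (hS : 0 ≤ S) (s : ℝ) : clamp S s ∈ Icc 0 S :=
  ⟨le_max_left _ _, max_le hS (min_le_left _ _)⟩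

lemma clamp_of_mem {S s : ℝ} (hs : s ∈ Icc 0 S) : clamp S s = s := by
  rw [clamp, min_eq_right hs.2, max_eq_right hs.1]

lemma continuous_clamp (S : ℝ) : Continuous (clamp S) := by unfold clamp; fun_prop

lemma clamp_mono (S : ℝ) : Monotone (clamp S) := fun _ _ h =>
  max_le_max le_rfl (min_le_min le_rfl h)

/-! ### Extended controls on the disjoint union: clock, level sets and rates -/

namespace System

variable {n m N M : ℕ} (D : System n m N M)

/-- The control rate `dφ_l/ds` on the disjoint union. -/
def rate (E : ExtendedTuple n m) (p : ℕ × ℝ) : Ctrl m := deriv (E.φ p.1) p.2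

/-- The time `τ_l = (l-1)h + φ₀` on the disjoint union. -/
def clock (E : ExtendedTuple n m) (p : ℕ × ℝ) : ℝ := D.start p.1 + E.φ₀ (clamp E.S p.2)

/-- `σ⁻` -/
def lo (E : ExtendedTuple n m) (r : ℝ) : ℝ := Function.leftLim (D.sigma E) r

/-- `σ⁺` -/
def up (E : ExtendedTuple n m) (r : ℝ) : ℝ := Function.rightLim (D.sigma E) r

/-- `E` carries a canonical extended control. -/
structure IsCanonicalControl (E : ExtendedTuple n m) : Prop where
  ctl : D.IsExtendedControl E
  speed : ∀ᵐ s ∂volume.restrict (Icc 0 E.S),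
    deriv E.φ₀ s + ∑ l ∈ Finset.Icc 1 N, norm1 (deriv (E.φ l) s) = 1

variable {D}

lemma start_succ (l : ℕ) : D.start (l + 1) = l * D.h := by simp [start]

lemma start_add_h (l : ℕ) : D.start l + D.h = l * D.h := by simp [start]; ring

lemma start_one : D.start 1 = 0 := by simp [start]

lemma nat_cast_eq_of_mul {h u : ℝ} (hh : 0 < h) {k l : ℕ} (e : ((k : ℝ) - l) * h = u)
    (h1 : -h < u) (h2 : u < h) : k = l := by
  have h3 : (k : ℝ) - l < 1 := by by_contra hc; nlinarith
  have h4 : -1 < (k : ℝ) - l := by by_contra hc; nlinarith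
  have h5 : (k : ℝ) < l + 1 := by linarith
  have h6 : (l : ℝ) < k + 1 := by linarith
  have h7 : k < l + 1 := by exact_mod_cast h5
  have h8 : l < k + 1 := by exact_mod_cast h6
  omega

/-- Only grid points have two representations as a period plus an offset in [0,h]; one interior
offset rules them out. -/
lemma start_add_inj (hh : 0 < D.h) {k l : ℕ} {u r : ℝ} (hu : u ∈ Icc 0 D.h) (hr : r ∈ Ioo 0 D.h) :
    D.start k + u = D.start l + r ↔ k = l ∧ u = r := by
  refine ⟨fun h => ?_, fun h => by rw [h.1, h.2]⟩
  have e : k = l := by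
    refine nat_cast_eq_of_mul hh (u := r - u) ?_ (by linarith [hr.1, hu.2]) (by linarith [hr.2, hu.1])
    unfold start at h; linarith
  subst e
  exact ⟨rfl, by linarith⟩

lemma start_add_eq_grid (hh : 0 < D.h) {k l : ℕ} {u : ℝ} (hu : u ∈ Icc 0 D.h) :
    D.start k + u = l * D.h ↔ (k = l ∧ u = D.h) ∨ (k = l + 1 ∧ u = 0) := by
  constructor
  · intro h
    unfold start at h
    rcases hu.2.eq_or_lt with h1 | h1
    · left
      refine ⟨nat_cast_eq_of_mul hh (u := 0) (by rw [h1] at h; linarith) (by linarith) hh, h1⟩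
    · right
      have : k = l + 1 := by
        refine nat_cast_eq_of_mul hh (u := -u) (by push_cast; linarith) (by linarith)
          (by linarith [hu.1])
      subst this
      push_cast at h
      exact ⟨rfl, by linarith⟩
  · rintro (⟨rfl, rfl⟩ | ⟨rfl, rfl⟩)
    · exact start_add_h k
    · rw [start_succ, add_zero]

namespace IsCanonicalControl

variable {E : ExtendedTuple n m}

lemma clk (hE : D.IsExtendedControl E) (hD : D.Standing) : IsClock E.φ₀ 0 E.S 0 D.h where
  hT := hE.S_pos
  hS := hD.h_pos
  cont := hE.lipschitz.choose_spec.1.continuousOn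
  mono := hE.mono
  left := hE.φ₀_zero
  right := hE.φ₀_end

end IsCanonicalControl

section Clock

variable {E : ExtendedTuple n m} (hc : IsClock E.φ₀ 0 E.S 0 D.h)
include hc

lemma lo_mem (r : ℝ) : D.lo E r ∈ Icc 0 E.S := hc.leftLim_mem r
lemma up_mem (r : ℝ) : D.up E r ∈ Icc 0 E.S := hc.rightLim_mem r
lemma lo_le_up (r : ℝ) : D.lo E r ≤ D.up E r := hc.leftLim_le_rightLim r
lemma lo_zero : D.lo E 0 = 0 := hc.leftLim_left
lemma up_end : D.up E D.h = E.S := hc.rightLim_right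
lemma phi0_up {r : ℝ} (hr : r ∈ Icc 0 D.h) : E.φ₀ (D.up E r) = r := hc.apply_rightLim hr
lemma phi0_le_iff {r s : ℝ} (hr : r ∈ Icc 0 D.h) (hs : s ∈ Icc 0 E.S) :
    E.φ₀ s ≤ r ↔ s ≤ D.up E r := hc.le_iff hr hs
lemma phi0_lt_iff {r s : ℝ} (hr : r ∈ Icc 0 D.h) (hs : s ∈ Icc 0 E.S) :
    E.φ₀ s < r ↔ s < D.lo E r := hc.lt_iff hr hs
lemma phi0_eq_iff {r s : ℝ} (hr : r ∈ Icc 0 D.h) (hs : s ∈ Icc 0 E.S) :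
    E.φ₀ s = r ↔ s ∈ Icc (D.lo E r) (D.up E r) := hc.eq_iff hr hs
lemma phi0_of_mem {r s : ℝ} (hr : r ∈ Icc 0 D.h) (hs : s ∈ Icc (D.lo E r) (D.up E r)) :
    E.φ₀ s = r :=
  (phi0_eq_iff hc hr ⟨(lo_mem hc r).1.trans hs.1, hs.2.trans (up_mem hc r).2⟩).2 hs

lemma level_Iic {r : ℝ} (hr : r ∈ Icc 0 D.h) : Icc 0 E.S ∩ E.φ₀ ⁻¹' Iic r = Icc 0 (D.up E r) := by
  ext s
  constructor
  · rintro ⟨h1, h2⟩; exact ⟨h1.1, (phi0_le_iff hc hr h1).1 h2⟩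
  · rintro ⟨h1, h2⟩
    have hs : s ∈ Icc 0 E.S := ⟨h1, h2.trans (up_mem hc r).2⟩
    exact ⟨hs, (phi0_le_iff hc hr hs).2 h2⟩

lemma level_singleton {r : ℝ} (hr : r ∈ Icc 0 D.h) :
    Icc 0 E.S ∩ E.φ₀ ⁻¹' {r} = Icc (D.lo E r) (D.up E r) := by
  ext s
  constructor
  · rintro ⟨h1, h2⟩; exact (phi0_eq_iff hc hr h1).1 h2
  · intro h
    have hs : s ∈ Icc 0 E.S := ⟨(lo_mem hc r).1.trans h.1, h.2.trans (up_mem hc r).2⟩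
    exact ⟨hs, (phi0_eq_iff hc hr hs).2 h⟩

lemma continuous_phi0_clamp : Continuous fun s => E.φ₀ (clamp E.S s) :=
  hc.cont.comp_continuous (continuous_clamp _) (clamp_mem hc.hT.le)

lemma measurableSet_level {B : Set ℝ} (hB : MeasurableSet B) :
    MeasurableSet (Icc 0 E.S ∩ E.φ₀ ⁻¹' B) := by
  have : Icc 0 E.S ∩ E.φ₀ ⁻¹' B = Icc 0 E.S ∩ (fun s => E.φ₀ (clamp E.S s)) ⁻¹' B := by
    ext s
    refine and_congr_right fun hs => ?_
    simp only [mem_preimage, clamp_of_mem hs]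
  rw [this]
  exact measurableSet_Icc.inter ((continuous_phi0_clamp hc).measurable hB)

lemma measurable_clock : Measurable (D.clock E) :=
  measurable_from_prod_countable_right fun l =>
    ((continuous_phi0_clamp hc).measurable.const_add (D.start l))

omit hc in
lemma clock_eq {l : ℕ} {s : ℝ} (hs : s ∈ Icc 0 E.S) : D.clock E (l, s) = D.start l + E.φ₀ s := by
  simp only [clock, clamp_of_mem hs]

omit hc in
lemma level_clock (l : ℕ) (B : Set ℝ) : Icc 0 E.S ∩ {s | (l, s) ∈ D.clock E ⁻¹' B}
    = Icc 0 E.S ∩ {s | D.start l + E.φ₀ s ∈ B} := by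
  ext s
  refine and_congr_right fun hs => ?_
  simp only [mem_preimage, mem_ofPred_eq, clock_eq hs]

variable {V : Type*} [NormedAddCommGroup V] [NormedSpace ℝ V]

lemma level_inner (k l : ℕ) {r : ℝ} (hr : r ∈ Ioo 0 D.h) :
    Icc 0 E.S ∩ {s | D.start k + E.φ₀ s ∈ ({D.start l + r} : Set ℝ)}
      = if k = l then Icc (D.lo E r) (D.up E r) else ∅ := by
  rw [← level_singleton hc (Ioo_subset_Icc_self hr)]
  ext s
  by_cases hs : s ∈ Icc 0 E.S
  · simp only [mem_inter_iff, hs, true_and, mem_ofPred_eq, mem_singleton_iff,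
      start_add_inj hc.hS (hc.mapsTo hs) hr]
    split_ifs with h <;> simp [h, hs.1, hs.2]
  · split_ifs <;> simp [hs]

lemma sum_inner (F : ℕ → ℝ → V) {l : ℕ} (hl : l ∈ Icc 1 N) {r : ℝ} (hr : r ∈ Ioo 0 D.h) :
    ∑ k ∈ Finset.Icc 1 N,
      ∫ s in Icc 0 E.S ∩ {s | D.start k + E.φ₀ s ∈ ({D.start l + r} : Set ℝ)}, F k s
      = ∫ s in D.lo E r..D.up E r, F l s := by
  rw [Finset.sum_eq_single l, level_inner hc l l hr, if_pos rfl, integral_Icc_eq_integral_Ioc,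
    intervalIntegral.integral_of_le (lo_le_up hc r)]
  · intro k _ hk
    rw [level_inner hc k l hr, if_neg hk]; simp
  · intro h; exact absurd (Finset.mem_Icc.2 hl) h

lemma level_grid (k l : ℕ) :
    Icc 0 E.S ∩ {s | D.start k + E.φ₀ s ∈ ({(l * D.h : ℝ)} : Set ℝ)}
      = if k = l then Icc (D.lo E D.h) (D.up E D.h) else
        if k = l + 1 then Icc (D.lo E 0) (D.up E 0) else ∅ := by
  rw [← level_singleton hc ⟨hc.hS.le, le_rfl⟩, ← level_singleton hc ⟨le_rfl, hc.hS.le⟩]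
  ext s
  by_cases hs : s ∈ Icc 0 E.S
  · simp only [mem_inter_iff, hs, true_and, mem_ofPred_eq, mem_singleton_iff,
      start_add_eq_grid hc.hS (hc.mapsTo hs)]
    split_ifs with h h'
    · subst h; simp [hs.1, hs.2]
    · subst h'; simp [hs.1, hs.2]
    · simp [h, h']
  · split_ifs <;> simp [hs]

/-- Two plateaus lie over the time lh: the last one of period l and the first one of period l+1. The
guards drop the one that is missing at t = 0 and at t = T, in accordance with the conventions ω^h_0
= 0 and ω^0_{N+1} = 0. -/
lemma sum_grid (F : ℕ → ℝ → V) {l : ℕ} (hl : l ≤ N) :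
    ∑ k ∈ Finset.Icc 1 N,
      ∫ s in Icc 0 E.S ∩ {s | D.start k + E.φ₀ s ∈ ({(l * D.h : ℝ)} : Set ℝ)}, F k s
      = (if 1 ≤ l ∧ l ≤ N then ∫ s in D.lo E D.h..D.up E D.h, F l s else 0)
        + (if 1 ≤ l + 1 ∧ l + 1 ≤ N then ∫ s in D.lo E 0..D.up E 0, F (l + 1) s else 0) := by
  have e : ∀ k ∈ Finset.Icc 1 N,
      ∫ s in Icc 0 E.S ∩ {s | D.start k + E.φ₀ s ∈ ({(l * D.h : ℝ)} : Set ℝ)}, F k s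
      = (if k = l then ∫ s in D.lo E D.h..D.up E D.h, F l s else 0)
        + (if k = l + 1 then ∫ s in D.lo E 0..D.up E 0, F (l + 1) s else 0) := by
    intro k _
    rw [level_grid hc k l, intervalIntegral.integral_of_le (lo_le_up hc _),
      intervalIntegral.integral_of_le (lo_le_up hc _)]
    by_cases h : k = l
    · subst h
      simp [integral_Icc_eq_integral_Ioc]
    · by_cases h' : k = l + 1
      · subst h'
        simp [integral_Icc_eq_integral_Ioc]
      · simp [h, h']
  rw [Finset.sum_congr rfl e, Finset.sum_add_distrib, Finset.sum_ite_eq', Finset.sum_ite_eq']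
  simp only [Finset.mem_Icc]

end Clock

namespace IsCanonicalControl

variable {E : ExtendedTuple n m}

section
variable (hC : D.IsExtendedControl E)
include hC

lemma solves_phi0 : SolvesOn (deriv E.φ₀) E.φ₀ 0 E.S :=
  LipschitzOnWith.solvesOn_deriv_real hC.S_pos.le hC.lipschitz.choose_spec.1

lemma solves_phi {l : ℕ} (hl : l ∈ Icc 1 N) : SolvesOn (deriv (E.φ l)) (E.φ l) 0 E.S :=
  LipschitzOnWith.solvesOn_deriv hC.S_pos.le (hC.lipschitz.choose_spec.2 l hl)

lemma deriv_phi0_nonneg : ∀ᵐ s ∂volume.restrict (Icc 0 E.S), 0 ≤ deriv E.φ₀ s := by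
  rw [← Measure.restrict_congr_set Ioo_ae_eq_Icc, ae_restrict_iff' measurableSet_Ioo]
  refine Eventually.of_forall fun s hs => ?_
  rw [← derivWithin_of_mem_nhds (Icc_mem_nhds hs.1 hs.2)]
  exact hC.mono.derivWithin_nonneg

lemma integrableOn_rate {l : ℕ} (hl : l ∈ Icc 1 N) :
    IntegrableOn (deriv (E.φ l)) (Icc 0 E.S) := by
  rw [integrableOn_Icc_iff_integrableOn_Ioc,
    ← intervalIntegrable_iff_integrableOn_Ioc_of_le hC.S_pos.le]
  exact (solves_phi hC hl).1

lemma integrableOn_deriv_phi0 : IntegrableOn (deriv E.φ₀) (Icc 0 E.S) := by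
  rw [integrableOn_Icc_iff_integrableOn_Ioc,
    ← intervalIntegrable_iff_integrableOn_Ioc_of_le hC.S_pos.le]
  exact (solves_phi0 hC).1

lemma integrable_rate : Integrable (rate E) (base N E.S) :=
  integrable_base.2 fun _ hl => integrableOn_rate hC hl

omit hC in
lemma measurable_rate : Measurable (rate E) :=
  measurable_from_prod_countable_right fun l => measurable_deriv (E.φ l)

lemma pushV_apply (hD : D.Standing) {B : Set ℝ} (hB : MeasurableSet B) (j : Fin m) :
    pushV (base N E.S) (D.clock E) (rate E) j B
      = ∑ k ∈ Finset.Icc 1 N, ∫ s in Icc 0 E.S ∩ {s | D.start k + E.φ₀ s ∈ B},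
        deriv (E.φ k) s j := by
  have hm := measurable_clock (clk hC hD)
  rw [DelayImpulse.pushV_apply hm (integrable_rate hC) hB,
    setIntegral_base (f := fun p => rate E p j)
      (fun l hl => (integrableOn_rate hC hl).eval j) (hm hB)]
  simp_rw [level_clock]
  rfl

lemma pushN_real (hD : D.Standing) {B : Set ℝ} (hB : MeasurableSet B) :
    (pushN (base N E.S) (D.clock E) (rate E)).real B
      = ∑ k ∈ Finset.Icc 1 N, ∫ s in Icc 0 E.S ∩ {s | D.start k + E.φ₀ s ∈ B},
        norm1 (deriv (E.φ k) s) := by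
  have hm := measurable_clock (clk hC hD)
  rw [DelayImpulse.pushN_real hm (integrable_rate hC) hB,
    setIntegral_base (f := fun p => norm1 (rate E p))
      (fun l hl => integrable_norm1 (integrableOn_rate hC hl)) (hm hB)]
  simp_rw [level_clock]
  rfl

end

lemma deriv_phi0_plateau (hC : D.IsExtendedControl E) (hD : D.Standing) {r : ℝ}
    (hr : r ∈ Icc 0 D.h) :
    ∀ᵐ s ∂volume.restrict (Icc (D.lo E r) (D.up E r)), deriv E.φ₀ s = 0 := by
  have hc := clk hC hD
  rw [← Measure.restrict_congr_set Ioo_ae_eq_Icc, ae_restrict_iff' measurableSet_Ioo]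
  refine Eventually.of_forall fun s hs => ?_
  have : E.φ₀ =ᶠ[𝓝 s] fun _ => r := by
    filter_upwards [Ioo_mem_nhds hs.1 hs.2] with u hu
    exact phi0_of_mem hc hr (Ioo_subset_Icc_self hu)
  rw [this.deriv_eq, deriv_const]

section
variable (h : D.IsCanonicalControl E)
include h

lemma speed_le {l : ℕ} (hl : l ∈ Icc 1 N) :
    ∀ᵐ s ∂volume.restrict (Icc 0 E.S), norm1 (deriv (E.φ l) s) ≤ 1 := by
  filter_upwards [h.speed, deriv_phi0_nonneg h.ctl] with s h1 h2
  have := Finset.single_le_sum (f := fun l => norm1 (deriv (E.φ l) s)) (fun _ _ => norm1_nonneg _)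
    (Finset.mem_Icc.2 hl)
  linarith

lemma deriv_phi0_le : ∀ᵐ s ∂volume.restrict (Icc 0 E.S), deriv E.φ₀ s ≤ 1 := by
  filter_upwards [h.speed] with s h1
  have := Finset.sum_nonneg (s := Finset.Icc 1 N)
    fun l _ => norm1_nonneg (deriv (E.φ l) s)
  linarith

end

/-- Change of variables `r = φ₀(s)` in an integral over a subset of `[0,h]`. -/
lemma integral_deriv_phi0_smul (hC : D.IsExtendedControl E) (hD : D.Standing)
    {V : Type*} [NormedAddCommGroup V] [NormedSpace ℝ V] {f : ℝ → V} (hf : StronglyMeasurable f)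
    {B : Set ℝ} (hB : MeasurableSet B) :
    ∫ s in Icc 0 E.S ∩ E.φ₀ ⁻¹' B, deriv E.φ₀ s • f (E.φ₀ s) = ∫ r in Icc 0 D.h ∩ B, f r := by
  have hc := clk hC hD
  set lam := volume.restrict (Icc 0 E.S) with hlam
  set ph : ℝ → ℝ := fun s => E.φ₀ (clamp E.S s) with hph
  have hphm : Measurable ph := (continuous_phi0_clamp hc).measurable
  set q : ℝ → ℝ≥0∞ := fun s => ENNReal.ofReal (deriv E.φ₀ s) with hq
  have hqm : Measurable q := (measurable_deriv E.φ₀).ennreal_ofReal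
  have hint := integrableOn_deriv_phi0 hC
  have hfin : IsFiniteMeasure (lam.withDensity q) := isFiniteMeasure_withDensity_ofReal hint.2
  have hlev : ∀ B, MeasurableSet B → ((lam.withDensity q).map ph).real B
      = ∫ s in Icc 0 E.S ∩ E.φ₀ ⁻¹' B, deriv E.φ₀ s := by
    intro B hB
    have e : lam.restrict (ph ⁻¹' B) = volume.restrict (Icc 0 E.S ∩ E.φ₀ ⁻¹' B) := by
      rw [hlam, Measure.restrict_restrict (hphm hB)]
      congr 1
      ext s
      constructor
      · rintro ⟨h1, h2⟩; exact ⟨h2, by simpa only [hph, mem_preimage, clamp_of_mem h2] using h1⟩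
      · rintro ⟨h1, h2⟩; exact ⟨by simpa only [hph, mem_preimage, clamp_of_mem h1] using h2, h1⟩
    have hnn : 0 ≤ᵐ[volume.restrict (Icc 0 E.S ∩ E.φ₀ ⁻¹' B)] deriv E.φ₀ :=
      ae_mono (Measure.restrict_mono inter_subset_left le_rfl) (deriv_phi0_nonneg hC)
    rw [Measure.real, Measure.map_apply hphm hB, withDensity_apply _ (hphm hB), e,
      ← ofReal_integral_eq_lintegral_ofReal (hint.mono_set inter_subset_left) hnn,
      ENNReal.toReal_ofReal (integral_nonneg_of_ae hnn)]
  -- The image of φ₀' ds under φ₀ is Lebesgue measure on [0,h]: the set [0,x] receives the mass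
  -- φ₀(σ⁺(x)) - φ₀(0) = x.
  have hmap : (lam.withDensity q).map ph = volume.restrict (Icc 0 D.h) := by
    refine measure_ext_Icc hc.hS.le ?_ (by simp) fun x hx => ?_
    · rw [Measure.map_apply hphm measurableSet_Icc.compl]
      have : ph ⁻¹' (Icc 0 D.h)ᶜ = ∅ := by
        ext s
        simp only [mem_preimage, mem_compl_iff, mem_empty_iff_false, iff_false, not_not]
        exact hc.mapsTo (clamp_mem hc.hT.le s)
      rw [this, measure_empty]
    · rw [hlev _ measurableSet_Icc]
      have e : Icc 0 E.S ∩ E.φ₀ ⁻¹' Icc 0 x = Icc 0 (D.up E x) := by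
        rw [← level_Iic hc hx]
        ext s
        refine and_congr_right fun hs => ?_
        simp only [mem_preimage, mem_Icc, mem_Iic, (hc.mapsTo hs).1, true_and]
      rw [e, integral_Icc_eq_integral_Ioc, ← intervalIntegral.integral_of_le (up_mem hc x).1,
        ← (solves_phi0 hC).sub_eq ⟨le_rfl, hc.hT.le⟩ (up_mem hc x), phi0_up hc hx, hC.φ₀_zero,
        Measure.real, Measure.restrict_apply measurableSet_Icc,
        inter_eq_left.2 (Icc_subset_Icc_right hx.2), Real.volume_Icc, sub_zero,
        ENNReal.toReal_ofReal hx.1]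
  rw [inter_comm (Icc 0 D.h), ← Measure.restrict_restrict hB, ← hmap,
    setIntegral_map hB hf.aestronglyMeasurable hphm.aemeasurable,
    setIntegral_withDensity_eq_setIntegral_toReal_smul hqm (by simp [hq]) _ (hphm hB)]
  have e : lam.restrict (ph ⁻¹' B) = volume.restrict (Icc 0 E.S ∩ E.φ₀ ⁻¹' B) := by
    rw [hlam, Measure.restrict_restrict (hphm hB)]
    congr 1
    ext s
    constructor
    · rintro ⟨h1, h2⟩; exact ⟨h2, by simpa only [hph, mem_preimage, clamp_of_mem h2] using h1⟩
    · rintro ⟨h1, h2⟩; exact ⟨by simpa only [hph, mem_preimage, clamp_of_mem h1] using h2, h1⟩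
  rw [e]
  refine integral_congr_ae ?_
  have h1 := ae_mono (Measure.restrict_mono (s := Icc 0 E.S ∩ E.φ₀ ⁻¹' B) inter_subset_left le_rfl)
    (deriv_phi0_nonneg hC)
  filter_upwards [h1, ae_restrict_mem (measurableSet_level hc hB)] with s hs hs'
  simp only [hq, hph, ENNReal.toReal_ofReal hs, clamp_of_mem hs'.1]

end IsCanonicalControl

end System

/-! ### Concatenations -/

lemma exists_period {N : ℕ} {S s : ℝ} (hS : 0 < S) (h0 : 0 ≤ s) (h1 : s < N * S) :
    ∃ l ∈ Icc 1 N, s ∈ Ico (((l : ℝ) - 1) * S) (l * S) := by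
  have hnn : 0 ≤ s / S := by positivity
  have h2 : (⌊s / S⌋₊ : ℝ) ≤ s / S := Nat.floor_le hnn
  have h3 : s / S < ⌊s / S⌋₊ + 1 := Nat.lt_floor_add_one _
  rw [le_div_iff₀ hS] at h2
  rw [div_lt_iff₀ hS] at h3
  have h4 : ⌊s / S⌋₊ < N := by
    have : (⌊s / S⌋₊ : ℝ) * S < N * S := h2.trans_lt h1
    exact_mod_cast lt_of_mul_lt_mul_right this hS.le
  refine ⟨⌊s / S⌋₊ + 1, ⟨by omega, by omega⟩, ?_, ?_⟩
  · push_cast; simpa using h2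
  · push_cast; exact h3

section Tilde

variable {V : Type*} [AddCommMonoid V] {N : ℕ} {S : ℝ} {z : ℕ → ℝ → V}

lemma period_unique {k l : ℕ} {s : ℝ} (hS : 0 < S) (hk : s ∈ Ico (((k : ℝ) - 1) * S) (k * S))
    (hl : s ∈ Ico (((l : ℝ) - 1) * S) (l * S)) : k = l := by
  have h1 : ((k : ℝ) - 1) * S < l * S := hk.1.trans_lt hl.2
  have h2 : ((l : ℝ) - 1) * S < k * S := hl.1.trans_lt hk.2
  have h1 := lt_of_mul_lt_mul_right h1 hS.le
  have h2 := lt_of_mul_lt_mul_right h2 hS.le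
  have h3 : (k : ℝ) < l + 1 := by linarith
  have h4 : (l : ℝ) < k + 1 := by linarith
  have h3 : k < l + 1 := by exact_mod_cast h3
  have h4 : l < k + 1 := by exact_mod_cast h4
  omega

lemma tilde_eq (hS : 0 < S) {l : ℕ} (hl : l ∈ Icc 1 N) {s : ℝ}
    (hs : s ∈ Ico (((l : ℝ) - 1) * S) (l * S)) : tilde N S z s = z l (s - ((l : ℝ) - 1) * S) := by
  have h1 : (l : ℝ) ≤ N := by exact_mod_cast hl.2
  have h2 : s ≠ N * S := (hs.2.trans_le (mul_le_mul_of_nonneg_right h1 hS.le)).ne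
  rw [tilde, if_neg h2, Finset.sum_eq_single l]
  · rw [indicator_of_mem hs]
  · intro k _ hk
    rw [indicator_of_notMem]
    exact fun hk' => hk (period_unique hS hk' hs)
  · intro h; exact absurd (Finset.mem_Icc.2 hl) h

lemma tilde_end : tilde N S z (N * S) = z N S := by simp [tilde]

lemma tilde_zero (hS : 0 < S) (hN : 1 ≤ N) : tilde N S z 0 = z 1 0 := by
  rw [tilde_eq hS (l := 1) ⟨le_rfl, hN⟩ (by simp [hS])]
  simp

end Tilde

lemma sum_Icc_eq_range {V : Type*} [AddCommMonoid V] (N : ℕ) (f : ℕ → V) :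
    ∑ l ∈ Finset.Icc 1 N, f l = ∑ k ∈ Finset.range N, f (k + 1) := by
  induction N with
  | zero => simp
  | succ n ih => rw [Finset.sum_Icc_succ_top (by omega), ih, Finset.sum_range_succ]

/-- A concatenation as a sum of functions that are constant outside one period. -/
lemma tilde_eq_sum {V : Type*} [AddCommGroup V] {N : ℕ} {S : ℝ} {z : ℕ → ℝ → V} (hS : 0 < S)
    (hN : 1 ≤ N) (hz : ∀ l ∈ Icc 2 N, z l 0 = z (l - 1) S) {s : ℝ} (hs : s ∈ Icc 0 (N * S)) :
    tilde N S z s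
      = z 1 0 + ∑ l ∈ Finset.Icc 1 N, (z l (clamp S (s - ((l : ℝ) - 1) * S)) - z l 0) := by
  -- For s in period L the clamped argument equals S in the earlier periods and 0 in the later ones,
  -- so the sum telescopes by the chain condition.
  have key : ∀ L ∈ Icc 1 N, ∀ s ∈ Icc (((L : ℝ) - 1) * S) (L * S),
      ∑ l ∈ Finset.Icc 1 N, (z l (clamp S (s - ((l : ℝ) - 1) * S)) - z l 0)
        = z L (s - ((L : ℝ) - 1) * S) - z 1 0 := by
    intro L hL s hs
    have tel : ∀ k < N, ∑ l ∈ Finset.Icc 1 k, (z l S - z l 0) = z (k + 1) 0 - z 1 0 := by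
      intro k
      induction k with
      | zero => simp
      | succ n ih =>
        intro hk
        rw [Finset.sum_Icc_succ_top (by omega), ih (by omega), hz (n + 1 + 1) ⟨by omega, by omega⟩]
        simp
    have hsplit : Finset.Icc 1 N = (Finset.Icc 1 (L - 1)) ∪ ({L} ∪ Finset.Icc (L + 1) N) := by
      obtain ⟨h1, h2⟩ := hL
      ext k
      simp only [Finset.mem_Icc, Finset.mem_union, Finset.mem_singleton]
      omega
    have hd1 : Disjoint (Finset.Icc 1 (L - 1)) ({L} ∪ Finset.Icc (L + 1) N) := by
      obtain ⟨h1, h2⟩ := hL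
      rw [Finset.disjoint_left]
      intro k
      simp only [Finset.mem_Icc, Finset.mem_union, Finset.mem_singleton]
      omega
    have hd2 : Disjoint {L} (Finset.Icc (L + 1) N) := by simp
    rw [hsplit, Finset.sum_union hd1, Finset.sum_union hd2, Finset.sum_singleton]
    have e1 : ∑ l ∈ Finset.Icc 1 (L - 1), (z l (clamp S (s - ((l : ℝ) - 1) * S)) - z l 0)
        = ∑ l ∈ Finset.Icc 1 (L - 1), (z l S - z l 0) := by
      refine Finset.sum_congr rfl fun l hl => ?_
      have hlL : (l : ℝ) + 1 ≤ L := by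
        have := (Finset.mem_Icc.1 hl).2
        have h1 := hL.1
        exact_mod_cast (by omega : l + 1 ≤ L)
      have : S ≤ s - ((l : ℝ) - 1) * S := by nlinarith [hs.1]
      rw [clamp, min_eq_left this, max_eq_right hS.le]
    have e2 : ∑ l ∈ Finset.Icc (L + 1) N, (z l (clamp S (s - ((l : ℝ) - 1) * S)) - z l 0) = 0 := by
      refine Finset.sum_eq_zero fun l hl => ?_
      have hlL : (L : ℝ) + 1 ≤ l := by
        have := (Finset.mem_Icc.1 hl).1
        exact_mod_cast this
      have : s - ((l : ℝ) - 1) * S ≤ 0 := by nlinarith [hs.2]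
      rw [clamp, max_eq_left ((min_le_right _ _).trans this), sub_self]
    rw [e1, e2, tel _ (by have := hL.1; have := hL.2; omega),
      clamp_of_mem ⟨by linarith [hs.1], by nlinarith [hs.2]⟩, Nat.sub_add_cancel hL.1]
    abel
  rcases hs.2.eq_or_lt with h | h
  · rw [h, tilde_end, key N ⟨hN, le_rfl⟩ (N * S) ⟨by nlinarith, le_rfl⟩]
    rw [show (N : ℝ) * S - ((N : ℝ) - 1) * S = S by ring]
    abel
  · obtain ⟨l, hl, hs'⟩ := exists_period hS hs.1 h
    rw [tilde_eq hS hl hs', key l hl s (Ico_subset_Icc_self hs')]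
    abel

lemma deriv_tilde {m N : ℕ} {S : ℝ} {z : ℕ → ℝ → Ctrl m} (hS : 0 < S) {l : ℕ} (hl : l ∈ Icc 1 N)
    {s : ℝ} (hs : s ∈ Ioo (((l : ℝ) - 1) * S) (l * S)) :
    deriv (tilde N S z) s = deriv (z l) (s - ((l : ℝ) - 1) * S) := by
  have : tilde N S z =ᶠ[𝓝 s] fun u => z l (u - ((l : ℝ) - 1) * S) := by
    filter_upwards [Ioo_mem_nhds hs.1 hs.2] with u hu using tilde_eq hS hl (Ioo_subset_Ico_self hu)
  rw [this.deriv_eq, deriv_comp_sub_const]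

lemma integral_periods {V : Type*} [NormedAddCommGroup V] [NormedSpace ℝ V] {N : ℕ} {S : ℝ}
    (hS : 0 < S) {f : ℝ → V} {g : ℕ → ℝ → V}
    (hg : ∀ l ∈ Icc 1 N, IntegrableOn (g l) (Icc 0 S))
    (h : ∀ l ∈ Icc 1 N, ∀ s ∈ Ioo (((l : ℝ) - 1) * S) (l * S), f s = g l (s - ((l : ℝ) - 1) * S)) :
    ∫ s in Icc 0 (N * S), f s = ∑ l ∈ Finset.Icc 1 N, ∫ s in Icc 0 S, g l s := by
  have h0 : ∀ k < N, k + 1 ∈ Icc 1 N := fun k hk => ⟨by omega, by omega⟩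
  have h' : ∀ k < N, ∀ s ∈ Ioo ((k : ℝ) * S) (((k + 1 : ℕ) : ℝ) * S), f s = g (k + 1) (s - k * S) := by
    intro k hk s hs
    have := h (k + 1) (h0 k hk) s (by push_cast at hs ⊢; simpa using hs)
    rw [this]; push_cast; simp
  have hle : ∀ k : ℕ, (k : ℝ) * S ≤ ((k + 1 : ℕ) : ℝ) * S := fun k => by push_cast; nlinarith
  have hint : ∀ k < N, IntervalIntegrable (fun s => g (k + 1) (s - k * S)) volume
      ((k : ℝ) * S) (((k + 1 : ℕ) : ℝ) * S) := by
    intro k hk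
    have h1 : IntervalIntegrable (g (k + 1)) volume 0 S := by
      rw [intervalIntegrable_iff_integrableOn_Icc_of_le hS.le]
      exact hg _ (h0 k hk)
    have := h1.comp_sub_right (c := (k : ℝ) * S)
    convert this using 1
    · simp
    · push_cast; ring
  have hae : ∀ k < N, ∀ᵐ s ∂volume, s ∈ uIoc ((k : ℝ) * S) (((k + 1 : ℕ) : ℝ) * S) →
      f s = g (k + 1) (s - k * S) := by
    intro k hk
    have : ∀ᵐ s ∂(volume : Measure ℝ), s ≠ ((k + 1 : ℕ) : ℝ) * S := by simp [ae_iff]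
    filter_upwards [this] with s hs hs'
    rw [uIoc_of_le (hle k)] at hs'
    exact h' k hk s ⟨hs'.1, lt_of_le_of_ne hs'.2 hs⟩
  have hfi : ∀ k < N, IntervalIntegrable f volume ((k : ℝ) * S) (((k + 1 : ℕ) : ℝ) * S) := by
    intro k hk
    refine (hint k hk).congr_ae ?_
    rw [EventuallyEq, ae_restrict_iff' measurableSet_uIoc]
    exact (hae k hk).mono fun s hs hs' => (hs hs').symm
  rw [integral_Icc_eq_integral_Ioc, ← intervalIntegral.integral_of_le (by positivity)]
  have := intervalIntegral.sum_integral_adjacent_intervals (a := fun k : ℕ => (k : ℝ) * S) hfi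
  simp only [Nat.cast_zero, zero_mul] at this
  rw [← this, sum_Icc_eq_range]
  refine Finset.sum_congr rfl fun k hk => ?_
  rw [intervalIntegral.integral_congr_ae (hae k (Finset.mem_range.1 hk)),
    intervalIntegral.integral_comp_sub_right (fun s => g (k + 1) s), integral_Icc_eq_integral_Ioc,
    ← intervalIntegral.integral_of_le hS.le]
  congr 1
  · simp
  · push_cast; ring

/-! ### The concatenated time, its right inverse, and Construction B as a push-forward -/

namespace System

variable {n m N M : ℕ} {D : System n m N M} {E : ExtendedTuple n m}

lemma exists_start {t : ℝ} (hh : 0 < D.h) (ht : t ∈ Ico 0 D.T) :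
    ∃ l ∈ Icc 1 N, ∃ r ∈ Ico 0 D.h, t = D.start l + r := by
  obtain ⟨l, hl, h1, h2⟩ := exists_period hh ht.1 ht.2
  refine ⟨l, hl, t - D.start l, ⟨by unfold start; linarith, by unfold start; linarith⟩, by ring⟩

lemma tau_eq (hC : D.IsExtendedControl E) (hE : D.IsExtendedSolution E) :
    ∀ l ∈ Icc 1 N, ∀ s ∈ Icc 0 E.S, E.τ l s = D.start l + E.φ₀ s := by
  have h1 : ∀ l ∈ Icc 1 N, ∀ s ∈ Icc 0 E.S, E.τ l s = E.τ l 0 + E.φ₀ s := by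
    intro l hl s hs
    rw [(hE.τ_ode l hl).2 s hs,
      ← (IsCanonicalControl.solves_phi0 hC).sub_eq ⟨le_rfl, hC.S_pos.le⟩ hs, hC.φ₀_zero, sub_zero]
  have h2 : ∀ l, l ∈ Icc 1 N → E.τ l 0 = D.start l := by
    intro l
    induction l with
    | zero => intro h; exact absurd h.1 (by norm_num)
    | succ k ih =>
      intro hk
      rcases Nat.eq_zero_or_pos k with rfl | hpos
      · rw [hE.init.1, start_one]
      · have hk' : k ∈ Icc 1 N := ⟨hpos, by have := hk.2; omega⟩
        rw [(hE.chain (k + 1) ⟨by omega, hk.2⟩).1, Nat.add_sub_cancel, h1 k hk' _ ⟨hC.S_pos.le, le_rfl⟩,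
          ih hk', hC.φ₀_end, start_add_h, start_succ]
  intro l hl s hs
  rw [h1 l hl s hs, h2 l hl]

section Global

variable (hD : D.Standing) (hC : D.IsExtendedControl E)
  (hτ : ∀ l ∈ Icc 1 N, ∀ s ∈ Icc 0 E.S, E.τ l s = D.start l + E.φ₀ s)
include hD hC hτ

omit hD in
lemma tau_chain : ∀ l ∈ Icc 2 N, E.τ l 0 = E.τ (l - 1) E.S := by
  intro l hl
  obtain ⟨k, rfl⟩ : ∃ k, l = k + 1 := ⟨l - 1, by have := hl.1; omega⟩
  rw [Nat.add_sub_cancel, hτ (k + 1) ⟨by omega, hl.2⟩ _ ⟨le_rfl, hC.S_pos.le⟩,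
    hτ k ⟨by have := hl.1; omega, by have := hl.2; omega⟩ _ ⟨hC.S_pos.le, le_rfl⟩, hC.φ₀_zero,
    hC.φ₀_end, start_add_h, start_succ, add_zero]

/-- Written as a sum of clamped copies of φ₀, the concatenated time needs no case distinction at the
junctions, and its continuity and monotonicity are those of φ₀. -/
lemma tildeTau_isClock : IsClock (tilde N E.S E.τ) 0 (N * E.S) 0 D.T := by
  have hc := IsCanonicalControl.clk hC hD
  have hN : (0 : ℝ) < N := by exact_mod_cast hD.one_le_N
  have heq : EqOn (tilde N E.S E.τ) (fun s => E.τ 1 0 + ∑ l ∈ Finset.Icc 1 N,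
      (E.φ₀ (clamp E.S (s - ((l : ℝ) - 1) * E.S)))) (Icc 0 (N * E.S)) := by
    intro s hs
    dsimp only
    rw [tilde_eq_sum hC.S_pos hD.one_le_N (tau_chain hC hτ) hs]
    congr 1
    refine Finset.sum_congr rfl fun l hl => ?_
    rw [hτ l (Finset.mem_Icc.1 hl) _ (clamp_mem hC.S_pos.le _),
      hτ l (Finset.mem_Icc.1 hl) _ ⟨le_rfl, hC.S_pos.le⟩, hC.φ₀_zero]
    ring
  refine ⟨mul_pos hN hC.S_pos, mul_pos hN hD.h_pos, ?_, ?_, ?_, ?_⟩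
  · refine ContinuousOn.congr (Continuous.continuousOn ?_) heq
    refine continuous_const.add (continuous_finsetSum _ fun l _ => ?_)
    exact (continuous_phi0_clamp hc).comp (continuous_sub_right _)
  · intro s hs s' hs' hle
    rw [heq hs, heq hs']
    dsimp only
    gcongr with l _
    exact hC.mono (clamp_mem hC.S_pos.le _) (clamp_mem hC.S_pos.le _)
      (clamp_mono _ (by linarith))
  · rw [tilde_zero hC.S_pos hD.one_le_N, hτ 1 ⟨le_rfl, hD.one_le_N⟩ _ ⟨le_rfl, hC.S_pos.le⟩,
      hC.φ₀_zero, start_one, add_zero]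
  · rw [tilde_end, hτ N ⟨hD.one_le_N, le_rfl⟩ _ ⟨hC.S_pos.le, le_rfl⟩, hC.φ₀_end, start_add_h, T]

lemma sigmaTilde_mem (t : ℝ) : D.sigmaTilde E t ∈ Icc 0 (N * E.S) :=
  (tildeTau_isClock hD hC hτ).rightInv_mem t

lemma sigmaTilde_mono : Monotone (D.sigmaTilde E) :=
  (tildeTau_isClock hD hC hτ).rightInv_monotone

/-- For r < h the time (l-1)h + r is left for good in period l, at the end of the plateau of r; at a
grid point this is the first plateau of the later period. The time 0 is excluded because σ̃(0) = 0
is prescribed, even if there is a plateau over 0. -/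
lemma sigmaTilde_eq {l : ℕ} (hl : l ∈ Icc 1 N) {r : ℝ} (hr : r ∈ Ico 0 D.h)
    (hpos : 0 < D.start l + r) :
    D.sigmaTilde E (D.start l + r) = ((l : ℝ) - 1) * E.S + D.up E r
      ∧ ((l : ℝ) - 1) * E.S + D.up E r ∈ Ico (((l : ℝ) - 1) * E.S) (l * E.S) := by
  have hc := IsCanonicalControl.clk hC hD
  have hck := tildeTau_isClock hD hC hτ
  have hr' : r ∈ Icc 0 D.h := Ico_subset_Icc_self hr
  have hl1 : (1 : ℝ) ≤ l := by exact_mod_cast hl.1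
  have hlN : (l : ℝ) ≤ N := by exact_mod_cast hl.2
  have hup : D.up E r < E.S := by
    by_contra hle
    have h1 : D.up E r = E.S := le_antisymm (up_mem hc r).2 (not_lt.1 hle)
    have h2 := phi0_up hc hr'
    rw [h1, hC.φ₀_end] at h2
    exact absurd h2 hr.2.ne'
  have hT : D.start l + r < D.T := by
    have h1 : (l : ℝ) * D.h ≤ N * D.h := mul_le_mul_of_nonneg_right hlN hD.h_pos.le
    have := hr.2
    unfold start T; linarith
  have hmem : ((l : ℝ) - 1) * E.S + D.up E r ∈ Ico (((l : ℝ) - 1) * E.S) (l * E.S) :=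
    ⟨by linarith [(up_mem hc r).1], by linarith⟩
  have hlNS : (l : ℝ) * E.S ≤ N * E.S := mul_le_mul_of_nonneg_right hlN hC.S_pos.le
  have hl0 : 0 ≤ ((l : ℝ) - 1) * E.S := mul_nonneg (by linarith) hC.S_pos.le
  have hval : ∀ s ∈ Ico (((l : ℝ) - 1) * E.S) (l * E.S),
      tilde N E.S E.τ s = D.start l + E.φ₀ (s - ((l : ℝ) - 1) * E.S) := fun s hs => by
    rw [tilde_eq hC.S_pos hl hs, hτ l hl _ ⟨by linarith [hs.1], by linarith [hs.2]⟩]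
  refine ⟨?_, hmem⟩
  unfold sigmaTilde
  rw [hck.rightInv_eq_rightLim ⟨hpos, hT.le⟩]
  refine hck.rightLim_eq_of ⟨hpos.le, hT.le⟩ ⟨hl0.trans hmem.1, hmem.2.le.trans hlNS⟩ ?_ ?_
  · rw [hval _ hmem, add_sub_cancel_left, phi0_up hc hr']
  · intro s hs hlt
    -- The point s may lie in a later period; an intermediate s' inside period l suffices, by
    -- monotonicity of the concatenated time.
    obtain ⟨s', h1, h2⟩ := exists_between (lt_min hlt hmem.2)
    have hs' : s' ∈ Ico (((l : ℝ) - 1) * E.S) (l * E.S) :=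
      ⟨hmem.1.trans h1.le, h2.trans_le (min_le_right _ _)⟩
    have hs'' : s' ∈ Icc 0 (N * E.S) := ⟨hl0.trans hs'.1, hs'.2.le.trans hlNS⟩
    refine lt_of_lt_of_le ?_ (hck.mono hs'' hs (h2.le.trans (min_le_left _ _)))
    rw [hval _ hs', add_lt_add_iff_left]
    by_contra hle
    have := (phi0_le_iff hc hr' ⟨by linarith [hs'.1], by linarith [hs'.2]⟩).1 (not_lt.1 hle)
    linarith

section
variable {V : Type*} [AddCommMonoid V] (z : ℕ → ℝ → V)

lemma tilde_sigmaTilde {l : ℕ} (hl : l ∈ Icc 1 N) {r : ℝ} (hr : r ∈ Ico 0 D.h)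
    (hpos : 0 < D.start l + r) :
    tilde N E.S z (D.sigmaTilde E (D.start l + r)) = z l (D.up E r) := by
  obtain ⟨h1, h2⟩ := sigmaTilde_eq hD hC hτ hl hr hpos
  rw [h1, tilde_eq hC.S_pos hl h2, add_sub_cancel_left]

omit hτ in
lemma tilde_sigmaTilde_zero : tilde N E.S z (D.sigmaTilde E 0) = z 1 0 := by
  rw [sigmaTilde, rightInv_of_le le_rfl, tilde_zero hC.S_pos hD.one_le_N]

lemma tilde_sigmaTilde_end : tilde N E.S z (D.sigmaTilde E D.T) = z N E.S := by
  rw [sigmaTilde, rightInv_of_ge (tildeTau_isClock hD hC hτ).hS le_rfl, tilde_end]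

end

/-- The integral up to `σ̃⁺(t)` of a function of the rate of `φ̃`, as a sum over the periods. -/
lemma integral_sigmaTilde {G : Ctrl m → ℝ}
    (hG : ∀ l ∈ Icc 1 N, IntegrableOn (fun s => G (deriv (E.φ l) s)) (Icc 0 E.S))
    {t : ℝ} (ht : t ∈ Icc 0 D.T) :
    ∫ s in (0 : ℝ)..Function.rightLim (D.sigmaTilde E) t, G (deriv (tilde N E.S E.φ) s)
      = ∑ l ∈ Finset.Icc 1 N, ∫ s in Icc 0 E.S ∩ {s | D.start l + E.φ₀ s ∈ Icc 0 t},
        G (deriv (E.φ l) s) := by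
  have hc := IsCanonicalControl.clk hC hD
  have hck := tildeTau_isClock hD hC hτ
  set R := Function.rightLim (D.sigmaTilde E) t with hR
  have hRm : R ∈ Icc 0 (N * E.S) := hck.rightLim_mem t
  have hm : ∀ l : ℕ, MeasurableSet (Icc 0 E.S ∩ {s | D.start l + E.φ₀ s ∈ Icc 0 t}) := by
    intro l
    have : Icc 0 E.S ∩ {s | D.start l + E.φ₀ s ∈ Icc 0 t}
        = Icc 0 E.S ∩ E.φ₀ ⁻¹' ((fun u => D.start l + u) ⁻¹' (Icc 0 t)) := rfl
    rw [this]
    exact measurableSet_level hc (measurableSet_Icc.preimage (measurable_const_add _))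
  rw [intervalIntegral.integral_of_le hRm.1, ← integral_Icc_eq_integral_Ioc]
  have e1 : ∫ s in Icc 0 R, G (deriv (tilde N E.S E.φ) s) = ∫ s in Icc 0 (N * E.S),
      (Icc 0 R).indicator (fun s => G (deriv (tilde N E.S E.φ) s)) s := by
    rw [setIntegral_indicator measurableSet_Icc, inter_eq_right.2 (Icc_subset_Icc_right hRm.2)]
  rw [e1, integral_periods hC.S_pos (g := fun l => (Icc 0 E.S ∩ {s | D.start l + E.φ₀ s ∈ Icc 0 t}).indicator
    fun s => G (deriv (E.φ l) s))]
  · refine Finset.sum_congr rfl fun l _ => ?_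
    rw [setIntegral_indicator (hm l), ← inter_assoc, inter_self]
  · intro l hl
    exact (hG l hl).indicator (hm l)
  · intro l hl s hs
    have hlN : (l : ℝ) ≤ N := by exact_mod_cast hl.2
    have hl1 : (1 : ℝ) ≤ l := by exact_mod_cast hl.1
    have hs2 : s - ((l : ℝ) - 1) * E.S ∈ Icc 0 E.S := ⟨by linarith [hs.1], by linarith [hs.2]⟩
    have hs3 : s ∈ Icc 0 (N * E.S) := ⟨le_trans (mul_nonneg (by linarith) hC.S_pos.le) hs.1.le,
      hs.2.le.trans (mul_le_mul_of_nonneg_right hlN hC.S_pos.le)⟩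
    have hst : 0 ≤ D.start l := mul_nonneg (by linarith) hD.h_pos.le
    -- The interval [0,R] is the sublevel set of the concatenated time at t, so cutting at σ̃⁺(t)
    -- amounts to a condition on the clock in each period.
    have hiff : s ∈ Icc 0 R ↔ s - ((l : ℝ) - 1) * E.S ∈
        Icc 0 E.S ∩ {s | D.start l + E.φ₀ s ∈ Icc 0 t} := by
      have hR' : tilde N E.S E.τ s ≤ t ↔ s ≤ R := hck.le_iff ht hs3
      rw [mem_Icc, ← hR', tilde_eq hC.S_pos hl (Ioo_subset_Ico_self hs), hτ l hl _ hs2]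
      have : 0 ≤ D.start l + E.φ₀ (s - ((l : ℝ) - 1) * E.S) :=
        add_nonneg hst (hc.mapsTo hs2).1
      simp only [mem_inter_iff, hs2, mem_ofPred_eq, mem_Icc, this, true_and, hs3.1]
    by_cases h : s ∈ Icc 0 R
    · rw [indicator_of_mem h, indicator_of_mem (hiff.1 h), deriv_tilde hC.S_pos hl hs]
    · rw [indicator_of_notMem h, indicator_of_notMem fun h' => h (hiff.2 h')]

end Global

variable (D) in
/-- The impulse control of `P` is the one constructed from the extended control of `E`. -/
structure ControlOf (E : ExtendedTuple n m) (P : ImpulseTuple n m) : Prop where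
  μ_eq : P.μ = pushV (base N E.S) (D.clock E) (rate E)
  ν_eq : P.ν = pushN (base N E.S) (D.clock E) (rate E)
  ω_eq : ∀ r ∈ Icc 0 D.h, ∀ l ∈ Icc 1 N, ∀ᵐ s ∂volume.restrict (Icc 0 1),
    P.ω r l s = (D.up E r - D.lo E r) • deriv (E.φ l) ((D.up E r - D.lo E r) * s + D.lo E r)

section Global

variable (hD : D.Standing) (hC : D.IsExtendedControl E)
include hD hC

lemma level_outside {l : ℕ} (hl : l ∈ Icc 1 N) {B : Set ℝ} (hB : Disjoint B (Icc 0 D.T)) :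
    Icc 0 E.S ∩ {s | D.start l + E.φ₀ s ∈ B} = ∅ := by
  have hc := IsCanonicalControl.clk hC hD
  have hlN : (l : ℝ) ≤ N := by exact_mod_cast hl.2
  have hl1 : (1 : ℝ) ≤ l := by exact_mod_cast hl.1
  ext s
  simp only [mem_inter_iff, mem_ofPred_eq, mem_empty_iff_false, iff_false, not_and]
  intro hs hs'
  refine disjoint_left.1 hB hs' ⟨?_, ?_⟩
  · exact add_nonneg (mul_nonneg (by linarith) hD.h_pos.le) (hc.mapsTo hs).1
  · have := (hc.mapsTo hs).2
    have h1 : (l : ℝ) * D.h ≤ N * D.h := mul_le_mul_of_nonneg_right hlN hD.h_pos.le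
    unfold start T; linarith

lemma pushV_outside {B : Set ℝ} (hBm : MeasurableSet B) (hB : Disjoint B (Icc 0 D.T)) (j : Fin m) :
    pushV (base N E.S) (D.clock E) (rate E) j B = 0 := by
  rw [IsCanonicalControl.pushV_apply hC hD hBm]
  refine Finset.sum_eq_zero fun l hl => ?_
  rw [level_outside hD hC (Finset.mem_Icc.1 hl) hB]; simp

lemma pushN_outside : pushN (base N E.S) (D.clock E) (rate E) (Icc 0 D.T)ᶜ = 0 := by
  have := isFiniteMeasure_pushN (τ := D.clock E) (IsCanonicalControl.integrable_rate (D := D) hC)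
  rw [← measureReal_eq_zero_iff, IsCanonicalControl.pushN_real hC hD measurableSet_Icc.compl]
  refine Finset.sum_eq_zero fun l hl => ?_
  rw [level_outside hD hC (Finset.mem_Icc.1 hl) disjoint_compl_left]; simp

variable (hτ : ∀ l ∈ Icc 1 N, ∀ s ∈ Icc 0 E.S, E.τ l s = D.start l + E.φ₀ s)
include hτ

lemma pushV_Icc {t : ℝ} (ht : t ∈ Icc 0 D.T) (j : Fin m) :
    pushV (base N E.S) (D.clock E) (rate E) j (Icc 0 t)
      = ∫ s in (0 : ℝ)..Function.rightLim (D.sigmaTilde E) t, deriv (tilde N E.S E.φ) s j := by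
  rw [IsCanonicalControl.pushV_apply hC hD measurableSet_Icc,
    integral_sigmaTilde hD hC hτ (G := fun w => w j)
      (fun l hl => (IsCanonicalControl.integrableOn_rate hC hl).eval j) ht]

lemma pushN_Icc {t : ℝ} (ht : t ∈ Icc 0 D.T) :
    (pushN (base N E.S) (D.clock E) (rate E)).real (Icc 0 t)
      = ∫ s in (0 : ℝ)..Function.rightLim (D.sigmaTilde E) t,
        norm1 (deriv (tilde N E.S E.φ) s) := by
  rw [IsCanonicalControl.pushN_real hC hD measurableSet_Icc,
    integral_sigmaTilde hD hC hτ (G := norm1)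
      (fun l hl => integrable_norm1 (IsCanonicalControl.integrableOn_rate hC hl)) ht]

/-- The distribution functions prescribed by Construction B are those of the pushed measures, and
measures on [0,T] are determined by them. All later arguments use the push-forward form. -/
lemma isImpulseOf_iff {P : ImpulseTuple n m} :
    D.IsImpulseOf E P ↔ D.ControlOf E P ∧ (∀ t ∈ Ico (-(M * D.h)) 0, P.x t = D.ξ t) ∧
      D.IsGCSolution E P.x P.v := by
  have hT : 0 ≤ D.T := (tildeTau_isClock hD hC hτ).hS.le
  have hfin := isFiniteMeasure_pushN (τ := D.clock E)
    (IsCanonicalControl.integrable_rate (D := D) hC)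
  constructor
  · rintro ⟨h1, h2, h3, h4, h5, h6, h7, h8⟩
    refine ⟨⟨?_, ?_, h6⟩, h7, h8⟩
    · funext j
      refine signedMeasure_ext_Icc hT (fun B hB hd => congrFun (h1 B hB hd) j)
        (fun B hB hd => pushV_outside hD hC hB hd j) fun t ht => ?_
      rw [h4 t ht, pushV_Icc hD hC hτ ht]
    · refine measure_ext_Icc hT h3 (pushN_outside hD hC) fun t ht => ?_
      rw [h5 t ht, pushN_Icc hD hC hτ ht]
  · rintro ⟨⟨h1, h2, h6⟩, h7, h8⟩
    refine ⟨?_, ?_, ?_, ?_, ?_, h6, h7, h8⟩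
    · intro B hB hd
      ext j
      rw [VMeas.val, h1]
      exact pushV_outside hD hC hB hd j
    · rw [h2]; exact hfin
    · rw [h2]; exact pushN_outside hD hC
    · intro t ht j
      rw [h1, pushV_Icc hD hC hτ ht]
    · intro t ht
      rw [h2, pushN_Icc hD hC hτ ht]

end Global

end System

/-! ### Pushed measures: cone values, continuous parts and weak* approximation -/

lemma closedConvexHull_smul_mem {m : ℕ} {K : Set (Ctrl m)}
    (hK : ∀ c : ℝ, 0 ≤ c → ∀ w ∈ K, c • w ∈ K) {c : ℝ} (hc : 0 ≤ c) {w : Ctrl m}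
    (hw : w ∈ closedConvexHull ℝ K) : c • w ∈ closedConvexHull ℝ K := by
  have h1 : closedConvexHull ℝ K ⊆ (fun w => c • w) ⁻¹' closedConvexHull ℝ K := by
    refine closedConvexHull_min ?_ ?_ ?_
    · exact fun w hw => subset_closedConvexHull (hK c hc w hw)
    · exact convex_closedConvexHull.linear_preimage (LinearMap.lsmul ℝ (Ctrl m) c)
    · exact isClosed_closedConvexHull.preimage (continuous_const_smul c)
  exact h1 hw

/-- The integral is the total mass times an average; averages of K-valued functions lie in the
closed convex hull, which is again a cone. -/
lemma integral_mem_closedConvexHull {Ω : Type*} [MeasurableSpace Ω] {m : ℕ} {K : Set (Ctrl m)}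
    (h0 : (0 : Ctrl m) ∈ K) (hK : ∀ c : ℝ, 0 ≤ c → ∀ w ∈ K, c • w ∈ K) {κ : Measure Ω}
    [IsFiniteMeasure κ] {Φ : Ω → Ctrl m} (hi : Integrable Φ κ) (hΦ : ∀ᵐ p ∂κ, Φ p ∈ K) :
    ∫ p, Φ p ∂κ ∈ closedConvexHull ℝ K := by
  rcases eq_or_ne κ 0 with h | h
  · rw [h, integral_zero_measure]; exact subset_closedConvexHull h0
  · have : NeZero κ := ⟨h⟩
    have h1 : (⨍ p, Φ p ∂κ) ∈ closedConvexHull ℝ K :=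
      convex_closedConvexHull.average_mem isClosed_closedConvexHull
        (hΦ.mono fun p hp => subset_closedConvexHull hp) hi
    rw [← measure_smul_average]
    exact closedConvexHull_smul_mem hK measureReal_nonneg h1

lemma pushV_of_null {Ω : Type*} [MeasurableSpace Ω] {m : ℕ} {κ : Measure Ω} {τ : Ω → ℝ}
    {Φ : Ω → Ctrl m} (hτ : Measurable τ) (hi : Integrable Φ κ) {B : Set ℝ} (hB : MeasurableSet B)
    (h : κ (τ ⁻¹' B) = 0) : (pushV κ τ Φ).val B = 0 := by
  ext j
  rw [VMeas.val, pushV_apply hτ hi hB, Measure.restrict_eq_zero.2 h, integral_zero_measure]; rfl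

namespace System

variable {n m N M : ℕ} {D : System n m N M} {E : ExtendedTuple n m}

variable (D) in
/-- The points of `[0,h]` over which `φ₀` is not injective, and the end points. -/
def plat (E : ExtendedTuple n m) : Set ℝ := {r | r ∈ Icc 0 D.h ∧ D.lo E r < D.up E r} ∪ {0, D.h}

variable (D) in
/-- The translates of `plat` to the `N` periods. -/
def knots (E : ExtendedTuple n m) : Set ℝ := ⋃ l ∈ Icc 1 N, (fun r => D.start l + r) '' D.plat E

lemma countable_plat (hc : IsClock E.φ₀ 0 E.S 0 D.h) : (D.plat E).Countable := by
  refine Countable.union ?_ (by simp)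
  have := hc.rightInv_monotone.countable_not_continuousAt
  refine this.mono fun r hr => ?_
  rw [mem_ofPred_eq, hc.rightInv_monotone.continuousAt_iff_leftLim_eq_rightLim]
  exact hr.2.ne

lemma countable_knots (hc : IsClock E.φ₀ 0 E.S 0 D.h) : (D.knots E).Countable :=
  (Set.to_countable _).biUnion fun _ _ => (countable_plat hc).image _

lemma zero_mem_plat : (0 : ℝ) ∈ D.plat E := Or.inr (Or.inl rfl)
lemma h_mem_plat : D.h ∈ D.plat E := Or.inr (Or.inr rfl)

section
variable (hc : IsClock E.φ₀ 0 E.S 0 D.h)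
include hc

lemma plat_subset : D.plat E ⊆ Icc 0 D.h := by
  rintro r (h | h | h)
  · exact h.1
  · rw [h]; exact ⟨le_rfl, hc.hS.le⟩
  · have h : r = D.h := h
    rw [h]; exact ⟨hc.hS.le, le_rfl⟩

lemma measurableSet_plat : MeasurableSet (D.plat E) := (countable_plat hc).measurableSet
lemma measurableSet_knots : MeasurableSet (D.knots E) := (countable_knots hc).measurableSet

omit hc in
lemma lo_eq_up_of_notMem (hc : IsClock E.φ₀ 0 E.S 0 D.h) {r : ℝ} (hr : r ∈ Icc 0 D.h)
    (h : r ∉ D.plat E) : D.lo E r = D.up E r := by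
  refine le_antisymm (lo_le_up hc r) (not_lt.1 fun hlt => h (Or.inl ⟨hr, hlt⟩))

omit hc in
lemma mem_Ioo_of_notMem_plat {r : ℝ} (hr : r ∈ Icc 0 D.h) (h : r ∉ D.plat E) : r ∈ Ioo 0 D.h := by
  refine ⟨lt_of_le_of_ne hr.1 ?_, lt_of_le_of_ne hr.2 ?_⟩
  · rintro rfl; exact h zero_mem_plat
  · rintro rfl; exact h h_mem_plat

/-- The points 0 and h were put into `plat` for the sake of this equivalence: an offset outside
`plat` is interior, so it belongs to a single period. -/
lemma mem_knots_iff {l : ℕ} (hl : l ∈ Icc 1 N) {r : ℝ} (hr : r ∈ Icc 0 D.h) :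
    D.start l + r ∈ D.knots E ↔ r ∈ D.plat E := by
  constructor
  · intro h
    by_contra hn
    simp only [knots, mem_iUnion, exists_prop] at h
    obtain ⟨k, _, r', hr', e⟩ := h
    have := (start_add_inj hc.hS (plat_subset hc hr') (mem_Ioo_of_notMem_plat hr hn)).1 e
    exact hn (this.2 ▸ hr')
  · intro h
    simp only [knots, mem_iUnion, exists_prop]
    exact ⟨l, hl, r, h, rfl⟩

lemma eq_of_phi0_eq {s s' : ℝ} (hs : s ∈ Icc 0 E.S) (hs' : s' ∈ Icc 0 E.S) (h : E.φ₀ s ∉ D.plat E)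
    (e : E.φ₀ s = E.φ₀ s') : s = s' := by
  have hr := hc.mapsTo hs
  have h1 := (phi0_eq_iff hc hr hs).1 rfl
  have h2 := (phi0_eq_iff hc hr hs').1 e.symm
  have h3 := lo_eq_up_of_notMem hc hr h
  have e1 : s = D.up E (E.φ₀ s) := le_antisymm h1.2 (h3 ▸ h1.1)
  have e2 : s' = D.up E (E.φ₀ s) := le_antisymm h2.2 (h3 ▸ h2.1)
  exact e1.trans e2.symm

lemma volume_level {l : ℕ} (hl : l ∈ Icc 1 N) {t : ℝ} (ht : t ∉ D.knots E) :
    volume (Icc 0 E.S ∩ {s | D.start l + E.φ₀ s ∈ ({t} : Set ℝ)}) = 0 := by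
  refine Set.Subsingleton.measure_zero ?_ _
  rintro s ⟨hs, e⟩ s' ⟨hs', e'⟩
  have e : D.start l + E.φ₀ s = t := e
  have e' : D.start l + E.φ₀ s' = t := e'
  refine eq_of_phi0_eq hc hs hs' ?_ (by linarith)
  rw [← mem_knots_iff hc hl (hc.mapsTo hs), e]
  exact ht

end

section
variable (hD : D.Standing) (hC : D.IsExtendedControl E)
include hD hC

lemma pushV_atoms : (pushV (base N E.S) (D.clock E) (rate E)).atoms ⊆ D.knots E := by
  intro t ht
  by_contra hn
  refine ht ?_
  ext j
  rw [VMeas.val, IsCanonicalControl.pushV_apply hC hD (measurableSet_singleton t)]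
  refine Finset.sum_eq_zero fun l hl => ?_
  rw [Measure.restrict_eq_zero.2 (volume_level (IsCanonicalControl.clk hC hD)
    (Finset.mem_Icc.1 hl) hn), integral_zero_measure]

lemma pushN_atoms (t : ℝ) (ht : pushN (base N E.S) (D.clock E) (rate E) {t} ≠ 0) :
    t ∈ D.knots E := by
  by_contra hn
  refine ht ?_
  have := isFiniteMeasure_pushN (τ := D.clock E) (IsCanonicalControl.integrable_rate (D := D) hC)
  rw [← measureReal_eq_zero_iff, IsCanonicalControl.pushN_real hC hD (measurableSet_singleton t)]
  refine Finset.sum_eq_zero fun l hl => ?_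
  rw [Measure.restrict_eq_zero.2 (volume_level (IsCanonicalControl.clk hC hD)
    (Finset.mem_Icc.1 hl) hn), integral_zero_measure]

variable (D E) in
/-- The part of the base measure off the plateaus. -/
def offBase : Measure (ℕ × ℝ) := (base N E.S).restrict (D.clock E ⁻¹' (D.knots E)ᶜ)

omit hD in
lemma integrable_rate_off : Integrable (rate E) (D.offBase E) :=
  (IsCanonicalControl.integrable_rate (D := D) hC).integrableOn

lemma pushV_cont : (pushV (base N E.S) (D.clock E) (rate E)).cont
    = pushV (D.offBase E) (D.clock E) (rate E) := by
  have hc := IsCanonicalControl.clk hC hD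
  funext j
  rw [cont_eq_restrict (countable_knots hc) (pushV_atoms hD hC),
    pushV_restrict (measurable_clock hc) (IsCanonicalControl.integrable_rate hC)
      (measurableSet_knots hc).compl, offBase]

lemma contPart_pushN : contPart (pushN (base N E.S) (D.clock E) (rate E))
    = pushN (D.offBase E) (D.clock E) (rate E) := by
  have hc := IsCanonicalControl.clk hC hD
  rw [contPart_eq_restrict (countable_knots hc) (pushN_atoms hD hC),
    pushN_restrict (measurable_clock hc) (measurableSet_knots hc).compl, offBase]

omit hD hC in
-- Off the knots both obstructions to injectivity are gone: the plateaus, and the double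
-- representation of the grid points.
lemma exists_injOn (hc : IsClock E.φ₀ 0 E.S 0 D.h) : ∃ A : Set (ℕ × ℝ), MeasurableSet A ∧
    InjOn (D.clock E) A ∧ D.offBase E Aᶜ = 0 := by
  set G : Set (ℕ × ℝ) := (Icc 1 N) ×ˢ (Icc 0 E.S) with hG
  have hGm : MeasurableSet G := (Set.to_countable _).measurableSet.prod measurableSet_Icc
  have hkm := measurable_clock hc (measurableSet_knots hc).compl
  refine ⟨D.clock E ⁻¹' (D.knots E)ᶜ ∩ G, hkm.inter hGm, ?_, ?_⟩
  · rintro ⟨k, s⟩ ⟨h1, hk, hs⟩ ⟨l, s'⟩ ⟨h1', hl, hs'⟩ e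
    have hs : s ∈ Icc 0 E.S := hs
    have hs' : s' ∈ Icc 0 E.S := hs'
    simp only [mem_preimage, mem_compl_iff, clock_eq hs, clock_eq hs'] at h1 h1' e
    rw [mem_knots_iff hc hk (hc.mapsTo hs)] at h1
    rw [mem_knots_iff hc hl (hc.mapsTo hs')] at h1'
    obtain ⟨e1, e2⟩ := (start_add_inj hc.hS (hc.mapsTo hs)
      (mem_Ioo_of_notMem_plat (hc.mapsTo hs') h1')).1 e
    rw [e1, eq_of_phi0_eq hc hs hs' h1 e2]
  · have h1 : ∀ᵐ p ∂base N E.S, p ∈ G := by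
      refine ae_base.2 fun l hl => ?_
      filter_upwards [ae_restrict_mem measurableSet_Icc] with s hs using ⟨hl, hs⟩
    have h2 : ∀ᵐ p ∂D.offBase E, p ∈ D.clock E ⁻¹' (D.knots E)ᶜ ∩ G := by
      filter_upwards [ae_restrict_of_ae h1, ae_restrict_mem hkm] with p hp hp' using ⟨hp', hp⟩
    exact h2

omit hD in
lemma rate_mem : ∀ᵐ p ∂base N E.S, rate E p ∈ D.K :=
  ae_base.2 fun l hl => hC.φ_cone l hl

/-- An atom integrates the rates over whole plateaus, possibly of two periods, so that without
convexity of K the values lie only in the closed convex hull. The continuous part keeps a K-valued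
density because the clock is injective off the knots. -/
lemma isConeMeasure_pushV : IsConeMeasure D.K D.T (pushV (base N E.S) (D.clock E) (rate E)) := by
  have hc := IsCanonicalControl.clk hC hD
  have hm := measurable_clock hc
  have hi := IsCanonicalControl.integrable_rate (D := D) hC
  have hfin := isFiniteMeasure_base (N := N) (S := E.S)
  refine ⟨fun B hB hd => ?_, fun B hB => ?_, ?_⟩
  · ext j; exact pushV_outside hD hC hB hd j
  · have e : (pushV (base N E.S) (D.clock E) (rate E)).val B
        = ∫ p in D.clock E ⁻¹' B, rate E p ∂base N E.S := by
      ext j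
      rw [VMeas.val, pushV_apply hm hi hB, eval_integral fun i => hi.integrableOn.eval i]
    rw [e]
    exact integral_mem_closedConvexHull hD.K_zero hD.K_cone hi.integrableOn
      (ae_restrict_of_ae (rate_mem hC))
  · rw [pushV_cont hD hC]
    obtain ⟨A, hA, hinj, h0⟩ := exists_injOn hc
    exact pushV_hasConeDensity hD.K_closed hD.K_zero hD.K_cone hm IsCanonicalControl.measurable_rate
      (integrable_rate_off hC) hA hinj h0 (ae_restrict_of_ae (rate_mem hC))

variable (D E) in
/-- Strictly increasing perturbations of `clock`. -/
def clockApprox (ε : ℝ) (p : ℕ × ℝ) : ℝ :=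
  D.start p.1 + ((1 - ε) * E.φ₀ (clamp E.S p.2) + ε * (D.h / E.S * clamp E.S p.2))

omit hC in
lemma clockApprox_mem (hc : IsClock E.φ₀ 0 E.S 0 D.h) {ε : ℝ} (hε : ε ∈ Ioc 0 1) :
    ∀ᵐ p ∂base N E.S, D.clockApprox E ε p ∈ Icc 0 D.T := by
  refine ae_base.2 fun l hl => Eventually.of_forall fun s => ?_
  have hlN : (l : ℝ) ≤ N := by exact_mod_cast hl.2
  have hl1 : (1 : ℝ) ≤ l := by exact_mod_cast hl.1
  have h1 := hc.mapsTo (clamp_mem hc.hT.le s)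
  have h2 := clamp_mem hc.hT.le s
  have h3 : D.h / E.S * clamp E.S s ∈ Icc 0 D.h := by
    refine ⟨mul_nonneg (div_nonneg hc.hS.le hc.hT.le) h2.1, ?_⟩
    rw [div_mul_eq_mul_div, div_le_iff₀ hc.hT]
    exact mul_le_mul_of_nonneg_left h2.2 hc.hS.le
  have h4 : (l : ℝ) * D.h ≤ N * D.h := mul_le_mul_of_nonneg_right hlN hD.h_pos.le
  have h5 : 0 ≤ ((l : ℝ) - 1) * D.h := mul_nonneg (by linarith) hD.h_pos.le
  have h6 := mul_nonneg (sub_nonneg.2 hε.2) h1.1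
  have h7 := mul_nonneg hε.1.le h3.1
  have h8 := mul_le_mul_of_nonneg_left h1.2 (sub_nonneg.2 hε.2)
  have h9 := mul_le_mul_of_nonneg_left h3.2 hε.1.le
  unfold clockApprox start T
  constructor <;> dsimp only <;> linarith

omit hD hC in
lemma measurable_clockApprox (hc : IsClock E.φ₀ 0 E.S 0 D.h) (ε : ℝ) :
    Measurable (D.clockApprox E ε) :=
  measurable_from_prod_countable_right fun l =>
    (((((continuous_phi0_clamp hc).measurable.const_mul (1 - ε)).add
      (((continuous_clamp E.S).measurable.const_mul (D.h / E.S)).const_mul ε)).const_add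
        (D.start l)) :)

omit hD hC in
-- The linear term makes each period strictly increasing and preserves the values 0 at s = 0 and h
-- at s = S. Hence different periods have disjoint images as soon as the null set of end points s =
-- S is removed.
lemma clockApprox_injOn (hc : IsClock E.φ₀ 0 E.S 0 D.h) {ε : ℝ} (hε : ε ∈ Ioc 0 1) :
    ∃ A : Set (ℕ × ℝ), MeasurableSet A ∧ InjOn (D.clockApprox E ε) A ∧ base N E.S Aᶜ = 0 := by
  refine ⟨univ ×ˢ Ico 0 E.S, MeasurableSet.univ.prod measurableSet_Ico, ?_, ?_⟩
  · have hmono : ∀ s ∈ Icc 0 E.S, ∀ s' ∈ Icc 0 E.S, s < s' →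
        (1 - ε) * E.φ₀ s + ε * (D.h / E.S * s) < (1 - ε) * E.φ₀ s' + ε * (D.h / E.S * s') := by
      intro s hs s' hs' hlt
      refine add_lt_add_of_le_of_lt
        (mul_le_mul_of_nonneg_left (hc.mono hs hs' hlt.le) (sub_nonneg.2 hε.2)) ?_
      exact mul_lt_mul_of_pos_left (mul_lt_mul_of_pos_left hlt (div_pos hc.hS hc.hT)) hε.1
    have hbd : ∀ s ∈ Ico 0 E.S, ∀ k : ℕ, D.clockApprox E ε (k, s)
        ∈ Ico (((k : ℝ) - 1) * D.h) (k * D.h) := by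
      intro s hs k
      have hs' := Ico_subset_Icc_self hs
      have h0 : (1 - ε) * E.φ₀ 0 + ε * (D.h / E.S * 0) = 0 := by rw [hc.left]; ring
      have h1 : (1 - ε) * E.φ₀ E.S + ε * (D.h / E.S * E.S) = D.h := by
        rw [hc.right, div_mul_cancel₀ _ hc.hT.ne']; ring
      have h2 := hmono s hs' E.S hc.mem_right hs.2
      have h3 : 0 ≤ (1 - ε) * E.φ₀ s + ε * (D.h / E.S * s) := by
        rcases hs.1.eq_or_lt with h | h
        · rw [← h, h0]
        · exact h0 ▸ (hmono 0 hc.mem_left s hs' h).le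
      simp only [clockApprox, clamp_of_mem hs', start]
      rw [h1] at h2
      constructor <;> linarith
    rintro ⟨k, s⟩ ⟨_, hs⟩ ⟨l, s'⟩ ⟨_, hs'⟩ e
    have hs : s ∈ Ico 0 E.S := hs
    have hs' : s' ∈ Ico 0 E.S := hs'
    have hkl : k = l := period_unique hc.hS (hbd s hs k) (by rw [e]; exact hbd s' hs' l)
    subst hkl
    simp only [clockApprox, clamp_of_mem (Ico_subset_Icc_self hs),
      clamp_of_mem (Ico_subset_Icc_self hs'), add_right_inj] at e
    rcases lt_trichotomy s s' with h | h | h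
    · exact absurd e (hmono s (Ico_subset_Icc_self hs) s' (Ico_subset_Icc_self hs') h).ne
    · rw [h]
    · exact absurd e (hmono s' (Ico_subset_Icc_self hs') s (Ico_subset_Icc_self hs) h).ne'
  · have : ∀ᵐ p ∂base N E.S, p ∈ (univ : Set ℕ) ×ˢ Ico 0 E.S := by
      refine ae_base.2 fun l hl => ?_
      rw [← Measure.restrict_congr_set Ico_ae_eq_Icc]
      filter_upwards [ae_restrict_mem measurableSet_Ico] with s hs using ⟨mem_univ _, hs⟩
    exact this

omit hD hC in
lemma tendsto_clockApprox (hc : IsClock E.φ₀ 0 E.S 0 D.h) {G : ℕ × ℝ → ℝ}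
    (hG : Integrable G (base N E.S)) {ψ : ℝ → ℝ} (hψ : Continuous ψ) {C : ℝ} (hC : ∀ t, ‖ψ t‖ ≤ C) :
    Tendsto (fun i : ℕ => ∫ p, G p * ψ (D.clockApprox E (1 / (i + 1)) p) ∂base N E.S) atTop
      (𝓝 (∫ p, G p * ψ (D.clock E p) ∂base N E.S)) := by
  refine tendsto_integral_of_dominated_convergence (fun p => ‖G p‖ * C) ?_ (hG.norm.mul_const C)
    ?_ ?_
  · intro i
    exact hG.aestronglyMeasurable.mul
      (hψ.measurable.comp (measurable_clockApprox hc _)).aestronglyMeasurable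
  · intro i
    refine Eventually.of_forall fun p => ?_
    rw [norm_mul]
    exact mul_le_mul_of_nonneg_left (hC _) (norm_nonneg _)
  · refine Eventually.of_forall fun p => ?_
    refine Tendsto.const_mul _ ((hψ.tendsto _).comp ?_)
    have h0 := tendsto_one_div_add_atTop_nhds_zero_nat (𝕜 := ℝ)
    have : Tendsto (fun i : ℕ => D.start p.1 + ((1 - 1 / ((i : ℝ) + 1)) * E.φ₀ (clamp E.S p.2)
        + 1 / ((i : ℝ) + 1) * (D.h / E.S * clamp E.S p.2))) atTop
        (𝓝 (D.start p.1 + ((1 - 0) * E.φ₀ (clamp E.S p.2) + 0 * (D.h / E.S * clamp E.S p.2)))) :=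
      (((h0.const_sub 1).mul_const _).add (h0.mul_const _)).const_add _
    simpa [clock, clockApprox] using this

omit hD hC in
lemma setIntegral_pushN {κ : Measure (ℕ × ℝ)} {τ : ℕ × ℝ → ℝ} {Φ : ℕ × ℝ → Ctrl m}
    (hτ : Measurable τ) (hΦ : Measurable Φ) {ψ : ℝ → ℝ} (hψ : Measurable ψ) {B : Set ℝ}
    (hB : MeasurableSet B) :
    ∫ t in B, ψ t ∂pushN κ τ Φ = ∫ p in τ ⁻¹' B, norm1 (Φ p) * ψ (τ p) ∂κ := by
  have hm : Measurable fun p => ENNReal.ofReal (norm1 (Φ p)) :=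
    (measurable_norm1.comp hΦ).ennreal_ofReal
  rw [pushN, setIntegral_map hB hψ.aestronglyMeasurable hτ.aemeasurable,
    setIntegral_withDensity_eq_setIntegral_toReal_smul hm
      (by simp) _ (hτ hB)]
  simp_rw [ENNReal.toReal_ofReal (norm1_nonneg _), smul_eq_mul]

/-- The approximating measures are the images of the same density under the perturbed clocks. These
are injective up to a null set, so their total variations are the images of ‖rate‖·base without any
cancellation, and both convergences follow from pointwise convergence of the clocks by dominated
convergence. -/
lemma memVc_push : MemVc D.K D.T (pushV (base N E.S) (D.clock E) (rate E))
    (pushN (base N E.S) (D.clock E) (rate E)) := by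
  have hc := IsCanonicalControl.clk hC hD
  have hm := measurable_clock hc
  have hi := IsCanonicalControl.integrable_rate (D := D) hC
  have hT : 0 ≤ D.T := mul_nonneg (Nat.cast_nonneg _) hD.h_pos.le
  have hε : ∀ i : ℕ, (1 / ((i : ℝ) + 1)) ∈ Ioc (0 : ℝ) 1 := fun i =>
    ⟨by positivity, by rw [div_le_one (by positivity)]; linarith [Nat.cast_nonneg (α := ℝ) i]⟩
  have hma := fun i : ℕ => measurable_clockApprox hc (1 / ((i : ℝ) + 1))
  have hmem := fun i : ℕ => clockApprox_mem hD hc (hε i)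
  have hcl : ∀ᵐ p ∂base N E.S, D.clock E p ∈ Icc 0 D.T := by
    refine ae_base.2 fun l hl => ?_
    filter_upwards [ae_restrict_mem measurableSet_Icc] with s hs
    rw [clock_eq hs]
    by_contra hn
    have := level_outside hD hC hl (B := (Icc 0 D.T)ᶜ) disjoint_compl_left
    exact (eq_empty_iff_forall_notMem.1 this s) ⟨hs, hn⟩
  refine ⟨isFiniteMeasure_pushN hi, pushN_outside hD hC, ?_,
    fun i => pushV (base N E.S) (D.clockApprox E (1 / ((i : ℝ) + 1))) (rate E), ?_, ?_, ?_⟩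
  · rw [contPart_pushN hD hC, pushV_cont hD hC]
    obtain ⟨A, hA, hinj, h0⟩ := exists_injOn hc
    exact (pushV_tv hm IsCanonicalControl.measurable_rate (integrable_rate_off hC) hA hinj h0).symm
  · intro i
    refine ⟨fun B hB hd => pushV_of_null (hma i) hi hB ?_, ?_⟩
    · exact measure_mono_null (fun p hp h => disjoint_left.1 hd hp h) (hmem i)
    · obtain ⟨A, hA, hinj, h0⟩ := clockApprox_injOn hc (hε i)
      exact pushV_hasConeDensity hD.K_closed hD.K_zero hD.K_cone (hma i)
        IsCanonicalControl.measurable_rate hi hA hinj h0 (rate_mem hC)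
  all_goals
    intro ψ hψ
    obtain ⟨C, hCb⟩ := isCompact_Icc.exists_bound_of_continuousOn (s := Icc 0 D.T) hψ.continuousOn
    -- A continuous ψ may be unbounded on the line. Composed with the projection onto [0,T] it
    -- becomes bounded, and it is unchanged on the interval where all the measures live.
    have hψc : Continuous fun t => ψ (clamp D.T t) := hψ.comp (continuous_clamp _)
    have hψb : ∀ t, ‖ψ (clamp D.T t)‖ ≤ C := fun t => hCb _ (clamp_mem hT t)
    have hres : ∀ τ : ℕ × ℝ → ℝ, (∀ᵐ p ∂base N E.S, τ p ∈ Icc 0 D.T) →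
        (base N E.S).restrict (τ ⁻¹' Icc 0 D.T) = base N E.S := fun τ hτ =>
      Measure.restrict_eq_self_of_ae_mem hτ
  · intro j
    have e : ∀ τ : ℕ × ℝ → ℝ, Measurable τ → (∀ᵐ p ∂base N E.S, τ p ∈ Icc 0 D.T) →
        ∫ᵛ t in Icc 0 D.T, ψ t ∂<•(pushV (base N E.S) τ (rate E) j)
          = ∫ p, rate E p j * ψ (clamp D.T (τ p)) ∂base N E.S := by
      intro τ hτ hτm
      rw [VectorMeasure.setIntegral_congr_fun (g := fun t => ψ (clamp D.T t))
        fun t ht => by simp only [clamp_of_mem ht],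
        setIntegral_pushV hτ hi hψc.stronglyMeasurable hψb j measurableSet_Icc, hres τ hτm]
      rfl
    rw [e _ hm hcl]
    simp_rw [fun i => e _ (hma i) (hmem i)]
    exact tendsto_clockApprox hc (hi.eval j) hψc hψb
  · have e : ∀ τ : ℕ × ℝ → ℝ, Measurable τ → (∀ᵐ p ∂base N E.S, τ p ∈ Icc 0 D.T) →
        ∫ t in Icc 0 D.T, ψ t ∂(pushN (base N E.S) τ (rate E))
          = ∫ p, norm1 (rate E p) * ψ (clamp D.T (τ p)) ∂base N E.S := by
      intro τ hτ hτm
      rw [setIntegral_congr_fun (g := fun t => ψ (clamp D.T t)) measurableSet_Icc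
        fun t ht => by simp only [clamp_of_mem ht],
        setIntegral_pushN hτ IsCanonicalControl.measurable_rate hψc.measurable measurableSet_Icc,
        hres τ hτm]
    rw [e _ hm hcl]
    have e2 : ∀ i : ℕ, (pushV (base N E.S) (D.clockApprox E (1 / ((i : ℝ) + 1))) (rate E)).tv
        = pushN (base N E.S) (D.clockApprox E (1 / ((i : ℝ) + 1))) (rate E) := by
      intro i
      obtain ⟨A, hA, hinj, h0⟩ := clockApprox_injOn hc (hε i)
      exact pushV_tv (hma i) IsCanonicalControl.measurable_rate hi hA hinj h0
    simp_rw [e2, fun i => e _ (hma i) (hmem i)]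
    exact tendsto_clockApprox hc (integrable_norm1 hi) hψc hψb

end

end System

/-! ### Affine changes of variables -/

lemma ae_comp_affine {p : ℝ → Prop} (h : ∀ᵐ x, p x) {c : ℝ} (hc : c ≠ 0) (d : ℝ) :
    ∀ᵐ x, p (c * x + d) := by
  have h1 : Measure.QuasiMeasurePreserving (fun x : ℝ => c * x + d) volume volume :=
    (quasiMeasurePreserving_add_right volume d).comp (Measure.quasiMeasurePreserving_smul volume hc)
  exact h1.ae h

lemma ae_unit_of_ae_Icc {p : ℝ → Prop} {a b : ℝ} (hab : a < b)
    (h : ∀ᵐ s ∂volume.restrict (Icc a b), p s) :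
    ∀ᵐ u ∂volume.restrict (Icc (0 : ℝ) 1), p ((b - a) * u + a) := by
  rw [ae_restrict_iff' measurableSet_Icc] at h ⊢
  filter_upwards [ae_comp_affine h (sub_pos.2 hab).ne' a] with u hu hu'
  refine hu ⟨by nlinarith [hu'.1], by nlinarith [hu'.2]⟩

lemma ae_Icc_of_ae_unit {p : ℝ → Prop} {a b : ℝ} (hab : a < b)
    (h : ∀ᵐ u ∂volume.restrict (Icc (0 : ℝ) 1), p u) :
    ∀ᵐ s ∂volume.restrict (Icc a b), p ((s - a) / (b - a)) := by
  have hp := sub_pos.2 hab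
  rw [ae_restrict_iff' measurableSet_Icc] at h ⊢
  filter_upwards [ae_comp_affine h (inv_pos.2 hp).ne' (-((b - a)⁻¹ * a))] with s hs hs'
  have e : (b - a)⁻¹ * s + -((b - a)⁻¹ * a) = (s - a) / (b - a) := by field_simp; ring
  rw [e] at hs
  exact hs ⟨div_nonneg (by linarith [hs'.1]) hp.le, (div_le_one hp).2 (by linarith [hs'.2])⟩

lemma integral_unit_affine {V : Type*} [NormedAddCommGroup V] [NormedSpace ℝ V] (f : ℝ → V)
    (a b : ℝ) : ∫ u in (0 : ℝ)..1, (b - a) • f ((b - a) * u + a) = ∫ s in a..b, f s := by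
  rw [intervalIntegral.integral_smul, intervalIntegral.smul_integral_comp_mul_add]
  simp

lemma rnDeriv_withDensityV {ρ : Measure ℝ} [IsFiniteMeasure ρ] {f : ℝ → ℝ} (hf : Integrable f ρ) :
    SignedMeasure.rnDeriv (ρ.withDensityᵥ f) ρ =ᵐ[ρ] f := by
  refine Integrable.ae_eq_of_withDensityᵥ_eq (SignedMeasure.integrable_rnDeriv _ _) hf ?_
  exact (SignedMeasure.absolutelyContinuous_iff_withDensityᵥ_rnDeriv_eq _ _).1
    (Measure.withDensityᵥ_absolutelyContinuous ρ f)

namespace System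

variable {n m N M : ℕ} {D : System n m N M} {E : ExtendedTuple n m} {P : ImpulseTuple n m}

/-! ### The impulse control of a canonical extended control -/

section
variable (hD : D.Standing) (hC : D.IsExtendedControl E) (hL : D.ControlOf E P)
include hD hC hL

omit hD hC in
lemma ControlOf.integral_ω {r : ℝ} (hr : r ∈ Icc 0 D.h) {l : ℕ} (hl : l ∈ Icc 1 N) (j : Fin m) :
    ∫ s in (0 : ℝ)..1, P.ω r l s j = ∫ s in D.lo E r..D.up E r, deriv (E.φ l) s j := by
  rw [← integral_unit_affine (fun s => deriv (E.φ l) s j)]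
  refine intervalIntegral.integral_congr_ae_restrict ?_
  rw [uIoc_of_le zero_le_one]
  filter_upwards [ae_mono (Measure.restrict_mono Ioc_subset_Icc_self le_rfl) (hL.ω_eq r hr l hl)]
    with s hs
  rw [hs]; rfl

lemma ControlOf.integral_norm_ω {r : ℝ} (hr : r ∈ Icc 0 D.h) {l : ℕ} (hl : l ∈ Icc 1 N) :
    ∫ s in (0 : ℝ)..1, norm1 (P.ω r l s)
      = ∫ s in D.lo E r..D.up E r, norm1 (deriv (E.φ l) s) := by
  have hc := IsCanonicalControl.clk hC hD
  rw [← integral_unit_affine (fun s => norm1 (deriv (E.φ l) s))]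
  refine intervalIntegral.integral_congr_ae_restrict ?_
  rw [uIoc_of_le zero_le_one]
  filter_upwards [ae_mono (Measure.restrict_mono Ioc_subset_Icc_self le_rfl) (hL.ω_eq r hr l hl)]
    with s hs
  rw [hs, norm1_smul, abs_of_nonneg (sub_nonneg.2 (lo_le_up hc r))]; rfl

omit hL in
lemma ae_unit_of_ae {p : ℝ → Prop} (h : ∀ᵐ s ∂volume.restrict (Icc 0 E.S), p s) {r : ℝ}
    (hlt : D.lo E r < D.up E r) :
    ∀ᵐ u ∂volume.restrict (Icc (0 : ℝ) 1), p ((D.up E r - D.lo E r) * u + D.lo E r) := by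
  have hc := IsCanonicalControl.clk hC hD
  exact ae_unit_of_ae_Icc hlt (ae_mono (Measure.restrict_mono
    (Icc_subset_Icc (lo_mem hc r).1 (up_mem hc r).2) le_rfl) h)

/-- The assumption on q 0 covers degenerate plateaus: there the factor σ⁺(r) - σ⁻(r) is 0, and so is
ω. -/
lemma ControlOf.ω_ae {q : Ctrl m → Prop} (h0 : q 0) {l : ℕ} (hl : l ∈ Icc 1 N) {r : ℝ}
    (hr : r ∈ Icc 0 D.h)
    (h : ∀ᵐ s ∂volume.restrict (Icc 0 E.S), q ((D.up E r - D.lo E r) • deriv (E.φ l) s)) :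
    ∀ᵐ u ∂volume.restrict (Icc (0 : ℝ) 1), q (P.ω r l u) := by
  have hc := IsCanonicalControl.clk hC hD
  rcases (lo_le_up hc r).eq_or_lt with he | hlt
  · filter_upwards [hL.ω_eq r hr l hl] with u hu
    rw [hu, he, sub_self, zero_smul]
    exact h0
  · filter_upwards [hL.ω_eq r hr l hl, ae_unit_of_ae hD hC h hlt] with u hu hu'
    rw [hu]; exact hu'

end

lemma attached_of_mem {ω : ℝ → ℕ → ℝ → Ctrl m} {r : ℝ} {l : ℕ} {s : ℝ} (h : 1 ≤ l ∧ l ≤ N) :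
    attached (N := N) ω r l s = ω r l s := if_pos h

lemma attached_of_notMem {ω : ℝ → ℕ → ℝ → Ctrl m} {r : ℝ} {l : ℕ} {s : ℝ}
    (h : ¬ (1 ≤ l ∧ l ≤ N)) : attached (N := N) ω r l s = 0 := if_neg h

/-- The integral of `G(ω^h_l) + G(ω^0_{l+1})`. -/
lemma integral_attached {ω : ℝ → ℕ → ℝ → Ctrl m} {G : Ctrl m → ℝ} (h0 : G 0 = 0)
    (hi : ∀ r ∈ ({0, D.h} : Set ℝ), ∀ l ∈ Icc 1 N,
      IntervalIntegrable (fun s => G (ω r l s)) volume 0 1) (l : ℕ) :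
    ∫ s in (0 : ℝ)..1, (G (attached (N := N) ω D.h l s) + G (attached (N := N) ω 0 (l + 1) s))
      = (if 1 ≤ l ∧ l ≤ N then ∫ s in (0 : ℝ)..1, G (ω D.h l s) else 0)
        + (if 1 ≤ l + 1 ∧ l + 1 ≤ N then ∫ s in (0 : ℝ)..1, G (ω 0 (l + 1) s) else 0) := by
  have key : ∀ r ∈ ({0, D.h} : Set ℝ), ∀ l,
      IntervalIntegrable (fun s => G (attached (N := N) ω r l s)) volume 0 1 ∧
      ∫ s in (0 : ℝ)..1, G (attached (N := N) ω r l s)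
        = if 1 ≤ l ∧ l ≤ N then ∫ s in (0 : ℝ)..1, G (ω r l s) else 0 := by
    intro r hr l
    split_ifs with h
    · simp_rw [attached_of_mem h]
      exact ⟨hi r hr l h, trivial⟩
    · simp_rw [attached_of_notMem h, h0]
      simp
  rw [intervalIntegral.integral_add (key _ (by simp) _).1 (key _ (by simp) _).1,
    (key D.h (by simp) l).2, (key 0 (by simp) (l + 1)).2]

lemma intervalIntegrable_of_memLp {m : ℕ} {w : ℝ → Ctrl m}
    (h : MemLp w ∞ (volume.restrict (Icc 0 1))) : IntervalIntegrable w volume 0 1 := by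
  rw [intervalIntegrable_iff_integrableOn_Icc_of_le zero_le_one]
  exact h.integrable le_top

lemma IntervalIntegrable.norm1 {m : ℕ} {w : ℝ → Ctrl m} {a b : ℝ} (hab : a ≤ b)
    (h : IntervalIntegrable w volume a b) :
    IntervalIntegrable (fun s => norm1 (w s)) volume a b := by
  rw [intervalIntegrable_iff_integrableOn_Icc_of_le hab] at h ⊢
  exact integrable_norm1 h

lemma IntervalIntegrable.apply {m : ℕ} {w : ℝ → Ctrl m} {a b : ℝ} (hab : a ≤ b)
    (h : IntervalIntegrable w volume a b) (j : Fin m) :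
    IntervalIntegrable (fun s => w s j) volume a b := by
  rw [intervalIntegrable_iff_integrableOn_Icc_of_le hab] at h ⊢
  exact h.eval j

lemma h_mem (hD : D.Standing) : D.h ∈ Icc 0 D.h := ⟨hD.h_pos.le, le_rfl⟩
lemma zero_mem (hD : D.Standing) : (0 : ℝ) ∈ Icc 0 D.h := ⟨le_rfl, hD.h_pos.le⟩

/-- The conditions on atoms compare integrals of the rates over level sets of the clock with
integrals of the rescaled rates. Constant speed holds because φ₀' = 0 on a plateau: unit speed
becomes ∑‖dφ_l/ds‖ = 1 there, and rescaling turns 1 into the length σ⁺(r) - σ⁻(r). -/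
theorem ControlOf.isImpulseControl (hD : D.Standing) (hK : D.IsCanonicalControl E)
    (hL : D.ControlOf E P) : D.IsImpulseControl P.μ P.ν P.ω := by
  have hC := hK.ctl
  have hc := IsCanonicalControl.clk hC hD
  have hnn : ∀ r, 0 ≤ D.up E r - D.lo E r := fun r => sub_nonneg.2 (lo_le_up hc r)
  have hb : ∀ r ∈ Icc 0 D.h, ∀ l ∈ Icc 1 N, MemLp (P.ω r l) ∞ (volume.restrict (Icc 0 1)) := by
    intro r hr l hl
    refine memLp_top_of_bound ?_ (D.up E r - D.lo E r) ?_
    · refine AEStronglyMeasurable.congr ?_ ((hL.ω_eq r hr l hl).mono fun s hs => hs.symm)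
      have := (measurable_deriv (E.φ l)).comp
        (((measurable_id (α := ℝ)).const_mul (D.up E r - D.lo E r)).add_const (D.lo E r))
      exact (this.const_smul (D.up E r - D.lo E r)).aestronglyMeasurable
    · refine hL.ω_ae hD hC (q := fun w => ‖w‖ ≤ D.up E r - D.lo E r) (by simpa using hnn r) hl hr ?_
      filter_upwards [hK.speed_le hl] with s hs
      rw [norm_smul, Real.norm_of_nonneg (hnn r)]
      exact mul_le_of_le_one_right (hnn r) ((norm_le_norm1 _).trans hs)
  have hgrid : ∀ r ∈ ({0, D.h} : Set ℝ), r ∈ Icc 0 D.h := by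
    rintro r (h | h)
    · rw [h]; exact zero_mem hD
    · rw [mem_singleton_iff.1 h]; exact h_mem hD
  refine ⟨?_, ?_, hb, ?_, ?_, ?_, ?_, ?_, ?_⟩
  · rw [hL.μ_eq]; exact isConeMeasure_pushV hD hC
  · rw [hL.μ_eq, hL.ν_eq]; exact memVc_push hD hC
  · intro r hr l hl
    refine hL.ω_ae hD hC (q := fun w => w ∈ D.K) hD.K_zero hl hr ?_
    filter_upwards [hC.φ_cone l hl] with s hs using hD.K_cone _ (hnn r) _ hs
  · intro r hr
    have hi : ∀ l ∈ Finset.Icc 1 N, IntervalIntegrable (fun s => norm1 (deriv (E.φ l) s)) volume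
        (D.lo E r) (D.up E r) := fun l hl =>
      IntervalIntegrable.norm1 (lo_le_up hc r) ((IsCanonicalControl.solves_phi hC
        (Finset.mem_Icc.1 hl)).intervalIntegrable (lo_mem hc r) (up_mem hc r))
    have e1 : ∑ l ∈ Finset.Icc 1 N, ∫ s' in (0 : ℝ)..1, norm1 (P.ω r l s')
        = D.up E r - D.lo E r := by
      rw [Finset.sum_congr rfl fun l hl => hL.integral_norm_ω hD hC hr (Finset.mem_Icc.1 hl),
        ← intervalIntegral.integral_finsetSum hi]
      have : ∫ s in D.lo E r..D.up E r, ∑ l ∈ Finset.Icc 1 N, norm1 (deriv (E.φ l) s)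
          = ∫ s in D.lo E r..D.up E r, (1 : ℝ) := by
        refine intervalIntegral.integral_congr_ae_restrict ?_
        rw [uIoc_of_le (lo_le_up hc r)]
        refine ae_mono (Measure.restrict_mono Ioc_subset_Icc_self le_rfl) ?_
        filter_upwards [IsCanonicalControl.deriv_phi0_plateau hC hD hr, ae_mono
          (Measure.restrict_mono (Icc_subset_Icc (lo_mem hc r).1 (up_mem hc r).2) le_rfl) hK.speed]
          with s h1 h2
        rw [h1, zero_add] at h2
        exact h2
      rw [this]; simp
    rw [e1]
    have hω : ∀ᵐ s ∂volume.restrict (Icc (0 : ℝ) 1), ∀ l ∈ Finset.Icc 1 N, P.ω r l s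
        = (D.up E r - D.lo E r) • deriv (E.φ l) ((D.up E r - D.lo E r) * s + D.lo E r) :=
      (ae_ball_iff (Finset.countable_toSet _)).2 fun l hl => hL.ω_eq r hr l (Finset.mem_Icc.1 hl)
    rcases (lo_le_up hc r).eq_or_lt with he | hlt
    · filter_upwards [hω] with s hs
      refine (Finset.sum_eq_zero fun l hl => ?_).trans (by rw [he, sub_self])
      rw [hs l hl, he, sub_self, zero_smul, norm1_zero]
    · filter_upwards [hω, ae_unit_of_ae hD hC hK.speed hlt,
        ae_unit_of_ae_Icc hlt (IsCanonicalControl.deriv_phi0_plateau hC hD hr)] with s hs h1 h2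
      rw [h2, zero_add] at h1
      rw [Finset.sum_congr rfl fun l hl => by
        rw [hs l hl, norm1_smul, abs_of_nonneg (hnn r)], ← Finset.mul_sum, h1, mul_one]
  · intro r hr l hl
    rw [hL.ν_eq, add_comm, IsCanonicalControl.pushN_real hC hD (measurableSet_singleton _),
      sum_inner hc _ hl hr, hL.integral_norm_ω hD hC (Ioo_subset_Icc_self hr) hl]
  · intro l hl
    rw [hL.ν_eq, IsCanonicalControl.pushN_real hC hD (measurableSet_singleton _),
      sum_grid hc _ hl, integral_attached (D := D) norm1_zero fun r hr l hl =>
        IntervalIntegrable.norm1 zero_le_one (intervalIntegrable_of_memLp (hb r (hgrid r hr) l hl))]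
    congr 1
    · split_ifs with h
      · rw [hL.integral_norm_ω hD hC (h_mem hD) h]
      · rfl
    · split_ifs with h
      · rw [hL.integral_norm_ω hD hC (zero_mem hD) h]
      · rfl
  · intro r hr l hl j
    rw [hL.μ_eq, add_comm, IsCanonicalControl.pushV_apply hC hD (measurableSet_singleton _),
      sum_inner hc (fun k s => deriv (E.φ k) s j) hl hr,
      hL.integral_ω (Ioo_subset_Icc_self hr) hl]
  · intro l hl j
    rw [hL.μ_eq, IsCanonicalControl.pushV_apply hC hD (measurableSet_singleton _),
      sum_grid hc (fun k s => deriv (E.φ k) s j) hl,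
      integral_attached (D := D) (G := fun w => w j) rfl fun r hr l hl =>
        IntervalIntegrable.apply zero_le_one
          (intervalIntegrable_of_memLp (hb r (hgrid r hr) l hl)) j]
    congr 1
    · split_ifs with h
      · rw [hL.integral_ω (h_mem hD) h]
      · rfl
    · split_ifs with h
      · rw [hL.integral_ω (zero_mem hD) h]
      · rfl

end System

namespace System

variable {n m N M : ℕ} {D : System n m N M} {E : ExtendedTuple n m} {P : ImpulseTuple n m}

/-- `φ₀`, continued by constants. -/
def ph (E : ExtendedTuple n m) (s : ℝ) : ℝ := E.φ₀ (clamp E.S s)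

lemma ph_of_mem {s : ℝ} (hs : s ∈ Icc 0 E.S) : ph E s = E.φ₀ s := by
  simp only [ph, clamp_of_mem hs]

lemma measurable_ph (hc : IsClock E.φ₀ 0 E.S 0 D.h) : Measurable (ph E) :=
  (continuous_phi0_clamp hc).measurable

lemma level_ph (B : Set ℝ) : Icc 0 E.S ∩ ph E ⁻¹' B = Icc 0 E.S ∩ E.φ₀ ⁻¹' B := by
  ext s
  refine and_congr_right fun hs => ?_
  simp only [mem_preimage, ph_of_mem hs]

lemma restrict_level (hc : IsClock E.φ₀ 0 E.S 0 D.h) {B : Set ℝ} (hB : MeasurableSet B) :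
    (volume.restrict (Icc 0 E.S)).restrict (ph E ⁻¹' B)
      = volume.restrict (Icc 0 E.S ∩ E.φ₀ ⁻¹' B) := by
  rw [Measure.restrict_restrict (measurable_ph hc hB), inter_comm, level_ph]

lemma map_ph_apply (hc : IsClock E.φ₀ 0 E.S 0 D.h) {B : Set ℝ} (hB : MeasurableSet B) :
    (volume.restrict (Icc 0 E.S)).map (ph E) B = volume (Icc 0 E.S ∩ E.φ₀ ⁻¹' B) := by
  rw [Measure.map_apply (measurable_ph hc) hB, Measure.restrict_apply (measurable_ph hc hB),
    inter_comm, level_ph]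

lemma level_Icc (hc : IsClock E.φ₀ 0 E.S 0 D.h) {r : ℝ} (hr : r ∈ Icc 0 D.h) :
    Icc 0 E.S ∩ E.φ₀ ⁻¹' Icc 0 r = Icc 0 (D.up E r) := by
  rw [← level_Iic hc hr]
  ext s
  refine and_congr_right fun hs => ?_
  simp only [mem_preimage, mem_Icc, mem_Iic, (hc.mapsTo hs).1, true_and]

lemma map_ph_real_Icc (hc : IsClock E.φ₀ 0 E.S 0 D.h) {r : ℝ} (hr : r ∈ Icc 0 D.h) :
    ((volume.restrict (Icc 0 E.S)).map (ph E)).real (Icc 0 r) = D.up E r := by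
  rw [Measure.real, map_ph_apply hc measurableSet_Icc, level_Icc hc hr, Real.volume_Icc, sub_zero,
    ENNReal.toReal_ofReal (up_mem hc r).1]

lemma map_ph_outside (hc : IsClock E.φ₀ 0 E.S 0 D.h) :
    (volume.restrict (Icc 0 E.S)).map (ph E) (Icc 0 D.h)ᶜ = 0 := by
  rw [map_ph_apply hc measurableSet_Icc.compl]
  convert measure_empty (μ := (volume : Measure ℝ))
  ext s
  simp only [mem_inter_iff, mem_preimage, mem_compl_iff, mem_empty_iff_false, iff_false, not_and,
    not_not]
  exact fun hs => hc.mapsTo hs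

/-! ### The function `φ` -/

lemma nuL_outside (hD : D.Standing) (l : ℕ) {B : Set ℝ} (hB : MeasurableSet B)
    (hd : Disjoint B (Icc 0 D.h)) : D.nuL P l B = 0 := by
  have h0 : (0 : ℝ) ∉ B := fun h => disjoint_left.1 hd h (zero_mem hD)
  have h1 : D.h ∉ B := fun h => disjoint_left.1 hd h (h_mem hD)
  have h2 : (fun t => t - D.start l) ⁻¹' B ∩ Ioo (D.start l) (l * D.h) = ∅ := by
    ext t
    simp only [mem_inter_iff, mem_preimage, mem_Ioo, mem_empty_iff_false, iff_false, not_and]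
    intro ht h3 h4
    exact disjoint_left.1 hd ht ⟨by linarith, by rw [← start_add_h] at h4; linarith⟩
  have hm : Measurable fun t : ℝ => t - D.start l := measurable_id.sub_const _
  rw [nuL, Measure.add_apply, Measure.add_apply, Measure.smul_apply, Measure.smul_apply,
    Measure.map_apply hm hB, Measure.restrict_apply (hm hB), h2, Measure.dirac_apply' _ hB,
    Measure.dirac_apply' _ hB]
  simp [h0, h1]

lemma isFiniteMeasure_nuL [IsFiniteMeasure P.ν] (l : ℕ) : IsFiniteMeasure (D.nuL P l) := by
  constructor
  unfold nuL
  simp only [Measure.add_apply, Measure.smul_apply, smul_eq_mul, ENNReal.add_lt_top]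
  refine ⟨⟨?_, measure_lt_top _ _⟩, ?_⟩ <;> simp

lemma isFiniteMeasure_dphi [IsFiniteMeasure P.ν] : IsFiniteMeasure (D.dphi P) := by
  have := fun l => isFiniteMeasure_nuL (D := D) (P := P) l
  unfold dphi
  infer_instance

lemma dphi_outside (hD : D.Standing) : D.dphi P (Icc 0 D.h)ᶜ = 0 := by
  rw [dphi, Measure.add_apply, Measure.finsetSum_apply,
    Finset.sum_eq_zero fun l _ => nuL_outside hD l measurableSet_Icc.compl disjoint_compl_left]
  simp

lemma dphi_real_Icc [IsFiniteMeasure P.ν] {r : ℝ} (hr : r ∈ Icc 0 D.h) :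
    (D.dphi P).real (Icc 0 r) = r + ∑ l ∈ Finset.Icc 1 N, (D.nuL P l).real (Icc 0 r) := by
  have := fun l => isFiniteMeasure_nuL (D := D) (P := P) l
  rw [dphi, measureReal_add_apply, Measure.real, Measure.restrict_apply measurableSet_Icc,
    inter_eq_left.2 (Icc_subset_Icc_right hr.2), Real.volume_Icc, sub_zero,
    ENNReal.toReal_ofReal hr.1]
  congr 1
  rw [Measure.real, Measure.finsetSum_apply, ENNReal.toReal_sum fun l _ => measure_ne_top _ _]
  rfl

lemma phi_of_pos {r : ℝ} (hr : 0 < r) :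
    D.phi P r = r + ∑ l ∈ Finset.Icc 1 N, (D.nuL P l).real (Icc 0 r) := if_neg hr.not_ge

lemma phi_eq_dphi [IsFiniteMeasure P.ν] {r : ℝ} (hr : r ∈ Ioc 0 D.h) :
    D.phi P r = (D.dphi P).real (Icc 0 r) := by
  rw [phi_of_pos hr.1, dphi_real_Icc ⟨hr.1.le, hr.2⟩]

lemma phi_of_ge (hD : D.Standing) {r : ℝ} (hr : D.h ≤ r) : D.phi P r = r - D.h + D.phi P D.h := by
  have e : ∀ l, (D.nuL P l).real (Icc 0 r) = (D.nuL P l).real (Icc 0 D.h) := by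
    intro l
    have hd : Disjoint (Icc 0 D.h) (Ioc D.h r) :=
      disjoint_left.2 fun x h h' => absurd h'.1 h.2.not_gt
    rw [Measure.real, Measure.real, ← Icc_union_Ioc_eq_Icc hD.h_pos.le hr,
      measure_union hd measurableSet_Ioc, nuL_outside hD l measurableSet_Ioc hd.symm, add_zero]
  rw [phi_of_pos (hD.h_pos.trans_le hr), phi_of_pos hD.h_pos]
  simp_rw [e]
  ring

section Phi

variable (hD : D.Standing) (hc : IsClock E.φ₀ 0 E.S 0 D.h)
  (hphi : ∀ r ∈ Ioc 0 D.h, D.phi P r = D.up E r)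
include hc hphi

/-- Because of φ(0) = 0, the function φ is the right inverse of φ₀ itself and not only its right
limit σ⁺. -/
lemma phi_eq_sigma {r : ℝ} (hr : r ≤ D.h) : D.phi P r = D.sigma E r := by
  rcases le_or_gt r 0 with h | h
  · rw [phi, if_pos h, sigma, rightInv_of_le h]
  · rw [hphi r ⟨h, hr⟩, up, sigma, hc.rightInv_eq_rightLim ⟨h, hr⟩]

lemma phiL_eq {r : ℝ} (hr : r ∈ Icc 0 D.h) : D.phiL P r = D.lo E r := by
  refine leftLim_eq_of_tendsto ?_
  refine (hc.rightInv_monotone.tendsto_leftLim r).congr' ?_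
  filter_upwards [self_mem_nhdsWithin] with x hx
  exact (phi_eq_sigma hc hphi ((le_of_lt hx).trans hr.2)).symm

include hD

lemma phiR_eq {r : ℝ} (hr : r ∈ Icc 0 D.h) : D.phiR P r = D.up E r := by
  refine rightLim_eq_of_tendsto ?_
  rcases hr.2.eq_or_lt with h | h
  · subst h
    have h1 : D.phi P D.h = D.up E D.h := hphi _ ⟨hD.h_pos, le_rfl⟩
    -- Beyond h the function φ continues with slope one whereas σ is constant, so the right limit at
    -- h has to be computed separately.
    have h2 : Tendsto (fun r => r - D.h + D.phi P D.h) (𝓝[>] D.h) (𝓝 (D.h - D.h + D.phi P D.h)) :=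
      ((continuous_id.sub continuous_const).add continuous_const).continuousWithinAt
    rw [sub_self, zero_add, h1] at h2
    refine h2.congr' ?_
    filter_upwards [self_mem_nhdsWithin] with x hx
    rw [phi_of_ge hD (le_of_lt hx), h1]
  · refine (hc.rightInv_monotone.tendsto_rightLim r).congr' ?_
    filter_upwards [Ioo_mem_nhdsGT h] with x hx
    exact (phi_eq_sigma hc hphi hx.2.le).symm

omit hD in
lemma mem_jumpSet {r : ℝ} : r ∈ D.jumpSet P ↔ r ∈ Icc 0 D.h ∧ D.lo E r < D.up E r := by
  refine and_congr_right fun hr => ?_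
  -- Since σ is constant on either side of [0,h], it factors through the projection onto [0,h].
  -- Continuity within [0,h] is therefore continuity on the line, which for a monotone function
  -- means that the one-sided limits agree.
  have hcl : (fun x => D.sigma E (clamp D.h x)) = D.sigma E := by
    funext x
    rcases le_or_gt x 0 with h | h
    · rw [clamp, max_eq_left ((min_le_right _ _).trans h), sigma, rightInv_of_le le_rfl,
        rightInv_of_le h]
    rcases le_or_gt D.h x with h' | h'
    · rw [clamp, min_eq_left h', max_eq_right hc.hS.le, sigma, rightInv_of_ge hc.hS le_rfl,
        rightInv_of_ge hc.hS h']
    · rw [clamp_of_mem ⟨h.le, h'.le⟩]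
  have e1 : ContinuousWithinAt (D.phi P) (Icc 0 D.h) r
      ↔ ContinuousWithinAt (D.sigma E) (Icc 0 D.h) r :=
    continuousWithinAt_congr (fun x hx => phi_eq_sigma hc hphi hx.2) (phi_eq_sigma hc hphi hr.2)
  have e2 : ContinuousWithinAt (D.sigma E) (Icc 0 D.h) r ↔ ContinuousAt (D.sigma E) r := by
    refine ⟨fun h => ?_, fun h => h.continuousWithinAt⟩
    rw [← hcl, ← continuousWithinAt_univ]
    refine ContinuousWithinAt.comp (t := Icc 0 D.h) (by rwa [clamp_of_mem hr])
      (continuous_clamp _).continuousWithinAt fun x _ => clamp_mem hc.hS.le x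
  have e3 : ContinuousAt (D.sigma E) r ↔ D.lo E r = D.up E r :=
    hc.rightInv_monotone.continuousAt_iff_leftLim_eq_rightLim
  rw [e1, e2, e3]
  exact ⟨fun h => lt_of_le_of_ne (lo_le_up hc r) h, fun h => h.ne⟩

lemma plateau_eq {r : ℝ} (hr : r ∈ Icc 0 D.h) : D.plateau P r = Icc (D.lo E r) (D.up E r) := by
  rw [plateau, phiL_eq hc hphi hr, phiR_eq hD hc hphi hr]

lemma mem_plateaus {s : ℝ} (hs : s ∈ Icc 0 E.S) :
    s ∈ D.plateaus P ↔ D.lo E (E.φ₀ s) < D.up E (E.φ₀ s) := by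
  simp only [plateaus, mem_iUnion, exists_prop]
  constructor
  · rintro ⟨r, hr, hsr⟩
    have hr' := (mem_jumpSet hc hphi).1 hr
    rw [plateau_eq hD hc hphi hr'.1, ← phi0_eq_iff hc hr'.1 hs] at hsr
    rw [hsr]; exact hr'.2
  · intro h
    have hr := hc.mapsTo hs
    refine ⟨_, (mem_jumpSet hc hphi).2 ⟨hr, h⟩, ?_⟩
    rw [plateau_eq hD hc hphi hr, ← phi0_eq_iff hc hr hs]

omit hD in
-- Taking right inverses twice returns φ₀. The adjunctions between φ₀ and σ^± show that φ₀(s) is the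
-- greatest lower bound of {t : φ(t) > s}.
lemma phi0_eq_rightInv {s : ℝ} (hs : s ∈ Icc 0 E.S) :
    E.φ₀ s = rightInv (D.phi P) 0 D.h 0 E.S s := by
  rcases hs.1.eq_or_lt with h | h
  · rw [← h, rightInv_of_le le_rfl, hc.left]
  rcases hs.2.eq_or_lt with h' | h'
  · rw [h', rightInv_of_ge hc.hT le_rfl, hc.right]
  rw [rightInv, if_neg h.not_ge, if_neg h'.not_ge]
  have hsm := hc.mapsTo hs
  have hmemh : D.h ∈ {t | t ∈ Icc 0 D.h ∧ s < D.phi P t} :=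
    ⟨⟨hc.hS.le, le_rfl⟩, by rw [hphi _ ⟨hc.hS, le_rfl⟩, up_end hc]; exact h'⟩
  symm
  refine IsGLB.csInf_eq (a := E.φ₀ s) ⟨?_, ?_⟩ ⟨D.h, hmemh⟩
  · rintro t ⟨ht, hlt⟩
    rcases ht.1.eq_or_lt with h0 | h0
    · rw [← h0, phi, if_pos le_rfl] at hlt; exact absurd hlt h.not_gt
    · rw [hphi t ⟨h0, ht.2⟩] at hlt
      exact (phi0_le_iff hc ht hs).2 hlt.le
  · intro b hb
    by_contra hlt
    push Not at hlt
    have hbh : b ≤ D.h := hb hmemh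
    obtain ⟨t, h1, h2⟩ := exists_between hlt
    have ht : t ∈ Ioc 0 D.h := ⟨hsm.1.trans_lt h1, h2.le.trans hbh⟩
    have ht' := Ioc_subset_Icc_self ht
    refine absurd (hb ⟨ht', ?_⟩) h2.not_ge
    rw [hphi t ht]
    exact ((phi0_lt_iff hc ht' hs).1 h1).trans_le (lo_le_up hc t)

end Phi

end System

lemma measure_split {ν : Measure ℝ} {h : ℝ} (hh : 0 < h) (h0 : ν (Icc 0 h)ᶜ = 0) :
    ν = ν {0} • Measure.dirac 0 + ν.restrict (Ioo 0 h) + ν {h} • Measure.dirac h := by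
  have e : ({0} ∪ Ioo 0 h) ∪ {h} = Icc 0 h := by
    rw [← insert_eq, Ioo_insert_left hh, union_comm, ← insert_eq, Ico_insert_right hh.le]
  have d1 : Disjoint ({0} ∪ Ioo 0 h) {h} := by
    rw [disjoint_singleton_right]; simp [hh.ne']
  have d2 : Disjoint {0} (Ioo 0 h) := by simp
  rw [← Measure.restrict_singleton, ← Measure.restrict_singleton,
    ← Measure.restrict_union d2 measurableSet_Ioo,
    ← Measure.restrict_union d1 (measurableSet_singleton h), e]
  refine (Measure.restrict_eq_self_of_ae_mem ?_).symm
  exact h0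

lemma signedMeasure_split {s : SignedMeasure ℝ} {h : ℝ} (hh : 0 < h)
    (h0 : ∀ B, MeasurableSet B → Disjoint B (Icc 0 h) → s B = 0) :
    s = VectorMeasure.dirac 0 (s {0}) + s.restrict (Ioo 0 h) + VectorMeasure.dirac h (s {h}) := by
  have e : ({0} ∪ Ioo 0 h) ∪ {h} = Icc 0 h := by
    rw [← insert_eq, Ioo_insert_left hh, union_comm, ← insert_eq, Ico_insert_right hh.le]
  have d1 : Disjoint ({0} ∪ Ioo 0 h) {h} := by
    rw [disjoint_singleton_right]; simp [hh.ne']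
  have d2 : Disjoint {0} (Ioo 0 h) := by simp
  ext B hB
  have hs : ∀ a : ℝ, MeasurableSet ({a} : Set ℝ) := measurableSet_singleton
  have hI : MeasurableSet (Ioo 0 h) := measurableSet_Ioo
  rw [← VectorMeasure.restrict_singleton, ← VectorMeasure.restrict_singleton, add_apply, add_apply,
    VectorMeasure.restrict_apply _ (hs 0) hB, VectorMeasure.restrict_apply _ hI hB,
    VectorMeasure.restrict_apply _ (hs h) hB,
    ← VectorMeasure.of_union (d2.mono inter_subset_right inter_subset_right) (hB.inter (hs 0))
      (hB.inter hI), ← inter_union_distrib_left,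
    ← VectorMeasure.of_union (d1.mono inter_subset_right inter_subset_right)
      (hB.inter ((hs 0).union hI)) (hB.inter (hs h)), ← inter_union_distrib_left, e]
  conv_lhs => rw [← inter_union_sdiff B (Icc 0 h)]
  rw [VectorMeasure.of_union disjoint_sdiff_inter.symm (hB.inter measurableSet_Icc)
    (hB.diff measurableSet_Icc), h0 _ (hB.diff measurableSet_Icc) disjoint_sdiff_left, add_zero]

namespace System

variable {n m N M : ℕ} {D : System n m N M} {E : ExtendedTuple n m} {P : ImpulseTuple n m}

/-! ### The measures `μ_l`, `ν_l` of a canonical extended control -/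

variable (E) in
/-- The image of `dφ_l` under `φ₀`. -/
def layerV (l : ℕ) : VMeas m := pushV (volume.restrict (Icc 0 E.S)) (ph E) (deriv (E.φ l))

variable (E) in
/-- The image of `‖dφ_l‖` under `φ₀`. -/
def layerN (l : ℕ) : Measure ℝ := pushN (volume.restrict (Icc 0 E.S)) (ph E) (deriv (E.φ l))

section
variable (hc : IsClock E.φ₀ 0 E.S 0 D.h) {l : ℕ} (hi : IntegrableOn (deriv (E.φ l)) (Icc 0 E.S))
include hc hi

lemma layerV_apply {B : Set ℝ} (hB : MeasurableSet B) (j : Fin m) :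
    layerV E l j B = ∫ s in Icc 0 E.S ∩ E.φ₀ ⁻¹' B, deriv (E.φ l) s j := by
  rw [layerV, pushV_apply (measurable_ph hc) hi hB, restrict_level hc hB]

lemma layerN_real {B : Set ℝ} (hB : MeasurableSet B) :
    (layerN E l).real B = ∫ s in Icc 0 E.S ∩ E.φ₀ ⁻¹' B, norm1 (deriv (E.φ l) s) := by
  rw [layerN, pushN_real (measurable_ph hc) hi hB, restrict_level hc hB]

lemma layerV_singleton {r : ℝ} (hr : r ∈ Icc 0 D.h) (j : Fin m) :
    layerV E l j {r} = ∫ s in D.lo E r..D.up E r, deriv (E.φ l) s j := by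
  rw [layerV_apply hc hi (measurableSet_singleton r), level_singleton hc hr,
    integral_Icc_eq_integral_Ioc, intervalIntegral.integral_of_le (lo_le_up hc r)]

lemma layerN_singleton {r : ℝ} (hr : r ∈ Icc 0 D.h) :
    (layerN E l).real {r} = ∫ s in D.lo E r..D.up E r, norm1 (deriv (E.φ l) s) := by
  rw [layerN_real hc hi (measurableSet_singleton r), level_singleton hc hr,
    integral_Icc_eq_integral_Ioc, intervalIntegral.integral_of_le (lo_le_up hc r)]

omit hi in
lemma level_disjoint {B : Set ℝ} (hd : Disjoint B (Icc 0 D.h)) :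
    Icc 0 E.S ∩ E.φ₀ ⁻¹' B = ∅ := by
  ext s
  simp only [mem_inter_iff, mem_preimage, mem_empty_iff_false, iff_false, not_and]
  exact fun hs h => disjoint_left.1 hd h (hc.mapsTo hs)

lemma layerV_outside {B : Set ℝ} (hB : MeasurableSet B) (hd : Disjoint B (Icc 0 D.h)) (j : Fin m) :
    layerV E l j B = 0 := by
  rw [layerV_apply hc hi hB, level_disjoint hc hd]; simp

omit hc in
lemma isFiniteMeasure_layerN : IsFiniteMeasure (layerN E l) := isFiniteMeasure_pushN hi

lemma layerN_outside : layerN E l (Icc 0 D.h)ᶜ = 0 := by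
  have := isFiniteMeasure_layerN hi
  rw [← measureReal_eq_zero_iff, layerN_real hc hi measurableSet_Icc.compl,
    level_disjoint hc disjoint_compl_left]
  simp

omit hi in
lemma level_shift (k l : ℕ) (B : Set ℝ) :
    Icc 0 E.S ∩ {s | D.start k + E.φ₀ s ∈ (fun t => t - D.start l) ⁻¹' B ∩
        Ioo (D.start l) (l * D.h)}
      = if k = l then Icc 0 E.S ∩ E.φ₀ ⁻¹' (B ∩ Ioo 0 D.h) else ∅ := by
  ext s
  by_cases hs : s ∈ Icc 0 E.S
  · have hr := hc.mapsTo hs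
    simp only [mem_inter_iff, hs, true_and, mem_ofPred_eq, mem_preimage]
    have key : D.start k + E.φ₀ s ∈ Ioo (D.start l) (l * D.h) ↔ k = l ∧ E.φ₀ s ∈ Ioo 0 D.h := by
      rw [← start_add_h]
      constructor
      · intro h
        have := (start_add_inj (D := D) hc.hS hr (k := k) (l := l)
          (r := D.start k + E.φ₀ s - D.start l) ⟨by linarith [h.1], by linarith [h.2]⟩).1 (by ring)
        obtain ⟨rfl, _⟩ := this
        exact ⟨rfl, by linarith [h.1], by linarith [h.2]⟩
      · rintro ⟨rfl, h⟩
        exact ⟨by linarith [h.1], by linarith [h.2]⟩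
    rw [key]
    split_ifs with h
    · subst h; simp [hs.1, hs.2]
    · simp [h]
  · split_ifs <;> simp [hs]

end

section
variable (hD : D.Standing) (hC : D.IsExtendedControl E) (hL : D.ControlOf E P)
include hD hC hL

/-- Construction A assigns the mass at a grid point to the two adjacent periods by means of ω. The
integrals of ω^0_l and ω^h_l are the contributions of the first and last plateaus of period l, so
the pieces reassemble to the image of dφ_l under φ₀. -/
lemma ControlOf.muL_eq {l : ℕ} (hl : l ∈ Icc 1 N) : D.muL P l = layerV E l := by
  have hc := IsCanonicalControl.clk hC hD
  have hi := IsCanonicalControl.integrableOn_rate hC hl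
  have hm : Measurable fun t : ℝ => t - D.start l := measurable_id.sub_const _
  funext j
  rw [signedMeasure_split (s := layerV E l j) hD.h_pos fun B hB hd => layerV_outside hc hi hB hd j,
    layerV_singleton hc hi (zero_mem hD), layerV_singleton hc hi (h_mem hD),
    ← hL.integral_ω (zero_mem hD) hl, ← hL.integral_ω (h_mem hD) hl, muL]
  congr 2
  ext B hB
  rw [VectorMeasure.map_apply _ hm hB, VectorMeasure.restrict_apply _ measurableSet_Ioo (hm hB),
    VectorMeasure.restrict_apply _ measurableSet_Ioo hB, hL.μ_eq,
    IsCanonicalControl.pushV_apply hC hD ((hm hB).inter measurableSet_Ioo),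
    layerV_apply hc hi (hB.inter measurableSet_Ioo), Finset.sum_eq_single l]
  · rw [level_shift hc, if_pos rfl]
  · intro k _ hk
    rw [level_shift hc, if_neg hk]; simp
  · intro h; exact absurd (Finset.mem_Icc.2 hl) h

lemma ControlOf.nuL_eq {l : ℕ} (hl : l ∈ Icc 1 N) : D.nuL P l = layerN E l := by
  have hc := IsCanonicalControl.clk hC hD
  have hi := IsCanonicalControl.integrableOn_rate hC hl
  have hm : Measurable fun t : ℝ => t - D.start l := measurable_id.sub_const _
  have hf := isFiniteMeasure_layerN hi
  have hfν : IsFiniteMeasure P.ν := by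
    rw [hL.ν_eq]; exact isFiniteMeasure_pushN (IsCanonicalControl.integrable_rate (D := D) hC)
  rw [measure_split (ν := layerN E l) hD.h_pos (layerN_outside hc hi),
    ← ofReal_measureReal (s := {0}), ← ofReal_measureReal (s := {D.h}),
    layerN_singleton hc hi (zero_mem hD), layerN_singleton hc hi (h_mem hD),
    ← hL.integral_norm_ω hD hC (zero_mem hD) hl, ← hL.integral_norm_ω hD hC (h_mem hD) hl, nuL]
  congr 2
  ext B hB
  rw [Measure.map_apply hm hB, Measure.restrict_apply (hm hB), Measure.restrict_apply hB,
    ← ENNReal.toReal_eq_toReal_iff' (measure_ne_top _ _) (measure_ne_top _ _)]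
  change P.ν.real _ = (layerN E l).real _
  rw [hL.ν_eq,
    IsCanonicalControl.pushN_real hC hD ((hm hB).inter measurableSet_Ioo),
    layerN_real hc hi (hB.inter measurableSet_Ioo), Finset.sum_eq_single l]
  · rw [level_shift hc, if_pos rfl]
  · intro k _ hk
    rw [level_shift hc, if_neg hk]; simp
  · intro h; exact absurd (Finset.mem_Icc.2 hl) h

end

section
variable (hD : D.Standing) (hK : D.IsCanonicalControl E) (hL : D.ControlOf E P)
include hD hK hL

omit hD in
lemma ControlOf.isFiniteMeasure_ν : IsFiniteMeasure P.ν := by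
  rw [hL.ν_eq]; exact isFiniteMeasure_pushN (IsCanonicalControl.integrable_rate (D := D) hK.ctl)

/-- Over [0, σ⁺(r)] the derivative φ₀' integrates to r and the norms ‖dφ_l/ds‖ integrate to
ν_l([0,r]); unit speed makes the total equal to the length σ⁺(r) of the interval. -/
lemma ControlOf.dphi_real {r : ℝ} (hr : r ∈ Icc 0 D.h) :
    (D.dphi P).real (Icc 0 r) = D.up E r := by
  have hC := hK.ctl
  have hc := IsCanonicalControl.clk hC hD
  have := hL.isFiniteMeasure_ν hK
  have hsub : Icc 0 (D.up E r) ⊆ Icc 0 E.S := Icc_subset_Icc_right (up_mem hc r).2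
  have e0 : ∫ s in Icc 0 (D.up E r), deriv E.φ₀ s = r := by
    rw [integral_Icc_eq_integral_Ioc, ← intervalIntegral.integral_of_le (up_mem hc r).1,
      ← (IsCanonicalControl.solves_phi0 hC).sub_eq ⟨le_rfl, hc.hT.le⟩ (up_mem hc r),
      phi0_up hc hr, hC.φ₀_zero, sub_zero]
  have e1 : ∀ l ∈ Finset.Icc 1 N, (D.nuL P l).real (Icc 0 r)
      = ∫ s in Icc 0 (D.up E r), norm1 (deriv (E.φ l) s) := by
    intro l hl
    rw [hL.nuL_eq hD hC (Finset.mem_Icc.1 hl), layerN_real hc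
      (IsCanonicalControl.integrableOn_rate hC (Finset.mem_Icc.1 hl)) measurableSet_Icc,
      level_Icc hc hr]
  have hi : ∀ l ∈ Finset.Icc 1 N, IntegrableOn (fun s => norm1 (deriv (E.φ l) s))
      (Icc 0 (D.up E r)) := fun l hl => (integrable_norm1
    (IsCanonicalControl.integrableOn_rate hC (Finset.mem_Icc.1 hl))).mono_measure
      (Measure.restrict_mono hsub le_rfl)
  rw [dphi_real_Icc hr, Finset.sum_congr rfl e1, ← integral_finsetSum _ hi]
  nth_rw 1 [← e0]
  rw [← integral_add ((IsCanonicalControl.integrableOn_deriv_phi0 hC).mono_set hsub)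
    (integrable_finsetSum _ hi)]
  have : ∫ s in Icc 0 (D.up E r), (deriv E.φ₀ s + ∑ l ∈ Finset.Icc 1 N, norm1 (deriv (E.φ l) s))
      = ∫ s in Icc 0 (D.up E r), (1 : ℝ) :=
    integral_congr_ae (ae_mono (Measure.restrict_mono hsub le_rfl) hK.speed)
  rw [this]
  simp [(up_mem hc r).1]

lemma ControlOf.phi_eq : ∀ r ∈ Ioc 0 D.h, D.phi P r = D.up E r := by
  intro r hr
  have := hL.isFiniteMeasure_ν hK
  rw [phi_eq_dphi hr, hL.dphi_real hD hK (Ioc_subset_Icc_self hr)]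

lemma ControlOf.dphi_eq : D.dphi P = (volume.restrict (Icc 0 E.S)).map (ph E) := by
  have hc := IsCanonicalControl.clk hK.ctl hD
  have := hL.isFiniteMeasure_ν hK
  have := isFiniteMeasure_dphi (D := D) (P := P)
  refine measure_ext_Icc hD.h_pos.le (dphi_outside hD) (map_ph_outside hc) fun r hr => ?_
  rw [hL.dphi_real hD hK hr, map_ph_real_Icc hc hr]

end

end System

/-! ### Recovering the control rates from the measures and from ω -/

namespace System

variable {n m N M : ℕ} {D : System n m N M} {E : ExtendedTuple n m} {P : ImpulseTuple n m}

section
variable (hc : IsClock E.φ₀ 0 E.S 0 D.h) {l : ℕ} (hi : IntegrableOn (deriv (E.φ l)) (Icc 0 E.S))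
include hc

lemma volume_level_singleton {r : ℝ} (hr : r ∉ D.plat E) :
    volume (Icc 0 E.S ∩ E.φ₀ ⁻¹' {r}) = 0 := by
  refine Set.Subsingleton.measure_zero ?_ _
  rintro s ⟨hs, e⟩ s' ⟨hs', e'⟩
  have e : E.φ₀ s = r := e
  have e' : E.φ₀ s' = r := e'
  exact eq_of_phi0_eq hc hs hs' (by rwa [e]) (e.trans e'.symm)

lemma injOn_ph : InjOn (ph E) (ph E ⁻¹' (D.plat E)ᶜ ∩ Icc 0 E.S) := by
  rintro s ⟨h, hs⟩ s' ⟨_, hs'⟩ e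
  simp only [mem_preimage, mem_compl_iff, ph_of_mem hs, ph_of_mem hs'] at h e
  exact eq_of_phi0_eq hc hs hs' h e

lemma measurableSet_off : MeasurableSet (ph E ⁻¹' (D.plat E)ᶜ ∩ Icc 0 E.S) :=
  (measurable_ph hc (measurableSet_plat hc).compl).inter measurableSet_Icc

/-- Over `plat`, almost every point lies on a plateau. -/
lemma ae_plat : ∀ᵐ s ∂volume.restrict (Icc 0 E.S),
    E.φ₀ s ∈ D.plat E → D.lo E (E.φ₀ s) < D.up E (E.φ₀ s) := by
  -- The points 0 and h belong to `plat` even when the plateau over them is degenerate; in that case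
  -- only s = 0 or s = S lies over them, a null set.
  have h0 : ∀ᵐ s ∂(volume : Measure ℝ), s ∉ ({0, E.S} : Set ℝ) :=
    (Set.toFinite {0, E.S}).countable.ae_notMem volume
  filter_upwards [ae_restrict_of_ae h0, ae_restrict_mem measurableSet_Icc] with s h1 hs hp
  have h2 := (phi0_eq_iff hc (hc.mapsTo hs) hs).1 rfl
  rcases hp with h | h | h
  · exact h.2
  · rw [h, lo_zero hc] at h2 ⊢
    exact lt_of_le_of_ne (up_mem hc 0).1 fun he => h1 (Or.inl (by
      rw [← he] at h2; exact le_antisymm h2.2 h2.1))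
  · have h : E.φ₀ s = D.h := h
    rw [h, up_end hc] at h2 ⊢
    exact lt_of_le_of_ne (lo_mem hc _).2 fun he => h1 (Or.inr (by
      rw [he] at h2; exact le_antisymm h2.2 h2.1))

include hi

lemma layerV_cont (j : Fin m) :
    (layerV E l).cont j = (layerV E l j).restrict (D.plat E)ᶜ := by
  refine cont_eq_restrict (countable_plat hc) (fun r hr => ?_) j
  by_contra hn
  refine hr (funext fun j => ?_)
  rw [VMeas.val, layerV_apply hc hi (measurableSet_singleton r),
    Measure.restrict_eq_zero.2 (volume_level_singleton hc hn), integral_zero_measure]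
  rfl

/-- Off the plateaus φ₀ is injective, so there dφ_l/ds is a measurable function w of φ₀. The
continuous part of the image measure is then w, cut off to the complement of `plat`, times the image
of Lebesgue measure, and uniqueness of densities gives the claim. -/
lemma rnDeriv_layerV (j : Fin m) : ∀ᵐ s ∂volume.restrict (Icc 0 E.S), E.φ₀ s ∉ D.plat E →
    SignedMeasure.rnDeriv ((layerV E l).cont j) ((volume.restrict (Icc 0 E.S)).map (ph E))
      (E.φ₀ s) = deriv (E.φ l) s j := by
  set lam := volume.restrict (Icc 0 E.S) with hlam
  have hm := measurable_ph (E := E) hc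
  have hpm := (measurableSet_plat hc).compl
  have h0 : (lam.restrict (ph E ⁻¹' (D.plat E)ᶜ)) (ph E ⁻¹' (D.plat E)ᶜ ∩ Icc 0 E.S)ᶜ = 0 := by
    have : ∀ᵐ s ∂lam.restrict (ph E ⁻¹' (D.plat E)ᶜ), s ∈ ph E ⁻¹' (D.plat E)ᶜ ∩ Icc 0 E.S := by
      filter_upwards [ae_restrict_mem (hm hpm), ae_restrict_of_ae (ae_restrict_mem measurableSet_Icc)]
        with s h1 h2 using ⟨h1, h2⟩
    exact this
  obtain ⟨w, hw, e⟩ := exists_factor hm (measurable_deriv (E.φ l)) (measurableSet_off hc)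
    (injOn_ph hc) h0
  obtain ⟨hiw, h1⟩ := pushV_eq_withDensity hm (Integrable.mono_measure hi Measure.restrict_le_self) hw e
  have hfin : IsFiniteMeasure (lam.map (ph E)) := inferInstance
  have e2 : (layerV E l).cont j
      = (lam.map (ph E)).withDensityᵥ ((D.plat E)ᶜ.indicator fun r => w r j) := by
    rw [layerV_cont hc hi, layerV, pushV_restrict hm hi hpm, h1, ← Measure.restrict_map hm hpm]
    have hiw' : IntegrableOn (fun r => w r j) (D.plat E)ᶜ (lam.map (ph E)) := by
      rw [IntegrableOn, Measure.restrict_map hm hpm]; exact hiw.eval j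
    ext B hB
    rw [withDensityᵥ_apply hiw' hB, withDensityᵥ_apply (hiw'.integrable_indicator hpm) hB,
      Measure.restrict_restrict hB, setIntegral_indicator hpm]
  have h2 : SignedMeasure.rnDeriv ((layerV E l).cont j) (lam.map (ph E)) =ᵐ[lam.map (ph E)]
      (D.plat E)ᶜ.indicator fun r => w r j := by
    rw [e2]
    refine rnDeriv_withDensityV (IntegrableOn.integrable_indicator ?_ hpm)
    rw [IntegrableOn, Measure.restrict_map hm hpm]; exact hiw.eval j
  have h3 := ae_of_ae_map hm.aemeasurable h2
  have h4 := (ae_restrict_iff' (hm hpm)).1 e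
  filter_upwards [h3, h4, ae_restrict_mem measurableSet_Icc] with s hs hs' hmem hn
  rw [ph_of_mem hmem] at hs
  rw [hs, indicator_of_mem hn]
  have := hs' (by rw [mem_preimage, ph_of_mem hmem]; exact hn)
  rw [ph_of_mem hmem] at this
  rw [this]

end

/-- A property holds almost everywhere as soon as it does on every plateau and off `plat`. -/
lemma ae_of_plateaus (hc : IsClock E.φ₀ 0 E.S 0 D.h) {p : ℝ → Prop}
    (h1 : ∀ r ∈ Icc 0 D.h, D.lo E r < D.up E r →
      ∀ᵐ s ∂volume.restrict (Icc (D.lo E r) (D.up E r)), p s)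
    (h2 : ∀ᵐ s ∂volume.restrict (Icc 0 E.S), E.φ₀ s ∉ D.plat E → p s) :
    ∀ᵐ s ∂volume.restrict (Icc 0 E.S), p s := by
  have h3 : ∀ᵐ s ∂(volume : Measure ℝ), ∀ r ∈ D.plat E, D.lo E r < D.up E r →
      s ∈ Icc (D.lo E r) (D.up E r) → p s := by
    refine (ae_ball_iff (countable_plat hc)).2 fun r hr => ?_
    by_cases h : D.lo E r < D.up E r
    · filter_upwards [(ae_restrict_iff' measurableSet_Icc).1 (h1 r (plat_subset hc hr) h)]
        with s hs _ using hs
    · exact Eventually.of_forall fun s h' => absurd h' h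
  filter_upwards [ae_restrict_of_ae h3, h2, ae_plat hc, ae_restrict_mem measurableSet_Icc]
    with s hs hs2 hs3 hmem
  by_cases h : E.φ₀ s ∈ D.plat E
  · exact hs _ h (hs3 h) ((phi0_eq_iff hc (hc.mapsTo hmem) hmem).1 rfl)
  · exact hs2 h

section
variable (hD : D.Standing) (hc : IsClock E.φ₀ 0 E.S 0 D.h)
  (hphi : ∀ r ∈ Ioc 0 D.h, D.phi P r = D.up E r)
include hD hc hphi

lemma phiRate_of_mem (l : ℕ) {r : ℝ} (hr : r ∈ Icc 0 D.h) (hlt : D.lo E r < D.up E r) {s : ℝ}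
    (hs : s ∈ Icc (D.lo E r) (D.up E r)) :
    D.phiRate P E.φ₀ l s = (D.up E r - D.lo E r)⁻¹ •
      P.ω r l ((s - D.lo E r) / (D.up E r - D.lo E r)) := by
  have hs' : s ∈ Icc 0 E.S := ⟨(lo_mem hc r).1.trans hs.1, hs.2.trans (up_mem hc r).2⟩
  have e := phi0_of_mem hc hr hs
  rw [phiRate, if_pos ((mem_plateaus hD hc hphi hs').2 (by rwa [e])), e, gam, phiL_eq hc hphi hr,
    phiR_eq hD hc hphi hr]

lemma phiRate_of_notMem (l : ℕ) {s : ℝ} (hs : s ∈ Icc 0 E.S) (h : E.φ₀ s ∉ D.plat E) :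
    D.phiRate P E.φ₀ l s = D.density P l (E.φ₀ s) := by
  rw [phiRate, if_neg]
  rw [mem_plateaus hD hc hphi hs]
  exact fun h' => h (Or.inl ⟨hc.mapsTo hs, h'⟩)

end

/-- On a plateau, the rescalings in the two constructions are inverse to each other. Elsewhere dφ is
the image of Lebesgue measure under φ₀, so the Radon–Nikodym derivative along φ₀ gives back the
rate. -/
theorem ControlOf.phiRate_ae (hD : D.Standing) (hK : D.IsCanonicalControl E)
    (hL : D.ControlOf E P) {l : ℕ} (hl : l ∈ Icc 1 N) :
    ∀ᵐ s ∂volume.restrict (Icc 0 E.S), deriv (E.φ l) s = D.phiRate P E.φ₀ l s := by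
  have hC := hK.ctl
  have hc := IsCanonicalControl.clk hC hD
  have hi := IsCanonicalControl.integrableOn_rate hC hl
  have hphi := hL.phi_eq hD hK
  refine ae_of_plateaus hc (fun r hr hlt => ?_) ?_
  · filter_upwards [ae_Icc_of_ae_unit hlt (hL.ω_eq r hr l hl), ae_restrict_mem measurableSet_Icc]
      with s h1 hs
    have hne : D.up E r - D.lo E r ≠ 0 := (sub_pos.2 hlt).ne'
    rw [phiRate_of_mem hD hc hphi l hr hlt hs, h1, smul_smul, inv_mul_cancel₀ hne, one_smul,
      mul_div_cancel₀ _ hne, sub_add_cancel]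
  · filter_upwards [ae_all_iff.2 fun j => rnDeriv_layerV hc hi j, ae_restrict_mem measurableSet_Icc]
      with s h1 hs hn
    rw [phiRate_of_notMem hD hc hphi l hs hn]
    ext j
    rw [density, hL.dphi_eq hD hK, hL.muL_eq hD hC hl, h1 j hn]

variable (D) in
/-- The equations of Construction A for the clock `φ₀`. -/
structure ClockExtends (P : ImpulseTuple n m) (E : ExtendedTuple n m) : Prop where
  S_eq : E.S = D.phi P D.h
  φ₀_eq : ∀ s ∈ Icc 0 E.S, E.φ₀ s = rightInv (D.phi P) 0 D.h 0 E.S s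

variable (D) in
/-- The equations of Construction A for the extended control. -/
structure ControlExtends (P : ImpulseTuple n m) (E : ExtendedTuple n m) : Prop
    extends D.ClockExtends P E where
  φ_eq : ∀ l ∈ Icc 1 N, SolvesOn (D.phiRate P E.φ₀ l) (E.φ l) 0 E.S
  φ_zero : E.φ 1 0 = 0
  φ_chain : ∀ l ∈ Icc 2 N, E.φ l 0 = E.φ (l - 1) E.S

theorem ControlOf.controlExtends (hD : D.Standing) (hK : D.IsCanonicalControl E)
    (hL : D.ControlOf E P) : D.ControlExtends P E := by
  have hc := IsCanonicalControl.clk hK.ctl hD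
  have hphi := hL.phi_eq hD hK
  refine ⟨⟨?_, fun s hs => phi0_eq_rightInv hc hphi hs⟩, fun l hl => ?_, hK.ctl.φ_zero, hK.ctl.φ_chain⟩
  · rw [hphi _ ⟨hD.h_pos, le_rfl⟩, up_end hc]
  · exact (IsCanonicalControl.solves_phi hK.ctl hl).congr_ae hc.hT.le (hL.phiRate_ae hD hK hl)

end System

namespace System

variable {n m N M : ℕ} {D : System n m N M} {E : ExtendedTuple n m} {P : ImpulseTuple n m}

/-! ### The clock of Construction A -/

/-- The Lebesgue part of dφ forces its distribution function to grow at least with slope one; from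
this follow both the positivity of S and the Lipschitz constant 1 of φ₀. -/
lemma dphi_real_add_le [IsFiniteMeasure P.ν] {r r' : ℝ} (hr : 0 ≤ r) (hrr : r ≤ r')
    (hr' : r' ≤ D.h) :
    (D.dphi P).real (Icc 0 r) + (r' - r) ≤ (D.dphi P).real (Icc 0 r') := by
  have := fun l => isFiniteMeasure_nuL (D := D) (P := P) l
  rw [dphi_real_Icc ⟨hr, hrr.trans hr'⟩, dphi_real_Icc ⟨hr.trans hrr, hr'⟩]
  have : ∑ l ∈ Finset.Icc 1 N, (D.nuL P l).real (Icc 0 r)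
      ≤ ∑ l ∈ Finset.Icc 1 N, (D.nuL P l).real (Icc 0 r') :=
    Finset.sum_le_sum fun l _ => measureReal_mono (Icc_subset_Icc_right hrr)
  linarith

lemma tendsto_dphi_real [IsFiniteMeasure P.ν] (r : ℝ) :
    Tendsto (fun t => (D.dphi P).real (Icc 0 t)) (𝓝[>] r) (𝓝 ((D.dphi P).real (Icc 0 r))) := by
  have := isFiniteMeasure_dphi (D := D) (P := P)
  have h := tendsto_measure_biInter_gt (μ := D.dphi P) (s := fun t => Icc 0 t) (a := r)
    (fun t _ => measurableSet_Icc.nullMeasurableSet) (fun i j _ hij => Icc_subset_Icc_right hij)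
    ⟨r + 1, by simp, measure_ne_top _ _⟩
  have e : ⋂ t, ⋂ (_ : t > r), Icc 0 t = Icc 0 r := by
    ext x
    simp only [mem_iInter, mem_Icc]
    constructor
    · intro hx
      exact ⟨(hx (r + 1) (by simp)).1, le_of_forall_gt_imp_ge_of_dense fun t ht => (hx t ht).2⟩
    · intro hx t ht
      exact ⟨hx.1, hx.2.trans (le_of_lt ht)⟩
  rw [e] at h
  exact (ENNReal.tendsto_toReal (measure_ne_top _ _)).comp h

section
variable (hD : D.Standing) [IsFiniteMeasure P.ν] (hE : D.ClockExtends P E)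
include hD hE

lemma ClockExtends.S_eq_dphi : E.S = (D.dphi P).real (Icc 0 D.h) := by
  rw [hE.S_eq, phi_eq_dphi ⟨hD.h_pos, le_rfl⟩]

lemma ClockExtends.S_pos : 0 < E.S := by
  rw [hE.S_eq_dphi hD]
  have := dphi_real_add_le (D := D) (P := P) le_rfl hD.h_pos.le le_rfl
  have := measureReal_nonneg (μ := D.dphi P) (s := Icc 0 0)
  linarith [hD.h_pos]

lemma ClockExtends.φ₀_zero : E.φ₀ 0 = 0 := by
  rw [hE.φ₀_eq 0 ⟨le_rfl, (hE.S_pos hD).le⟩, rightInv_of_le le_rfl]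

lemma ClockExtends.φ₀_end : E.φ₀ E.S = D.h := by
  rw [hE.φ₀_eq _ ⟨(hE.S_pos hD).le, le_rfl⟩, rightInv_of_ge (hE.S_pos hD) le_rfl]

/-- The adjunction between φ₀ and the distribution function of dφ. Right continuity of the latter
gives one direction, its strict growth the other. The ends need separate care because φ(0) = 0
disregards a possible atom of dφ at 0. -/
lemma ClockExtends.phi0_le_iff {s r : ℝ} (hs : s ∈ Icc 0 E.S) (hr : r ∈ Icc 0 D.h) :
    E.φ₀ s ≤ r ↔ s ≤ (D.dphi P).real (Icc 0 r) := by
  have hS := hE.S_eq_dphi hD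
  have hSp := hE.S_pos hD
  rcases hs.1.eq_or_lt with h | h
  · rw [← h, hE.φ₀_zero hD]
    exact ⟨fun _ => measureReal_nonneg, fun _ => hr.1⟩
  rcases hr.2.eq_or_lt with hrh | hrh
  · rw [hrh, ← hS]
    refine ⟨fun _ => hs.2, fun _ => ?_⟩
    rw [hE.φ₀_eq s hs, rightInv]
    split_ifs with h1 h2
    · exact hD.h_pos.le
    · exact le_rfl
    · refine csInf_le ⟨0, fun t ht => ht.1.1⟩ ⟨h_mem hD, ?_⟩
      rw [← hE.S_eq]; exact not_le.1 h2
  rcases hs.2.eq_or_lt with h' | h'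
  · rw [h', hE.φ₀_end hD]
    refine ⟨fun h => absurd h hrh.not_ge, fun h => ?_⟩
    have := dphi_real_add_le (D := D) (P := P) hr.1 hrh.le le_rfl
    linarith
  rw [hE.φ₀_eq s hs, rightInv, if_neg h.not_ge, if_neg h'.not_ge]
  have hmem : ∀ t, t ∈ Icc 0 D.h ∧ s < D.phi P t ↔
      t ∈ Ioc 0 D.h ∧ s < (D.dphi P).real (Icc 0 t) := by
    intro t
    rcases le_or_gt t 0 with h0 | h0
    · refine ⟨fun ht => ?_, fun ht => absurd ht.1.1 h0.not_gt⟩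
      rw [phi, if_pos h0] at ht
      exact absurd ht.2 h.not_gt
    · constructor
      · rintro ⟨h1, h2⟩
        exact ⟨⟨h0, h1.2⟩, by rwa [← phi_eq_dphi ⟨h0, h1.2⟩]⟩
      · rintro ⟨h1, h2⟩
        exact ⟨Ioc_subset_Icc_self h1, by rwa [phi_eq_dphi h1]⟩
  simp_rw [hmem]
  have hbdd : BddBelow {t | t ∈ Ioc 0 D.h ∧ s < (D.dphi P).real (Icc 0 t)} :=
    ⟨0, fun t ht => ht.1.1.le⟩
  have hne : {t | t ∈ Ioc 0 D.h ∧ s < (D.dphi P).real (Icc 0 t)}.Nonempty :=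
    ⟨D.h, ⟨hD.h_pos, le_rfl⟩, by rwa [← hS]⟩
  constructor
  · intro hle
    refine ge_of_tendsto (tendsto_dphi_real r) ?_
    filter_upwards [Ioo_mem_nhdsGT hrh] with t ht
    obtain ⟨t', ht', hlt⟩ := exists_lt_of_csInf_lt hne (hle.trans_lt ht.1)
    have := dphi_real_add_le (D := D) (P := P) ht'.1.1.le hlt.le ht.2.le
    have := ht'.2
    linarith
  · intro hle
    refine le_of_forall_gt_imp_ge_of_dense fun t ht => ?_
    have h0 := hr.1.trans_lt ht
    rcases le_or_gt t D.h with h1 | h1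
    · refine csInf_le hbdd ⟨⟨h0, h1⟩, ?_⟩
      have := dphi_real_add_le (D := D) (P := P) hr.1 ht.le h1
      linarith
    · exact (csInf_le hbdd ⟨⟨hD.h_pos, le_rfl⟩, by rwa [← hS]⟩).trans h1.le

lemma ClockExtends.phi0_mem {s : ℝ} (hs : s ∈ Icc 0 E.S) : E.φ₀ s ∈ Icc 0 D.h := by
  refine ⟨?_, (hE.phi0_le_iff hD hs (h_mem hD)).2 (by rw [← hE.S_eq_dphi hD]; exact hs.2)⟩
  rw [hE.φ₀_eq s hs, rightInv]
  split_ifs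
  · exact le_rfl
  · exact hD.h_pos.le
  · exact Real.sInf_nonneg fun t ht => ht.1.1

lemma ClockExtends.monotoneOn : MonotoneOn E.φ₀ (Icc 0 E.S) := by
  intro s hs s' hs' h
  have hm := hE.phi0_mem hD hs'
  exact (hE.phi0_le_iff hD hs hm).2 (h.trans ((hE.phi0_le_iff hD hs' hm).1 le_rfl))

/-- If φ₀(s) ≤ r < φ₀(s'), then s ≤ dφ([0,φ₀(s)]) and dφ([0,r]) < s'. Since dφ dominates Lebesgue
measure, r - φ₀(s) < s' - s. -/
lemma ClockExtends.lipschitzOnWith_phi0 : LipschitzOnWith 1 E.φ₀ (Icc 0 E.S) := by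
  have key : ∀ s ∈ Icc 0 E.S, ∀ s' ∈ Icc 0 E.S, E.φ₀ s' ≤ E.φ₀ s + |s' - s| := by
    intro s hs s' hs'
    rcases le_total s' s with h | h
    · linarith [hE.monotoneOn hD hs' hs h, abs_nonneg (s' - s)]
    rw [abs_of_nonneg (sub_nonneg.2 h)]
    have hm := hE.phi0_mem hD hs
    have hm' := hE.phi0_mem hD hs'
    refine le_of_forall_lt fun r hr => ?_
    rcases lt_or_ge r (E.φ₀ s) with h1 | h1
    · linarith
    have hr' : r ∈ Icc 0 D.h := ⟨hm.1.trans h1, hr.le.trans hm'.2⟩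
    have h2 := (hE.phi0_le_iff hD hs hm).1 le_rfl
    have h3 := dphi_real_add_le (D := D) (P := P) hm.1 h1 hr'.2
    have h4 : (D.dphi P).real (Icc 0 r) < s' := by
      by_contra hle
      exact absurd ((hE.phi0_le_iff hD hs' hr').2 (not_lt.1 hle)) hr.not_ge
    linarith
  refine LipschitzOnWith.of_dist_le_mul fun s hs s' hs' => ?_
  rw [NNReal.coe_one, one_mul, Real.dist_eq, Real.dist_eq, abs_le]
  have h1 := key s hs s' hs'
  have h2 := key s' hs' s hs
  rw [abs_sub_comm] at h1
  constructor <;> linarith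

lemma ClockExtends.isClock : IsClock E.φ₀ 0 E.S 0 D.h where
  hT := hE.S_pos hD
  hS := hD.h_pos
  cont := (hE.lipschitzOnWith_phi0 hD).continuousOn
  mono := hE.monotoneOn hD
  left := hE.φ₀_zero hD
  right := hE.φ₀_end hD

lemma ClockExtends.up_eq {r : ℝ} (hr : r ∈ Icc 0 D.h) :
    D.up E r = (D.dphi P).real (Icc 0 r) := by
  have := isFiniteMeasure_dphi (D := D) (P := P)
  have hmem : (D.dphi P).real (Icc 0 r) ∈ Icc 0 E.S := by
    refine ⟨measureReal_nonneg, ?_⟩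
    rw [hE.S_eq_dphi hD]
    exact measureReal_mono (Icc_subset_Icc_right hr.2)
  refine (hE.isClock hD).rightLim_eq_of hr hmem ((hE.phi0_le_iff hD hmem hr).2 le_rfl) ?_
  intro s hs hlt
  by_contra hle
  exact absurd ((hE.phi0_le_iff hD hs hr).1 (not_lt.1 hle)) hlt.not_ge

lemma ClockExtends.phi_eq : ∀ r ∈ Ioc 0 D.h, D.phi P r = D.up E r := by
  intro r hr
  rw [phi_eq_dphi hr, hE.up_eq hD (Ioc_subset_Icc_self hr)]

/-- Both measures give [0,r] the mass σ⁺(r). This transfers statements that hold dφ-almost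
everywhere to Lebesgue-almost every s. -/
lemma ClockExtends.dphi_eq : D.dphi P = (volume.restrict (Icc 0 E.S)).map (ph E) := by
  have hc := hE.isClock hD
  have := isFiniteMeasure_dphi (D := D) (P := P)
  refine measure_ext_Icc hD.h_pos.le (dphi_outside hD) (map_ph_outside hc) fun r hr => ?_
  rw [map_ph_real_Icc hc hr, hE.up_eq hD hr]

lemma ClockExtends.dphi_singleton {r : ℝ} (hr : r ∈ Icc 0 D.h) :
    (D.dphi P).real {r} = D.up E r - D.lo E r := by
  have hc := hE.isClock hD
  rw [hE.dphi_eq hD, Measure.real, map_ph_apply hc (measurableSet_singleton r),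
    level_singleton hc hr, Real.volume_Icc, ENNReal.toReal_ofReal (sub_nonneg.2 (lo_le_up hc r))]

end

end System

/-- The density of a vector measure `w ν` with respect to a dominating measure, if `‖w‖ = 1`. -/
lemma rnDeriv_of_factor {m : ℕ} {K : Set (Ctrl m)} (hK : ∀ c : ℝ, 0 ≤ c → ∀ w ∈ K, c • w ∈ K)
    {ρ ν : Measure ℝ} [IsFiniteMeasure ρ] [IsFiniteMeasure ν] (hac : ν ≪ ρ) {w : ℝ → Ctrl m}
    (hwK : ∀ t, w t ∈ K) (hi : Integrable w ν) (hn : ∀ᵐ t ∂ν, norm1 (w t) = 1)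
    {s : VMeas m} (hs : ∀ j, s j = ν.withDensityᵥ fun t => w t j) :
    (∀ j, ρ.withDensityᵥ (SignedMeasure.rnDeriv (s j) ρ) = s j) ∧
    ∀ᵐ t ∂ρ, (fun j => SignedMeasure.rnDeriv (s j) ρ t) ∈ K ∧
      norm1 (fun j => SignedMeasure.rnDeriv (s j) ρ t) = (ν.rnDeriv ρ t).toReal := by
  have hν : ρ.withDensity (ν.rnDeriv ρ) = ν := Measure.withDensity_rnDeriv_eq ν ρ hac
  have hm : Measurable (ν.rnDeriv ρ) := Measure.measurable_rnDeriv ν ρ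
  have hlt := Measure.rnDeriv_lt_top ν ρ
  have hij : ∀ j, Integrable (fun t => (ν.rnDeriv ρ t).toReal * w t j) ρ := fun j => by
    have h1 := hi.eval j
    rw [← hν, integrable_withDensity_iff_integrable_smul' hm hlt] at h1
    exact h1
  have e : ∀ j, s j = ρ.withDensityᵥ fun t => (ν.rnDeriv ρ t).toReal * w t j := by
    intro j
    rw [hs j]
    ext B hB
    rw [withDensityᵥ_apply (hi.eval j) hB, withDensityᵥ_apply (hij j) hB]
    conv_lhs => rw [← hν]
    exact setIntegral_withDensity_eq_setIntegral_toReal_smul hm (ae_restrict_of_ae hlt) _ hB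
  have hae : ∀ᵐ t ∂ρ, ∀ j, SignedMeasure.rnDeriv (s j) ρ t = (ν.rnDeriv ρ t).toReal * w t j := by
    refine ae_all_iff.2 fun j => ?_
    have := rnDeriv_withDensityV (hij j)
    rw [← e j] at this
    exact this
  refine ⟨fun j => ?_, ?_⟩
  · refine SignedMeasure.withDensityᵥ_rnDeriv_eq _ _ ?_
    rw [e j]
    exact Measure.withDensityᵥ_absolutelyContinuous ρ _
  -- The norm of w is known only ν-almost everywhere; where the density of ν vanishes, both sides of
  -- the norm identity are 0.
  · have hn' : ∀ᵐ t ∂ρ, ν.rnDeriv ρ t ≠ 0 → norm1 (w t) = 1 := by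
      rw [← ae_withDensity_iff hm, hν]; exact hn
    filter_upwards [hae, hn'] with t h1 h2
    have e1 : (fun j => SignedMeasure.rnDeriv (s j) ρ t) = (ν.rnDeriv ρ t).toReal • w t :=
      funext h1
    rw [e1]
    refine ⟨hK _ ENNReal.toReal_nonneg _ (hwK t), ?_⟩
    rw [norm1_smul, abs_of_nonneg ENNReal.toReal_nonneg]
    by_cases h : ν.rnDeriv ρ t = 0
    · simp [h]
    · rw [h2 h, mul_one]

lemma norm1_integral_le {m : ℕ} {w : ℝ → Ctrl m} (h : IntervalIntegrable w volume 0 1) (j : Fin m) :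
    |∫ s in (0 : ℝ)..1, w s j| ≤ ∫ s in (0 : ℝ)..1, norm1 (w s) :=
  (intervalIntegral.abs_integral_le_integral_abs zero_le_one).trans
    (intervalIntegral.integral_mono_on zero_le_one
      (System.IntervalIntegrable.apply zero_le_one h j).abs
      (System.IntervalIntegrable.norm1 zero_le_one h) fun _ _ => abs_le_norm1 _ j)

namespace System

variable {n m N M : ℕ} {D : System n m N M} {E : ExtendedTuple n m} {P : ImpulseTuple n m}

/-! ### The measures `μ_l`, `ν_l` of an impulse control -/

lemma preimage_sub_subset {l : ℕ} {B : Set ℝ} (hB : B ⊆ Ioo 0 D.h) :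
    (fun t => t - D.start l) ⁻¹' B ⊆ Ioo (D.start l) (l * D.h) := by
  intro t ht
  have := hB ht
  rw [← start_add_h]
  exact ⟨by linarith [this.1], by linarith [this.2]⟩

lemma nuL_apply (l : ℕ) {B : Set ℝ} (hB : MeasurableSet B) (h : B ⊆ Ioo 0 D.h) :
    D.nuL P l B = P.ν ((fun t => t - D.start l) ⁻¹' B) := by
  have hm : Measurable fun t : ℝ => t - D.start l := measurable_id.sub_const _
  have h0 : (0 : ℝ) ∉ B := fun h' => (h h').1.false
  have h1 : D.h ∉ B := fun h' => (h h').2.false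
  rw [nuL, Measure.add_apply, Measure.add_apply, Measure.smul_apply, Measure.smul_apply,
    Measure.map_apply hm hB, Measure.restrict_apply (hm hB), inter_eq_left.2 (preimage_sub_subset h),
    Measure.dirac_apply' _ hB, Measure.dirac_apply' _ hB]
  simp [h0, h1]

lemma muL_apply (l : ℕ) {B : Set ℝ} (hB : MeasurableSet B) (h : B ⊆ Ioo 0 D.h) (j : Fin m) :
    D.muL P l j B = P.μ j ((fun t => t - D.start l) ⁻¹' B) := by
  have hm : Measurable fun t : ℝ => t - D.start l := measurable_id.sub_const _
  have h0 : (0 : ℝ) ∉ B := fun h' => (h h').1.false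
  have h1 : D.h ∉ B := fun h' => (h h').2.false
  rw [muL, add_apply, add_apply, VectorMeasure.dirac_apply_of_notMem h0,
    VectorMeasure.dirac_apply_of_notMem h1, VectorMeasure.map_apply _ hm hB,
    VectorMeasure.restrict_apply _ measurableSet_Ioo (hm hB),
    inter_eq_left.2 (preimage_sub_subset h), zero_add, add_zero]

lemma muL_outside (hD : D.Standing) (l : ℕ) {B : Set ℝ} (hB : MeasurableSet B)
    (hd : Disjoint B (Icc 0 D.h)) (j : Fin m) : D.muL P l j B = 0 := by
  have hm : Measurable fun t : ℝ => t - D.start l := measurable_id.sub_const _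
  have h0 : (0 : ℝ) ∉ B := fun h => disjoint_left.1 hd h (zero_mem hD)
  have h1 : D.h ∉ B := fun h => disjoint_left.1 hd h (h_mem hD)
  have h2 : (fun t => t - D.start l) ⁻¹' B ∩ Ioo (D.start l) (l * D.h) = ∅ := by
    ext t
    simp only [mem_inter_iff, mem_preimage, mem_Ioo, mem_empty_iff_false, iff_false, not_and]
    intro ht h3 h4
    exact disjoint_left.1 hd ht ⟨by linarith, by rw [← start_add_h] at h4; linarith⟩
  rw [muL, add_apply, add_apply, VectorMeasure.dirac_apply_of_notMem h0,
    VectorMeasure.dirac_apply_of_notMem h1, VectorMeasure.map_apply _ hm hB,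
    VectorMeasure.restrict_apply _ measurableSet_Ioo (hm hB), h2, VectorMeasure.empty, zero_add,
    add_zero]

lemma preimage_sub_singleton (l : ℕ) (r : ℝ) :
    (fun t => t - D.start l) ⁻¹' {r} = {r + D.start l} := by
  ext t; simp [sub_eq_iff_eq_add]

lemma grid_preimage_empty (l : ℕ) {r : ℝ} (hr : r ∈ ({0, D.h} : Set ℝ)) :
    (fun t => t - D.start l) ⁻¹' {r} ∩ Ioo (D.start l) (l * D.h) = ∅ := by
  ext t
  simp only [mem_inter_iff, mem_preimage, mem_singleton_iff, mem_Ioo, mem_empty_iff_false,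
    iff_false, not_and]
  rw [← start_add_h]
  rcases hr with h | h
  · intro h1 h2; rw [h] at h1; linarith
  · have h : r = D.h := h
    intro h1 h2; rw [h] at h1; linarith

section
variable (hD : D.Standing) (hP : D.IsImpulseControl P.μ P.ν P.ω)
include hD hP

omit hD in
lemma IsImpulseControl.intervalIntegrable {r : ℝ} (hr : r ∈ Icc 0 D.h) {l : ℕ} (hl : l ∈ Icc 1 N) :
    IntervalIntegrable (P.ω r l) volume 0 1 :=
  intervalIntegrable_of_memLp (hP.bounded r hr l hl)

lemma IsImpulseControl.nuL_singleton {r : ℝ} (hr : r ∈ Icc 0 D.h) {l : ℕ} (hl : l ∈ Icc 1 N) :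
    (D.nuL P l).real {r} = ∫ s in (0 : ℝ)..1, norm1 (P.ω r l s) := by
  have hm : Measurable fun t : ℝ => t - D.start l := measurable_id.sub_const _
  have hs : MeasurableSet ({r} : Set ℝ) := measurableSet_singleton r
  have hnn : 0 ≤ ∫ s in (0 : ℝ)..1, norm1 (P.ω r l s) :=
    intervalIntegral.integral_nonneg zero_le_one fun _ _ => norm1_nonneg _
  by_cases hg : r ∈ ({0, D.h} : Set ℝ)
  · rw [Measure.real, nuL, Measure.add_apply, Measure.add_apply, Measure.smul_apply,
      Measure.smul_apply, Measure.map_apply hm hs, Measure.restrict_apply (hm hs),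
      grid_preimage_empty l hg, Measure.dirac_apply' _ hs, Measure.dirac_apply' _ hs]
    rcases hg with h | h
    · subst h
      simp [hD.h_pos.ne', ENNReal.toReal_ofReal hnn]
    · have h : r = D.h := h
      subst h
      simp [hD.h_pos.ne, ENNReal.toReal_ofReal hnn]
  · have hr' : r ∈ Ioo 0 D.h :=
      ⟨lt_of_le_of_ne hr.1 fun h => hg (Or.inl h.symm), lt_of_le_of_ne hr.2 fun h => hg (Or.inr h)⟩
    rw [Measure.real, nuL_apply l hs (singleton_subset_iff.2 hr'), preimage_sub_singleton,
      hP.ν_inner r hr' l hl]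
    rfl

/-- The clauses `μ_inner` and `ν_inner` express both masses through the same ω. In particular μ has
no atom where ν_l has none. -/
lemma IsImpulseControl.abs_muL_singleton_le {r : ℝ} (hr : r ∈ Ioo 0 D.h) {l : ℕ} (hl : l ∈ Icc 1 N)
    (j : Fin m) : |D.muL P l j {r}| ≤ (D.nuL P l).real {r} := by
  have hr' := Ioo_subset_Icc_self hr
  rw [hP.nuL_singleton hD hr' hl,
    muL_apply l (measurableSet_singleton r) (singleton_subset_iff.2 hr), preimage_sub_singleton,
    ← hP.μ_inner r hr l hl j]
  exact norm1_integral_le (hP.intervalIntegrable hr' hl) j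

section
variable (hE : D.ClockExtends P E)
include hE

omit hD hP hE in
lemma nuL_real_le [IsFiniteMeasure P.ν] {l : ℕ} (hl : l ∈ Icc 1 N) (B : Set ℝ) :
    (D.nuL P l).real B ≤ (D.dphi P).real B := by
  have := isFiniteMeasure_dphi (D := D) (P := P)
  refine ENNReal.toReal_mono (measure_ne_top _ _) ?_
  rw [dphi, Measure.add_apply, Measure.finsetSum_apply]
  exact le_trans (Finset.single_le_sum (f := fun l => D.nuL P l B) (fun _ _ => zero_le)
    (Finset.mem_Icc.2 hl)) le_add_self

lemma ClockExtends.nuL_singleton_zero {l : ℕ} (hl : l ∈ Icc 1 N) {r : ℝ} (hr : r ∈ Icc 0 D.h)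
    (hn : r ∉ D.plat E) : (D.nuL P l).real {r} = 0 := by
  have := hP.mem_Vc.1
  have hc := hE.isClock hD
  have h1 := hE.dphi_singleton hD hr
  rw [lo_eq_up_of_notMem hc hr hn, sub_self] at h1
  exact le_antisymm (h1 ▸ nuL_real_le hl {r}) measureReal_nonneg

omit hP hE in
-- Grid points are always knots, so only offsets inside a period have to be examined.
lemma mem_knots_of_mem (hc : IsClock E.φ₀ 0 E.S 0 D.h) {t : ℝ} (ht : t ∈ Icc 0 D.T)
    (h : ∀ l ∈ Icc 1 N, ∀ r ∈ Ioo 0 D.h, t = D.start l + r → r ∈ D.plat E) : t ∈ D.knots E := by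
  rcases ht.2.eq_or_lt with he | hlt
  · rw [he, T, ← start_add_h]
    exact (mem_knots_iff hc ⟨hD.one_le_N, le_rfl⟩ (h_mem hD)).2 h_mem_plat
  · obtain ⟨l, hl, r, hr, e⟩ := exists_start hD.h_pos ⟨ht.1, hlt⟩
    rw [e, mem_knots_iff hc hl (Ico_subset_Icc_self hr)]
    rcases hr.1.eq_or_lt with h0 | h0
    · rw [← h0]; exact zero_mem_plat
    · exact h l hl r ⟨h0, hr.2⟩ e

lemma ClockExtends.ν_atoms {t : ℝ} (ht : P.ν {t} ≠ 0) : t ∈ D.knots E := by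
  have := hP.mem_Vc.1
  have htT : t ∈ Icc 0 D.T := by
    by_contra hn
    exact ht (measure_mono_null (singleton_subset_iff.2 hn) hP.mem_Vc.2.1)
  refine mem_knots_of_mem hD (hE.isClock hD) htT fun l hl r hr e => ?_
  by_contra hn
  have h0 := hE.nuL_singleton_zero hD hP hl (Ioo_subset_Icc_self hr) hn
  rw [measureReal_eq_zero_iff (by
      have := isFiniteMeasure_nuL (D := D) (P := P) l; exact measure_ne_top _ _),
    nuL_apply l (measurableSet_singleton r) (singleton_subset_iff.2 hr), preimage_sub_singleton,
    add_comm, ← e] at h0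
  exact ht h0

lemma ClockExtends.μ_atoms : P.μ.atoms ⊆ D.knots E := by
  intro t ht
  have := hP.mem_Vc.1
  have htT : t ∈ Icc 0 D.T := by
    by_contra hn
    exact ht (hP.mem_cone.1 _ (measurableSet_singleton t) (disjoint_singleton_left.2 hn))
  refine mem_knots_of_mem hD (hE.isClock hD) htT fun l hl r hr e => ?_
  by_contra hn
  refine ht (funext fun j => ?_)
  have h0 := hE.nuL_singleton_zero hD hP hl (Ioo_subset_Icc_self hr) hn
  have h1 := hP.abs_muL_singleton_le hD hr hl j
  rw [h0, muL_apply l (measurableSet_singleton r) (singleton_subset_iff.2 hr),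
    preimage_sub_singleton, add_comm, ← e] at h1
  exact abs_eq_zero.1 (le_antisymm h1 (abs_nonneg _))

lemma ClockExtends.muL_atoms {l : ℕ} (hl : l ∈ Icc 1 N) : (D.muL P l).atoms ⊆ D.plat E := by
  intro r hr
  by_contra hn
  refine hr (funext fun j => ?_)
  by_cases h : r ∈ Icc 0 D.h
  · have h0 := hE.nuL_singleton_zero hD hP hl h hn
    have h1 := hP.abs_muL_singleton_le hD (mem_Ioo_of_notMem_plat h hn) hl j
    rw [h0] at h1
    exact abs_eq_zero.1 (le_antisymm h1 (abs_nonneg _))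
  · exact muL_outside hD l (measurableSet_singleton r) (disjoint_singleton_left.2 h) j

omit hP in
lemma ClockExtends.preimage_off [IsFiniteMeasure P.ν] {l : ℕ} (hl : l ∈ Icc 1 N) (B : Set ℝ) :
    (fun t => t - D.start l) ⁻¹' (B ∩ (D.plat E)ᶜ ∩ Icc 0 D.h)
      = ((fun t => t - D.start l) ⁻¹' B ∩ Ioo (D.start l) (l * D.h)) ∩ (D.knots E)ᶜ := by
  have hc := hE.isClock hD
  ext t
  simp only [mem_inter_iff, mem_preimage, mem_compl_iff]
  have e : t = D.start l + (t - D.start l) := by ring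
  constructor
  · rintro ⟨⟨h1, h2⟩, h3⟩
    have h4 := mem_Ioo_of_notMem_plat h3 h2
    refine ⟨⟨h1, ?_⟩, ?_⟩
    · rw [← start_add_h]; exact ⟨by linarith [h4.1], by linarith [h4.2]⟩
    · rw [e, mem_knots_iff hc hl h3]; exact h2
  · rintro ⟨⟨h1, h2⟩, h3⟩
    rw [← start_add_h] at h2
    have h4 : t - D.start l ∈ Icc 0 D.h := ⟨by linarith [h2.1], by linarith [h2.2]⟩
    rw [e, mem_knots_iff hc hl h4] at h3
    exact ⟨⟨h1, h3⟩, h4⟩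

/-- The atoms placed at 0 and h by ω lie in `plat`, and so do the offsets of all atoms of ν inside a
period. What remains is the translated continuous part of ν. -/
lemma ClockExtends.nuL_restrict {l : ℕ} (hl : l ∈ Icc 1 N) :
    (D.nuL P l).restrict (D.plat E)ᶜ
      = ((contPart P.ν).restrict (Ioo (D.start l) (l * D.h))).map (fun t => t - D.start l) := by
  have := hP.mem_Vc.1
  have hc := hE.isClock hD
  have hm : Measurable fun t : ℝ => t - D.start l := measurable_id.sub_const _
  have hp := (measurableSet_plat hc).compl
  ext B hB
  have e1 : D.nuL P l (B ∩ (D.plat E)ᶜ) = D.nuL P l (B ∩ (D.plat E)ᶜ ∩ Icc 0 D.h) := by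
    rw [← measure_inter_add_sdiff (B ∩ (D.plat E)ᶜ) measurableSet_Icc, nuL_outside hD l
      ((hB.inter hp).diff measurableSet_Icc) disjoint_sdiff_left, add_zero]
  rw [Measure.restrict_apply hB, e1, nuL_apply l ((hB.inter hp).inter measurableSet_Icc)
      (fun r hr => mem_Ioo_of_notMem_plat hr.2 hr.1.2), hE.preimage_off hD hl,
    Measure.map_apply hm hB, Measure.restrict_apply (hm hB),
    contPart_eq_restrict (countable_knots hc) fun t ht => hE.ν_atoms hD hP ht,
    Measure.restrict_apply ((hm hB).inter measurableSet_Ioo)]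

lemma ClockExtends.muL_cont {l : ℕ} (hl : l ∈ Icc 1 N) {w : ℝ → Ctrl m} (hw : Measurable w)
    (hwi : ∀ j, Integrable (fun t => w t j) (contPart P.ν))
    (hwe : ∀ j B, MeasurableSet B → P.μ.cont j B = ∫ t in B, w t j ∂(contPart P.ν)) :
    Integrable (fun r => w (r + D.start l)) ((D.nuL P l).restrict (D.plat E)ᶜ) ∧
    ∀ j, (D.muL P l).cont j
      = ((D.nuL P l).restrict (D.plat E)ᶜ).withDensityᵥ fun r => w (r + D.start l) j := by
  have := hP.mem_Vc.1
  have hc := hE.isClock hD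
  have hm : Measurable fun t : ℝ => t - D.start l := measurable_id.sub_const _
  have hm' : Measurable fun t : ℝ => t + D.start l := measurable_id.add_const _
  have hp := (measurableSet_plat hc).compl
  have hwj : ∀ j, Measurable fun r => w (r + D.start l) j := fun j =>
    (measurable_pi_apply j).comp (hw.comp hm')
  have hi : Integrable (fun r => w (r + D.start l)) ((D.nuL P l).restrict (D.plat E)ᶜ) := by
    have hw' : Measurable fun r => w (r + D.start l) := hw.comp hm'
    rw [hE.nuL_restrict hD hP hl, integrable_map_measure hw'.aestronglyMeasurable hm.aemeasurable]
    refine Integrable.mono_measure ?_ Measure.restrict_le_self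
    simp only [Function.comp_def, sub_add_cancel]
    exact Integrable.of_eval hwi
  refine ⟨hi, fun j => ?_⟩
  ext B hB
  rw [cont_eq_restrict (countable_plat hc) (hE.muL_atoms hD hP hl),
    VectorMeasure.restrict_apply _ hp hB, withDensityᵥ_apply (hi.eval j) hB,
    hE.nuL_restrict hD hP hl, setIntegral_map hB (hwj j).aestronglyMeasurable hm.aemeasurable,
    Measure.restrict_restrict (hm hB)]
  simp only [sub_add_cancel]
  have hC := (hm hB).inter (measurableSet_Ioo (a := D.start l) (b := (l : ℝ) * D.h))
  rw [← hwe j _ hC, cont_eq_restrict (countable_knots hc) (hE.μ_atoms hD hP),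
    VectorMeasure.restrict_apply _ (measurableSet_knots hc).compl hC, ← hE.preimage_off hD hl,
    ← muL_apply l ((hB.inter hp).inter measurableSet_Icc)
      (fun r hr => mem_Ioo_of_notMem_plat hr.2 hr.1.2)]
  conv_lhs => rw [← inter_union_sdiff (B ∩ (D.plat E)ᶜ) (Icc 0 D.h)]
  rw [VectorMeasure.of_union disjoint_sdiff_inter.symm ((hB.inter hp).inter measurableSet_Icc)
    ((hB.inter hp).diff measurableSet_Icc), muL_outside hD l ((hB.inter hp).diff measurableSet_Icc)
      disjoint_sdiff_left, add_zero]

end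

end

end System

/-! ### Densities with respect to dφ, and unit speed off the plateaus -/

lemma norm1_eq_one_of_tv {m : ℕ} {ρ : Measure ℝ} [IsFiniteMeasure ρ] {w : ℝ → Ctrl m}
    (hw : Measurable w) (hi : Integrable w ρ)
    (h : VMeas.tv (fun j => ρ.withDensityᵥ fun t => w t j) = ρ) : ∀ᵐ t ∂ρ, norm1 (w t) = 1 := by
  rw [tv_withDensity hw hi] at h
  have h1 : ρ.withDensity 1 = ρ.withDensity fun t => ENNReal.ofReal (norm1 (w t)) := by
    rw [withDensity_one, h]
  have hm : Measurable fun t => ENNReal.ofReal (norm1 (w t)) :=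
    (measurable_norm1.comp hw).ennreal_ofReal
  rw [withDensity_eq_iff measurable_one.aemeasurable hm.aemeasurable (by simp)] at h1
  filter_upwards [h1] with t ht
  simpa using ht.symm

namespace System

variable {n m N M : ℕ} {D : System n m N M} {E : ExtendedTuple n m} {P : ImpulseTuple n m}

section
variable (hD : D.Standing) (hP : D.IsImpulseControl P.μ P.ν P.ω) (hE : D.ClockExtends P E)
include hD hP hE

/-- This is where νᶜ = |μᶜ| enters: the direction w of μᶜ has norm one νᶜ-almost everywhere. So m_l
is w times the density of the continuous part of ν_l; its norm is that density, and it lies in K by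
the cone property. -/
lemma ClockExtends.density_spec {l : ℕ} (hl : l ∈ Icc 1 N) :
    (∀ j, (D.dphi P).withDensityᵥ (fun r => D.density P l r j) = (D.muL P l).cont j) ∧
    ∀ᵐ r ∂D.dphi P, D.density P l r ∈ D.K ∧ norm1 (D.density P l r)
      = (((D.nuL P l).restrict (D.plat E)ᶜ).rnDeriv (D.dphi P) r).toReal := by
  have hfν := hP.mem_Vc.1
  have hfν' : IsFiniteMeasure (contPart P.ν) := by unfold contPart; infer_instance
  have := isFiniteMeasure_dphi (D := D) (P := P)
  have := isFiniteMeasure_nuL (D := D) (P := P) l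
  have hm : Measurable fun t : ℝ => t - D.start l := measurable_id.sub_const _
  have hm' : Measurable fun t : ℝ => t + D.start l := measurable_id.add_const _
  obtain ⟨w, hw, hwK, hwi, hwe⟩ := hP.mem_cone.2.2
  rw [← hP.mem_Vc.2.2.1] at hwi hwe
  have hwi' : Integrable w (contPart P.ν) := Integrable.of_eval hwi
  have hcont : P.μ.cont = fun j => (contPart P.ν).withDensityᵥ fun t => w t j := by
    funext j
    ext B hB
    rw [hwe j B hB, withDensityᵥ_apply (hwi j) hB]
  have hn1 : ∀ᵐ t ∂contPart P.ν, norm1 (w t) = 1 :=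
    norm1_eq_one_of_tv hw hwi' (by rw [← hcont, ← hP.mem_Vc.2.2.1])
  obtain ⟨h1, h2⟩ := hE.muL_cont hD hP hl hw hwi hwe
  have hn : ∀ᵐ r ∂(D.nuL P l).restrict (D.plat E)ᶜ, norm1 (w (r + D.start l)) = 1 := by
    have hmn : Measurable fun r => norm1 (w (r + D.start l)) := measurable_norm1.comp (hw.comp hm')
    have hs : MeasurableSet {r | norm1 (w (r + D.start l)) = 1} := hmn (measurableSet_singleton 1)
    rw [hE.nuL_restrict hD hP hl, ae_map_iff hm.aemeasurable hs]
    simp only [sub_add_cancel]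
    exact ae_restrict_of_ae hn1
  have hac : (D.nuL P l).restrict (D.plat E)ᶜ ≪ D.dphi P := by
    refine Measure.absolutelyContinuous_of_le (Measure.restrict_le_self.trans ?_)
    refine Measure.le_intro fun B _ _ => ?_
    rw [dphi, Measure.add_apply, Measure.finsetSum_apply]
    exact le_trans (Finset.single_le_sum (f := fun l => D.nuL P l B) (fun _ _ => zero_le)
      (Finset.mem_Icc.2 hl)) le_add_self
  exact rnDeriv_of_factor hD.K_cone hac (fun t => hwK _) h1 hn h2

variable (E) in
omit hP hE hD in
lemma measurable_density (l : ℕ) : Measurable (D.density P l) :=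
  measurable_pi_iff.2 fun _ => SignedMeasure.measurable_rnDeriv _ _

omit hP hE hD in
lemma integrable_density (l : ℕ) : Integrable (D.density P l) (D.dphi P) :=
  Integrable.of_eval fun _ => SignedMeasure.integrable_rnDeriv _ _

variable (D) in
omit hP hE hD in
/-- The density of Lebesgue measure with respect to `dφ`. -/
def leb (P : ImpulseTuple n m) (r : ℝ) : ℝ :=
  ((volume.restrict (Icc 0 D.h)).rnDeriv (D.dphi P) r).toReal

omit hP hE hD in
lemma withDensity_leb [IsFiniteMeasure P.ν] :
    (D.dphi P).withDensity ((volume.restrict (Icc 0 D.h)).rnDeriv (D.dphi P))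
      = volume.restrict (Icc 0 D.h) := by
  have := isFiniteMeasure_dphi (D := D) (P := P)
  refine Measure.withDensity_rnDeriv_eq _ _ (Measure.absolutelyContinuous_of_le ?_)
  exact Measure.le_intro fun B _ _ => by rw [dphi, Measure.add_apply]; exact le_self_add

/-- Off `plat`, dφ is the sum of Lebesgue measure and of the ν_l without their atoms; the densities
of these parts with respect to dφ itself add up to 1. On the countable set `plat` the Lebesgue part
has no mass. -/
lemma ClockExtends.speed_density : ∀ᵐ r ∂D.dphi P,
    (r ∉ D.plat E → D.leb P r + ∑ l ∈ Finset.Icc 1 N, norm1 (D.density P l r) = 1) ∧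
    (r ∈ D.plat E → D.leb P r = 0) := by
  have := hP.mem_Vc.1
  have := isFiniteMeasure_dphi (D := D) (P := P)
  have := fun l => isFiniteMeasure_nuL (D := D) (P := P) l
  have hc := hE.isClock hD
  have hp := (measurableSet_plat hc).compl
  set ρ := D.dphi P with hρ
  set κ := (volume.restrict (Icc 0 D.h)).rnDeriv ρ with hκ
  set ν : ℕ → ℝ → ℝ≥0∞ := fun l => ((D.nuL P l).restrict (D.plat E)ᶜ).rnDeriv ρ with hν
  have hac : ∀ l ∈ Finset.Icc 1 N, (D.nuL P l).restrict (D.plat E)ᶜ ≪ ρ := by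
    intro l hl
    refine Measure.absolutelyContinuous_of_le (Measure.restrict_le_self.trans ?_)
    refine Measure.le_intro fun B _ _ => ?_
    rw [hρ, dphi, Measure.add_apply, Measure.finsetSum_apply]
    exact le_trans (Finset.single_le_sum (f := fun l => D.nuL P l B) (fun _ _ => zero_le) hl)
      le_add_self
  have hmκ : Measurable κ := Measure.measurable_rnDeriv _ _
  have hmν : ∀ l, Measurable (ν l) := fun l => Measure.measurable_rnDeriv _ _
  have hvol : (volume.restrict (Icc 0 D.h)).restrict (D.plat E)ᶜ = volume.restrict (Icc 0 D.h) := by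
    refine Measure.restrict_eq_self_of_ae_mem ?_
    exact ae_restrict_of_ae ((countable_plat hc).ae_notMem volume)
  -- The measure obtained from dφ by removing `plat` is written once with an indicator as density
  -- and once as the sum of its parts; comparison of the densities gives both claims.
  have key : ρ.withDensity ((D.plat E)ᶜ.indicator 1)
      = ρ.withDensity fun r => κ r + ∑ l ∈ Finset.Icc 1 N, ν l r := by
    rw [withDensity_indicator_one hp]
    ext B hB
    rw [withDensity_apply _ hB, lintegral_add_left hmκ, lintegral_finsetSum _ fun l _ => hmν l,
      ← withDensity_apply _ hB, withDensity_leb, Finset.sum_congr rfl fun l hl => by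
        rw [← withDensity_apply _ hB, Measure.withDensity_rnDeriv_eq _ _ (hac l hl)],
      Measure.restrict_apply hB, hρ, dphi, Measure.add_apply, Measure.finsetSum_apply,
      ← Measure.restrict_apply hB, hvol]
    congr 1
    exact Finset.sum_congr rfl fun l _ => (Measure.restrict_apply hB).symm
  have hms : Measurable fun r => κ r + ∑ l ∈ Finset.Icc 1 N, ν l r :=
    hmκ.add (Finset.measurable_fun_sum _ fun l _ => hmν l)
  rw [withDensity_eq_iff (measurable_one.indicator hp).aemeasurable hms.aemeasurable (by
      rw [lintegral_indicator_one hp]; exact measure_ne_top _ _)] at key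
  have hspec : ∀ᵐ r ∂ρ, ∀ l ∈ Finset.Icc 1 N, norm1 (D.density P l r) = (ν l r).toReal :=
    (ae_ball_iff (Finset.countable_toSet _)).2 fun l hl =>
      (hE.density_spec hD hP (Finset.mem_Icc.1 hl)).2.mono fun r hr => hr.2
  filter_upwards [key, hspec] with r h1 h2
  constructor
  · intro hr
    rw [indicator_of_mem hr, Pi.one_apply] at h1
    have hfin : κ r + ∑ l ∈ Finset.Icc 1 N, ν l r ≠ ∞ := by rw [← h1]; exact ENNReal.one_ne_top
    obtain ⟨h3, h4⟩ := ENNReal.add_ne_top.1 hfin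
    rw [Finset.sum_congr rfl h2, ← ENNReal.toReal_sum fun l hl => ENNReal.sum_ne_top.1 h4 l hl]
    change (κ r).toReal + _ = 1
    rw [← ENNReal.toReal_add h3 h4, ← h1, ENNReal.toReal_one]
  · intro hr
    rw [indicator_of_notMem (not_not.2 hr)] at h1
    have : κ r = 0 := (add_eq_zero.1 h1.symm).1
    change (κ r).toReal = 0
    rw [this, ENNReal.toReal_zero]

end

end System

/-! ### Canonicity of the control given by Construction A -/

namespace System

variable {n m N M : ℕ} {D : System n m N M} {E : ExtendedTuple n m} {P : ImpulseTuple n m}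

section
variable (hD : D.Standing) (hP : D.IsImpulseControl P.μ P.ν P.ω) (hE : D.ClockExtends P E)
include hD hP hE

lemma ClockExtends.ae_phi0 {p : ℝ → Prop} (h : ∀ᵐ r ∂D.dphi P, p r) :
    ∀ᵐ s ∂volume.restrict (Icc 0 E.S), p (E.φ₀ s) := by
  have := hP.mem_Vc.1
  rw [hE.dphi_eq hD] at h
  filter_upwards [ae_of_ae_map (measurable_ph (hE.isClock hD)).aemeasurable h,
    ae_restrict_mem measurableSet_Icc] with s hs hmem
  rwa [ph_of_mem hmem] at hs

lemma ClockExtends.setIntegral_dphi {f : ℝ → ℝ} (hf : Measurable f) {B : Set ℝ}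
    (hB : MeasurableSet B) :
    ∫ r in B, f r ∂D.dphi P = ∫ s in Icc 0 E.S ∩ E.φ₀ ⁻¹' B, f (E.φ₀ s) := by
  have := hP.mem_Vc.1
  have hc := hE.isClock hD
  rw [hE.dphi_eq hD, setIntegral_map hB hf.aestronglyMeasurable (measurable_ph hc).aemeasurable,
    restrict_level hc hB]
  refine setIntegral_congr_fun (measurableSet_level hc hB) fun s hs => ?_
  simp only [ph_of_mem hs.1]

/-- Identifies φ₀' as the density of Lebesgue measure with respect to dφ, taken along φ₀. Up to
σ⁺(φ₀(s)) the integral is φ₀(s), because φ₀ transports Lebesgue measure to dφ; the stretch from s to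
σ⁺(φ₀(s)) lies on a plateau and contributes nothing. -/
lemma ClockExtends.solvesOn_leb : SolvesOn (fun s => D.leb P (ph E s)) E.φ₀ 0 E.S := by
  have := hP.mem_Vc.1
  have := isFiniteMeasure_dphi (D := D) (P := P)
  have hc := hE.isClock hD
  have hm := measurable_ph hc
  have hml : Measurable (D.leb P) := (Measure.measurable_rnDeriv _ _).ennreal_toReal
  have hi : IntegrableOn (fun s => D.leb P (ph E s)) (Icc 0 E.S) := by
    have h1 : Integrable (D.leb P) (D.dphi P) := Measure.integrable_toReal_rnDeriv
    rw [hE.dphi_eq hD] at h1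
    exact (integrable_map_measure hml.aestronglyMeasurable hm.aemeasurable).1 h1
  have hii : ∀ a ∈ Icc 0 E.S, ∀ b ∈ Icc 0 E.S,
      IntervalIntegrable (fun s => D.leb P (ph E s)) volume a b := fun a ha b hb => by
    refine IntervalIntegrable.mono_set (a := 0) (b := E.S) ?_ ?_
    · rwa [intervalIntegrable_iff_integrableOn_Icc_of_le hc.hT.le]
    · rw [uIcc_of_le hc.hT.le]; exact uIcc_subset_Icc ha hb
  refine ⟨hii _ hc.mem_left _ hc.mem_right, fun s hs => ?_⟩
  have hr := hc.mapsTo hs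
  have hu := up_mem hc (E.φ₀ s)
  have e1 : ∫ s' in (0 : ℝ)..D.up E (E.φ₀ s), D.leb P (ph E s') = E.φ₀ s := by
    rw [intervalIntegral.integral_of_le hu.1, ← integral_Icc_eq_integral_Ioc, ← level_Icc hc hr]
    have e := hE.setIntegral_dphi hD hP hml (measurableSet_Icc (a := 0) (b := E.φ₀ s))
    have e' : ∫ s' in Icc 0 E.S ∩ E.φ₀ ⁻¹' Icc 0 (E.φ₀ s), D.leb P (ph E s')
        = ∫ s' in Icc 0 E.S ∩ E.φ₀ ⁻¹' Icc 0 (E.φ₀ s), D.leb P (E.φ₀ s') := by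
      refine setIntegral_congr_fun (measurableSet_level hc measurableSet_Icc) fun s hs => ?_
      simp only [ph_of_mem hs.1]
    rw [e', ← e]
    unfold leb
    rw [Measure.setIntegral_toReal_rnDeriv (Measure.absolutelyContinuous_of_le
      (Measure.le_intro fun B _ _ => by rw [dphi, Measure.add_apply]; exact le_self_add)),
      Measure.real, Measure.restrict_apply measurableSet_Icc,
      inter_eq_left.2 (Icc_subset_Icc_right hr.2), Real.volume_Icc, sub_zero,
      ENNReal.toReal_ofReal hr.1]
  have hsm := (phi0_eq_iff hc hr hs).1 rfl
  have e2 : ∫ s' in s..D.up E (E.φ₀ s), D.leb P (ph E s') = 0 := by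
    rcases (lo_le_up hc (E.φ₀ s)).eq_or_lt with h | h
    · have : s = D.up E (E.φ₀ s) := le_antisymm hsm.2 (h ▸ hsm.1)
      rw [← this, intervalIntegral.integral_same]
    · have h1 := (ae_restrict_iff' measurableSet_Icc).1
        (hE.ae_phi0 hD hP ((hE.speed_density hD hP).mono fun r hr => hr.2))
      refine intervalIntegral.integral_zero_ae ?_
      filter_upwards [h1] with s' h2 hs'
      rw [uIoc_of_le hsm.2] at hs'
      have hm' : s' ∈ Icc 0 E.S := ⟨hs.1.trans hs'.1.le, hs'.2.trans hu.2⟩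
      have e3 := phi0_of_mem hc hr ⟨hsm.1.trans hs'.1.le, hs'.2⟩
      rw [ph_of_mem hm']
      exact h2 hm' (by rw [e3]; exact Or.inl ⟨hr, h⟩)
  have e3 := intervalIntegral.integral_add_adjacent_intervals (hii _ hc.mem_left _ hs)
    (hii _ hs _ hu)
  rw [e2, e1, add_zero] at e3
  rw [hc.left, zero_add, e3]

/-- Both sides are the mass of the atom of dφ at r, to which Lebesgue measure contributes nothing.
-/
lemma ClockExtends.sum_norm_ω {r : ℝ} (hr : r ∈ Icc 0 D.h) :
    ∑ l ∈ Finset.Icc 1 N, ∫ s in (0 : ℝ)..1, norm1 (P.ω r l s) = D.up E r - D.lo E r := by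
  have := hP.mem_Vc.1
  have := fun l => isFiniteMeasure_nuL (D := D) (P := P) l
  rw [← hE.dphi_singleton hD hr, dphi, measureReal_add_apply, measureReal_def,
    measureReal_def, measure_mono_null (t := {r}) subset_rfl (by
      rw [Measure.restrict_apply (measurableSet_singleton r)]
      exact measure_mono_null inter_subset_left Real.volume_singleton), ENNReal.toReal_zero, zero_add,
    Measure.finsetSum_apply, ENNReal.toReal_sum fun l _ => measure_ne_top _ _]
  exact Finset.sum_congr rfl fun l hl => (hP.nuL_singleton hD hr (Finset.mem_Icc.1 hl)).symm

end

section
variable (hD : D.Standing) (hP : D.IsImpulseControl P.μ P.ν P.ω) (hE : D.ControlExtends P E)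
include hD hP hE

lemma ControlExtends.ae_deriv_phi : ∀ᵐ s ∂volume.restrict (Icc 0 E.S),
    ∀ l ∈ Finset.Icc 1 N, deriv (E.φ l) s = D.phiRate P E.φ₀ l s := by
  have := hP.mem_Vc.1
  exact (ae_ball_iff (Finset.countable_toSet _)).2 fun l hl =>
    (hE.φ_eq l (Finset.mem_Icc.1 hl)).ae_deriv (hE.S_pos hD).le

lemma ControlExtends.ae_deriv_phi0 :
    ∀ᵐ s ∂volume.restrict (Icc 0 E.S), deriv E.φ₀ s = D.leb P (E.φ₀ s) := by
  have := hP.mem_Vc.1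
  filter_upwards [(hE.solvesOn_leb hD hP).ae_deriv (hE.S_pos hD).le,
    ae_restrict_mem measurableSet_Icc] with s hs hm
  rw [hs, ph_of_mem hm]

lemma ControlExtends.deriv_plateau {r : ℝ} (hr : r ∈ Icc 0 D.h) (hlt : D.lo E r < D.up E r) :
    ∀ᵐ s ∂volume.restrict (Icc (D.lo E r) (D.up E r)), ∀ l ∈ Finset.Icc 1 N,
      deriv (E.φ l) s = (D.up E r - D.lo E r)⁻¹ •
        P.ω r l ((s - D.lo E r) / (D.up E r - D.lo E r)) := by
  have := hP.mem_Vc.1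
  have hc := hE.isClock hD
  filter_upwards [ae_mono (Measure.restrict_mono (Icc_subset_Icc (lo_mem hc r).1 (up_mem hc r).2)
    le_rfl) (hE.ae_deriv_phi hD hP), ae_restrict_mem measurableSet_Icc] with s hs hm l hl
  rw [hs l hl, phiRate_of_mem hD hc (hE.phi_eq hD) l hr hlt hm]

lemma ControlExtends.deriv_off : ∀ᵐ s ∂volume.restrict (Icc 0 E.S), E.φ₀ s ∉ D.plat E →
    ∀ l ∈ Finset.Icc 1 N, deriv (E.φ l) s = D.density P l (E.φ₀ s) := by
  have := hP.mem_Vc.1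
  have hc := hE.isClock hD
  filter_upwards [hE.ae_deriv_phi hD hP, ae_restrict_mem measurableSet_Icc] with s hs hm hn l hl
  rw [hs l hl, phiRate_of_notMem hD hc (hE.phi_eq hD) l hm hn]

/-- On a plateau φ₀' = 0, and the factor (σ⁺(r) - σ⁻(r))⁻¹ normalises the constant speed of ω to
one. Off the plateaus the claim is `speed_density` read along φ₀. -/
lemma ControlExtends.speed_cone : ∀ᵐ s ∂volume.restrict (Icc 0 E.S),
    deriv E.φ₀ s + ∑ l ∈ Finset.Icc 1 N, norm1 (deriv (E.φ l) s) = 1 ∧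
      ∀ l ∈ Finset.Icc 1 N, deriv (E.φ l) s ∈ D.K := by
  have := hP.mem_Vc.1
  have hc := hE.isClock hD
  have hsp := hE.ae_phi0 hD hP (hE.speed_density hD hP)
  refine ae_of_plateaus hc (fun r hr hlt => ?_) ?_
  · have hne := sub_pos.2 hlt
    have hsub := Icc_subset_Icc (lo_mem hc r).1 (up_mem hc r).2
    have hval : ∀ᵐ u ∂volume.restrict (Icc (0 : ℝ) 1), ∀ l ∈ Finset.Icc 1 N, P.ω r l u ∈ D.K :=
      (ae_ball_iff (Finset.countable_toSet _)).2 fun l hl =>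
        hP.valued r hr l (Finset.mem_Icc.1 hl)
    filter_upwards [hE.deriv_plateau hD hP hr hlt, ae_Icc_of_ae_unit hlt hval,
      ae_Icc_of_ae_unit hlt (hP.const_speed r hr),
      ae_mono (Measure.restrict_mono hsub le_rfl) (hE.ae_deriv_phi0 hD hP),
      ae_mono (Measure.restrict_mono hsub le_rfl) hsp, ae_restrict_mem measurableSet_Icc]
      with s h1 h2 h3 h4 h5 hm
    have e := phi0_of_mem hc hr hm
    constructor
    · rw [h4, h5.2 (by rw [e]; exact Or.inl ⟨hr, hlt⟩), zero_add, Finset.sum_congr rfl fun l hl => by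
        rw [h1 l hl, norm1_smul, abs_of_pos (inv_pos.2 hne)], ← Finset.mul_sum, h3,
        hE.sum_norm_ω hD hP hr, inv_mul_cancel₀ hne.ne']
    · intro l hl
      rw [h1 l hl]
      exact hD.K_cone _ (inv_pos.2 hne).le _ (h2 l hl)
  · have hd : ∀ᵐ r ∂D.dphi P, ∀ l ∈ Finset.Icc 1 N, D.density P l r ∈ D.K :=
      (ae_ball_iff (Finset.countable_toSet _)).2 fun l hl =>
        (hE.density_spec hD hP (Finset.mem_Icc.1 hl)).2.mono fun r hr => hr.1
    filter_upwards [hE.deriv_off hD hP, hE.ae_deriv_phi0 hD hP, hsp, hE.ae_phi0 hD hP hd]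
      with s h1 h2 h3 h4 hn
    constructor
    · rw [h2, Finset.sum_congr rfl fun l hl => by rw [h1 hn l hl]]
      exact h3.1 hn
    · intro l hl
      rw [h1 hn l hl]
      exact h4 l hl

theorem ControlExtends.isCanonicalControl : D.IsCanonicalControl E := by
  have := hP.mem_Vc.1
  have hc := hE.isClock hD
  have hsc := hE.speed_cone hD hP
  have h0 : ∀ᵐ s ∂volume.restrict (Icc 0 E.S), 0 ≤ deriv E.φ₀ s := by
    filter_upwards [hE.ae_deriv_phi0 hD hP] with s hs
    rw [hs]; exact ENNReal.toReal_nonneg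
  refine ⟨⟨hc.hT, ⟨1, hE.lipschitzOnWith_phi0 hD, fun l hl => ?_⟩, hc.mono, hc.left, hc.right,
    hE.φ_zero, hE.φ_chain, fun l hl => ?_⟩, hsc.mono fun s hs => hs.1⟩
  · refine (hE.φ_eq l hl).lipschitzOnWith ?_
    filter_upwards [hsc, h0, hE.ae_deriv_phi hD hP] with s h1 h2 h3
    have h4 := Finset.single_le_sum (f := fun l => norm1 (deriv (E.φ l) s))
      (fun _ _ => norm1_nonneg _) (Finset.mem_Icc.2 hl)
    have h5 := norm_le_norm1 (deriv (E.φ l) s)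
    rw [← h3 l (Finset.mem_Icc.2 hl), NNReal.coe_one]
    linarith [h1.1]
  · exact hsc.mono fun s hs => hs.2 l (Finset.mem_Icc.2 hl)

lemma ControlExtends.ω_eq : ∀ r ∈ Icc 0 D.h, ∀ l ∈ Icc 1 N, ∀ᵐ u ∂volume.restrict (Icc (0 : ℝ) 1),
    P.ω r l u = (D.up E r - D.lo E r) • deriv (E.φ l) ((D.up E r - D.lo E r) * u + D.lo E r) := by
  have := hP.mem_Vc.1
  have hc := hE.isClock hD
  intro r hr l hl
  rcases (lo_le_up hc r).eq_or_lt with h | h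
  -- On a degenerate plateau the constant speed is 0, which forces every ω^r_l to vanish almost
  -- everywhere.
  · have hs := hE.sum_norm_ω hD hP hr
    filter_upwards [hP.const_speed r hr] with u hu
    rw [hs, ← h, sub_self] at hu
    have := (Finset.sum_eq_zero_iff_of_nonneg fun _ _ => norm1_nonneg _).1 hu l (Finset.mem_Icc.2 hl)
    rw [eq_zero_of_norm1 this, ← h, sub_self, zero_smul]
  · have hne := (sub_pos.2 h).ne'
    filter_upwards [ae_unit_of_ae_Icc h (hE.deriv_plateau hD hP hr h)] with u hu
    rw [hu l (Finset.mem_Icc.2 hl), add_sub_cancel_right, mul_div_cancel_left₀ _ hne, smul_smul,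
      mul_inv_cancel₀ hne, one_smul]

end

end System

/-! ### Recovering μ and ν from the control of Construction A -/

namespace System

variable {n m N M : ℕ} {D : System n m N M} {E : ExtendedTuple n m} {P : ImpulseTuple n m}

/-- Signed measures on `[0,T]` are determined by their values on the points of `knots` and on the
subsets of the open periods. -/
lemma signedMeasure_ext_knots (hD : D.Standing) (hc : IsClock E.φ₀ 0 E.S 0 D.h)
    {s t : SignedMeasure ℝ} (hs : ∀ B, MeasurableSet B → Disjoint B (Icc 0 D.T) → s B = 0)
    (ht : ∀ B, MeasurableSet B → Disjoint B (Icc 0 D.T) → t B = 0)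
    (h1 : ∀ l ∈ Icc 1 N, ∀ r ∈ Icc 0 D.h, s {D.start l + r} = t {D.start l + r})
    (h2 : ∀ l ∈ Icc 1 N, ∀ B, MeasurableSet B → B ⊆ Ioo 0 D.h → B ⊆ (D.plat E)ᶜ →
      s ((fun u => u - D.start l) ⁻¹' B) = t ((fun u => u - D.start l) ⁻¹' B)) : s = t := by
  refine signedMeasure_ext_countable (countable_knots hc) ?_ ?_
  · intro x hx
    simp only [knots, mem_iUnion, exists_prop] at hx
    obtain ⟨l, hl, r, hr, rfl⟩ := hx
    exact h1 l hl r (plat_subset hc hr)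
  · intro B hB hd
    have hm : ∀ l : ℕ, Measurable fun u : ℝ => u - D.start l := fun l => measurable_id.sub_const _
    have hm' : ∀ l : ℕ, Measurable fun u : ℝ => u + D.start l := fun l => measurable_id.add_const _
    set C : ℕ → Set ℝ := fun l => (fun u => u + D.start l) ⁻¹' B ∩ Ioo 0 D.h with hC
    have hCm : ∀ l, MeasurableSet (C l) := fun l => (hm' l hB).inter measurableSet_Ioo
    set A : ℕ → Set ℝ := fun l => (fun u => u - D.start l) ⁻¹' C l with hA
    have hmem : ∀ l u, u ∈ A l ↔ u ∈ B ∧ u - D.start l ∈ Ioo 0 D.h := fun l u => by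
      simp only [hA, hC, mem_preimage, mem_inter_iff, sub_add_cancel]
    have hAm : ∀ l ∈ Finset.Icc 1 N, MeasurableSet (A l) := fun l _ => hm l (hCm l)
    have hdis : PairwiseDisjoint (↑(Finset.Icc 1 N)) A := by
      intro k _ l _ hkl
      refine disjoint_left.2 fun u hk hl => hkl ?_
      have h3 := ((hmem k u).1 hk).2
      have h4 := ((hmem l u).1 hl).2
      exact ((start_add_inj hD.h_pos (D := D) (k := k) (l := l) (Ioo_subset_Icc_self h3) h4).1
        (by ring)).1
    have hunion : B ∩ Icc 0 D.T = ⋃ l ∈ Finset.Icc 1 N, A l := by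
      ext u
      simp only [mem_inter_iff, mem_iUnion, exists_prop, hmem]
      constructor
      · rintro ⟨hu, huT⟩
        have hnk : u ∉ D.knots E := disjoint_left.1 hd hu
        by_contra hcon
        push Not at hcon
        refine hnk (mem_knots_of_mem hD hc huT fun l hl r hr e => ?_)
        exact absurd (by rw [e]; simpa using hr) (hcon l (Finset.mem_Icc.2 hl) hu)
      · rintro ⟨l, hl, hu, h3⟩
        refine ⟨hu, ?_⟩
        by_contra hn
        have hl' := Finset.mem_Icc.1 hl
        have hlN : (l : ℝ) ≤ N := by exact_mod_cast hl'.2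
        have hl1 : (1 : ℝ) ≤ l := by exact_mod_cast hl'.1
        refine hn ⟨?_, ?_⟩
        · have : 0 ≤ D.start l := mul_nonneg (by linarith) hD.h_pos.le
          linarith [h3.1]
        · have h5 : (l : ℝ) * D.h ≤ N * D.h := mul_le_mul_of_nonneg_right hlN hD.h_pos.le
          have := start_add_h (D := D) l
          unfold T
          linarith [h3.2]
    rw [← inter_union_sdiff B (Icc 0 D.T), VectorMeasure.of_union disjoint_sdiff_inter.symm
      (hB.inter measurableSet_Icc) (hB.diff measurableSet_Icc),
      VectorMeasure.of_union disjoint_sdiff_inter.symm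
      (hB.inter measurableSet_Icc) (hB.diff measurableSet_Icc),
      hs _ (hB.diff measurableSet_Icc) disjoint_sdiff_left,
      ht _ (hB.diff measurableSet_Icc) disjoint_sdiff_left, hunion,
      VectorMeasure.of_biUnion_finset hdis hAm, VectorMeasure.of_biUnion_finset hdis hAm]
    congr 1
    refine Finset.sum_congr rfl fun l hl => h2 l (Finset.mem_Icc.1 hl) _ (hCm l)
      inter_subset_right fun r hr hp => ?_
    refine disjoint_left.1 hd hr.1 ?_
    simp only [knots, mem_iUnion, exists_prop]
    exact ⟨l, Finset.mem_Icc.1 hl, r, hp, add_comm _ _⟩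

/-- The atoms of an impulse control are determined by the attached controls. -/
lemma IsImpulseControl.singleton_eq {μ μ' : VMeas m} {ν ν' : Measure ℝ}
    {ω : ℝ → ℕ → ℝ → Ctrl m} (h : D.IsImpulseControl μ ν ω) (h' : D.IsImpulseControl μ' ν' ω)
    {l : ℕ} (hl : l ∈ Icc 1 N) {r : ℝ} (hr : r ∈ Icc 0 D.h) :
    (∀ j, μ j {D.start l + r} = μ' j {D.start l + r}) ∧
      ν.real {D.start l + r} = ν'.real {D.start l + r} := by
  rcases hr.1.eq_or_lt with h0 | h0
  · obtain ⟨k, rfl⟩ : ∃ k, l = k + 1 := ⟨l - 1, by have := hl.1; omega⟩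
    have hk : k ≤ N := by have := hl.2; omega
    rw [← h0, add_zero, start_succ]
    exact ⟨fun j => (h.μ_grid k hk j).symm.trans (h'.μ_grid k hk j),
      (h.ν_grid k hk).symm.trans (h'.ν_grid k hk)⟩
  rcases hr.2.eq_or_lt with h1 | h1
  · rw [h1, start_add_h]
    exact ⟨fun j => (h.μ_grid l hl.2 j).symm.trans (h'.μ_grid l hl.2 j),
      (h.ν_grid l hl.2).symm.trans (h'.ν_grid l hl.2)⟩
  · rw [add_comm]
    exact ⟨fun j => (h.μ_inner r ⟨h0, h1⟩ l hl j).symm.trans (h'.μ_inner r ⟨h0, h1⟩ l hl j),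
      (h.ν_inner r ⟨h0, h1⟩ l hl).symm.trans (h'.ν_inner r ⟨h0, h1⟩ l hl)⟩

section
variable (hD : D.Standing) (hP : D.IsImpulseControl P.μ P.ν P.ω) (hE : D.ControlExtends P E)
include hD hP hE

lemma ControlExtends.muL_off {l : ℕ} (hl : l ∈ Icc 1 N) {B : Set ℝ} (hB : MeasurableSet B)
    (h : B ⊆ (D.plat E)ᶜ) (j : Fin m) : D.muL P l j B = layerV E l j B := by
  have := hP.mem_Vc.1
  have hc := hE.isClock hD
  have hi := IsCanonicalControl.integrableOn_rate (hE.isCanonicalControl hD hP).ctl hl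
  have e1 : D.muL P l j B = (D.muL P l).cont j B := by
    rw [cont_eq_restrict (countable_plat hc) (hE.muL_atoms hD hP hl),
      VectorMeasure.restrict_apply _ (measurableSet_plat hc).compl hB, inter_eq_left.2 h]
  have hmj : Measurable fun r => D.density P l r j :=
    (measurable_pi_apply j).comp (measurable_density l)
  rw [e1, ← (hE.density_spec hD hP hl).1 j,
    withDensityᵥ_apply ((integrable_density l).eval j) hB, layerV_apply hc hi hB,
    hE.setIntegral_dphi hD hP hmj hB]
  refine setIntegral_congr_ae (measurableSet_level hc hB) ?_
  filter_upwards [(ae_restrict_iff' measurableSet_Icc).1 (hE.deriv_off hD hP)] with s hs hm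
  rw [hs hm.1 (h hm.2) l (Finset.mem_Icc.2 hl)]

lemma ControlExtends.nuL_off {l : ℕ} (hl : l ∈ Icc 1 N) {B : Set ℝ} (hB : MeasurableSet B)
    (h : B ⊆ (D.plat E)ᶜ) : (D.nuL P l).real B = (layerN E l).real B := by
  have := hP.mem_Vc.1
  have := isFiniteMeasure_dphi (D := D) (P := P)
  have := isFiniteMeasure_nuL (D := D) (P := P) l
  have hc := hE.isClock hD
  have hi := IsCanonicalControl.integrableOn_rate (hE.isCanonicalControl hD hP).ctl hl
  have hac : (D.nuL P l).restrict (D.plat E)ᶜ ≪ D.dphi P := by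
    refine Measure.absolutelyContinuous_of_le (Measure.restrict_le_self.trans ?_)
    refine Measure.le_intro fun B _ _ => ?_
    rw [dphi, Measure.add_apply, Measure.finsetSum_apply]
    exact le_trans (Finset.single_le_sum (f := fun l => D.nuL P l B) (fun _ _ => zero_le)
      (Finset.mem_Icc.2 hl)) le_add_self
  have e1 : (D.nuL P l).real B = ((D.nuL P l).restrict (D.plat E)ᶜ).real B := by
    rw [Measure.real, Measure.real, Measure.restrict_apply hB, inter_eq_left.2 h]
  have hmn : Measurable fun r => norm1 (D.density P l r) :=
    measurable_norm1.comp (measurable_density l)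
  rw [e1, ← Measure.setIntegral_toReal_rnDeriv hac, layerN_real hc hi hB,
    setIntegral_congr_ae (g := fun r => norm1 (D.density P l r)) hB (by
      filter_upwards [(hE.density_spec hD hP hl).2] with r hr _ using hr.2.symm),
    hE.setIntegral_dphi hD hP hmn hB]
  refine setIntegral_congr_ae (measurableSet_level hc hB) ?_
  filter_upwards [(ae_restrict_iff' measurableSet_Icc).1 (hE.deriv_off hD hP)] with s hs hm
  rw [hs hm.1 (h hm.2) l (Finset.mem_Icc.2 hl)]

/-- The pushed measures, together with the given ω, again form an impulse control. Since ω
determines the atoms, including those at grid points, the atoms agree; off the knots both pairs of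
measures have the same densities in each period. -/
theorem ControlExtends.controlOf : D.ControlOf E P := by
  have := hP.mem_Vc.1
  have hc := hE.isClock hD
  have hK := hE.isCanonicalControl hD hP
  set Q : ImpulseTuple n m := { P with
    μ := pushV (base N E.S) (D.clock E) (rate E)
    ν := pushN (base N E.S) (D.clock E) (rate E) } with hQ
  have hω := hE.ω_eq hD hP
  have hL : D.ControlOf E Q := ⟨rfl, rfl, hω⟩
  have hQc : D.IsImpulseControl Q.μ Q.ν P.ω := hL.isImpulseControl hD hK
  have hfQ : IsFiniteMeasure Q.ν := hQc.mem_Vc.1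
  refine ⟨?_, ?_, hω⟩
  · funext j
    refine signedMeasure_ext_knots (t := Q.μ j) hD hc
      (fun B hB hd => congrFun (hP.mem_cone.1 B hB hd) j)
      (fun B hB hd => congrFun (hQc.mem_cone.1 B hB hd) j)
      (fun l hl r hr => (hP.singleton_eq hQc hl hr).1 j) fun l hl B hB h1 h2 => ?_
    rw [← muL_apply l hB h1, ← muL_apply l hB h1, hL.muL_eq hD hK.ctl hl,
      hE.muL_off hD hP hl hB h2]
  · have hz : ∀ (ν : Measure ℝ) [IsFiniteMeasure ν], ν (Icc 0 D.T)ᶜ = 0 → ∀ B, MeasurableSet B →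
        Disjoint B (Icc 0 D.T) → ν.toSignedMeasure B = 0 := by
      intro ν _ h0 B hB hd
      rw [Measure.toSignedMeasure_apply_measurable hB, Measure.real,
        measure_mono_null (disjoint_left.1 hd) h0, ENNReal.toReal_zero]
    have hm : ∀ l : ℕ, Measurable fun u : ℝ => u - D.start l := fun l => measurable_id.sub_const _
    change P.ν = Q.ν
    rw [← Measure.toSignedMeasure_eq_toSignedMeasure_iff]
    refine signedMeasure_ext_knots hD hc (hz _ hP.mem_Vc.2.1) (hz _ hQc.mem_Vc.2.1) ?_ ?_
    · intro l hl r hr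
      rw [Measure.toSignedMeasure_apply_measurable (measurableSet_singleton _),
        Measure.toSignedMeasure_apply_measurable (measurableSet_singleton _)]
      exact (hP.singleton_eq hQc hl hr).2
    · intro l hl B hB h1 h2
      rw [Measure.toSignedMeasure_apply_measurable (hm l hB),
        Measure.toSignedMeasure_apply_measurable (hm l hB), Measure.real, Measure.real,
        ← nuL_apply l hB h1, ← nuL_apply l hB h1, hL.nuL_eq hD hK.ctl hl]
      exact hE.nuL_off hD hP hl hB h2

end

end System

/-! ### Splitting integrals over [0,S] into plateaus and their complement -/

section
variable {V : Type*} [NormedAddCommGroup V] [NormedSpace ℝ V]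

lemma SolvesOn.affine {F y : ℝ → V} {A B a b : ℝ} (h : SolvesOn F y A B) (ha : a ∈ Icc A B)
    (hb : b ∈ Icc A B) (hab : a ≤ b) :
    SolvesOn (fun u => (b - a) • F ((b - a) * u + a)) (fun u => y ((b - a) * u + a)) 0 1 := by
  have key : ∀ u ∈ Icc (0 : ℝ) 1, (b - a) * u + a ∈ Icc a b := fun u hu => by
    have h1 := mul_nonneg (sub_nonneg.2 hab) hu.1
    have h2 := mul_le_mul_of_nonneg_left hu.2 (sub_nonneg.2 hab)
    constructor <;> linarith
  refine ⟨?_, fun u hu => ?_⟩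
  · rcases hab.eq_or_lt with he | hlt
    · simp [he]
    · have h1 := h.intervalIntegrable ha hb
      have h2 := (h1.comp_add_right a).comp_mul_left (c := b - a)
      rw [sub_self, zero_div, div_self (sub_pos.2 hlt).ne'] at h2
      exact h2.smul (b - a)
  · have hm := key u hu
    have h1 := h.sub_eq ha (⟨ha.1.trans hm.1, hm.2.trans hb.2⟩ : (b - a) * u + a ∈ Icc A B)
    beta_reduce
    rw [mul_zero, zero_add, intervalIntegral.integral_smul,
      intervalIntegral.smul_integral_comp_mul_add, mul_zero, zero_add, ← h1]
    abel

end

namespace System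

variable {n m N M : ℕ} {D : System n m N M} {E : ExtendedTuple n m}
  {V : Type*} [NormedAddCommGroup V] [NormedSpace ℝ V]

section
variable (hc : IsClock E.φ₀ 0 E.S 0 D.h)
include hc

lemma level_Ioc {r : ℝ} (hr : r ∈ Icc 0 D.h) :
    Icc 0 E.S ∩ E.φ₀ ⁻¹' Ioc 0 r = Ioc (D.up E 0) (D.up E r) := by
  have h0 : (0 : ℝ) ∈ Icc 0 D.h := ⟨le_rfl, hc.hS.le⟩
  ext s
  constructor
  · rintro ⟨hs, h1, h2⟩
    exact ⟨not_le.1 fun h => h1.not_ge ((phi0_le_iff hc h0 hs).2 h), (phi0_le_iff hc hr hs).1 h2⟩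
  · rintro ⟨h1, h2⟩
    have hs : s ∈ Icc 0 E.S := ⟨(up_mem hc 0).1.trans h1.le, h2.trans (up_mem hc r).2⟩
    exact ⟨hs, not_le.1 fun h => h1.not_ge ((phi0_le_iff hc h0 hs).1 h),
      (phi0_le_iff hc hr hs).2 h2⟩

lemma up_mono {r r' : ℝ} (h : r ≤ r') : D.up E r ≤ D.up E r' := hc.rightInv_monotone.rightLim h

/-- The contributions of the plateaus to an integral. -/
lemma hasSum_plateaus {F : ℝ → V} (hF : IntegrableOn F (Icc 0 E.S)) {r : ℝ} (hr : r ∈ Icc 0 D.h) :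
    HasSum (fun r' : Ioc 0 r => ∫ s in D.lo E r'..D.up E r', F s)
      ((∫ s in D.up E 0..D.up E r, F s)
        - ∫ s in Icc 0 E.S ∩ E.φ₀ ⁻¹' (Icc 0 r ∩ (D.plat E)ᶜ), F s) := by
  -- The sum over the interval ]0,r] has nonzero terms only at the countably many points of `plat`,
  -- where countable additivity applies.
  set A : Set ℝ := Ioc 0 r ∩ D.plat E with hA
  have hAc : A.Countable := (countable_plat hc).mono inter_subset_right
  have hAsub : ∀ r' ∈ Ioc 0 r, r' ∈ Icc 0 D.h := fun r' h => ⟨h.1.le, h.2.trans hr.2⟩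
  have hp := measurableSet_plat hc
  have : Countable A := hAc.to_subtype
  have hU : ⋃ r' : A, Icc (D.lo E r') (D.up E r') = Icc 0 E.S ∩ E.φ₀ ⁻¹' A := by
    ext s
    simp only [mem_iUnion, Subtype.exists, exists_prop]
    constructor
    · rintro ⟨r', hr', hs⟩
      have hs' : s ∈ Icc 0 E.S := ⟨(lo_mem hc r').1.trans hs.1, hs.2.trans (up_mem hc r').2⟩
      exact ⟨hs', by rw [mem_preimage, phi0_of_mem hc (hAsub _ hr'.1) hs]; exact hr'⟩
    · rintro ⟨hs, hs'⟩
      exact ⟨E.φ₀ s, hs', (phi0_eq_iff hc (hc.mapsTo hs) hs).1 rfl⟩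
  have h1 : HasSum (fun r' : A => ∫ s in Icc (D.lo E r') (D.up E r'), F s)
      (∫ s in Icc 0 E.S ∩ E.φ₀ ⁻¹' A, F s) := by
    rw [← hU]
    refine hasSum_integral_iUnion (fun _ => measurableSet_Icc) ?_ ?_
    · intro a b hab
      refine disjoint_left.2 fun s hs hs' => hab (Subtype.ext ?_)
      rw [← phi0_of_mem hc (hAsub _ a.2.1) hs, phi0_of_mem hc (hAsub _ b.2.1) hs']
    · rw [hU]; exact hF.mono_set inter_subset_left
  have h2 : (∫ s in D.up E 0..D.up E r, F s)
      - ∫ s in Icc 0 E.S ∩ E.φ₀ ⁻¹' (Icc 0 r ∩ (D.plat E)ᶜ), F s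
      = ∫ s in Icc 0 E.S ∩ E.φ₀ ⁻¹' A, F s := by
    have e1 : Icc 0 r ∩ (D.plat E)ᶜ = Ioc 0 r ∩ (D.plat E)ᶜ := by
      ext x
      simp only [mem_inter_iff, mem_compl_iff, mem_Icc, mem_Ioc]
      refine ⟨fun h => ⟨⟨lt_of_le_of_ne h.1.1 ?_, h.1.2⟩, h.2⟩, fun h => ⟨⟨h.1.1.le, h.1.2⟩, h.2⟩⟩
      rintro rfl
      exact h.2 zero_mem_plat
    rw [e1, intervalIntegral.integral_of_le (up_mono hc hr.1), ← level_Ioc hc hr, sub_eq_iff_eq_add,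
      ← setIntegral_union _ (measurableSet_level hc (measurableSet_Ioc.inter hp.compl))
      (hF.mono_set inter_subset_left) (hF.mono_set inter_subset_left), ← inter_union_distrib_left,
      ← preimage_union, ← inter_union_distrib_left, union_compl_self, inter_univ]
    refine disjoint_left.2 ?_
    rintro s ⟨_, h⟩ ⟨_, h'⟩
    exact h'.2 h.2
  rw [h2]
  have h3 : HasSum ((fun r' => ∫ s in D.lo E r'..D.up E r', F s) ∘ ((↑) : A → ℝ))
      (∫ s in Icc 0 E.S ∩ E.φ₀ ⁻¹' A, F s) := by
    convert h1 using 2 with r'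
    rw [Function.comp_apply, intervalIntegral.integral_of_le (lo_le_up hc _),
      integral_Icc_eq_integral_Ioc]
  have h4 : A.indicator (fun r' => ∫ s in D.lo E r'..D.up E r', F s)
      = (Ioc 0 r).indicator fun r' => ∫ s in D.lo E r'..D.up E r', F s := by
    ext x
    by_cases hx : x ∈ Ioc 0 r
    · rw [indicator_of_mem hx]
      by_cases hx' : x ∈ D.plat E
      · rw [indicator_of_mem (show x ∈ A from ⟨hx, hx'⟩)]
      · rw [indicator_of_notMem (show x ∉ A from fun h => hx' h.2), lo_eq_up_of_notMem hc (hAsub x hx) hx',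
          intervalIntegral.integral_same]
    · rw [indicator_of_notMem hx, indicator_of_notMem (show x ∉ A from fun h => hx h.1)]
  rw [hasSum_subtype_iff_indicator, h4, ← hasSum_subtype_iff_indicator] at h3
  exact h3

omit [NormedSpace ℝ V] in
-- When the states come from Construction A, nothing is known yet about their continuity, so
-- measurability of the right-hand side is assembled from the complement of the plateaus and from
-- the countably many plateaus.
lemma aestronglyMeasurable_of_plateaus {F : ℝ → V}
    (h1 : AEStronglyMeasurable F (volume.restrict (Icc 0 E.S ∩ E.φ₀ ⁻¹' (D.plat E)ᶜ)))
    (h2 : ∀ r ∈ Icc 0 D.h, D.lo E r < D.up E r →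
      IntervalIntegrable (fun u => F ((D.up E r - D.lo E r) * u + D.lo E r)) volume 0 1) :
    AEStronglyMeasurable F (volume.restrict (Icc 0 E.S)) := by
  have : Countable (D.plat E) := (countable_plat hc).to_subtype
  have hcov : Icc 0 E.S ⊆ (Icc 0 E.S ∩ E.φ₀ ⁻¹' (D.plat E)ᶜ)
      ∪ ⋃ r : D.plat E, Icc (D.lo E r) (D.up E r) := by
    intro s hs
    by_cases h : E.φ₀ s ∈ D.plat E
    · exact Or.inr (mem_iUnion.2 ⟨⟨_, h⟩, (phi0_eq_iff hc (hc.mapsTo hs) hs).1 rfl⟩)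
    · exact Or.inl ⟨hs, h⟩
  refine AEStronglyMeasurable.mono_set hcov (aestronglyMeasurable_union_iff.2 ⟨h1,
    AEStronglyMeasurable.iUnion fun r => ?_⟩)
  have hr := plat_subset hc r.2
  rcases (lo_le_up hc (r : ℝ)).eq_or_lt with he | hlt
  · rw [← he, Icc_self, Measure.restrict_singleton]; simp
  have hpos := sub_pos.2 hlt
  have h3 := ((h2 r hr hlt).comp_mul_left (c := (D.up E r - D.lo E r)⁻¹)).comp_sub_right (D.lo E r)
  rw [zero_div, one_div, inv_inv, zero_add, sub_add_cancel] at h3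
  have h4 : (fun x => F ((D.up E r - D.lo E r) * ((D.up E r - D.lo E r)⁻¹ *
      (x - D.lo E r)) + D.lo E r)) = F := by
    funext x
    congr 1
    field_simp
    ring
  rw [h4, intervalIntegrable_iff_integrableOn_Icc_of_le hlt.le] at h3
  exact h3.aestronglyMeasurable

omit [NormedSpace ℝ V] in
/-- The left limits of a function that equals `y ∘ σ⁺` on an open period. -/
lemma leftLim_eq {x y : ℝ → V} {l : ℕ} (hy : ContinuousOn y (Icc 0 E.S))
    (hx : ∀ r ∈ Ioo 0 D.h, x (D.start l + r) = y (D.up E r)) {r : ℝ} (hr : r ∈ Ioc 0 D.h) :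
    Function.leftLim x (r + D.start l) = y (D.lo E r) := by
  refine leftLim_eq_of_tendsto ?_
  -- To the left of r, σ⁺ lies between σ and σ⁻(r), so it too has the left limit σ⁻(r).
  have h1 : Tendsto (D.up E) (𝓝[<] r) (𝓝[Icc 0 E.S] (D.lo E r)) := by
    refine tendsto_nhdsWithin_iff.2 ⟨?_, Eventually.of_forall fun r' => up_mem hc r'⟩
    refine tendsto_of_tendsto_of_tendsto_of_le_of_le' (hc.rightInv_monotone.tendsto_leftLim r)
      tendsto_const_nhds (Eventually.of_forall fun r' => hc.rightInv_monotone.le_rightLim le_rfl) ?_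
    filter_upwards [self_mem_nhdsWithin] with r' hr'
    obtain ⟨q, h1, h2⟩ := exists_between (show r' < r from hr')
    exact (hc.rightInv_monotone.rightLim_le h1).trans (hc.rightInv_monotone.le_leftLim h2)
  have h2 : Tendsto (fun r' => y (D.up E r')) (𝓝[<] r) (𝓝 (y (D.lo E r))) :=
    (hy _ (lo_mem hc r)).tendsto.comp h1
  have h3 : Tendsto (fun t => t - D.start l) (𝓝[<] (r + D.start l)) (𝓝[<] r) := by
    refine tendsto_nhdsWithin_iff.2 ⟨?_, ?_⟩
    · have : Tendsto (fun t : ℝ => t - D.start l) (𝓝 (r + D.start l)) (𝓝 (r + D.start l - D.start l)) :=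
        (continuous_sub_right _).tendsto _
      rw [add_sub_cancel_right] at this
      exact this.mono_left nhdsWithin_le_nhds
    · filter_upwards [self_mem_nhdsWithin] with t ht
      have ht : t < r + D.start l := ht
      exact (by linarith : t - D.start l < r)
  refine (h2.comp h3).congr' ?_
  filter_upwards [Ioo_mem_nhdsLT (show D.start l < r + D.start l by linarith [hr.1])] with t ht
  rw [Function.comp_apply, ← hx _ ⟨by linarith [ht.1], by linarith [ht.2, hr.2]⟩]
  congr 1; ring

/-- A function given by the evolution off the plateaus and by the jumps on the plateaus solves the
differential equation of the extended process. -/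
lemma solvesOn_of_jumps {F y x : ℝ → V} {Z : ℝ → ℝ → V} {l : ℕ} (hF : IntegrableOn F (Icc 0 E.S))
    (h0 : ∀ r ∈ Icc 0 D.h, ∀ u ∈ Icc (0 : ℝ) 1, Z r u = Z r 0 + ∫ u' in (0 : ℝ)..u,
      (D.up E r - D.lo E r) • F ((D.up E r - D.lo E r) * u' + D.lo E r))
    (h1 : ∀ r ∈ Ioc 0 D.h, Z r 0 = Function.leftLim x (r + D.start l))
    (h2 : ∀ r ∈ Ioo 0 D.h, x (D.start l + r) = Z 0 1 + ∫ s in D.up E 0..D.up E r, F s)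
    (hy0 : y 0 = Z 0 0)
    (hoff : ∀ s ∈ Icc 0 E.S, E.φ₀ s ∉ D.plat E → y s = x (D.start l + E.φ₀ s))
    (hyS : y E.S = Z D.h 1)
    (hon : ∀ r ∈ Icc 0 D.h, D.lo E r < D.up E r → ∀ s ∈ Icc (D.lo E r) (D.up E r),
      y s = Z r ((s - D.lo E r) / (D.up E r - D.lo E r))) :
    SolvesOn F y 0 E.S ∧ ∀ r ∈ Icc 0 D.h, Z r 1 = y (D.up E r) := by
  have hi : IntervalIntegrable F volume 0 E.S := by
    rwa [intervalIntegrable_iff_integrableOn_Icc_of_le hc.hT.le]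
  -- The primitive Y is the expected solution. The jump at 0 starts on Y, hence x is the composite
  -- of Y with σ⁺ inside the period; its left limits then show that every jump starts on Y, and y =
  -- Y follows on and off the plateaus.
  set Y : ℝ → V := fun s => y 0 + ∫ s' in (0 : ℝ)..s, F s' with hY
  have hYs : SolvesOn F Y 0 E.S := ⟨hi, fun s _ => by simp [hY]⟩
  have h00 : (0 : ℝ) ∈ Icc 0 D.h := ⟨le_rfl, hc.hS.le⟩
  have hz : ∀ r ∈ Icc 0 D.h, Z r 0 = Y (D.lo E r) → ∀ u ∈ Icc (0 : ℝ) 1,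
      Z r u = Y ((D.up E r - D.lo E r) * u + D.lo E r) := by
    intro r hr e u hu
    have := (hYs.affine (lo_mem hc r) (up_mem hc r) (lo_le_up hc r)).2 u hu
    beta_reduce at this
    rw [h0 r hr u hu, this, mul_zero, zero_add, e]
  have hz0 : Z 0 0 = Y (D.lo E 0) := by simp [hY, lo_zero hc, hy0]
  have h01 : Z 0 1 = Y (D.up E 0) := by
    rw [hz 0 h00 hz0 1 ⟨zero_le_one, le_rfl⟩]; congr 1; ring
  have hx : ∀ r ∈ Ioo 0 D.h, x (D.start l + r) = Y (D.up E r) := by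
    intro r hr
    rw [h2 r hr, h01, ← hYs.sub_eq (up_mem hc 0) (up_mem hc r)]
    abel
  have hzr : ∀ r ∈ Icc 0 D.h, Z r 0 = Y (D.lo E r) := by
    intro r hr
    rcases hr.1.eq_or_lt with h | h
    · rw [← h]; exact hz0
    · rw [h1 r ⟨h, hr.2⟩, leftLim_eq hc (hYs.continuousOn hc.hT.le) hx ⟨h, hr.2⟩]
  have hz1 : ∀ r ∈ Icc 0 D.h, Z r 1 = Y (D.up E r) := by
    intro r hr
    rw [hz r hr (hzr r hr) 1 ⟨zero_le_one, le_rfl⟩]; congr 1; ring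
  have hyY : ∀ s ∈ Icc 0 E.S, y s = Y s := by
    intro s hs
    have hr := hc.mapsTo hs
    have hm := (phi0_eq_iff hc hr hs).1 rfl
    rcases (lo_le_up hc (E.φ₀ s)).eq_or_lt with h | h
    · have hsu : s = D.up E (E.φ₀ s) := le_antisymm hm.2 (h ▸ hm.1)
      rcases hs.1.eq_or_lt with h' | h'
      · rw [← h']; simp [hY]
      rcases hs.2.eq_or_lt with h'' | h''
      · rw [h'', hyS, hz1 _ ⟨hc.hS.le, le_rfl⟩, up_end hc]
      have hn : E.φ₀ s ∉ D.plat E := by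
        rintro (hp | hp | hp)
        · exact hp.2.ne h
        · rw [hp, lo_zero hc] at h
          rw [hp, ← h] at hsu
          exact h'.ne' hsu
        · have hp : E.φ₀ s = D.h := hp
          rw [hp, up_end hc] at hsu
          exact h''.ne hsu
      rw [hoff s hs hn, hx _ (mem_Ioo_of_notMem_plat hr hn), ← hsu]
    · rw [hon _ hr h s hm, hz _ hr (hzr _ hr) _ ⟨div_nonneg (by linarith [hm.1]) (by linarith),
        (div_le_one (by linarith)).2 (by linarith [hm.2])⟩, mul_div_cancel₀ _ (sub_pos.2 h).ne',
        sub_add_cancel]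
  refine ⟨⟨hi, fun s hs => hyY s hs⟩, fun r hr => ?_⟩
  rw [hz1 r hr, hyY _ (up_mem hc r)]

end

end System

/-! ### Right-hand sides of the state equations on and off the plateaus -/

lemma exists_measurable_of_boundedVariationOn {n : ℕ} {x : ℝ → State n} {a b : ℝ}
    (hx : BoundedVariationOn x (Icc a b)) : ∃ X : ℝ → State n, Measurable X ∧ EqOn X x (Icc a b) := by
  have key : ∀ i : Fin n, ∃ X : ℝ → ℝ, Measurable X ∧ EqOn X (fun t => x t i) (Icc a b) := by
    intro i
    have h1 : BoundedVariationOn (fun t => x t i) (Icc a b) :=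
      (LipschitzWith.of_dist_le_mul (K := 1) (f := fun w : State n => w i) fun u w => by
        simpa [dist_eq_norm] using PiLp.norm_apply_le (u - w) i).comp_boundedVariationOn hx
    -- A component of bounded variation is a difference of two increasing functions on [a,b], and
    -- each of them extends to an increasing function on the line. The given x is arbitrary outside
    -- its interval and need not be measurable there.
    obtain ⟨p, q, hp, hq, e⟩ := h1.locallyBoundedVariationOn.exists_monotoneOn_sub_monotoneOn
    rcases lt_or_ge b a with hab | hab
    · exact ⟨0, measurable_zero, by simp [Icc_eq_empty hab.not_ge]⟩
    have ext : ∀ p : ℝ → ℝ, MonotoneOn p (Icc a b) → ∃ g, Monotone g ∧ EqOn p g (Icc a b) :=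
      fun p hp => hp.exists_monotone_extension
        ⟨p a, forall_mem_image.2 fun t ht => hp ⟨le_rfl, hab⟩ ht ht.1⟩
        ⟨p b, forall_mem_image.2 fun t ht => hp ht ⟨hab, le_rfl⟩ ht.2⟩
    obtain ⟨p', hp', ep⟩ := ext p hp
    obtain ⟨q', hq', eq⟩ := ext q hq
    refine ⟨p' - q', hp'.measurable.sub hq'.measurable, fun t ht => ?_⟩
    have := congrFun e t
    exact (by rw [this, Pi.sub_apply, ep ht, eq ht] : p' t - q' t = x t i)
  choose X hX hXe using key
  refine ⟨fun t => WithLp.toLp 2 fun i => X i t, ?_, fun t ht => ?_⟩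
  · exact (WithLp.measurable_toLp 2 _).comp (measurable_pi_iff.2 hX)
  · ext i
    exact hXe i ht

namespace System

variable {n m N M : ℕ} {D : System n m N M} {E : ExtendedTuple n m} {P : ImpulseTuple n m}
  {ζ : ℕ → ℝ → ℝ → State n} {θ : ℕ → ℝ → ℝ → ℝ}

variable (D) in
/-- The right-hand side of the equation for `y_l`. -/
def field (E : ExtendedTuple n m) (l : ℕ) (s : ℝ) : State n :=
  deriv E.φ₀ s • D.f (E.τ l s) (fun k => D.backState E l k s)
    + ∑ j, deriv (E.φ l) s j • D.g j (E.τ l s) (fun k => D.backState E l k s)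

variable (D) in
/-- The states of `E` are those of `P` off the plateaus, and those of the jumps `ζ, θ` on the
plateaus. -/
structure Matches (E : ExtendedTuple n m) (P : ImpulseTuple n m) (ζ : ℕ → ℝ → ℝ → State n)
    (θ : ℕ → ℝ → ℝ → ℝ) : Prop where
  off : ∀ l ∈ Icc 1 N, ∀ s ∈ Icc 0 E.S, E.φ₀ s ∉ D.plat E →
    E.y l s = P.x (D.start l + E.φ₀ s) ∧ E.β l s = P.v (D.start l + E.φ₀ s)
  on : ∀ l ∈ Icc 1 N, ∀ r ∈ Icc 0 D.h, D.lo E r < D.up E r → ∀ s ∈ Icc (D.lo E r) (D.up E r),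
    E.y l s = ζ l r ((s - D.lo E r) / (D.up E r - D.lo E r)) ∧
    E.β l s = θ l r ((s - D.lo E r) / (D.up E r - D.lo E r))
  hist : ∀ t ∈ Ico (-(M * D.h)) 0, P.x t = D.ξ t
  bv : BoundedVariationOn P.x (Icc 0 D.T)

section

variable (hD : D.Standing) (hK : D.IsCanonicalControl E) (hL : D.ControlOf E P)
  (hτ : ∀ l ∈ Icc 1 N, ∀ s ∈ Icc 0 E.S, E.τ l s = D.start l + E.φ₀ s)
  (hM : D.Matches E P ζ θ)
include hD hK hτ hM

include hL in
/-- On the plateaus the equation for `y_l` is the rescaled equation for the jumps. -/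
lemma Matches.field_ae {l : ℕ} (hl : l ∈ Icc 1 N) {r : ℝ} (hr : r ∈ Icc 0 D.h) :
    ∀ᵐ u ∂volume.restrict (Icc (0 : ℝ) 1),
      ∑ j, P.ω r l u j • D.g j (r + D.start l) (fun k => D.backJump ζ l k r u)
        = (D.up E r - D.lo E r) • D.field E l ((D.up E r - D.lo E r) * u + D.lo E r) := by
  have hc := IsCanonicalControl.clk hK.ctl hD
  rcases (lo_le_up hc r).eq_or_lt with he | hlt
  · filter_upwards [hL.ω_eq r hr l hl] with u hu
    simp [hu, he]
  have hd := ae_unit_of_ae_Icc hlt (IsCanonicalControl.deriv_phi0_plateau hK.ctl hD hr)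
  -- Excluding u = 1 avoids the exceptional value ζ^h_0(1), which is the initial state and not a
  -- value of the history.
  have h1 : ∀ᵐ u ∂volume.restrict (Icc (0 : ℝ) 1), u ≠ 1 :=
    ae_restrict_of_ae (by simp [ae_iff])
  filter_upwards [hL.ω_eq r hr l hl, hd, h1, ae_restrict_mem measurableSet_Icc] with u h2 h3 h4 hu
  have hp := sub_pos.2 hlt
  have hs : (D.up E r - D.lo E r) * u + D.lo E r ∈ Icc (D.lo E r) (D.up E r) :=
    ⟨by nlinarith [hu.1], by nlinarith [hu.2]⟩
  have hs' : (D.up E r - D.lo E r) * u + D.lo E r ∈ Icc 0 E.S :=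
    ⟨(lo_mem hc r).1.trans hs.1, hs.2.trans (up_mem hc r).2⟩
  have hφ := phi0_of_mem hc hr hs
  have hb : (fun k : Fin (M + 1) => D.backState E l k ((D.up E r - D.lo E r) * u + D.lo E r))
      = fun k : Fin (M + 1) => D.backJump ζ l k r u := by
    funext k
    unfold backState backJump
    split_ifs with hk
    · rw [(hM.on (l - k) ⟨by omega, by have := hl.2; omega⟩ r hr hlt _ hs).1]
      congr 1
      field_simp
      ring
    · rw [hτ 1 ⟨le_rfl, hD.one_le_N⟩ _ hs', hφ, start_one, zero_add, histJump, if_neg fun h => h4 h.2.2]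
  rw [field, h3, zero_smul, zero_add, hτ l hl _ hs', hφ, hb, add_comm (D.start l), Finset.smul_sum]
  refine Finset.sum_congr rfl fun j _ => ?_
  rw [h2, Pi.smul_apply, smul_eq_mul, mul_smul]

/-- The delayed states off the plateaus. -/
lemma Matches.backState_eq {l : ℕ} (hl : l ∈ Icc 1 N) {s : ℝ} (hs : s ∈ Icc 0 E.S)
    (h : E.φ₀ s ∉ D.plat E) :
    (fun k : Fin (M + 1) => D.backState E l k s) = D.delayed P.x (D.start l + E.φ₀ s) := by
  have hc := IsCanonicalControl.clk hK.ctl hD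
  have hφ := mem_Ioo_of_notMem_plat (hc.mapsTo hs) h
  funext k
  unfold backState delayed
  split_ifs with hk
  · rw [(hM.off (l - k) ⟨by omega, by have := hl.2; omega⟩ s hs h).1, start, start, Nat.cast_sub hk.le]
    congr 1; ring
  · have hk' : l ≤ k := not_lt.1 hk
    -- Off `plat` one has φ₀(s) < h, so the delayed time is strictly negative and x equals the
    -- history there. At time 0 this could fail, since the initial state need not be ξ₀(0).
    have e : D.start l + E.φ₀ s - k * D.h = E.φ₀ s - ((((k : ℕ) - l : ℕ) : ℝ) + 1) * D.h := by
      rw [start, Nat.cast_sub hk']; ring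
    rw [hτ 1 ⟨le_rfl, hD.one_le_N⟩ _ hs, start_one, zero_add, e, hM.hist]
    have h1 : ((((k : ℕ) - l : ℕ) : ℝ) + 1) ≤ M := by
      have := k.2
      have := hl.1
      exact_mod_cast (by omega : (k : ℕ) - l + 1 ≤ M)
    have h2 : (1 : ℝ) ≤ ((((k : ℕ) - l : ℕ) : ℝ) + 1) := by
      have : (0 : ℝ) ≤ (((k : ℕ) - l : ℕ) : ℝ) := Nat.cast_nonneg _
      linarith
    have h3 := mul_le_mul_of_nonneg_right h1 hD.h_pos.le
    have h4 := mul_le_mul_of_nonneg_right h2 hD.h_pos.le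
    exact ⟨by linarith [hφ.1], by linarith [hφ.2]⟩

lemma Matches.field_off {l : ℕ} (hl : l ∈ Icc 1 N) {s : ℝ} (hs : s ∈ Icc 0 E.S)
    (h : E.φ₀ s ∉ D.plat E) : D.field E l s
      = deriv E.φ₀ s • D.f (D.start l + E.φ₀ s) (D.delayed P.x (D.start l + E.φ₀ s))
        + ∑ j, deriv (E.φ l) s j •
          D.g j (D.start l + E.φ₀ s) (D.delayed P.x (D.start l + E.φ₀ s)) := by
  rw [field, hM.backState_eq hD hK hτ hl hs h, hτ l hl s hs]

omit hK hτ in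
/-- The trajectory has a measurable modification. -/
lemma Matches.exists_measurable : ∃ X : ℝ → State n, Measurable X ∧
    ∀ t ∈ Icc 0 D.T, D.delayed (M := M) X t = D.delayed P.x t := by
  obtain ⟨X, hX, e⟩ := exists_measurable_of_boundedVariationOn hM.bv
  have h0 : -(M * D.h) ≤ (0 : ℝ) := neg_nonpos.2 (mul_nonneg (Nat.cast_nonneg _) hD.h_pos.le)
  have hξ : Continuous fun t => D.ξ (projIcc (-(M * D.h)) 0 h0 t) :=
    hD.ξ_cont.domRestrict.comp continuous_projIcc
  refine ⟨fun t => if t < 0 then D.ξ (projIcc (-(M * D.h)) 0 h0 t) else X t,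
    Measurable.ite measurableSet_Iio hξ.measurable hX, fun t ht => ?_⟩
  funext k
  simp only [delayed]
  have hk : (k : ℝ) ≤ M := by have := k.2; exact_mod_cast (by omega : (k : ℕ) ≤ M)
  have h1 := mul_le_mul_of_nonneg_right hk hD.h_pos.le
  have h2 : 0 ≤ (k : ℝ) * D.h := mul_nonneg (Nat.cast_nonneg _) hD.h_pos.le
  have h3 := ht.1
  have h4 := ht.2
  split_ifs with h
  · have hm : t - k * D.h ∈ Ico (-(M * D.h)) 0 := ⟨by linarith, h⟩
    rw [projIcc_of_mem h0 (Ico_subset_Icc_self hm), hM.hist _ hm]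
  · exact e ⟨not_lt.1 h, by linarith⟩

omit hD hK hτ hM in
lemma measurable_comp_delayed {F : ℝ → (Fin (M + 1) → State n) → State n}
    (hF : ContDiff ℝ 1 (fun p : ℝ × (Fin (M + 1) → State n) => F p.1 p.2)) {X : ℝ → State n}
    (hX : Measurable X) : StronglyMeasurable fun t => F t (D.delayed X t) := by
  have hm : Measurable fun t : ℝ => (t, D.delayed (M := M) X t) :=
    measurable_id.prodMk (measurable_pi_iff.2 fun k => hX.comp (measurable_id.sub_const _))
  exact (hF.continuous.measurable.comp hm).stronglyMeasurable

end

end System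

/-! ### Change of variables in the state equation off the plateaus -/

namespace System

variable {n m N M : ℕ} {D : System n m N M} {E : ExtendedTuple n m} {P : ImpulseTuple n m}
  {ζ : ℕ → ℝ → ℝ → State n} {θ : ℕ → ℝ → ℝ → ℝ}

lemma integrable_smul_of_bound {α V : Type*} [MeasurableSpace α] [NormedAddCommGroup V] [NormedSpace ℝ V]
    {κ : Measure α} {c : α → ℝ} {F : α → V} (hc : Integrable c κ) (hF : AEStronglyMeasurable F κ)
    {C : ℝ} (hC : ∀ s, ‖F s‖ ≤ C) : Integrable (fun s => c s • F s) κ :=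
  hc.smul_of_top_left (memLp_top_of_bound hF C (Eventually.of_forall hC))

lemma start_add_mem (hD : D.Standing) {l : ℕ} (hl : l ∈ Icc 1 N) :
    ∀ r ∈ Icc 0 D.h, D.start l + r ∈ Icc 0 D.T := by
  intro r hr
  have hlN : (l : ℝ) ≤ N := by exact_mod_cast hl.2
  have hl1 : (1 : ℝ) ≤ l := by exact_mod_cast hl.1
  refine ⟨add_nonneg (mul_nonneg (by linarith) hD.h_pos.le) hr.1, ?_⟩
  have h1 : (l : ℝ) * D.h ≤ N * D.h := mul_le_mul_of_nonneg_right hlN hD.h_pos.le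
  have := start_add_h (D := D) l
  unfold T
  linarith [hr.2]

variable (hD : D.Standing) (hK : D.IsCanonicalControl E)
include hD hK

/-- The part of a period off the knots, in terms of the measure without atoms. -/
lemma setIntegral_offBase {V : Type*} [NormedAddCommGroup V] [NormedSpace ℝ V] {f : ℕ × ℝ → V}
    (hf : ∀ l ∈ Icc 1 N, IntegrableOn (fun s => f (l, s)) (Icc 0 E.S)) {l : ℕ} (hl : l ∈ Icc 1 N)
    {r : ℝ} (hr : r ∈ Ico 0 D.h) :
    ∫ p in D.clock E ⁻¹' Icc (D.start l) (D.start l + r), f p ∂D.offBase E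
      = ∫ s in Icc 0 E.S ∩ E.φ₀ ⁻¹' (Icc 0 r ∩ (D.plat E)ᶜ), f (l, s) := by
  have hc := IsCanonicalControl.clk hK.ctl hD
  have hm1 := measurable_clock hc
    (measurableSet_Icc : MeasurableSet (Icc (D.start l) (D.start l + r)))
  have hm2 := measurable_clock hc (measurableSet_knots hc).compl
  rw [offBase, Measure.restrict_restrict hm1, setIntegral_base hf (hm1.inter hm2)]
  have key : ∀ k ∈ Icc 1 N, Icc 0 E.S ∩ {s | (k, s) ∈ D.clock E ⁻¹' Icc (D.start l) (D.start l + r)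
      ∩ D.clock E ⁻¹' (D.knots E)ᶜ} = if k = l then
        Icc 0 E.S ∩ E.φ₀ ⁻¹' (Icc 0 r ∩ (D.plat E)ᶜ) else ∅ := by
    intro k hk
    ext s
    by_cases hs : s ∈ Icc 0 E.S
    swap
    · split_ifs <;> simp [hs]
    have hφ := hc.mapsTo hs
    simp only [mem_inter_iff, hs, true_and, mem_ofPred_eq, mem_preimage, clock_eq hs, mem_compl_iff,
      mem_knots_iff hc hk hφ]
    split_ifs with hkl
    · subst hkl
      simp only [mem_inter_iff, hs, true_and, mem_preimage, mem_compl_iff, mem_Icc]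
      constructor
      · rintro ⟨⟨h1, h2⟩, h3⟩; exact ⟨⟨by linarith, by linarith⟩, h3⟩
      · rintro ⟨⟨h1, h2⟩, h3⟩; exact ⟨⟨by linarith, by linarith⟩, h3⟩
    · simp only [mem_empty_iff_false, iff_false, not_and, not_not]
      rintro ⟨h1, h2⟩
      by_contra h3
      refine hkl ((start_add_inj hc.hS (k := l) (u := D.start k + E.φ₀ s - D.start l)
        ⟨by linarith, by linarith [hr.2]⟩ (mem_Ioo_of_notMem_plat hφ h3)).1 (by ring)).1.symm
  rw [Finset.sum_eq_single l]
  · rw [key l hl, if_pos rfl]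
  · intro k hk hkl
    rw [key k (Finset.mem_Icc.1 hk), if_neg hkl]; simp
  · intro h; exact absurd (Finset.mem_Icc.2 hl) h

lemma ControlOf.contPart_ν (hL : D.ControlOf E P) {l : ℕ} (hl : l ∈ Icc 1 N) {r : ℝ}
    (hr : r ∈ Ico 0 D.h) : (contPart P.ν).real (Icc (D.start l) (D.start l + r))
      = ∫ s in Icc 0 E.S ∩ E.φ₀ ⁻¹' (Icc 0 r ∩ (D.plat E)ᶜ), norm1 (deriv (E.φ l) s) := by
  have hc := IsCanonicalControl.clk hK.ctl hD
  rw [hL.ν_eq, contPart_pushN hD hK.ctl, DelayImpulse.pushN_real (measurable_clock hc)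
    (integrable_rate_off hK.ctl) measurableSet_Icc]
  exact setIntegral_offBase hD hK (f := fun p => norm1 (rate E p))
    (fun l hl => integrable_norm1 (IsCanonicalControl.integrableOn_rate hK.ctl hl)) hl hr

variable (hL : D.ControlOf E P)
  (hτ : ∀ l ∈ Icc 1 N, ∀ s ∈ Icc 0 E.S, E.τ l s = D.start l + E.φ₀ s)
  (hM : D.Matches E P ζ θ)
include hτ hM

omit hτ in
-- The substitution t = (l-1)h + φ₀(s) has Jacobian φ₀', and the removed set `plat` is countable,
-- hence null in the variable t. A measurable modification of x makes the substitution legitimate.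
lemma Matches.integral_drift {l : ℕ} (hl : l ∈ Icc 1 N) {r : ℝ} (hr : r ∈ Ico 0 D.h) :
    ∫ s in Icc 0 E.S ∩ E.φ₀ ⁻¹' (Icc 0 r ∩ (D.plat E)ᶜ), deriv E.φ₀ s •
        D.f (D.start l + E.φ₀ s) (D.delayed P.x (D.start l + E.φ₀ s))
      = ∫ t in D.start l..D.start l + r, D.f t (D.delayed P.x t) := by
  have hc := IsCanonicalControl.clk hK.ctl hD
  obtain ⟨X, hX, hXe⟩ := hM.exists_measurable hD
  have hst := start_add_mem hD hl
  have hsm : StronglyMeasurable fun u => D.f (D.start l + u) (D.delayed X (D.start l + u)) :=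
    (measurable_comp_delayed hD.f_smooth hX).comp_measurable (measurable_const_add _)
  have h1 := IsCanonicalControl.integral_deriv_phi0_smul hK.ctl hD hsm
    (measurableSet_Icc.inter (measurableSet_plat hc).compl : MeasurableSet (Icc 0 r ∩ (D.plat E)ᶜ))
  calc _ = ∫ s in Icc 0 E.S ∩ E.φ₀ ⁻¹' (Icc 0 r ∩ (D.plat E)ᶜ), deriv E.φ₀ s •
        D.f (D.start l + E.φ₀ s) (D.delayed X (D.start l + E.φ₀ s)) := by
        refine setIntegral_congr_fun (measurableSet_level hc (measurableSet_Icc.inter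
          (measurableSet_plat hc).compl)) fun s hs => ?_
        rw [hXe _ (hst _ (hc.mapsTo hs.1))]
    _ = ∫ u in Icc 0 r, D.f (D.start l + u) (D.delayed X (D.start l + u)) := by
        rw [h1]
        refine setIntegral_congr_set ?_
        have h2 : (Icc 0 D.h ∩ (Icc 0 r ∩ (D.plat E)ᶜ)) = Icc 0 r \ D.plat E := by
          ext u
          simp only [mem_inter_iff, mem_Icc, mem_compl_iff, Set.mem_sdiff]
          exact ⟨fun h => h.2, fun h => ⟨⟨h.1.1, h.1.2.trans hr.2.le⟩, h⟩⟩
        rw [h2]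
        exact sdiff_null_ae_eq_self ((countable_plat hc).measure_zero _)
    _ = ∫ t in D.start l..D.start l + r, D.f t (D.delayed X t) := by
        rw [integral_Icc_eq_integral_Ioc, ← intervalIntegral.integral_of_le hr.1,
          intervalIntegral.integral_comp_add_left (fun t => D.f t (D.delayed X t)), add_zero]
    _ = _ := by
        refine intervalIntegral.integral_congr fun t ht => ?_
        rw [uIcc_of_le (by linarith [hr.1])] at ht
        have := hst (t - D.start l) ⟨by linarith [ht.1], by linarith [ht.2, hr.2]⟩
        rw [add_sub_cancel] at this
        rw [hXe _ this]

omit hτ in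
include hL in
-- Since μᶜ is the image under the clock of the rates off the knots, integration against it pulls
-- back to s with the rate as weight.
lemma Matches.integral_control {l : ℕ} (hl : l ∈ Icc 1 N) {r : ℝ} (hr : r ∈ Ico 0 D.h) (j : Fin m) :
    ∫ s in Icc 0 E.S ∩ E.φ₀ ⁻¹' (Icc 0 r ∩ (D.plat E)ᶜ), deriv (E.φ l) s j •
        D.g j (D.start l + E.φ₀ s) (D.delayed P.x (D.start l + E.φ₀ s))
      = ∫ᵛ t in Icc (D.start l) (D.start l + r), D.g j t (D.delayed P.x t) ∂<•(P.μ.cont j) := by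
  have hc := IsCanonicalControl.clk hK.ctl hD
  obtain ⟨X, hX, hXe⟩ := hM.exists_measurable hD
  obtain ⟨C, hC⟩ := hD.g_bounded j
  have hst := start_add_mem hD hl
  have hsm := measurable_comp_delayed (D := D) (hD.g_smooth j) hX
  have hint : ∀ k ∈ Icc 1 N, IntegrableOn (fun s => rate E (k, s) j •
      D.g j (D.clock E (k, s)) (D.delayed X (D.clock E (k, s)))) (Icc 0 E.S) := by
    intro k hk
    refine integrable_smul_of_bound ?_ (hsm.comp_measurable ((measurable_clock hc).comp measurable_prodMk_left)).aestronglyMeasurable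
      (fun s => hC _ _)
    exact (IsCanonicalControl.integrableOn_rate hK.ctl hk).eval j
  have h1 : ∫ᵛ t in Icc (D.start l) (D.start l + r), D.g j t (D.delayed P.x t) ∂<•(P.μ.cont j)
      = ∫ᵛ t in Icc (D.start l) (D.start l + r), D.g j t (D.delayed X t) ∂<•(P.μ.cont j) := by
    refine VectorMeasure.setIntegral_congr_ae (Eventually.of_forall fun t ht => ?_)
    have := hst (t - D.start l) ⟨by linarith [ht.1], by linarith [ht.2, hr.2]⟩
    rw [add_sub_cancel] at this
    rw [hXe _ this]
  rw [h1, hL.μ_eq, pushV_cont hD hK.ctl, setIntegral_pushV (measurable_clock hc)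
    (integrable_rate_off hK.ctl) hsm (fun t => hC _ _) j measurableSet_Icc,
    setIntegral_offBase hD hK hint hl hr]
  refine setIntegral_congr_fun (measurableSet_level hc (measurableSet_Icc.inter
    (measurableSet_plat hc).compl)) fun s hs => ?_
  rw [clock_eq hs.1, hXe _ (hst _ (hc.mapsTo hs.1)), rate]

include hL in
/-- The evolution off the plateaus, as an integral over a period. -/
lemma Matches.integral_field {l : ℕ} (hl : l ∈ Icc 1 N) {r : ℝ} (hr : r ∈ Ico 0 D.h) :
    ∫ s in Icc 0 E.S ∩ E.φ₀ ⁻¹' (Icc 0 r ∩ (D.plat E)ᶜ), D.field E l s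
      = (∫ t in D.start l..D.start l + r, D.f t (D.delayed P.x t))
        + ∑ j, ∫ᵛ t in Icc (D.start l) (D.start l + r), D.g j t (D.delayed P.x t) ∂<•(P.μ.cont j) := by
  have hc := IsCanonicalControl.clk hK.ctl hD
  obtain ⟨X, hX, hXe⟩ := hM.exists_measurable hD
  obtain ⟨C, hC⟩ := hD.f_bounded
  have hst := start_add_mem hD hl
  have hms := measurableSet_level hc (measurableSet_Icc.inter
    (measurableSet_plat hc).compl : MeasurableSet (Icc 0 r ∩ (D.plat E)ᶜ))
  have hcl : Measurable fun s => D.clock E (l, s) := (measurable_clock hc).comp measurable_prodMk_left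
  have h1 : ∀ j, IntegrableOn (fun s => deriv (E.φ l) s j •
      D.g j (D.start l + E.φ₀ s) (D.delayed P.x (D.start l + E.φ₀ s)))
      (Icc 0 E.S ∩ E.φ₀ ⁻¹' (Icc 0 r ∩ (D.plat E)ᶜ)) := by
    intro j
    obtain ⟨C, hC⟩ := hD.g_bounded j
    have : IntegrableOn (fun s => deriv (E.φ l) s j •
        D.g j (D.clock E (l, s)) (D.delayed X (D.clock E (l, s)))) (Icc 0 E.S) :=
      integrable_smul_of_bound ((IsCanonicalControl.integrableOn_rate hK.ctl hl).eval j)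
        ((measurable_comp_delayed (hD.g_smooth j) hX).comp_measurable hcl).aestronglyMeasurable
        fun s => hC _ _
    refine (this.mono_set inter_subset_left).congr_fun (fun s hs => ?_) hms
    simp only
    rw [clock_eq hs.1, hXe _ (hst _ (hc.mapsTo hs.1))]
  rw [setIntegral_congr_fun hms fun s hs => hM.field_off hD hK hτ hl hs.1 hs.2.2, integral_add,
    integral_finsetSum _ fun j _ => h1 j]
  · rw [hM.integral_drift hD hK hl hr]
    congr 1
    exact Finset.sum_congr rfl fun j _ => hM.integral_control hD hK hL hl hr j
  · have : IntegrableOn (fun s => deriv E.φ₀ s •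
        D.f (D.clock E (l, s)) (D.delayed X (D.clock E (l, s)))) (Icc 0 E.S) :=
      integrable_smul_of_bound (IsCanonicalControl.integrableOn_deriv_phi0 hK.ctl)
        ((measurable_comp_delayed hD.f_smooth hX).comp_measurable hcl).aestronglyMeasurable
        fun s => hC _ _
    refine (this.mono_set inter_subset_left).congr_fun (fun s hs => ?_) hms
    simp only
    rw [clock_eq hs.1, hXe _ (hst _ (hc.mapsTo hs.1))]
  · exact integrable_finsetSum _ fun j _ => h1 j

omit hM hτ in
-- Unit speed bounds φ₀' and every component of the rates by one, so the bounds of f and of the g_j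
-- bound the right-hand side.
lemma norm_field_le : ∃ C : ℝ, ∀ l ∈ Icc 1 N, ∀ᵐ s ∂volume.restrict (Icc 0 E.S),
    ‖D.field E l s‖ ≤ C := by
  obtain ⟨C, hC⟩ := hD.f_bounded
  choose G hG using hD.g_bounded
  refine ⟨C + ∑ j, G j, fun l hl => ?_⟩
  filter_upwards [hK.speed_le hl, hK.deriv_phi0_le, IsCanonicalControl.deriv_phi0_nonneg hK.ctl]
    with s h1 h2 h3
  refine (norm_add_le _ _).trans (add_le_add ?_ ((norm_sum_le _ _).trans
    (Finset.sum_le_sum fun j _ => ?_)))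
  · rw [norm_smul, Real.norm_of_nonneg h3]
    exact (mul_le_of_le_one_left (norm_nonneg _) h2).trans (hC _ _)
  · rw [norm_smul]
    exact (mul_le_of_le_one_left (norm_nonneg _) ((abs_le_norm1 _ j).trans h1)).trans (hG _ _ _)

include hL in
-- The bound is given by `norm_field_le`, so only measurability is at stake: off the plateaus it
-- comes from the measurable modification of x, on a plateau from the integrability contained in the
-- jump equation.
lemma Matches.integrable_field {l : ℕ} (hl : l ∈ Icc 1 N)
    (hζ : ∀ r ∈ Icc 0 D.h, IntervalIntegrable (fun u => ∑ j, P.ω r l u j •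
      D.g j (r + D.start l) (fun k => D.backJump ζ l k r u)) volume 0 1) :
    IntegrableOn (D.field E l) (Icc 0 E.S) := by
  have hc := IsCanonicalControl.clk hK.ctl hD
  obtain ⟨X, hX, hXe⟩ := hM.exists_measurable hD
  have hst := start_add_mem hD hl
  obtain ⟨C, hC⟩ := norm_field_le hD hK
  have hp := measurableSet_plat hc
  refine Integrable.of_bound ?_ C (hC l hl)
  refine aestronglyMeasurable_of_plateaus hc ?_ fun r hr hlt => ?_
  · have hms := measurableSet_level hc hp.compl
    have hcl : Measurable fun s => D.clock E (l, s) :=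
      (measurable_clock hc).comp measurable_prodMk_left
    have hsm : StronglyMeasurable fun s =>
        deriv E.φ₀ s • D.f (D.clock E (l, s)) (D.delayed X (D.clock E (l, s)))
        + ∑ j, deriv (E.φ l) s j • D.g j (D.clock E (l, s)) (D.delayed X (D.clock E (l, s))) := by
      refine StronglyMeasurable.add ?_ (Finset.stronglyMeasurable_fun_sum _ fun j _ => ?_)
      · exact (measurable_deriv E.φ₀).stronglyMeasurable.smul
          ((measurable_comp_delayed hD.f_smooth hX).comp_measurable hcl)
      · exact ((measurable_pi_apply j).comp (measurable_deriv (E.φ l))).stronglyMeasurable.smul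
          ((measurable_comp_delayed (hD.g_smooth j) hX).comp_measurable hcl)
    refine hsm.aestronglyMeasurable.congr ((ae_restrict_mem hms).mono fun s hs => ?_)
    beta_reduce
    rw [hM.field_off hD hK hτ hl hs.1 hs.2, clock_eq hs.1, hXe _ (hst _ (hc.mapsTo hs.1))]
  · have h1 : IntervalIntegrable (fun u => (D.up E r - D.lo E r) •
        D.field E l ((D.up E r - D.lo E r) * u + D.lo E r)) volume 0 1 := by
      refine (hζ r hr).congr_ae ?_
      rw [uIoc_of_le zero_le_one]
      exact ae_mono (Measure.restrict_mono Ioc_subset_Icc_self le_rfl)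
        (hM.field_ae hD hK hL hτ hl hr)
    refine (h1.smul (D.up E r - D.lo E r)⁻¹).congr_ae (Eventually.of_forall fun u => ?_)
    simp only [Pi.smul_apply, smul_smul, inv_mul_cancel₀ (sub_pos.2 hlt).ne', one_smul]

end System

/-! ### Uniqueness of the jump trajectories -/

lemma eq_zero_of_le_mul_integral {u : ℝ → ℝ} (hu : Continuous u) (h0 : ∀ s, 0 ≤ u s) {K : ℝ}
    (hK : ∀ s ∈ Icc (0 : ℝ) 1, u s ≤ K * ∫ s' in (0 : ℝ)..s, u s') : ∀ s ∈ Icc (0 : ℝ) 1, u s = 0 := by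
  have hd : ∀ s, HasDerivAt (fun s => ∫ s' in (0 : ℝ)..s, u s') (u s) s := fun s =>
    intervalIntegral.integral_hasDerivAt_right (hu.intervalIntegrable _ _)
      (hu.stronglyMeasurableAtFilter _ _) hu.continuousAt
  have hnn : ∀ s ∈ Icc (0 : ℝ) 1, 0 ≤ ∫ s' in (0 : ℝ)..s, u s' := fun s hs =>
    intervalIntegral.integral_nonneg hs.1 fun t _ => h0 t
  -- Grönwall's lemma is applied to the primitive of u: it vanishes at 0, and its derivative u is at
  -- most K times the primitive itself.
  have key := eq_zero_of_abs_deriv_le_mul_abs_self_of_eq_zero_right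
    (f := fun s => ∫ s' in (0 : ℝ)..s, u s') (f' := u) (K := K) (a := 0) (b := 1)
    (fun s _ => (hd s).continuousAt.continuousWithinAt) (fun s _ => (hd s).hasDerivWithinAt)
    intervalIntegral.integral_same fun s hs => by
      have hs' := Ico_subset_Icc_self hs
      rw [Real.norm_of_nonneg (h0 s), Real.norm_of_nonneg (hnn s hs')]
      exact hK s hs'
  intro s hs
  refine le_antisymm ?_ (h0 s)
  have := hK s hs
  rwa [show (∫ s' in (0 : ℝ)..s, u s') = 0 from key s hs, mul_zero] at this

lemma ae_norm_le_of_memLp_top {V : Type*} [NormedAddCommGroup V] {α : Type*} [MeasurableSpace α]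
    {κ : Measure α} {w : α → V} (h : MemLp w ∞ κ) : ∃ C : ℝ, 0 ≤ C ∧ ∀ᵐ s ∂κ, ‖w s‖ ≤ C := by
  refine ⟨(eLpNormEssSup w κ).toReal, ENNReal.toReal_nonneg, ?_⟩
  have h1 : eLpNormEssSup w κ ≠ ∞ := by rw [← eLpNorm_exponent_top]; exact h.2.ne
  filter_upwards [ae_le_eLpNormEssSup (f := w) (μ := κ)] with s hs
  rw [← ofReal_norm] at hs
  exact (ENNReal.ofReal_le_iff_le_toReal h1).1 hs

namespace System

variable {n m N M : ℕ} {D : System n m N M} {P : ImpulseTuple n m}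
  {ζ ζ' : ℕ → ℝ → ℝ → State n} {θ θ' : ℕ → ℝ → ℝ → ℝ}

lemma exists_backJump_bound {l : ℕ} (hl : l ∈ Icc 1 N) {r : ℝ}
    (h : ∀ k ∈ Icc 1 N, ContinuousOn (ζ k r) (Icc 0 1)) :
    ∃ R : ℝ, ∀ s ∈ Icc (0 : ℝ) 1, ‖fun k : Fin (M + 1) => D.backJump ζ l k r s‖ ≤ R := by
  have key : ∀ k : Fin (M + 1), ∃ R : ℝ, ∀ s ∈ Icc (0 : ℝ) 1, ‖D.backJump ζ l k r s‖ ≤ R := by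
    intro k
    unfold backJump
    split_ifs with hk
    · exact isCompact_Icc.exists_bound_of_continuousOn
        (h (l - k) ⟨by omega, by have := hl.2; omega⟩)
    · refine ⟨‖D.x₀‖ + ‖D.ξ (r - (((k : ℕ) - l : ℕ) + 1) * D.h)‖, fun s _ => ?_⟩
      unfold histJump
      split_ifs
      · linarith [norm_nonneg (D.ξ (r - (((k : ℕ) - l : ℕ) + 1) * D.h))]
      · linarith [norm_nonneg D.x₀]
  choose R hR using key
  refine ⟨∑ k, |R k|, fun s hs => (pi_norm_le_iff_of_nonneg
    (Finset.sum_nonneg fun _ _ => abs_nonneg _)).2 fun k => ?_⟩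
  exact (hR k s hs).trans ((le_abs_self _).trans
    (Finset.single_le_sum (f := fun k => |R k|) (fun _ _ => abs_nonneg _) (Finset.mem_univ k)))

/-- The trajectories over a jump are determined by the initial value and by those of the earlier
periods. -/
lemma IsJump.eqOn_of_init (hD : D.Standing) (hI : D.IsImpulseControl P.μ P.ν P.ω)
    (h : D.IsJump P.ω P.x P.v ζ θ) (h' : D.IsJump P.ω P.x P.v ζ' θ') {l : ℕ} (hl : l ∈ Icc 1 N)
    {r : ℝ} (hr : r ∈ Icc 0 D.h) (hprev : ∀ k ∈ Ico 1 l, EqOn (ζ k r) (ζ' k r) (Icc 0 1))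
    (h0 : ζ l r 0 = ζ' l r 0) : EqOn (ζ l r) (ζ' l r) (Icc 0 1) := by
  have hc : ∀ k ∈ Icc 1 N, ContinuousOn (ζ k r) (Icc 0 1) := fun k hk =>
    (h.ode k hk r hr).continuousOn zero_le_one
  have hc' : ∀ k ∈ Icc 1 N, ContinuousOn (ζ' k r) (Icc 0 1) := fun k hk =>
    (h'.ode k hk r hr).continuousOn zero_le_one
  obtain ⟨R, hR⟩ := exists_backJump_bound (D := D) hl hc
  obtain ⟨R', hR'⟩ := exists_backJump_bound (D := D) hl hc'
  obtain ⟨W, hW0, hW⟩ := ae_norm_le_of_memLp_top (hI.bounded r hr l hl)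
  -- The g_j are only of class C¹, so a Lipschitz constant is available on a ball; the radius max R
  -- R' makes the ball contain the delayed states of both solutions.
  have hLip : ∀ j, ∃ L : ℝ≥0, LipschitzOnWith L (D.g j (r + D.start l))
      (Metric.closedBall (0 : Fin (M + 1) → State n) (max R R')) := fun j => by
    have : ContDiff ℝ 1 (D.g j (r + D.start l)) :=
      (hD.g_smooth j).comp (contDiff_const.prodMk contDiff_id)
    exact (this.locallyLipschitz.locallyLipschitzOn).exists_lipschitzOnWith_of_compact
      (isCompact_closedBall _ _)
  choose L hL using hLip
  set u : ℝ → ℝ := fun s => ‖ζ l r (clamp 1 s) - ζ' l r (clamp 1 s)‖ with hu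
  have huc : Continuous u := by
    have key : ∀ {z : ℝ → State n}, ContinuousOn z (Icc 0 1) → Continuous fun s => z (clamp 1 s) :=
      fun hz => hz.comp_continuous (continuous_clamp 1) fun s => clamp_mem zero_le_one s
    exact ((key (hc l hl)).sub (key (hc' l hl))).norm
  have hu1 : ∀ s ∈ Icc (0 : ℝ) 1, u s = ‖ζ l r s - ζ' l r s‖ := fun s hs => by
    rw [hu]; simp only [clamp_of_mem hs]
  -- Only the undelayed component k = 0 can differ: earlier periods agree by assumption, and the
  -- history is common to both solutions.
  have hz : ∀ s ∈ Icc (0 : ℝ) 1, ‖(fun k : Fin (M + 1) => D.backJump ζ l k r s)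
      - fun k : Fin (M + 1) => D.backJump ζ' l k r s‖ ≤ u s := by
    intro s hs
    refine (pi_norm_le_iff_of_nonneg (norm_nonneg _)).2 fun k => ?_
    rw [Pi.sub_apply]
    unfold backJump
    split_ifs with hk
    · rcases Nat.eq_zero_or_pos (k : ℕ) with hk0 | hk0
      · rw [hk0, Nat.sub_zero]; exact (hu1 s hs).ge
      · rw [hprev (l - k) ⟨by omega, by omega⟩ hs, sub_self, norm_zero]; exact norm_nonneg _
    · rw [sub_self, norm_zero]; exact norm_nonneg _
  have hmain : ∀ s ∈ Icc (0 : ℝ) 1, u s ≤ (W * ∑ j, (L j : ℝ)) * ∫ s' in (0 : ℝ)..s, u s' := by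
    intro s hs
    have hi := (h.ode l hl r hr).intervalIntegrable ⟨le_rfl, zero_le_one⟩ hs
    have hi' := (h'.ode l hl r hr).intervalIntegrable ⟨le_rfl, zero_le_one⟩ hs
    rw [hu1 s hs, (h.ode l hl r hr).2 s hs, (h'.ode l hl r hr).2 s hs, h0, add_sub_add_left_eq_sub,
      ← intervalIntegral.integral_sub hi hi', ← intervalIntegral.integral_const_mul]
    refine intervalIntegral.norm_integral_le_of_norm_le hs.1 ?_
      ((huc.const_mul _).intervalIntegrable _ _)
    filter_upwards [(ae_restrict_iff' measurableSet_Icc).1 hW] with s' hs' hm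
    have hm' : s' ∈ Icc (0 : ℝ) 1 := ⟨hm.1.le, hm.2.trans hs.2⟩
    rw [← Finset.sum_sub_distrib, mul_assoc, Finset.sum_mul, Finset.mul_sum]
    refine (norm_sum_le _ _).trans (Finset.sum_le_sum fun j _ => ?_)
    rw [← smul_sub, norm_smul]
    refine mul_le_mul ((norm_le_pi_norm _ j).trans (hs' hm')) ?_ (norm_nonneg _) hW0
    refine (((hL j).norm_sub_le ?_ ?_).trans
      (mul_le_mul_of_nonneg_left (hz s' hm') (L j).coe_nonneg))
    · rw [mem_closedBall_zero_iff]; exact (hR s' hm').trans (le_max_left _ _)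
    · rw [mem_closedBall_zero_iff]; exact (hR' s' hm').trans (le_max_right _ _)
  intro s hs
  have := eq_zero_of_le_mul_integral huc (fun s => norm_nonneg _) hmain s hs
  rw [hu1 s hs, norm_eq_zero, sub_eq_zero] at this
  exact this

/-- Strong induction on the period. The earlier periods supply the delayed states and, at r = 0, the
initial value; for r > 0 the initial values are left limits of x and v, hence common to both.
Consequently the jumps in the definition of an impulse solution and those in Construction A are the
same. -/
theorem IsJump.eqOn (hD : D.Standing) (hI : D.IsImpulseControl P.μ P.ν P.ω)
    (h : D.IsJump P.ω P.x P.v ζ θ) (h' : D.IsJump P.ω P.x P.v ζ' θ') :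
    ∀ l ∈ Icc 1 N, ∀ r ∈ Icc 0 D.h, EqOn (ζ l r) (ζ' l r) (Icc 0 1) ∧
      EqOn (θ l r) (θ' l r) (Icc 0 1) := by
  intro l
  induction l using Nat.strong_induction_on with
  | _ l ih =>
    intro hl r hr
    have hh : D.h ∈ Icc 0 D.h := ⟨hD.h_pos.le, le_rfl⟩
    have h1 : (1 : ℝ) ∈ Icc (0 : ℝ) 1 := ⟨zero_le_one, le_rfl⟩
    have hζ : ζ l r 0 = ζ' l r 0 := by
      rcases hr.1.eq_or_lt with e | hpos
      · rw [← e, h.init_zero l hl, h'.init_zero l hl]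
        unfold backJump
        split_ifs with hl1
        · exact (ih (l - 1) (by omega) ⟨by omega, by have := hl.2; omega⟩ D.h hh).1 h1
        · rfl
      · rw [h.init l hl r ⟨hpos, hr.2⟩, h'.init l hl r ⟨hpos, hr.2⟩]
    have hθ : θ l r 0 = θ' l r 0 := by
      rcases hr.1.eq_or_lt with e | hpos
      · rw [← e, h.var_init_zero l hl, h'.var_init_zero l hl]
        split_ifs with hl1
        · rfl
        · have := hl.1
          exact (ih (l - 1) (by omega) ⟨by omega, by have := hl.2; omega⟩ D.h hh).2 h1
      · rw [h.var_init l hl r ⟨hpos, hr.2⟩, h'.var_init l hl r ⟨hpos, hr.2⟩]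
    refine ⟨h.eqOn_of_init hD hI h' hl hr (fun k hk => (ih k hk.2 ⟨hk.1, by
      have := hl.2; have := hk.2; omega⟩ r hr).1) hζ, fun s hs => ?_⟩
    rw [h.var l hl r hr s hs, h'.var l hl r hr s hs, hθ]

end System

/-! ### Construction A and impulse solutions with fixed jump trajectories -/

namespace System

variable {n m N M : ℕ} {D : System n m N M} {E : ExtendedTuple n m} {P : ImpulseTuple n m}
  {ζ : ℕ → ℝ → ℝ → State n} {θ : ℕ → ℝ → ℝ → ℝ}

variable (D) in
/-- The states of `E` are those constructed from `P` and from its jumps `ζ, θ`. -/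
structure StatesExtend (P : ImpulseTuple n m) (E : ExtendedTuple n m) (ζ : ℕ → ℝ → ℝ → State n)
    (θ : ℕ → ℝ → ℝ → ℝ) : Prop where
  jump : D.IsJump P.ω P.x P.v ζ θ
  y_zero : E.y 1 0 = D.x₀
  β_zero : E.β 1 0 = 0
  chain : ∀ l ∈ Icc 2 N, E.y l 0 = ζ (l - 1) D.h 1 ∧ E.β l 0 = θ (l - 1) D.h 1
  final : ∀ l ∈ Icc 1 N, E.y l E.S = ζ l D.h 1 ∧ E.β l E.S = θ l D.h 1
  off : ∀ l ∈ Icc 1 N, ∀ s ∈ Icc 0 E.S, E.φ₀ s ∉ D.plat E →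
    E.y l s = P.x (D.start l + E.φ₀ s) ∧ E.β l s = P.v (D.start l + E.φ₀ s)
  on : ∀ l ∈ Icc 1 N, ∀ r ∈ Icc 0 D.h, D.lo E r < D.up E r → ∀ s ∈ Icc (D.lo E r) (D.up E r),
    E.y l s = ζ l r ((s - D.lo E r) / (D.up E r - D.lo E r)) ∧
    E.β l s = θ l r ((s - D.lo E r) / (D.up E r - D.lo E r))

lemma StatesExtend.start_eq (h : D.StatesExtend P E ζ θ) {l : ℕ} (hl : l ∈ Icc 1 N) :
    E.y l 0 = ζ l 0 0 ∧ E.β l 0 = θ l 0 0 := by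
  rw [h.jump.init_zero l hl, h.jump.var_init_zero l hl]
  unfold backJump
  rcases hl.1.eq_or_lt with rfl | h1
  · simp [h.y_zero, h.β_zero, histJump]
  · rw [if_pos h1, if_neg (by omega)]
    exact h.chain l ⟨h1, hl.2⟩

/-- Construction A, split into its part on the controls and its part on the states. -/
lemma isExtendedOf_iff (hD : D.Standing) (hc : IsClock E.φ₀ 0 E.S 0 D.h)
    (hphi : ∀ r ∈ Ioc 0 D.h, D.phi P r = D.up E r) :
    D.IsExtendedOf P E ↔ D.ControlExtends P E ∧
      (∀ l ∈ Icc 1 N, ∀ s ∈ Icc 0 E.S, E.τ l s = D.start l + E.φ₀ s) ∧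
      ∃ ζ θ, D.StatesExtend P E ζ θ := by
  have hgam : ∀ r ∈ Icc 0 D.h, ∀ s, D.gam P r s = (s - D.lo E r) / (D.up E r - D.lo E r) :=
    fun r hr s => by rw [gam, phiL_eq hc hphi hr, phiR_eq hD hc hphi hr]
  constructor
  · rintro ⟨h1, h2, h3, h4, h5, h6, ζ, θ, hj, hy, hβ, hch, hfin, hoff, hon⟩
    refine ⟨⟨⟨h1, h2⟩, h3, h4, h5⟩, h6, ζ, θ, ?_⟩
    have hst : ∀ l ∈ Icc 1 N, E.y l 0 = ζ l 0 0 ∧ E.β l 0 = θ l 0 0 := by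
      intro l hl
      rw [hj.init_zero l hl, hj.var_init_zero l hl]
      unfold backJump
      rcases hl.1.eq_or_lt with rfl | h1
      · simp [hy, hβ, histJump]
      · rw [if_pos h1, if_neg (by omega)]
        exact hch l ⟨h1, hl.2⟩
    refine ⟨hj, hy, hβ, hch, hfin, fun l hl s hs hn => ?_, fun l hl r hr hlt s hs => ?_⟩
    · have hr := mem_Ioo_of_notMem_plat (hc.mapsTo hs) hn
      have h0 : 0 < s := lt_of_le_of_ne hs.1 (by rintro rfl; exact hr.1.ne' hc.left)
      have hS : s < E.S := lt_of_le_of_ne hs.2 (by rintro rfl; exact hr.2.ne hc.right)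
      rw [← h6 l hl s hs]
      refine hoff l hl s ⟨⟨h0, hS⟩, fun h => ?_⟩
      rw [mem_plateaus hD hc hphi hs] at h
      exact hn (Or.inl ⟨hc.mapsTo hs, h⟩)
    · have hs' : s ∈ Icc 0 E.S := ⟨(lo_mem hc r).1.trans hs.1, hs.2.trans (up_mem hc r).2⟩
      have hφ := phi0_of_mem hc hr hs
      -- On a plateau Construction A speaks only of 0 < s < S. At the two ends the prescribed values
      -- are ζ^0_l(0) and ζ^h_l(1), which is what the plateau formula gives there.
      rcases hs'.1.eq_or_lt with h0 | h0
      · subst h0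
        have hr0 : r = 0 := by rw [← hφ, hc.left]
        rw [hr0, lo_zero hc, sub_self, zero_div]
        exact hst l hl
      rcases hs'.2.eq_or_lt with hS | hS
      · subst hS
        have hr0 : r = D.h := by rw [← hφ, hc.right]
        rw [hr0, up_end hc] at hlt
        rw [hr0, up_end hc, div_self (sub_pos.2 hlt).ne']
        exact hfin l hl
      · rw [← hgam r hr]
        exact hon l hl r ((mem_jumpSet hc hphi).2 ⟨hr, hlt⟩) s
          ⟨⟨h0, hS⟩, by rw [plateau_eq hD hc hphi hr]; exact hs⟩
  · rintro ⟨hC, hτ, ζ, θ, h⟩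
    refine ⟨hC.S_eq, hC.φ₀_eq, hC.φ_eq, hC.φ_zero, hC.φ_chain, hτ, ζ, θ, h.jump, h.y_zero, h.β_zero,
      h.chain, h.final, fun l hl s hs => ?_, fun l hl r hr s hs => ?_⟩
    · have hs' : s ∈ Icc 0 E.S := Ioo_subset_Icc_self hs.1
      have hn := hs.2
      rw [mem_plateaus hD hc hphi hs'] at hn
      rw [hτ l hl s hs']
      refine h.off l hl s hs' ?_
      have hm := (phi0_eq_iff hc (hc.mapsTo hs') hs').1 rfl
      have he : D.lo E (E.φ₀ s) = D.up E (E.φ₀ s) := le_antisymm (lo_le_up hc _) (not_lt.1 hn)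
      rintro (hp | hp | hp)
      · exact hn hp.2
      · rw [hp] at he hm
        rw [← he, lo_zero hc] at hm
        exact hs.1.1.not_ge hm.2
      · have hp : E.φ₀ s = D.h := hp
        rw [hp] at he hm
        rw [he, up_end hc] at hm
        exact hs.1.2.not_ge hm.1
    · obtain ⟨hr', hlt⟩ := (mem_jumpSet hc hphi).1 hr
      rw [hgam r hr']
      refine h.on l hl r hr' hlt s ?_
      rw [← plateau_eq hD hc hphi hr']
      exact hs.2

variable (D) in
/-- `(x,v)` is an impulse solution with the jumps `ζ, θ`. -/
structure SolutionWith (P : ImpulseTuple n m) (ζ : ℕ → ℝ → ℝ → State n)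
    (θ : ℕ → ℝ → ℝ → ℝ) : Prop where
  bv_x : BoundedVariationOn P.x (Icc 0 D.T)
  bv_v : BoundedVariationOn P.v (Icc 0 D.T)
  hist : ∀ t ∈ Ico (-(M * D.h)) 0, P.x t = D.ξ t
  x_zero : P.x 0 = D.x₀
  v_zero : P.v 0 = 0
  jump : D.IsJump P.ω P.x P.v ζ θ
  grid : ∀ l ∈ Icc 2 N, P.x (D.start l) = ζ l 0 1 ∧ P.v (D.start l) = θ l 0 1
  x_end : P.x D.T = ζ N D.h 1
  v_end : P.v D.T = θ N D.h 1
  evol : ∀ l ∈ Icc 1 N, ∀ r ∈ Ioo 0 D.h,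
    Summable (fun r' : Ioc 0 r => ζ l r' 1 - Function.leftLim P.x (r' + D.start l)) ∧
    Summable (fun r' : Ioc 0 r => θ l r' 1 - Function.leftLim P.v (r' + D.start l)) ∧
    P.x (D.start l + r) = ζ l 0 1 + (∫ t in D.start l..D.start l + r, D.f t (D.delayed P.x t))
      + (∑ j, ∫ᵛ t in Icc (D.start l) (D.start l + r), D.g j t (D.delayed P.x t) ∂<•(P.μ.cont j))
      + ∑' r' : Ioc 0 r, (ζ l r' 1 - Function.leftLim P.x (r' + D.start l)) ∧
    P.v (D.start l + r) = θ l 0 1 + (contPart P.ν).real (Icc (D.start l) (D.start l + r))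
      + ∑' r' : Ioc 0 r, (θ l r' 1 - Function.leftLim P.v (r' + D.start l))

lemma isImpulseSolution_iff : D.IsImpulseSolution P ↔ ∃ ζ θ, D.SolutionWith P ζ θ := by
  constructor
  · rintro ⟨h1, h2, h3, h4, h5, ζ, θ, h6, h7, h8, h9, h10⟩
    refine ⟨ζ, θ, h1, h2, h3, h4, h5, h6, h7, h8, h9, fun l hl r hr => ?_⟩
    have := h10 l hl (D.start l + r) ⟨by linarith [hr.1], by
      rw [← start_add_h]; linarith [hr.2]⟩
    rwa [add_sub_cancel_left] at this
  · rintro ⟨ζ, θ, h⟩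
    refine ⟨h.bv_x, h.bv_v, h.hist, h.x_zero, h.v_zero, ζ, θ, h.jump, h.grid, h.x_end, h.v_end,
      fun l hl t ht => ?_⟩
    have := h.evol l hl (t - D.start l) ⟨by linarith [ht.1], by
      have := ht.2; rw [← start_add_h] at this; linarith⟩
    rwa [add_sub_cancel] at this

/-- The solution formulas involve the jumps only through their values at s = 1, and these are
independent of the choice by `IsJump.eqOn`. -/
lemma SolutionWith.congr (hD : D.Standing) (hI : D.IsImpulseControl P.μ P.ν P.ω)
    {ζ' : ℕ → ℝ → ℝ → State n} {θ' : ℕ → ℝ → ℝ → ℝ} (h : D.SolutionWith P ζ' θ')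
    (hj : D.IsJump P.ω P.x P.v ζ θ) : D.SolutionWith P ζ θ := by
  have e := h.jump.eqOn hD hI hj
  have h1 : (1 : ℝ) ∈ Icc (0 : ℝ) 1 := ⟨zero_le_one, le_rfl⟩
  have h0 : (0 : ℝ) ∈ Icc 0 D.h := ⟨le_rfl, hD.h_pos.le⟩
  have hh : D.h ∈ Icc 0 D.h := ⟨hD.h_pos.le, le_rfl⟩
  have hN : N ∈ Icc 1 N := ⟨hD.one_le_N, le_rfl⟩
  refine ⟨h.bv_x, h.bv_v, h.hist, h.x_zero, h.v_zero, hj, fun l hl => ?_, ?_, ?_, fun l hl r hr => ?_⟩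
  · have hl' : l ∈ Icc 1 N := ⟨by have := hl.1; omega, hl.2⟩
    rw [← (e l hl' 0 h0).1 h1, ← (e l hl' 0 h0).2 h1]
    exact h.grid l hl
  · rw [← (e N hN _ hh).1 h1]; exact h.x_end
  · rw [← (e N hN _ hh).2 h1]; exact h.v_end
  · have h2 := h.evol l hl r hr
    have e1 : (fun r' : Ioc 0 r => ζ l r' 1 - Function.leftLim P.x (r' + D.start l))
        = fun r' : Ioc 0 r => ζ' l r' 1 - Function.leftLim P.x (r' + D.start l) := by
      funext r'
      rw [(e l hl r' ⟨r'.2.1.le, r'.2.2.trans hr.2.le⟩).1 h1]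
    have e2 : (fun r' : Ioc 0 r => θ l r' 1 - Function.leftLim P.v (r' + D.start l))
        = fun r' : Ioc 0 r => θ' l r' 1 - Function.leftLim P.v (r' + D.start l) := by
      funext r'
      rw [(e l hl r' ⟨r'.2.1.le, r'.2.2.trans hr.2.le⟩).2 h1]
    rw [e1, e2, ← (e l hl 0 h0).1 h1, ← (e l hl 0 h0).2 h1]
    exact h2

section

variable (hD : D.Standing) (hK : D.IsCanonicalControl E) (hL : D.ControlOf E P)
include hD hK hL

lemma ControlOf.jump_θ (hj : D.IsJump P.ω P.x P.v ζ θ) {l : ℕ} (hl : l ∈ Icc 1 N) {r : ℝ}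
    (hr : r ∈ Icc 0 D.h) {u : ℝ} (hu : u ∈ Icc (0 : ℝ) 1) :
    θ l r u = θ l r 0 + ∫ u' in (0 : ℝ)..u, (D.up E r - D.lo E r) •
      norm1 (deriv (E.φ l) ((D.up E r - D.lo E r) * u' + D.lo E r)) := by
  have hc := IsCanonicalControl.clk hK.ctl hD
  rw [hj.var l hl r hr u hu]
  congr 1
  refine intervalIntegral.integral_congr_ae ?_
  filter_upwards [(ae_restrict_iff' measurableSet_Icc).1 (hL.ω_eq r hr l hl)] with s hs hm
  rw [uIoc_of_le hu.1] at hm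
  rw [hs ⟨hm.1.le, hm.2.trans hu.2⟩, norm1_smul, abs_of_nonneg (sub_nonneg.2 (lo_le_up hc r)),
    smul_eq_mul]

lemma Matches.jump_ζ (hM : D.Matches E P ζ θ)
    (hτ : ∀ l ∈ Icc 1 N, ∀ s ∈ Icc 0 E.S, E.τ l s = D.start l + E.φ₀ s)
    (hj : D.IsJump P.ω P.x P.v ζ θ) {l : ℕ} (hl : l ∈ Icc 1 N) {r : ℝ}
    (hr : r ∈ Icc 0 D.h) {u : ℝ} (hu : u ∈ Icc (0 : ℝ) 1) :
    ζ l r u = ζ l r 0 + ∫ u' in (0 : ℝ)..u, (D.up E r - D.lo E r) •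
      D.field E l ((D.up E r - D.lo E r) * u' + D.lo E r) := by
  rw [(hj.ode l hl r hr).2 u hu]
  congr 1
  refine intervalIntegral.integral_congr_ae ?_
  filter_upwards [(ae_restrict_iff' measurableSet_Icc).1 (hM.field_ae hD hK hL hτ hl hr)] with s hs hm
  rw [uIoc_of_le hu.1] at hm
  exact hs ⟨hm.1.le, hm.2.trans hu.2⟩

end

end System

/-! ### From impulse solutions to solutions of the delay-free system -/

namespace System

variable {n m N M : ℕ} {D : System n m N M} {E : ExtendedTuple n m} {P : ImpulseTuple n m}
  {ζ : ℕ → ℝ → ℝ → State n} {θ : ℕ → ℝ → ℝ → ℝ}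

/-- The contributions of the plateaus, in terms of functions over `[0,1]`. -/
lemma hasSum_jumps {V : Type*} [NormedAddCommGroup V] [NormedSpace ℝ V]
    (hc : IsClock E.φ₀ 0 E.S 0 D.h) {F : ℝ → V} {Z : ℝ → ℝ → V}
    (hF : IntegrableOn F (Icc 0 E.S))
    (h0 : ∀ r ∈ Icc 0 D.h, ∀ u ∈ Icc (0 : ℝ) 1, Z r u = Z r 0 + ∫ u' in (0 : ℝ)..u,
      (D.up E r - D.lo E r) • F ((D.up E r - D.lo E r) * u' + D.lo E r))
    {z : ℝ → V} (hz : ∀ r ∈ Ioc 0 D.h, Z r 0 = z r) {r : ℝ} (hr : r ∈ Icc 0 D.h) :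
    HasSum (fun r' : Ioc 0 r => Z r' 1 - z r') ((∫ s in D.up E 0..D.up E r, F s)
        - ∫ s in Icc 0 E.S ∩ E.φ₀ ⁻¹' (Icc 0 r ∩ (D.plat E)ᶜ), F s) := by
  convert hasSum_plateaus hc hF hr using 2 with r'
  have hr' : (r' : ℝ) ∈ Ioc 0 D.h := ⟨r'.2.1, r'.2.2.trans hr.2⟩
  rw [h0 r' (Ioc_subset_Icc_self hr') 1 ⟨zero_le_one, le_rfl⟩, hz r' hr', add_sub_cancel_left,
    intervalIntegral.integral_smul, intervalIntegral.smul_integral_comp_mul_add, mul_zero, zero_add,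
    mul_one, sub_add_cancel]

section

variable (hD : D.Standing) (hK : D.IsCanonicalControl E) (hL : D.ControlOf E P)
  (hτ : ∀ l ∈ Icc 1 N, ∀ s ∈ Icc 0 E.S, E.τ l s = D.start l + E.φ₀ s)
  (hX : D.StatesExtend P E ζ θ) (hS : D.SolutionWith P ζ θ)
include hD hK hL hτ hX hS

omit hD hK hL hτ in
lemma StatesExtend.matches : D.Matches E P ζ θ := ⟨hX.off, hX.on, hS.hist, hS.bv_x⟩

/-- The sum over jumps is the integral of the field over the plateaus in ]σ⁺(0), σ⁺(r)], and drift
plus control terms are its integral off `plat`. Together they are the integral from σ⁺(0) to σ⁺(r),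
the evolution required by `solvesOn_of_jumps`. -/
lemma StatesExtend.solves_y {l : ℕ} (hl : l ∈ Icc 1 N) :
    SolvesOn (D.field E l) (E.y l) 0 E.S ∧ (∀ r ∈ Icc 0 D.h, ζ l r 1 = E.y l (D.up E r)) ∧
      ∀ r ∈ Ioo 0 D.h, P.x (D.start l + r) = E.y l (D.up E r) := by
  have hc := IsCanonicalControl.clk hK.ctl hD
  have hM := hX.matches hS
  have hF : IntegrableOn (D.field E l) (Icc 0 E.S) :=
    hM.integrable_field hD hK hL hτ hl fun r hr => (hS.jump.ode l hl r hr).1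
  have h0 := fun r hr u hu => hM.jump_ζ hD hK hL hτ hS.jump hl (r := r) hr (u := u) hu
  have hev : ∀ r ∈ Ioo 0 D.h,
      P.x (D.start l + r) = ζ l 0 1 + ∫ s in D.up E 0..D.up E r, D.field E l s := by
    intro r hr
    rw [(hS.evol l hl r hr).2.2.1, (hasSum_jumps hc hF h0 (hS.jump.init l hl)
      (Ioo_subset_Icc_self hr)).tsum_eq, hM.integral_field hD hK hL hτ hl ⟨hr.1.le, hr.2⟩]
    abel
  obtain ⟨h1, h2⟩ := solvesOn_of_jumps hc hF h0 (hS.jump.init l hl) hev (hX.start_eq hl).1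
    (fun s hs hn => (hX.off l hl s hs hn).1) (hX.final l hl).1
    (fun r hr hlt s hs => (hX.on l hl r hr hlt s hs).1)
  refine ⟨h1, h2, fun r hr => ?_⟩
  rw [hev r hr, h2 0 ⟨le_rfl, hD.h_pos.le⟩, ← h1.sub_eq (up_mem hc 0) (up_mem hc r)]
  abel

omit hτ in
lemma StatesExtend.solves_β {l : ℕ} (hl : l ∈ Icc 1 N) :
    SolvesOn (fun s => norm1 (deriv (E.φ l) s)) (E.β l) 0 E.S ∧
      (∀ r ∈ Icc 0 D.h, θ l r 1 = E.β l (D.up E r)) ∧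
      ∀ r ∈ Ioo 0 D.h, P.v (D.start l + r) = E.β l (D.up E r) := by
  have hc := IsCanonicalControl.clk hK.ctl hD
  have hF : IntegrableOn (fun s => norm1 (deriv (E.φ l) s)) (Icc 0 E.S) :=
    integrable_norm1 (IsCanonicalControl.integrableOn_rate hK.ctl hl)
  have h0 := fun r hr u hu => hL.jump_θ hD hK hS.jump hl (r := r) hr (u := u) hu
  have hev : ∀ r ∈ Ioo 0 D.h,
      P.v (D.start l + r) = θ l 0 1 + ∫ s in D.up E 0..D.up E r, norm1 (deriv (E.φ l) s) := by
    intro r hr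
    rw [(hS.evol l hl r hr).2.2.2, (hasSum_jumps hc hF h0 (hS.jump.var_init l hl)
      (Ioo_subset_Icc_self hr)).tsum_eq, hL.contPart_ν hD hK hl ⟨hr.1.le, hr.2⟩]
    abel
  obtain ⟨h1, h2⟩ := solvesOn_of_jumps hc hF h0 (hS.jump.var_init l hl) hev (hX.start_eq hl).2
    (fun s hs hn => (hX.off l hl s hs hn).2) (hX.final l hl).2
    (fun r hr hlt s hs => (hX.on l hl r hr hlt s hs).2)
  refine ⟨h1, h2, fun r hr => ?_⟩
  rw [hev r hr, h2 0 ⟨le_rfl, hD.h_pos.le⟩, ← h1.sub_eq (up_mem hc 0) (up_mem hc r)]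
  abel

omit hD hK hL hτ hS in
lemma StatesExtend.chain_eq {l : ℕ} (hl : l ∈ Icc 2 N) :
    E.y l 0 = E.y (l - 1) E.S ∧ E.β l 0 = E.β (l - 1) E.S := by
  have hl' : l - 1 ∈ Icc 1 N := ⟨by have := hl.1; omega, by have := hl.2; omega⟩
  rw [(hX.final _ hl').1, (hX.final _ hl').2]
  exact hX.chain l hl

theorem StatesExtend.isExtendedSolution : D.IsExtendedSolution E := by
  have hc := IsCanonicalControl.clk hK.ctl hD
  have hφ0 := IsCanonicalControl.solves_phi0 hK.ctl
  have h0 : (0 : ℝ) ∈ Icc 0 E.S := ⟨le_rfl, hc.hT.le⟩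
  refine ⟨fun l hl => ⟨hφ0.1, fun s hs => ?_⟩, fun l hl => (hX.solves_y hD hK hL hτ hS hl).1,
    fun l hl => (hX.solves_β hD hK hL hS hl).1, ⟨?_, hX.y_zero, hX.β_zero⟩,
    fun l hl => ⟨tau_chain hK.ctl hτ l hl, hX.chain_eq hl⟩, fun l hl s hs => ⟨?_, ?_⟩⟩
  · rw [hτ l hl s hs, hτ l hl 0 h0, hφ0.2 s hs]
    abel
  · rw [hτ 1 ⟨le_rfl, hD.one_le_N⟩ 0 h0, start_one, hc.left, add_zero]
  · rw [hτ l hl s hs]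
    exact (start_add_mem hD hl _ (hc.mapsTo hs)).1
  · have hs0 : ∀ {l : ℕ}, l ∈ Icc 1 N → ∀ s ∈ Icc 0 E.S, E.β l 0 ≤ E.β l s := by
      intro l hl s hs
      rw [(hX.solves_β hD hK hL hS hl).1.2 s hs]
      exact le_add_of_nonneg_right (intervalIntegral.integral_nonneg hs.1 fun _ _ => norm1_nonneg _)
    have hst : ∀ l, l ∈ Icc 1 N → 0 ≤ E.β l 0 := by
      intro l
      induction l with
      | zero => intro h; exact absurd h.1 (by norm_num)
      | succ k ih =>
        intro hk
        rcases Nat.eq_zero_or_pos k with rfl | hpos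
        · exact hX.β_zero.ge
        · have hk' : k ∈ Icc 1 N := ⟨hpos, by have := hk.2; omega⟩
          rw [(hX.chain_eq (l := k + 1) ⟨by omega, hk.2⟩).2, Nat.add_sub_cancel]
          exact (ih hk').trans (hs0 hk' _ ⟨hc.hT.le, le_rfl⟩)
    exact (hst l hl).trans (hs0 hl s hs)

/-- Inside a period σ̃ is given by σ⁺. At a grid point 0 < (l-1)h < T it selects the end of the
first plateau of period l, where the state is ζ^0_l(1), the value assigned to x there. The times 0
and T are settled by the prescribed values of σ̃. -/
theorem StatesExtend.isGCSolution : D.IsGCSolution E P.x P.v := by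
  have hc := IsCanonicalControl.clk hK.ctl hD
  have hN : N ∈ Icc 1 N := ⟨hD.one_le_N, le_rfl⟩
  intro t ht
  rcases ht.2.eq_or_lt with h | h
  · rw [h, tilde_sigmaTilde_end hD hK.ctl hτ, tilde_sigmaTilde_end hD hK.ctl hτ, hS.x_end, hS.v_end,
      (hX.final N hN).1, (hX.final N hN).2]
    exact ⟨rfl, rfl⟩
  rcases ht.1.eq_or_lt with h0 | h0
  · rw [← h0, tilde_sigmaTilde_zero hD hK.ctl, tilde_sigmaTilde_zero hD hK.ctl, hS.x_zero, hS.v_zero,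
      hX.y_zero, hX.β_zero]
    exact ⟨rfl, rfl⟩
  obtain ⟨l, hl, r, hr, rfl⟩ := exists_start hD.h_pos ⟨ht.1, h⟩
  rw [tilde_sigmaTilde hD hK.ctl hτ _ hl hr h0, tilde_sigmaTilde hD hK.ctl hτ _ hl hr h0]
  obtain ⟨-, h1, h2⟩ := hX.solves_y hD hK hL hτ hS hl
  obtain ⟨-, h3, h4⟩ := hX.solves_β hD hK hL hS hl
  rcases hr.1.eq_or_lt with e | hpos
  · subst e
    have hl2 : l ∈ Icc 2 N := by
      refine ⟨?_, hl.2⟩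
      rcases hl.1.eq_or_lt with rfl | h'
      · rw [start_one, add_zero] at h0; exact absurd h0 (lt_irrefl _)
      · exact h'
    have hz := zero_mem hD
    rw [← h1 0 hz, ← h3 0 hz, add_zero]
    exact hS.grid l hl2
  · exact ⟨h2 r ⟨hpos, hr.2⟩, h4 r ⟨hpos, hr.2⟩⟩

end

end System

/-! ### From canonical extended processes to impulse solutions -/

lemma lipschitzOnWith_tilde {V : Type*} [NormedAddCommGroup V] {N : ℕ} {S : ℝ} {z : ℕ → ℝ → V}
    (hS : 0 < S) (hN : 1 ≤ N) (hch : ∀ l ∈ Icc 2 N, z l 0 = z (l - 1) S) {C : ℝ≥0}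
    (hz : ∀ l ∈ Icc 1 N, LipschitzOnWith C (z l) (Icc 0 S)) :
    LipschitzOnWith (N * C) (tilde N S z) (Icc 0 (N * S)) := by
  have hcl : LipschitzWith 1 (clamp S) := (LipschitzWith.id.const_min S).const_max 0
  refine LipschitzOnWith.of_dist_le_mul fun s hs s' hs' => ?_
  rw [tilde_eq_sum hS hN hch hs, tilde_eq_sum hS hN hch hs', dist_add_left]
  refine (dist_sum_sum_le_of_le (d := fun _ => C * dist s s') _ fun l hl => ?_).trans ?_
  · rw [dist_sub_right]
    refine ((hz l (Finset.mem_Icc.1 hl)).dist_le_mul _ (clamp_mem hS.le _) _ (clamp_mem hS.le _)).trans ?_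
    refine mul_le_mul_of_nonneg_left ((hcl.dist_le_mul _ _).trans ?_) C.coe_nonneg
    rw [NNReal.coe_one, one_mul, dist_sub_right]
  · simp [mul_assoc]

namespace System

variable {n m N M : ℕ} {D : System n m N M} {E : ExtendedTuple n m} {P : ImpulseTuple n m}

variable (D) in
/-- The states over the plateaus, in terms of functions over `[0,1]`. -/
def onPlateaus {V : Type*} (E : ExtendedTuple n m) (z : ℕ → ℝ → V) (l : ℕ) (r u : ℝ) : V :=
  z l ((D.up E r - D.lo E r) * u + D.lo E r)

lemma onPlateaus_zero {V : Type*} (z : ℕ → ℝ → V) (l : ℕ) (r : ℝ) :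
    D.onPlateaus E z l r 0 = z l (D.lo E r) := by simp [onPlateaus]

lemma onPlateaus_one {V : Type*} (z : ℕ → ℝ → V) (l : ℕ) (r : ℝ) :
    D.onPlateaus E z l r 1 = z l (D.up E r) := by simp [onPlateaus]

variable (hD : D.Standing) (hK : D.IsCanonicalControl E) (hE : D.IsExtendedSolution E)
include hD hK hE

lemma lipschitz_states : ∃ C : ℝ≥0, ∀ l ∈ Icc 1 N, LipschitzOnWith C (E.y l) (Icc 0 E.S) ∧
    LipschitzOnWith C (E.β l) (Icc 0 E.S) := by
  obtain ⟨C, hC⟩ := norm_field_le hD hK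
  refine ⟨Real.toNNReal (max C 1), fun l hl => ⟨?_, ?_⟩⟩
  · refine (hE.y_ode l hl).lipschitzOnWith ?_
    filter_upwards [hC l hl] with s hs
    exact (hs.trans (le_max_left _ _)).trans (Real.le_coe_toNNReal _)
  · refine (hE.β_ode l hl).lipschitzOnWith ?_
    filter_upwards [hK.speed_le hl] with s hs
    rw [Real.norm_of_nonneg (norm1_nonneg _)]
    exact (hs.trans (le_max_right C 1)).trans (Real.le_coe_toNNReal _)

variable (hL : D.ControlOf E P) (hx : ∀ t ∈ Ico (-(M * D.h)) 0, P.x t = D.ξ t)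
  (hG : D.IsGCSolution E P.x P.v)
include hG

omit hL hx in
-- The states are Lipschitz functions of s, and composition with the bounded increasing function σ̃
-- yields bounded variation.
lemma IsGCSolution.boundedVariationOn :
    BoundedVariationOn P.x (Icc 0 D.T) ∧ BoundedVariationOn P.v (Icc 0 D.T) := by
  have hτ := tau_eq hK.ctl hE
  obtain ⟨C, hC⟩ := lipschitz_states hD hK hE
  have hT : 0 ≤ D.T := (tildeTau_isClock hD hK.ctl hτ).hS.le
  have hσ : BoundedVariationOn (D.sigmaTilde E) (Icc 0 D.T) :=
    ((sigmaTilde_mono hD hK.ctl hτ).monotoneOn _).boundedVariationOn (C := N * E.S) fun t _ => by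
      have := sigmaTilde_mem hD hK.ctl hτ t
      rw [abs_of_nonneg this.1]; exact this.2
  have hm : MapsTo (D.sigmaTilde E) (Icc 0 D.T) (Icc 0 (N * E.S)) := fun t _ =>
    sigmaTilde_mem hD hK.ctl hτ t
  constructor
  · have := (lipschitzOnWith_tilde hK.ctl.S_pos hD.one_le_N (fun l hl => (hE.chain l hl).2.1)
      fun l hl => (hC l hl).1).comp_boundedVariationOn hm hσ
    unfold BoundedVariationOn at this ⊢
    rwa [eVariationOn.congr fun t ht => (hG t ht).1]
  · have := (lipschitzOnWith_tilde hK.ctl.S_pos hD.one_le_N (fun l hl => (hE.chain l hl).2.2)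
      fun l hl => (hC l hl).2).comp_boundedVariationOn hm hσ
    unfold BoundedVariationOn at this ⊢
    rwa [eVariationOn.congr fun t ht => (hG t ht).2]

omit hL hx in
lemma IsGCSolution.inner {l : ℕ} (hl : l ∈ Icc 1 N) {r : ℝ} (hr : r ∈ Ico 0 D.h)
    (hpos : 0 < D.start l + r) :
    P.x (D.start l + r) = E.y l (D.up E r) ∧ P.v (D.start l + r) = E.β l (D.up E r) := by
  have hτ := tau_eq hK.ctl hE
  have := hG _ (start_add_mem hD hl r (Ico_subset_Icc_self hr))
  rwa [tilde_sigmaTilde hD hK.ctl hτ _ hl hr hpos, tilde_sigmaTilde hD hK.ctl hτ _ hl hr hpos] at this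

omit hL hx in
lemma IsGCSolution.Ioo {l : ℕ} (hl : l ∈ Icc 1 N) : ∀ r ∈ Ioo 0 D.h,
    P.x (D.start l + r) = E.y l (D.up E r) ∧ P.v (D.start l + r) = E.β l (D.up E r) := by
  intro r hr
  refine hG.inner hD hK hE hl ⟨hr.1.le, hr.2⟩ ?_
  have := (start_add_mem hD hl 0 (zero_mem hD)).1
  rw [add_zero] at this
  linarith [hr.1]

include hx

omit hL in
lemma IsGCSolution.matches : D.Matches E P (D.onPlateaus E E.y) (D.onPlateaus E E.β) := by
  have hc := IsCanonicalControl.clk hK.ctl hD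
  refine ⟨fun l hl s hs hn => ?_, fun l hl r hr hlt s hs => ?_, hx,
    (hG.boundedVariationOn hD hK hE).1⟩
  · have hr := hc.mapsTo hs
    have hm := (phi0_eq_iff hc hr hs).1 rfl
    have e : s = D.up E (E.φ₀ s) := le_antisymm hm.2 (lo_eq_up_of_notMem hc hr hn ▸ hm.1)
    have := hG.Ioo hD hK hE hl _ (mem_Ioo_of_notMem_plat hr hn)
    rw [this.1, this.2, ← e]
    exact ⟨rfl, rfl⟩
  · have e : (D.up E r - D.lo E r) * ((s - D.lo E r) / (D.up E r - D.lo E r)) + D.lo E r = s := by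
      rw [mul_div_cancel₀ _ (sub_pos.2 hlt).ne', sub_add_cancel]
    rw [onPlateaus, onPlateaus, e]
    exact ⟨rfl, rfl⟩

include hL

/-- The jump trajectories are the states over the plateaus, rescaled to [0,1]. They start at the
left limits of (x,v) because these are the states at σ⁻(r), and the first plateau of a period starts
where the last one of the preceding period ends. -/
lemma IsGCSolution.isJump :
    D.IsJump P.ω P.x P.v (D.onPlateaus E E.y) (D.onPlateaus E E.β) := by
  have hc := IsCanonicalControl.clk hK.ctl hD
  have hτ := tau_eq hK.ctl hE
  have hM := hG.matches hD hK hE hx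
  refine ⟨fun l hl r hr => ?_, fun l hl r hr => ?_, fun l hl => ?_, fun l hl r hr s hs => ?_,
    fun l hl r hr => ?_, fun l hl => ?_⟩
  · refine SolvesOn.congr_ae
      ((hE.y_ode l hl).affine (lo_mem hc r) (up_mem hc r) (lo_le_up hc r)) zero_le_one ?_
    filter_upwards [hM.field_ae hD hK hL hτ hl hr] with u hu
    exact hu.symm
  · rw [leftLim_eq hc ((hE.y_ode l hl).continuousOn hc.hT.le)
      (fun r hr => (hG.Ioo hD hK hE hl r hr).1) hr, onPlateaus_zero]
  · rw [onPlateaus_zero, lo_zero hc, backJump]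
    rcases hl.1.eq_or_lt with rfl | h1
    · simp [hE.init.2.1, histJump]
    · rw [if_pos h1, onPlateaus_one, up_end hc]
      exact (hE.chain l ⟨h1, hl.2⟩).2.1
  · have h1 := ((hE.β_ode l hl).affine (lo_mem hc r) (up_mem hc r) (lo_le_up hc r)).2 s hs
    refine h1.trans (congrArg _ (intervalIntegral.integral_congr_ae ?_))
    filter_upwards [(ae_restrict_iff' measurableSet_Icc).1 (hL.ω_eq r hr l hl)] with u hu hm
    rw [uIoc_of_le hs.1] at hm
    rw [hu ⟨hm.1.le, hm.2.trans hs.2⟩, norm1_smul, abs_of_nonneg (sub_nonneg.2 (lo_le_up hc r)),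
      smul_eq_mul]
  · rw [leftLim_eq hc ((hE.β_ode l hl).continuousOn hc.hT.le)
      (fun r hr => (hG.Ioo hD hK hE hl r hr).2) hr, onPlateaus_zero]
  · rw [onPlateaus_zero, lo_zero hc]
    rcases hl.1.eq_or_lt with rfl | h1
    · simp [hE.init.2.2]
    · rw [if_neg (by omega), onPlateaus_one, up_end hc]
      exact (hE.chain l ⟨h1, hl.2⟩).2.2

theorem IsGCSolution.statesExtend :
    D.StatesExtend P E (D.onPlateaus E E.y) (D.onPlateaus E E.β) := by
  have hc := IsCanonicalControl.clk hK.ctl hD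
  have hM := hG.matches hD hK hE hx
  refine ⟨hG.isJump hD hK hE hL hx, hE.init.2.1, hE.init.2.2, fun l hl => ?_, fun l hl => ?_,
    hM.off, hM.on⟩
  · rw [onPlateaus_one, onPlateaus_one, up_end hc]
    exact (hE.chain l hl).2
  · rw [onPlateaus_one, onPlateaus_one, up_end hc]
    exact ⟨rfl, rfl⟩

/-- The computation behind `StatesExtend.solves_y` in the opposite direction: the increment of y_l
between σ⁺(0) and σ⁺(r) is split into jumps and continuous evolution, and convergence of the sums
comes with it. -/
theorem IsGCSolution.solutionWith :
    D.SolutionWith P (D.onPlateaus E E.y) (D.onPlateaus E E.β) := by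
  have hc := IsCanonicalControl.clk hK.ctl hD
  have hτ := tau_eq hK.ctl hE
  have hM := hG.matches hD hK hE hx
  have hj := hG.isJump hD hK hE hL hx
  have hT : (0 : ℝ) ≤ D.T := (tildeTau_isClock hD hK.ctl hτ).hS.le
  have hz := hG 0 ⟨le_rfl, hT⟩
  have he := hG D.T ⟨hT, le_rfl⟩
  rw [tilde_sigmaTilde_zero hD hK.ctl, tilde_sigmaTilde_zero hD hK.ctl] at hz
  rw [tilde_sigmaTilde_end hD hK.ctl hτ, tilde_sigmaTilde_end hD hK.ctl hτ] at he
  refine ⟨hM.bv, (hG.boundedVariationOn hD hK hE).2, hx, hz.1.trans hE.init.2.1,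
    hz.2.trans hE.init.2.2, hj, fun l hl => ?_, ?_, ?_, fun l hl r hr => ?_⟩
  · have hl' : l ∈ Icc 1 N := ⟨by have := hl.1; omega, hl.2⟩
    have hl2 : (2 : ℝ) ≤ l := by exact_mod_cast hl.1
    have hpos : 0 < D.start l + 0 := by
      rw [add_zero]; exact mul_pos (by linarith) hD.h_pos
    have := hG.inner hD hK hE hl' ⟨le_rfl, hD.h_pos⟩ hpos
    rwa [add_zero, ← onPlateaus_one E.y, ← onPlateaus_one E.β] at this
  · rw [he.1, onPlateaus_one, up_end hc]
  · rw [he.2, onPlateaus_one, up_end hc]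
  · have hr' := Ioo_subset_Icc_self hr
    have hFy : IntegrableOn (D.field E l) (Icc 0 E.S) := by
      rw [← intervalIntegrable_iff_integrableOn_Icc_of_le hc.hT.le]
      exact (hE.y_ode l hl).1
    have hFβ : IntegrableOn (fun s => norm1 (deriv (E.φ l) s)) (Icc 0 E.S) := by
      rw [← intervalIntegrable_iff_integrableOn_Icc_of_le hc.hT.le]
      exact (hE.β_ode l hl).1
    have hy := hasSum_jumps hc hFy
      (fun r hr u hu => hM.jump_ζ hD hK hL hτ hj hl (r := r) hr (u := u) hu) (hj.init l hl) hr'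
    have hβ := hasSum_jumps hc hFβ
      (fun r hr u hu => hL.jump_θ hD hK hj hl (r := r) hr (u := u) hu) (hj.var_init l hl) hr'
    refine ⟨hy.summable, hβ.summable, ?_, ?_⟩
    · rw [hy.tsum_eq, hM.integral_field hD hK hL hτ hl ⟨hr.1.le, hr.2⟩, (hG.Ioo hD hK hE hl r hr).1,
        onPlateaus_one]
      have : E.y l (D.up E r) - E.y l (D.up E 0) = ∫ s in D.up E 0..D.up E r, D.field E l s :=
        (hE.y_ode l hl).sub_eq (up_mem hc 0) (up_mem hc r)
      rw [← this]
      abel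
    · rw [hβ.tsum_eq, hL.contPart_ν hD hK hl ⟨hr.1.le, hr.2⟩, (hG.Ioo hD hK hE hl r hr).2,
        onPlateaus_one, ← (hE.β_ode l hl).sub_eq (up_mem hc 0) (up_mem hc r)]
      abel

end System

namespace System

variable {n m N M : ℕ} {D : System n m N M} {E E' : ExtendedTuple n m} {P P' : ImpulseTuple n m}
  {ζ ζ' : ℕ → ℝ → ℝ → State n} {θ θ' : ℕ → ℝ → ℝ → ℝ}

/-! ### Existence of the extended process -/

/-- Integrability has to be established from the impulse control and the clock alone, because φ_l is
yet to be defined as a primitive of this rate. -/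
lemma ClockExtends.intervalIntegrable_phiRate (hD : D.Standing)
    (hP : D.IsImpulseControl P.μ P.ν P.ω) (hE : D.ClockExtends P E) {l : ℕ} (hl : l ∈ Icc 1 N) :
    IntervalIntegrable (D.phiRate P E.φ₀ l) volume 0 E.S := by
  have := hP.mem_Vc.1
  have hc := hE.isClock hD
  have hphi := hE.phi_eq hD
  have hms := measurableSet_level hc (measurableSet_plat hc).compl
  rw [intervalIntegrable_iff_integrableOn_Icc_of_le hc.hT.le]
  -- The bound 1 is the unit speed, obtained from `const_speed` on the plateaus and from
  -- `speed_density` elsewhere.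
  refine Integrable.of_bound (C := 1) ?_ ?_
  · refine aestronglyMeasurable_of_plateaus hc ?_ fun r hr hlt => ?_
    · have hm : Measurable fun s => D.density P l (ph E s) :=
        (measurable_density l).comp (measurable_ph hc)
      refine hm.aestronglyMeasurable.congr ((ae_restrict_mem hms).mono fun s hs => ?_)
      beta_reduce
      rw [phiRate_of_notMem hD hc hphi l hs.1 hs.2, ph_of_mem hs.1]
    · refine ((hP.intervalIntegrable hr hl).smul (D.up E r - D.lo E r)⁻¹).congr_ae ?_
      have hpos := sub_pos.2 hlt
      refine (ae_restrict_mem measurableSet_uIoc).mono fun u hu => ?_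
      rw [uIoc_of_le zero_le_one] at hu
      beta_reduce
      rw [phiRate_of_mem hD hc hphi l hr hlt ⟨by nlinarith [hu.1], by nlinarith [hu.2]⟩,
        add_sub_cancel_right, mul_div_cancel_left₀ _ hpos.ne', Pi.smul_apply]
  · refine ae_of_plateaus hc (fun r hr hlt => ?_) ?_
    · have hpos := sub_pos.2 hlt
      filter_upwards [ae_Icc_of_ae_unit hlt (hP.const_speed r hr), ae_restrict_mem measurableSet_Icc]
        with s h1 hs
      rw [hE.sum_norm_ω hD hP hr] at h1
      rw [phiRate_of_mem hD hc hphi l hr hlt hs, norm_smul, Real.norm_of_nonneg (inv_pos.2 hpos).le,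
        inv_mul_le_iff₀ hpos, mul_one]
      exact ((norm_le_norm1 _).trans (Finset.single_le_sum
        (f := fun l => norm1 (P.ω r l ((s - D.lo E r) / (D.up E r - D.lo E r))))
        (fun _ _ => norm1_nonneg _) (Finset.mem_Icc.2 hl))).trans h1.le
    · filter_upwards [hE.ae_phi0 hD hP (hE.speed_density hD hP), ae_restrict_mem measurableSet_Icc]
        with s h1 hs hn
      rw [phiRate_of_notMem hD hc hphi l hs hn]
      have h2 := h1.1 hn
      have h3 := Finset.single_le_sum (f := fun l => norm1 (D.density P l (E.φ₀ s)))
        (fun _ _ => norm1_nonneg _) (Finset.mem_Icc.2 hl)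
      have h4 : 0 ≤ D.leb P (E.φ₀ s) := ENNReal.toReal_nonneg
      have h5 := norm_le_norm1 (D.density P l (E.φ₀ s))
      linarith

variable (D) in
/-- The controls and clocks of Construction A. -/
def extendControl (P : ImpulseTuple n m) : ExtendedTuple n m where
  S := D.phi P D.h
  φ₀ := rightInv (D.phi P) 0 D.h 0 (D.phi P D.h)
  φ := fun l s =>
    (∑ k ∈ Finset.Ico 1 l, ∫ s' in (0 : ℝ)..D.phi P D.h,
      D.phiRate P (rightInv (D.phi P) 0 D.h 0 (D.phi P D.h)) k s')
      + ∫ s' in (0 : ℝ)..s, D.phiRate P (rightInv (D.phi P) 0 D.h 0 (D.phi P D.h)) l s'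
  τ := fun l s => D.start l + rightInv (D.phi P) 0 D.h 0 (D.phi P D.h) s
  y := 0
  β := 0

variable (D) in
/-- A state of Construction A: `x` off the plateaus, and `Z` on the plateaus and at the ends. -/
def extendState {V : Type*} (E : ExtendedTuple n m) (x : ℝ → V) (Z : ℕ → ℝ → ℝ → V) (l : ℕ)
    (s : ℝ) : V :=
  open Classical in
  if D.lo E (E.φ₀ s) < D.up E (E.φ₀ s) then
    Z l (E.φ₀ s) ((s - D.lo E (E.φ₀ s)) / (D.up E (E.φ₀ s) - D.lo E (E.φ₀ s)))
  else if s = 0 then Z l 0 0 else if s = E.S then Z l D.h 1 else x (D.start l + E.φ₀ s)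

section
variable {V : Type*} (hc : IsClock E.φ₀ 0 E.S 0 D.h) (x : ℝ → V) (Z : ℕ → ℝ → ℝ → V) (l : ℕ)
include hc

lemma extendState_zero : D.extendState E x Z l 0 = Z l 0 0 := by
  unfold extendState
  rw [hc.left]
  by_cases h : D.lo E 0 < D.up E 0
  · rw [if_pos h, lo_zero hc, sub_self, zero_div]
  · rw [if_neg h, if_pos rfl]

lemma extendState_end : D.extendState E x Z l E.S = Z l D.h 1 := by
  unfold extendState
  rw [hc.right]
  by_cases h : D.lo E D.h < D.up E D.h
  · rw [if_pos h]
    rw [up_end hc] at h ⊢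
    rw [div_self (sub_pos.2 h).ne']
  · rw [if_neg h, if_neg hc.hT.ne', if_pos rfl]

lemma extendState_off {s : ℝ} (hs : s ∈ Icc 0 E.S) (hn : E.φ₀ s ∉ D.plat E) :
    D.extendState E x Z l s = x (D.start l + E.φ₀ s) := by
  have hr := mem_Ioo_of_notMem_plat (hc.mapsTo hs) hn
  unfold extendState
  rw [if_neg fun h => hn (Or.inl ⟨hc.mapsTo hs, h⟩), if_neg, if_neg]
  · rintro rfl; exact hr.2.ne hc.right
  · rintro rfl; exact hr.1.ne' hc.left

lemma extendState_on {r : ℝ} (hr : r ∈ Icc 0 D.h) (hlt : D.lo E r < D.up E r) {s : ℝ}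
    (hs : s ∈ Icc (D.lo E r) (D.up E r)) :
    D.extendState E x Z l s = Z l r ((s - D.lo E r) / (D.up E r - D.lo E r)) := by
  have e := phi0_of_mem hc hr hs
  unfold extendState
  rw [e, if_pos hlt]

end

theorem exists_isExtendedOf (hD : D.Standing) (hP : D.IsImpulseProc P) :
    ∃ E, D.IsExtendedOf P E := by
  have := hP.1.mem_Vc.1
  obtain ⟨ζ, θ, hS⟩ := isImpulseSolution_iff.1 hP.2
  -- The one-sided limits σ^± depend only on S and φ₀. So they can be taken from F, whose states are
  -- dummies, and then used to define the actual states.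
  set F := D.extendControl P with hF
  have hCl : D.ClockExtends P F := ⟨rfl, fun s _ => rfl⟩
  set E : ExtendedTuple n m :=
    { F with
      y := D.extendState F P.x ζ
      β := D.extendState F P.v θ } with hE
  have hCE : D.ClockExtends P E := ⟨rfl, fun s _ => rfl⟩
  have hC : D.ControlExtends P E := by
    refine ⟨hCE, fun l hl => ⟨hCE.intervalIntegrable_phiRate hD hP.1 hl, fun s _ => ?_⟩, ?_,
      fun l hl => ?_⟩
    · simp [hE, hF, extendControl]
    · simp [hE, hF, extendControl]
    · obtain ⟨k, rfl⟩ : ∃ k, l = k + 1 := ⟨l - 1, by have := hl.1; omega⟩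
      have hk : 1 ≤ k := by have := hl.1; omega
      simp [hE, hF, extendControl, Finset.sum_Ico_succ_top hk]
  have hc := hC.isClock hD
  have hcF : IsClock F.φ₀ 0 F.S 0 D.h := hc
  refine ⟨E, (isExtendedOf_iff hD hc (hC.phi_eq hD)).2 ⟨hC, fun l _ s _ => rfl, ζ, θ, ?_⟩⟩
  have hz := fun l => extendState_zero hcF P.x ζ l
  have hz' := fun l => extendState_zero hcF P.v θ l
  have hone : 1 ∈ Icc 1 N := ⟨le_rfl, hD.one_le_N⟩
  refine ⟨hS.jump, ?_, ?_, fun l hl => ?_, fun l hl => ?_, fun l hl s hs hn => ?_,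
    fun l hl r hr hlt s hs => ?_⟩
  · refine (hz 1).trans ?_
    rw [hS.jump.init_zero 1 hone]
    simp [backJump, histJump]
  · refine (hz' 1).trans ?_
    rw [hS.jump.var_init_zero 1 hone]
    simp
  · have hl' : l ∈ Icc 1 N := ⟨by have := hl.1; omega, hl.2⟩
    have h1 : 1 < l := hl.1
    refine ⟨(hz l).trans ?_, (hz' l).trans ?_⟩
    · rw [hS.jump.init_zero l hl', backJump, if_pos h1]
    · rw [hS.jump.var_init_zero l hl', if_neg (by omega)]
  · exact ⟨extendState_end hcF P.x ζ l, extendState_end hcF P.v θ l⟩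
  · exact ⟨extendState_off hcF P.x ζ l hs hn, extendState_off hcF P.v θ l hs hn⟩
  · exact ⟨extendState_on hcF P.x ζ l hr hlt hs, extendState_on hcF P.v θ l hr hlt hs⟩

/-! ### Uniqueness of the extended process -/

lemma IsExtendedOf.controlExtends (h : D.IsExtendedOf P E) : D.ControlExtends P E :=
  ⟨⟨h.1, h.2.1⟩, h.2.2.1, h.2.2.2.1, h.2.2.2.2.1⟩

lemma ControlExtends.eqOn (hD : D.Standing) [IsFiniteMeasure P.ν] (h : D.ControlExtends P E)
    (h' : D.ControlExtends P E') : E.S = E'.S ∧ EqOn E.φ₀ E'.φ₀ (Icc 0 E.S) ∧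
      ∀ l ∈ Icc 1 N, EqOn (E.φ l) (E'.φ l) (Icc 0 E.S) := by
  have hS : E.S = E'.S := h.S_eq.trans h'.S_eq.symm
  have hSpos := h.S_pos hD
  have h0 : EqOn E.φ₀ E'.φ₀ (Icc 0 E.S) := fun s hs => by
    rw [h.φ₀_eq s hs, h'.φ₀_eq s (hS ▸ hs), hS]
  refine ⟨hS, h0, ?_⟩
  have hstep : ∀ l ∈ Icc 1 N, E.φ l 0 = E'.φ l 0 → EqOn (E.φ l) (E'.φ l) (Icc 0 E.S) := by
    intro l hl e s hs
    rw [(h.φ_eq l hl).2 s hs, (h'.φ_eq l hl).2 s (hS ▸ hs), e]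
    congr 1
    refine intervalIntegral.integral_congr fun s' hs' => ?_
    rw [uIcc_of_le hs.1] at hs'
    unfold phiRate
    rw [h0 ⟨hs'.1, hs'.2.trans hs.2⟩]
  intro l
  induction l with
  | zero => intro hl; exact absurd hl.1 (by norm_num)
  | succ k ih =>
    intro hl
    refine hstep _ hl ?_
    rcases Nat.eq_zero_or_pos k with rfl | hk
    · rw [h.φ_zero, h'.φ_zero]
    · have hk' : k ∈ Icc 1 N := ⟨hk, by have := hl.2; omega⟩
      rw [h.φ_chain (k + 1) ⟨by omega, hl.2⟩, h'.φ_chain (k + 1) ⟨by omega, hl.2⟩,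
        Nat.add_sub_cancel, ih hk' ⟨hSpos.le, le_rfl⟩, hS]

lemma sigma_congr (hS : E.S = E'.S) (h0 : EqOn E.φ₀ E'.φ₀ (Icc 0 E.S)) : D.sigma E = D.sigma E' := by
  funext r
  unfold sigma rightInv
  have : {t | t ∈ Icc 0 E.S ∧ r < E.φ₀ t} = {t | t ∈ Icc 0 E'.S ∧ r < E'.φ₀ t} := by
    ext t
    simp only [mem_ofPred_eq, ← hS]
    exact and_congr_right fun ht => by rw [h0 ht]
  rw [this, hS]

lemma StatesExtend.eqOn (hD : D.Standing) (hP : D.IsImpulseControl P.μ P.ν P.ω)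
    (hc : IsClock E.φ₀ 0 E.S 0 D.h) (hS : E.S = E'.S) (h0 : EqOn E.φ₀ E'.φ₀ (Icc 0 E.S))
    (h : D.StatesExtend P E ζ θ) (h' : D.StatesExtend P E' ζ' θ') {l : ℕ} (hl : l ∈ Icc 1 N) :
    EqOn (E.y l) (E'.y l) (Icc 0 E.S) ∧ EqOn (E.β l) (E'.β l) (Icc 0 E.S) := by
  have hj := h.jump.eqOn hD hP h'.jump l hl
  have hlo : D.lo E' = D.lo E := by funext r; rw [lo, lo, sigma_congr hS h0]
  have hup : D.up E' = D.up E := by funext r; rw [up, up, sigma_congr hS h0]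
  have hplat : D.plat E' = D.plat E := by rw [plat, plat, hlo, hup]
  have h01 : (0 : ℝ) ∈ Icc (0 : ℝ) 1 := ⟨le_rfl, zero_le_one⟩
  have h11 : (1 : ℝ) ∈ Icc (0 : ℝ) 1 := ⟨zero_le_one, le_rfl⟩
  suffices hs : ∀ s ∈ Icc 0 E.S, E.y l s = E'.y l s ∧ E.β l s = E'.β l s from
    ⟨fun s hs' => (hs s hs').1, fun s hs' => (hs s hs').2⟩
  intro s hs
  have hr := hc.mapsTo hs
  have hm := (phi0_eq_iff hc hr hs).1 rfl
  rcases (lo_le_up hc (E.φ₀ s)).eq_or_lt with he | hlt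
  -- A degenerate point of `plat` is 0 or h, and s is then the corresponding end of [0,S], where the
  -- states are given by the first or the last jump of the period.
  · by_cases hp : E.φ₀ s ∈ D.plat E
    · rcases hp with hp | hp | hp
      · exact absurd he hp.2.ne
      · rw [hp] at he hm
        rw [← he, lo_zero hc] at hm
        have e : s = 0 := le_antisymm hm.2 hs.1
        rw [e, (h.start_eq hl).1, (h.start_eq hl).2, (h'.start_eq hl).1, (h'.start_eq hl).2]
        exact ⟨(hj 0 (zero_mem hD)).1 h01, (hj 0 (zero_mem hD)).2 h01⟩
      · have hp : E.φ₀ s = D.h := hp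
        rw [hp] at he hm
        rw [he, up_end hc] at hm
        have e : s = E.S := le_antisymm hs.2 hm.1
        have h1 := h'.final l hl
        rw [← hS] at h1
        rw [e, (h.final l hl).1, (h.final l hl).2, h1.1, h1.2]
        exact ⟨(hj _ (h_mem hD)).1 h11, (hj _ (h_mem hD)).2 h11⟩
    · have h1 := h'.off l hl s (hS ▸ hs) (by rwa [hplat, ← h0 hs])
      rw [(h.off l hl s hs hp).1, (h.off l hl s hs hp).2, h1.1, h1.2, h0 hs]
      exact ⟨rfl, rfl⟩
  · have h1 := h.on l hl _ hr hlt s hm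
    have h2 := h'.on l hl (E.φ₀ s) hr (by rwa [hlo, hup]) s (by rwa [hlo, hup])
    rw [hlo, hup] at h2
    have hu : (s - D.lo E (E.φ₀ s)) / (D.up E (E.φ₀ s) - D.lo E (E.φ₀ s)) ∈ Icc (0 : ℝ) 1 :=
      ⟨div_nonneg (by linarith [hm.1]) (by linarith), (div_le_one (by linarith)).2 (by linarith [hm.2])⟩
    rw [h1.1, h1.2, h2.1, h2.2]
    exact ⟨(hj _ hr).1 hu, (hj _ hr).2 hu⟩

theorem IsExtendedOf.same (hD : D.Standing) (hP : D.IsImpulseControl P.μ P.ν P.ω)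
    (h : D.IsExtendedOf P E) (h' : D.IsExtendedOf P E') : E.Same N E' := by
  have := hP.mem_Vc.1
  have hC := h.controlExtends
  have hC' := h'.controlExtends
  have hc := hC.isClock hD
  obtain ⟨hS, h0, hφ⟩ := hC.eqOn hD hC'
  obtain ⟨-, hτ, ζ, θ, hX⟩ := (isExtendedOf_iff hD hc (hC.phi_eq hD)).1 h
  obtain ⟨-, hτ', ζ', θ', hX'⟩ := (isExtendedOf_iff hD (hC'.isClock hD) (hC'.phi_eq hD)).1 h'
  refine ⟨hS, h0, fun l hl => ⟨hφ l hl, fun s hs => ?_, hX.eqOn hD hP hc hS h0 hX' hl⟩⟩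
  rw [hτ l hl s hs, hτ' l hl s (hS ▸ hs), h0 hs]

/-! ### The correspondence -/

theorem IsImpulseProc.of_isExtendedOf (hD : D.Standing) (hP : D.IsImpulseProc P)
    (h : D.IsExtendedOf P E) :
    D.IsCanonicalProc E ∧ D.IsGCSolution E P.x P.v ∧ D.IsImpulseOf E P := by
  have := hP.1.mem_Vc.1
  have hC := h.controlExtends
  have hK := hC.isCanonicalControl hD hP.1
  have hL := hC.controlOf hD hP.1
  obtain ⟨-, hτ, ζ, θ, hX⟩ := (isExtendedOf_iff hD (hC.isClock hD) (hC.phi_eq hD)).1 h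
  obtain ⟨ζ', θ', hS'⟩ := isImpulseSolution_iff.1 hP.2
  -- The jumps supplied by the impulse solution are replaced by those used in Construction A, so
  -- that one pair (ζ, θ) serves both descriptions.
  have hS := hS'.congr hD hP.1 hX.jump
  have hG := hX.isGCSolution hD hK hL hτ hS
  exact ⟨⟨hK.ctl, hX.isExtendedSolution hD hK hL hτ hS, hK.speed⟩, hG,
    (isImpulseOf_iff hD hK.ctl hτ).2 ⟨hL, hS.hist, hG⟩⟩

theorem exists_isImpulseOf (hD : D.Standing) (h : D.IsCanonicalProc E) :
    ∃ P, D.IsImpulseOf E P := by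
  refine ⟨⟨pushV (base N E.S) (D.clock E) (rate E), pushN (base N E.S) (D.clock E) (rate E),
    fun r l s => (D.up E r - D.lo E r) • deriv (E.φ l) ((D.up E r - D.lo E r) * s + D.lo E r),
    fun t => if t < 0 then D.ξ t else tilde N E.S E.y (D.sigmaTilde E t),
    fun t => tilde N E.S E.β (D.sigmaTilde E t)⟩, (isImpulseOf_iff hD h.1 (tau_eq h.1 h.2.1)).2
    ⟨⟨rfl, rfl, fun r _ l _ => Eventually.of_forall fun s => rfl⟩, fun t ht => ?_, fun t ht => ?_⟩⟩
  · exact if_pos ht.2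
  · exact ⟨if_neg ht.1.not_gt, rfl⟩

theorem IsCanonicalProc.of_isImpulseOf (hD : D.Standing) (h : D.IsCanonicalProc E)
    (hP : D.IsImpulseOf E P) : D.IsImpulseProc P ∧ D.IsExtendedOf P E := by
  have hK : D.IsCanonicalControl E := ⟨h.1, h.2.2⟩
  have hτ := tau_eq h.1 h.2.1
  obtain ⟨hL, hx, hG⟩ := (isImpulseOf_iff hD h.1 hτ).1 hP
  exact ⟨⟨hL.isImpulseControl hD hK, isImpulseSolution_iff.2
      ⟨_, _, hG.solutionWith hD hK h.2.1 hL hx⟩⟩,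
    (isExtendedOf_iff hD (IsCanonicalControl.clk h.1 hD) (hL.phi_eq hD hK)).2
      ⟨hL.controlExtends hD hK, hτ, _, _, hG.statesExtend hD hK h.2.1 hL hx⟩⟩

theorem IsImpulseOf.same (hD : D.Standing) (h : D.IsCanonicalProc E) (hP : D.IsImpulseOf E P)
    (hP' : D.IsImpulseOf E P') : D.SameImpulse P P' := by
  have hτ := tau_eq h.1 h.2.1
  obtain ⟨hL, hx, hG⟩ := (isImpulseOf_iff hD h.1 hτ).1 hP
  obtain ⟨hL', hx', hG'⟩ := (isImpulseOf_iff hD h.1 hτ).1 hP'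
  refine ⟨hL.μ_eq.trans hL'.μ_eq.symm, hL.ν_eq.trans hL'.ν_eq.symm, fun r hr l hl => ?_,
    fun t ht => ?_, fun t ht => (hG t ht).2.trans (hG' t ht).2.symm⟩
  · filter_upwards [hL.ω_eq r hr l hl, hL'.ω_eq r hr l hl] with s h1 h2
    rw [h1, h2]
  · rcases lt_or_ge t 0 with h0 | h0
    · rw [hx t ⟨ht.1, h0⟩, hx' t ⟨ht.1, h0⟩]
    · exact (hG t ⟨h0, ht.2⟩).1.trans (hG' t ⟨h0, ht.2⟩).1.symm

end System

end DelayImpulse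
end

theorem mainTheorem2 {n m N M : ℕ} (D : DelayImpulse.System n m N M) (hD : D.Standing) :
    (∀ P : DelayImpulse.ImpulseTuple n m, D.IsImpulseProc P →
      (∃ E, D.IsExtendedOf P E) ∧
      ∀ E, D.IsExtendedOf P E →
        D.IsCanonicalProc E ∧ D.IsGCSolution E P.x P.v ∧
        ∀ E', D.IsExtendedOf P E' → E.Same N E') ∧
    (∀ E : DelayImpulse.ExtendedTuple n m, D.IsCanonicalProc E →
      (∃ P, D.IsImpulseOf E P) ∧
      ∀ P, D.IsImpulseOf E P →
        D.IsImpulseProc P ∧ D.IsExtendedOf P E ∧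
        ∀ P', D.IsImpulseOf E P' → D.SameImpulse P P') ∧
    (∀ (P : DelayImpulse.ImpulseTuple n m) (E : DelayImpulse.ExtendedTuple n m),
      D.IsImpulseProc P → D.IsExtendedOf P E → D.IsImpulseOf E P) := by
  refine ⟨fun P hP => ⟨DelayImpulse.System.exists_isExtendedOf hD hP, fun E hE => ?_⟩,
    fun E hE => ⟨DelayImpulse.System.exists_isImpulseOf hD hE, fun P hP => ?_⟩,
    fun P E hP hE => (hP.of_isExtendedOf hD hE).2.2⟩
  · obtain ⟨h1, h2, -⟩ := hP.of_isExtendedOf hD hE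
    exact ⟨h1, h2, fun E' hE' => hE.same hD hP.1 hE'⟩
  · obtain ⟨h1, h2⟩ := hE.of_isImpulseOf hD hP
    exact ⟨h1, h2, fun P' hP' => hP.same hD hE hP'⟩
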